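/- **Setting.** Let $M$ be a compact, connected, orientable, irreducible 3-manifold, possibly with boundary, and let $S\subset M$ be a (tamely embedded) closed connected nonorientable surface such that $M\setminus S$ is irreducible. Let $p\colon\widetilde S\to S$ be the orientable double cover, with deck transformation $\tau$. Identify a regular neighbourhood of $S$ with the twisted $I$-bundle $S\widetilde\times I=(\widetilde S\times[-1,1])/\big((y,t)\sim(\tau y,-t)\big)$, with $S=\{t=0\}$, let $q$ be the quotient map, and let $M\backslash\backslash S=\overline{M\setminus (S\widetilde\times I)}$; its boundary is $\widetilde S\sqcup\partial M$, where $y\in\widetilde S$ corresponds to $q(y,1)$. Assume that each component of $\partial M$ is incompressible in $M\setminus S$. Let $L\subset S\widetilde\times I$ be a non-empty link, $\widetilde L=q^{-1}(L)\subset\widetilde S\times[-1,1]$, and $\widetilde\pi(y,t)=y$. Assume that the projection of $L$ to $S$ is transverse (only finitely many transverse double points, the crossings), that each component of $L$ passes through at least one crossing, and that the diagram is alternating: along $\widetilde L$, consecutive crossings of $\widetilde\pi(\widetilde L)$ on $\widetilde S$ alternate between over and under (over means larger $t$). Then each edge of the 4-valent graph $\widetilde\pi(\widetilde L)$ has one over-crossing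 end and one under-crossing end. For a crossing $y$ of $\widetilde\pi(\widetilde L)$, its crossing arc is the open vertical segment of $q(\{y\}\times[-1,1])$ between the two points of $L$; $y$ and $\tau y$ have the same crossing arc. A *chunk* is a compact, connected, orientable, irreducible 3-manifold $C$ with a non-empty finite graph $\Gamma$ embedded in $\partial C$, all of whose vertices have valence at least 3, such that each component of $\partial C$ disjoint from $\Gamma$ is incompressible. The other components of $\partial C$, cut along $\Gamma$, are the (closed) interior faces. A decomposition of a 3-manifold $Y$ into the single chunk $C$ with ideal vertices is a homeomorphism from $Y$ to the quotient of $C\setminus\{\text{vertices of }\Gamma\}$ by the equivalence relation generated by a fixed-point-free involutive homeomorphism of the disjoint union of the closed interior faces that takes vertices to vertices and edges to edges. **Theorem.** $M\setminus L$ admits a chunk decomposition with a single chunk $C$, such that: 1. $C$ is (homeomorphic to) $M\backslash\backslash S$. 2. The graph $\Gamma$ on $\widetilde S\subset\partial C$ is the diagram graph $\widetilde\pi(\widetilde L)$: the ideal vertices are its crossings, and the edges of $\Gamma$ are the edges of $\widetilde\pi(\widetilde L)$. 3. Each region $R$ of $\widetilde S\setminus\widetilde\pi(\widetilde L)$ is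 glued to $\tau(R)$. The gluing is $\tau$ followed by a rotation of $\tau(R)$, that is, a homeomorphism isotopic to the identity through homeomorphisms of the closed face which move each corner along the boundary to the next corner, in the direction in which the boundary of $\tau(R)$ runs from under-crossing to over-crossing. (Whether this is clockwise or anticlockwise thus depends on whether that boundary component runs from under to over clockwise or anticlockwise.) 4. The quotient map takes each open edge of $\Gamma$ bijectively onto the crossing arc at its under-crossing end; exactly four edges of $\Gamma$ are glued to each crossing arc; and at each ideal vertex two opposite edges are glued together. -/

import Mathlib

open Set Filter Topology

universe u v

namespace LinkChunk

/-! ## Manifolds, orientability, irreducibility, incompressibility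

All manifolds have dimension at most three and all submanifolds below are tame (they come with
collars, tubular neighbourhoods or charts), so the topological and the piecewise linear theories
agree. -/

/-- `X` is a topological `n`-manifold whose boundary is exactly the set `B`: a second countable
Hausdorff space with charts to the half-space `{x | 0 ≤ x 0}` in which the points of `B` are those
that are sent to the hyperplane `x 0 = 0`. -/
structure IsManifoldWithBoundary (n : ℕ) [NeZero n] (X : Type*) [TopologicalSpace X]
    (B : Set X) : Prop where
  t2 : T2Space X
  secondCountable : SecondCountableTopology X
  exists_chart : ∀ x : X, ∃ e : OpenPartialHomeomorph X (EuclideanHalfSpace n),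
    x ∈ e.source ∧ ∀ y ∈ e.source, (y ∈ B ↔ (e y).1 0 = 0)

/-- Orientability of an `n`-manifold `X` (`n ≥ 1`): a coordinate ball cannot be carried around `X`,
through a continuous family of embeddings `h t : ℝⁿ → X`, so that it returns to its mirror image
(there is no orientation-reversing loop).  By invariance of domain the injective continuous maps
`h t` are open embeddings into the interior. -/
def Orientable (n : ℕ) (X : Type*) [TopologicalSpace X] : Prop :=
  ¬ ∃ h : unitInterval × (Fin n → ℝ) → X, Continuous h ∧
      (∀ t, Function.Injective fun x => h (t, x)) ∧
      ∃ A : Matrix (Fin n) (Fin n) ℝ, A.det < 0 ∧ ∀ x, h (1, x) = h (0, A.mulVec x)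

/-- A 3-manifold is irreducible: every tame 2-sphere (given with a two-sided collar, as the unit
sphere of an embedded spherical shell) bounds an embedded 3-ball. -/
def Irreducible3 (X : Type*) [TopologicalSpace X] : Prop :=
  ∀ f : EuclideanSpace ℝ (Fin 3) → X,
    ContinuousOn f {x | 1 / 2 ≤ ‖x‖ ∧ ‖x‖ ≤ 2} → InjOn f {x | 1 / 2 ≤ ‖x‖ ∧ ‖x‖ ≤ 2} →
    ∃ g : EuclideanSpace ℝ (Fin 3) → X,
      ContinuousOn g (Metric.closedBall 0 1) ∧ InjOn g (Metric.closedBall 0 1) ∧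
      IsOpen (g '' Metric.ball 0 1) ∧ g '' Metric.sphere 0 1 = f '' Metric.sphere 0 1

/-- A closed surface `K` in the boundary of a 3-manifold `X` is incompressible: the boundary of
every embedded disc that meets `K` exactly in its boundary also bounds a disc in `K`, and
`K` is not a sphere that bounds a ball in `X`. -/
def Incompressible (X : Type*) [TopologicalSpace X] (K : Set X) : Prop :=
  (∀ g : EuclideanSpace ℝ (Fin 2) → X,
    ContinuousOn g (Metric.closedBall 0 1) → InjOn g (Metric.closedBall 0 1) →
    (∀ x ∈ Metric.closedBall (0 : EuclideanSpace ℝ (Fin 2)) 1,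
      (g x ∈ K ↔ x ∈ Metric.sphere (0 : EuclideanSpace ℝ (Fin 2)) 1)) →
    ∃ d : EuclideanSpace ℝ (Fin 2) → X,
      ContinuousOn d (Metric.closedBall 0 1) ∧ InjOn d (Metric.closedBall 0 1) ∧
      d '' Metric.closedBall 0 1 ⊆ K ∧ d '' Metric.sphere 0 1 = g '' Metric.sphere 0 1) ∧
  ¬ ∃ g : EuclideanSpace ℝ (Fin 3) → X,
      ContinuousOn g (Metric.closedBall 0 1) ∧ InjOn g (Metric.closedBall 0 1) ∧
      g '' Metric.sphere 0 1 = K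

/-! ## Embedded graphs, chunks, chunk decompositions -/

/-- A finite graph embedded in a space.  Loops and multiple edges are allowed; edges are
parametrized by `[0,1]`, and meet the vertices and each other only in their ends. -/
structure EmbeddedGraph (X : Type*) [TopologicalSpace X] where
  verts : Set X
  finite_verts : verts.Finite
  numEdges : ℕ
  edge : Fin numEdges → unitInterval → X
  continuous_edge : ∀ e, Continuous (edge e)
  edge_zero_mem : ∀ e, edge e 0 ∈ verts
  edge_one_mem : ∀ e, edge e 1 ∈ verts
  edge_not_vert : ∀ e, ∀ s ∈ Ioo (0 : unitInterval) 1, edge e s ∉ verts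
  edge_inj : ∀ e e', ∀ s ∈ Ioo (0 : unitInterval) 1, ∀ s' : unitInterval,
    edge e s = edge e' s' → e = e' ∧ s = s'

namespace EmbeddedGraph

variable {X : Type*} [TopologicalSpace X] (G : EmbeddedGraph X)

/-- The underlying point set of the graph. -/
def support : Set X := G.verts ∪ ⋃ e, range (G.edge e)

/-- The number of edge ends at `x` (a loop counts twice). -/
noncomputable def valence (x : X) : ℕ :=
  {e | G.edge e 0 = x}.ncard + {e | G.edge e 1 = x}.ncard

end EmbeddedGraph

/-- `C`, with boundary `B` and graph `G`, is a chunk: a compact connected orientable irreducible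
3-manifold with a non-empty graph embedded in its boundary, all of whose vertices have valence at
least three, such that the components of `B` disjoint from the graph (exterior faces) are
incompressible. -/
structure IsChunk (C : Type*) [TopologicalSpace C] (B : Set C) (G : EmbeddedGraph C) : Prop where
  compact : CompactSpace C
  connected : ConnectedSpace C
  manifold : IsManifoldWithBoundary 3 C B
  orientable : Orientable 3 C
  irreducible : Irreducible3 C
  nonempty : G.support.Nonempty
  subset_boundary : G.support ⊆ B
  three_le_valence : ∀ x ∈ G.verts, 3 ≤ G.valence x
  exterior : ∀ x ∈ B, Disjoint (connectedComponentIn B x) G.support →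
    Incompressible C (connectedComponentIn B x)

/-- The union of the components of the boundary `B` that meet the graph. -/
def interiorBoundary {C : Type*} [TopologicalSpace C] (B : Set C) (G : EmbeddedGraph C) : Set C :=
  {x ∈ B | (connectedComponentIn B x ∩ G.support).Nonempty}

/-- The closed surface `B₀` cut open along the embedded graph `G`: a compact surface with boundary,
the disjoint union of the (abstract) closed faces, with the regluing map `toX` onto `B₀`.  That
map is injective off the boundary, the boundary is the preimage of the graph, and the boundary is
subdivided into sides, two over each edge, each traversing its edge once. -/
structure CutSurface {X : Type u} [TopologicalSpace X] (G : EmbeddedGraph X) (B₀ : Set X) where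
  carrier : Type u
  [top : TopologicalSpace carrier]
  [compact : CompactSpace carrier]
  bd : Set carrier
  manifold : IsManifoldWithBoundary 2 carrier bd
  toX : carrier → X
  continuous_toX : Continuous toX
  range_toX : range toX = B₀
  injOn_toX : InjOn toX bdᶜ
  mem_bd_iff : ∀ z, z ∈ bd ↔ toX z ∈ G.support
  side : Fin G.numEdges → Bool → unitInterval → carrier
  continuous_side : ∀ e b, Continuous (side e b)
  toX_side : ∀ e b s, toX (side e b s) = G.edge e s
  side_ne : ∀ e, ∀ s ∈ Ioo (0 : unitInterval) 1, side e false s ≠ side e true s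
  exists_side : ∀ z ∈ bd, ∃ e b s, side e b s = z

attribute [instance] CutSurface.top CutSurface.compact

/-- A decomposition of `Y` into a single chunk `C` (with boundary `B`) with ideal vertices: a graph
making `C` a chunk, a free involution `glue` of the closed interior faces pairing faces
homeomorphically, ideal vertices to ideal vertices and edges to edges, and a quotient map from `C`
minus the ideal vertices onto `Y` whose fibres are exactly the classes of the equivalence relation
generated by the gluing (so `Y` is homeomorphic to the glued chunk).  A face may be glued to itself
by a free involution. -/
structure ChunkDecomposition (C : Type u) [TopologicalSpace C] (B : Set C)
    (Y : Type v) [TopologicalSpace Y] where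
  graph : EmbeddedGraph C
  isChunk : IsChunk C B graph
  faces : CutSurface graph (interiorBoundary B graph)
  glue : faces.carrier ≃ₜ faces.carrier
  glue_glue : ∀ z, glue (glue z) = z
  glue_ne : ∀ z, glue z ≠ z
  glue_corner : ∀ z, faces.toX z ∈ graph.verts → faces.toX (glue z) ∈ graph.verts
  glue_side : ∀ e b, ∃ e' b', glue '' range (faces.side e b) = range (faces.side e' b')
  quot : {x : C // x ∉ graph.verts} → Y
  isQuotientMap_quot : IsQuotientMap quot
  quot_eq_iff : ∀ x y, quot x = quot y ↔
    Relation.EqvGen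
      (fun x y : {x : C // x ∉ graph.verts} =>
        ∃ z, faces.toX z = x.1 ∧ faces.toX (glue z) = y.1) x y

/-- The open edge `e`, as a subset of the chunk minus its ideal vertices. -/
def ChunkDecomposition.openEdge {C : Type u} [TopologicalSpace C] {B : Set C} {Y : Type v}
    [TopologicalSpace Y] (𝒟 : ChunkDecomposition C B Y) (e : Fin 𝒟.graph.numEdges) :
    Set {x : C // x ∉ 𝒟.graph.verts} :=
  {x | ∃ s ∈ Ioo (0 : unitInterval) 1, 𝒟.graph.edge e s = x.1}

/-! ## Nonorientable projection surfaces -/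

/-- A connected nonorientable projection surface in the 3-manifold `M` with boundary `bM`, with its
regular neighbourhood.  `St` is the orientable double cover of the surface and `τ` its deck
transformation.  The tubular neighbourhood is given by `nbhd : St × ℝ → M`, which is open,
continuous, and identifies exactly the orbits of `(y, t) ↦ (τ y, -t)`, that is, it induces an open
embedding of the twisted line bundle over the surface.  The surface is the image of `t = 0`, and
the twisted `I`-bundle (`I = [-1, 1]`) is the image of `-1 ≤ t ≤ 1`. -/
structure ProjectionSurface (M : Type u) [TopologicalSpace M] (bM : Set M)
    (St : Type v) [TopologicalSpace St] where
  compact : CompactSpace St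
  connected : ConnectedSpace St
  isSurface : IsManifoldWithBoundary 2 St ∅
  orientable : Orientable 2 St
  τ : St ≃ₜ St
  τ_τ : ∀ y, τ (τ y) = y
  τ_ne : ∀ y, τ y ≠ y
  nbhd : St × ℝ → M
  continuous_nbhd : Continuous nbhd
  isOpenMap_nbhd : IsOpenMap nbhd
  nbhd_eq_iff : ∀ a b : St × ℝ, nbhd a = nbhd b ↔ b = a ∨ b = (τ a.1, -a.2)
  nbhd_not_mem : ∀ a, nbhd a ∉ bM
  /-- The surface `S = {t = 0}` is nonorientable. -/
  nonorientable : ¬ Orientable 2 (nbhd '' (univ ×ˢ {0}) : Set M)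
  /-- `M \ S` is irreducible. -/
  irreducible_compl : Irreducible3 {x : M // x ∉ nbhd '' (univ ×ˢ {0})}

namespace ProjectionSurface

variable {M : Type u} [TopologicalSpace M] {bM : Set M} {St : Type v} [TopologicalSpace St]
  (P : ProjectionSurface M bM St)

/-- The projection surface `S` in `M`. -/
def surface : Set M := P.nbhd '' (univ ×ˢ {0})

/-- The twisted `I`-bundle over `S` in `M`. -/
def thickening : Set M := P.nbhd '' (univ ×ˢ Icc (-1) 1)

/-- `M \\ S`: the closure of the complement of the twisted `I`-bundle, i.e. the complement of the
open twisted `I`-bundle. -/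
abbrev Cut : Type u := {x : M // x ∉ P.nbhd '' (univ ×ˢ Ioo (-1) 1)}

theorem nbhd_one_not_mem (y : St) : P.nbhd (y, 1) ∉ P.nbhd '' (univ ×ˢ Ioo (-1) 1) := by
  rintro ⟨⟨z, t⟩, ⟨-, ht⟩, h⟩
  rcases (P.nbhd_eq_iff _ _).1 h with h | h
  · have h2 : (1 : ℝ) = t := congrArg Prod.snd h
    have := ht.2
    simp only at this
    linarith
  · have h2 : (1 : ℝ) = -t := congrArg Prod.snd h
    have := ht.1
    simp only at this
    linarith

/-- The identification of `St` with the level `t = 1`, the part of the boundary of `M \\ S` that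
does not lie in the boundary of `M`. -/
def toCut (y : St) : P.Cut := ⟨P.nbhd (y, 1), P.nbhd_one_not_mem y⟩

/-- The boundary of `M \\ S`. -/
def cutBoundary : Set P.Cut := range P.toCut ∪ {x | x.1 ∈ bM}

/-! ## Links and generalised diagrams -/

/-- The preimage of `L` in `St × ℝ`. -/
def lift (L : Set M) : Set (St × ℝ) := P.nbhd ⁻¹' L

/-- The projection of the preimage of `L` to `St`: the lifted diagram. -/
def diagram (L : Set M) : Set St := Prod.fst '' P.lift L

/-- `a` lies on the over-strand at a crossing. -/
def IsOver (L : Set M) (a : St × ℝ) : Prop :=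
  a ∈ P.lift L ∧ ∃ t, t < a.2 ∧ (a.1, t) ∈ P.lift L

/-- `a` lies on the under-strand at a crossing. -/
def IsUnder (L : Set M) (a : St × ℝ) : Prop :=
  a ∈ P.lift L ∧ ∃ t, a.2 < t ∧ (a.1, t) ∈ P.lift L

/-- The crossings (double points) of the lifted diagram. -/
def crossings (L : Set M) : Set St :=
  {y | ∃ t t', t < t' ∧ (y, t) ∈ P.lift L ∧ (y, t') ∈ P.lift L}

/-- The projection of `L` is a generalised diagram (transversality): near each of its points,
in a suitable chart of the surface, the diagram is either a line over which the link is a graph, or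
two lines crossing transversely, over each of which a strand of the link is a graph, one strand
lying below the other at the crossing.  As the double cover is a local homeomorphism, it does not
matter whether this is stated on the surface or on its double cover. -/
def IsGeneralisedDiagram (L : Set M) : Prop :=
  ∀ y ∈ P.diagram L, ∃ h : OpenPartialHomeomorph St (ℝ × ℝ),
    y ∈ h.source ∧ h.target = univ ∧ h y = (0, 0) ∧
    ((∃ f : ℝ → ℝ, Continuous f ∧
        ∀ z ∈ h.source, ∀ t, ((z, t) ∈ P.lift L ↔ (h z).2 = 0 ∧ t = f (h z).1)) ∨
     (∃ f g : ℝ → ℝ, Continuous f ∧ Continuous g ∧ f 0 < g 0 ∧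
        ∀ z ∈ h.source, ∀ t, ((z, t) ∈ P.lift L ↔
          ((h z).2 = 0 ∧ t = f (h z).1) ∨ ((h z).1 = 0 ∧ t = g (h z).2))))

/-- The diagram is alternating: the lifted diagram is alternating on the double cover, that is,
any arc of the lifted link between consecutive crossings runs from over to under or from under to
over. -/
def IsAlternating (L : Set M) : Prop :=
  ∀ c : unitInterval → St × ℝ, Continuous c → (∀ s, c s ∈ P.lift L) →
    InjOn c (Ioo 0 1) → (∀ s ∈ Ioo (0 : unitInterval) 1, (c s).1 ∉ P.crossings L) →
    (c 0).1 ∈ P.crossings L → (c 1).1 ∈ P.crossings L →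
    (P.IsOver L (c 0) ↔ P.IsUnder L (c 1))

/-- The crossing arc at the crossing `y`: the open vertical segment in `M` joining the two strands
of the link over `y`.  It is the same for `y` and `τ y`. -/
def crossingArc (L : Set M) (y : St) : Set M :=
  {x | ∃ t₁ t t₂, t₁ < t ∧ t < t₂ ∧ (y, t₁) ∈ P.lift L ∧ (y, t₂) ∈ P.lift L ∧ x = P.nbhd (y, t)}

end ProjectionSurface

/-- A link: a non-empty finite disjoint union of embedded circles. -/
def IsLink {M : Type*} [TopologicalSpace M] (L : Set M) : Prop :=
  ∃ (n : ℕ) (f : Fin (n + 1) × Circle → M), Continuous f ∧ Function.Injective f ∧ range f = L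

/-- Two edges `α`, `α'` of the planar diagram `D`, both starting at the crossing `y`, are opposite
at `y`: in a chart in which `D` consists of the two coordinate axes, they start along opposite
half-axes. -/
def OppositeAt {St : Type*} [TopologicalSpace St] (D : Set St) (y : St)
    (α α' : unitInterval → St) : Prop :=
  α 0 = y ∧ α' 0 = y ∧
  ∃ h : OpenPartialHomeomorph St (ℝ × ℝ), y ∈ h.source ∧ h.target = univ ∧ h y = (0, 0) ∧
    (∀ z ∈ h.source, (z ∈ D ↔ (h z).1 = 0 ∨ (h z).2 = 0)) ∧
    (∀ᶠ s in 𝓝[>] (0 : unitInterval), α s ∈ h.source ∧ 0 < (h (α s)).1 ∧ (h (α s)).2 = 0) ∧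
    (∀ᶠ s in 𝓝[>] (0 : unitInterval), α' s ∈ h.source ∧ (h (α' s)).1 < 0 ∧ (h (α' s)).2 = 0)

end LinkChunk

open LinkChunk

/-!
The idea is to describe the gluing by a *sweep*.  Cut the surface `St` open along the lifted
diagram.  The product of the cut surface with `[0, 1]` maps onto a collar of the copy of `St` in
the boundary of `M \\ S`, and it also maps onto a neighbourhood of `S` in `M`: the bottom is
pushed down, past the strands of the link, until each face meets the face with which it is to be
glued.  Comparing the two maps identifies a quotient of `M \\ S`, without the ideal vertices, with
`M \ L`.

*The faces.*  Near each of its points the diagram is a line or a pair of crossing lines, and the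
closed sectors of these charts, closed up under `τ`, form a `PatchSystem`.  The cut surface
`PatchSystem.Carrier` is the closure of a graph over the complement of the diagram, in which the
different sectors at a point of the diagram are separated by bump functions.  It is a compact
surface, and its boundary maps to the diagram as a double cover off the crossings.  The link is a
union of circles; lifting their rotations to the double cover `St × ℝ → M` gives a flow along the
lifted link (`exists_isLinkFlow`), and by alternation the flow lines between consecutive
crossings, directed suitably, run from an under- to an over-crossing
(`IsLinkFlow.exists_edgeSystem`).  Each edge has two lifts to the boundary of the cut surface, its
sides.  Because every edge runs from under to over, at every corner one side ends and one side
starts: this is where alternation enters.  Hence the sides, placed end to end, are the orbits of a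
flow `R` on the boundary that moves each corner to the next one in unit time and is reversed by
the involution over `τ` (`IsSides.exists_isFlow`).  With an equivariant collar
(`PatchSystem.exists_isCollar`), damping `R` along the collar extends it to an isotopy `rotate` of
the faces, and the gluing of the faces is `regluing`, the involution followed by `rotate 1`.

*The sweep.*  A point of the collar with parameters `z` and `u` is moved along the boundary
circles by an amount that depends on the phase `κ z`, twice the distance of `z` from the closest
corner measured along its side.  It is moved forwards by the source map `src` and backwards, by
the same amount, by the target map `tgt`; `height` is the position on the vertical line over the
target.  The displacement is damped along the collar, and there `z` is slightly offset to make up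
for the damping.  On the boundary of the bottom the effect is the following.  The first half of a
side is stretched by `src` over the whole side and is contracted by `tgt` to the corner where the
side starts, while the height runs from the upper to the lower strand there.  The second half is
contracted by `src` to the corner where the side ends, an ideal vertex, and is stretched by `tgt`
over the side, while the height follows the link.  So the open edge is taken onto the crossing arc
at its under-crossing, and the ideal vertices are exactly what is pushed into the link
(`mem_link_iff`).  In the interior of the faces both maps are injective because the phase is
Lipschitz.  Passing from `z` to its image under the involution, moved on by half a side, turns the
phase `κ` into `1 - κ` and, at the bottom, the height into its negative; that is why two points of
the bottom are swept to the same point of `M` exactly when `regluing` identifies their sources.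

The fibres are compared in `tgt_eq_of_src_eq`, `src_eq_of_tgt_eq` and `src_rel_of_tgt_eq`, and
surjectivity follows from the intermediate value theorem.  Together with the inclusion of the
outside of a thick collar, and after straightening the heights of the link
(`exists_isHeightData`), this gives the quotient map from `M \\ S` to the complement of `L`
(`exists_quot`).

*The chunk.*  `M \\ S` is a chunk because it is the complement of an open collar in `M \ S`: a
sphere in it bounds a ball in `M \ S`, which cannot meet the connected punctured collar without
containing it and having points of `S` in its closure (`irreducible_cut`); similarly disks and
spheres transfer for incompressibility.

*The edges.*  Edges over the same crossing arc are those that start at one of the two crossings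
`y` and `τ y` above it, and at each of these the two halves of the strand below start
(`ncard_crossingArc`, `exists_oppositeAt`).
-/

open scoped NNReal

/-! ### Auxiliary facts on charts and continuity -/

namespace LinkChunk

/-- To produce a chart of a manifold with boundary near a point it is enough to give a space `T`
with open embeddings into the manifold and into the half-space. -/
theorem exists_chart_of_isOpenEmbedding {n : ℕ} [NeZero n] {X T : Type*} [TopologicalSpace X]
    [TopologicalSpace T] {B : Set X} {φ : T → X} {χ : T → EuclideanHalfSpace n}
    (hφ : IsOpenEmbedding φ) (hχ : IsOpenEmbedding χ) (hB : ∀ t, φ t ∈ B ↔ (χ t).1 0 = 0) (t : T) :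
    ∃ e : OpenPartialHomeomorph X (EuclideanHalfSpace n),
      φ t ∈ e.source ∧ ∀ y ∈ e.source, (y ∈ B ↔ (e y).1 0 = 0) := by
  have : Nonempty T := ⟨t⟩
  have key : ∀ t, (hφ.toOpenPartialHomeomorph φ).symm (φ t) = t := fun t => by
    have := (hφ.toOpenPartialHomeomorph φ).left_inv (x := t) (by simp)
    simpa using this
  refine ⟨(hφ.toOpenPartialHomeomorph φ).symm.trans (hχ.toOpenPartialHomeomorph χ), ?_, ?_⟩
  · simp
  · rintro y hy
    have hy' : y ∈ range φ := by simpa using hy.1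
    obtain ⟨s, rfl⟩ := hy'
    rw [hB]
    simp [key]

/-- The homeomorphism of the upper half-plane with the model half-space of dimension two, as an
open embedding. -/
theorem isOpenEmbedding_halfPlane :
    IsOpenEmbedding (fun p : ℝ × ℝ≥0 =>
      (⟨!₂[(p.2 : ℝ), p.1], by simp⟩ : EuclideanHalfSpace 2)) := by
  have hc : Continuous (fun p : ℝ × ℝ≥0 =>
      (⟨!₂[(p.2 : ℝ), p.1], by simp⟩ : EuclideanHalfSpace 2)) := by
    refine Continuous.subtype_mk ?_ _
    refine (PiLp.continuous_toLp 2 _).comp (continuous_pi fun i => ?_)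
    fin_cases i <;> simp <;> fun_prop
  have hg : Continuous (fun x : EuclideanHalfSpace 2 => ((x.1 1, ⟨x.1 0, x.2⟩) : ℝ × ℝ≥0)) := by
    refine Continuous.prodMk ?_ (Continuous.subtype_mk ?_ _) <;> fun_prop
  let e : (ℝ × ℝ≥0) ≃ₜ EuclideanHalfSpace 2 :=
    { toFun := _
      invFun := fun x => ((x.1 1, ⟨x.1 0, x.2⟩) : ℝ × ℝ≥0)
      left_inv := fun _ => rfl
      right_inv := fun x => by
        apply Subtype.ext
        ext i
        fin_cases i <;> rfl
      continuous_toFun := hc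
      continuous_invFun := hg }
  exact e.isOpenEmbedding

theorem dense_inner : Dense {p : ℝ × ℝ≥0 | 0 < p.2} := by
  have h1 : Dense (Ioi (0 : ℝ≥0)) := by
    rw [dense_iff_closure_eq, closure_Ioi]
    ext x; simp
  have := (dense_univ (X := ℝ)).prod h1
  refine this.mono ?_
  rintro ⟨a, b⟩ ⟨-, h⟩
  exact h

/-- Arbitrarily small half-discs with connected interior. -/
theorem exists_preconnected_inner {p : ℝ × ℝ≥0} {N : Set (ℝ × ℝ≥0)} (hN : N ∈ 𝓝 p) :
    ∃ B ∈ 𝓝 p, B ⊆ N ∧ IsPreconnected (B ∩ {p | 0 < p.2}) := by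
  obtain ⟨ε, hε, hb⟩ := Metric.mem_nhds_iff.1 hN
  refine ⟨Metric.ball p ε, Metric.ball_mem_nhds _ hε, hb, ?_⟩
  have : Metric.ball p ε ∩ {p | 0 < p.2} =
      Metric.ball p.1 ε ×ˢ (Metric.ball p.2 ε ∩ Ioi 0) := by
    rw [← Prod.mk.eta (p := p), ← ball_prod_same]
    ext ⟨a, b⟩
    simp [and_assoc]
  rw [this]
  refine IsPreconnected.prod ?_ ?_
  · rw [Real.ball_eq_Ioo]; exact isPreconnected_Ioo
  · refine OrdConnected.isPreconnected (OrdConnected.inter ?_ ordConnected_Ioi)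
    have : Metric.ball p.2 ε = (fun x : ℝ≥0 => (x : ℝ)) ⁻¹' (Ioo (p.2 - ε) (p.2 + ε)) := by
      ext x
      rw [Metric.mem_ball, NNReal.dist_eq, mem_preimage, mem_Ioo, abs_lt]
      constructor <;> intro h <;> constructor <;> linarith [h.1, h.2]
    rw [this]
    exact ordConnected_Ioo.preimage_mono NNReal.coe_mono

/-! ### Cutting a surface open along a diagram -/

/-- A finite system of *patches* for a closed subset `D` of a surface `S` (a graph with vertex set
`V`), invariant under the involution `τ`.  A patch `q i` is an embedded half-plane whose interior,
a sector, lies in the complement of `D` and whose boundary line lies on `D`; the function `bump i`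
is supported where the sector is relatively closed in the complement of `D`.  Near a point `y` of
`D` the complement of `D` is the disjoint union of the sectors in `sectors y`: two of them if `y`
lies on an edge, four at a crossing. -/
structure PatchSystem {S : Type*} [TopologicalSpace S] (D V : Set S) (τ : S ≃ₜ S) where
  ι : Type
  [fintype : Fintype ι]
  q : ι → ℝ × ℝ≥0 → S
  embedding : ∀ i, IsEmbedding (q i)
  isOpen_inner : ∀ i, IsOpen (q i '' {p | 0 < p.2})
  mem_iff : ∀ i p, q i p ∈ D ↔ p.2 = 0
  bump : ι → S → ℝ
  continuous_bump : ∀ i, Continuous (bump i)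
  bump_nonneg : ∀ i y, 0 ≤ bump i y
  closure_inner : ∀ i, ∀ y ∈ closure (q i '' {p | 0 < p.2}), 0 < bump i y → y ∈ range (q i)
  twist : ι → ι
  twist_twist : ∀ i, twist (twist i) = i
  q_twist : ∀ i p, q (twist i) p = τ (q i p)
  bump_twist : ∀ i y, bump (twist i) (τ y) = bump i y
  sectors : S → Finset ι
  bump_pos : ∀ y ∈ D, ∀ i ∈ sectors y, 0 < bump i y
  mem_range : ∀ y ∈ D, ∀ i ∈ sectors y, y ∈ range (q i)
  disjoint_inner : ∀ y ∈ D, ∀ i ∈ sectors y, ∀ j ∈ sectors y, i ≠ j →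
    Disjoint (q i '' {p | 0 < p.2}) (q j '' {p | 0 < p.2})
  cover : ∀ y ∈ D, ∀ᶠ z in 𝓝 y, z ∉ D → ∃ i ∈ sectors y, z ∈ q i '' {p | 0 < p.2}
  card_crossing : ∀ y ∈ V, (sectors y).card = 4
  card_edge : ∀ y ∈ D \ V, (sectors y).card = 2
  boundary_mem : ∀ y ∈ D \ V, ∀ i ∈ sectors y, q i '' {p | p.2 = 0} ∈ 𝓝[D] y

attribute [instance] PatchSystem.fintype

namespace PatchSystem

variable {S : Type*} [TopologicalSpace S] {D V : Set S} {τ : S ≃ₜ S}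
  (Q : PatchSystem D V τ)

/-- The open sector of a patch. -/
def inner (i : Q.ι) : Set S := Q.q i '' {p | 0 < p.2}

theorem inner_disjoint {i : Q.ι} {y : S} (hy : y ∈ Q.inner i) : y ∉ D := by
  obtain ⟨p, hp, rfl⟩ := hy
  rw [Q.mem_iff]
  exact hp.ne'

theorem inner_of_closure {i : Q.ι} {y : S} (hy : y ∈ closure (Q.inner i)) (hb : 0 < Q.bump i y)
    (hD : y ∉ D) : y ∈ Q.inner i := by
  obtain ⟨p, rfl⟩ := Q.closure_inner i y hy hb
  rw [Q.mem_iff] at hD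
  exact ⟨p, pos_iff_ne_zero.2 hD, rfl⟩

/-- The bump function of a patch, cut off outside its sector.  These functions jump along `D`; the
surface cut open along `D` is the closure of their graph over the complement of `D`. -/
noncomputable def gauge (y : S) (i : Q.ι) : ℝ := (Q.inner i).indicator (Q.bump i) y

theorem gauge_of_mem {i : Q.ι} {y : S} (hy : y ∈ Q.inner i) : Q.gauge y i = Q.bump i y :=
  indicator_of_mem hy _

theorem gauge_of_notMem {i : Q.ι} {y : S} (hy : y ∉ Q.inner i) : Q.gauge y i = 0 :=
  indicator_of_notMem hy _

theorem gauge_nonneg (i : Q.ι) (y : S) : 0 ≤ Q.gauge y i :=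
  indicator_nonneg (fun _ _ => Q.bump_nonneg i _) _

theorem gauge_le (i : Q.ι) (y : S) : Q.gauge y i ≤ Q.bump i y :=
  indicator_le_self' (fun _ _ => Q.bump_nonneg i _) _

theorem mem_inner_of_gauge_pos {i : Q.ι} {y : S} (h : 0 < Q.gauge y i) : y ∈ Q.inner i := by
  by_contra hy
  rw [Q.gauge_of_notMem hy] at h
  exact lt_irrefl _ h

/-- The gauges have limits along each sector. -/
theorem exists_tendsto_gauge (i j : Q.ι) (p : ℝ × ℝ≥0) :
    ∃ l, Tendsto (fun p => Q.gauge (Q.q j p) i) (𝓝[{p | 0 < p.2}] p) (𝓝 l) := by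
  have hc : Continuous fun p => Q.bump i (Q.q j p) :=
    (Q.continuous_bump i).comp (Q.embedding j).continuous
  rcases (Q.bump_nonneg i (Q.q j p)).eq_or_lt with h0 | h0
  · refine ⟨0, tendsto_of_tendsto_of_tendsto_of_le_of_le tendsto_const_nhds
      (h := fun p => Q.bump i (Q.q j p)) ?_ (fun _ => Q.gauge_nonneg _ _)
      (fun _ => Q.gauge_le _ _)⟩
    rw [h0]
    exact hc.continuousWithinAt
  · obtain ⟨B, hB, hBN, hBc⟩ := exists_preconnected_inner (hc.continuousAt.eventually_const_lt h0)
    have hpre : IsPreconnected (Q.q j '' (B ∩ {p | 0 < p.2})) :=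
      hBc.image _ (Q.embedding j).continuous.continuousOn
    have hsub : Q.q j '' (B ∩ {p | 0 < p.2}) ⊆ Q.inner i ∪ (closure (Q.inner i))ᶜ := by
      rintro _ ⟨r, ⟨hr, hr'⟩, rfl⟩
      by_cases hcl : Q.q j r ∈ closure (Q.inner i)
      · exact Or.inl (Q.inner_of_closure hcl (hBN hr) (Q.inner_disjoint ⟨r, hr', rfl⟩))
      · exact Or.inr hcl
    have hB' : B ∩ {p | 0 < p.2} ∈ 𝓝[{p | 0 < p.2}] p :=
      inter_comm B _ ▸ inter_mem_nhdsWithin _ hB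
    rcases isPreconnected_iff_subset_of_disjoint.1 hpre _ _ (Q.isOpen_inner i)
      isClosed_closure.isOpen_compl hsub (by
        rw [eq_empty_iff_forall_notMem]
        rintro x ⟨-, hx, hx'⟩
        exact hx' (subset_closure hx)) with h | h
    · refine ⟨Q.bump i (Q.q j p), Tendsto.congr' ?_ hc.continuousWithinAt⟩
      filter_upwards [hB'] with r hr
      exact (Q.gauge_of_mem (h ⟨r, hr, rfl⟩)).symm
    · refine ⟨0, Tendsto.congr' ?_ tendsto_const_nhds⟩
      filter_upwards [hB'] with r hr
      exact (Q.gauge_of_notMem fun hm => h ⟨r, hr, rfl⟩ (subset_closure hm)).symm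

/-- The surface cut open along `D`. -/
def Carrier : Type _ :=
  {x : S × (Q.ι → ℝ) // x ∈ closure ((fun y => (y, Q.gauge y)) '' Dᶜ)}

instance : TopologicalSpace Q.Carrier := inferInstanceAs (TopologicalSpace (Subtype _))

instance [T2Space S] : T2Space Q.Carrier := inferInstanceAs (T2Space (Subtype _))

instance [SecondCountableTopology S] : SecondCountableTopology Q.Carrier :=
  inferInstanceAs (SecondCountableTopology (Subtype _))

instance [CompactSpace S] : CompactSpace Q.Carrier := by
  have hb : ∀ i, ∃ M, ∀ y, Q.bump i y ≤ M := fun i => by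
    obtain ⟨M, hM⟩ := (isCompact_range (Q.continuous_bump i)).bddAbove
    exact ⟨M, fun y => hM ⟨y, rfl⟩⟩
  choose M hM using hb
  refine isCompact_iff_compactSpace.1 (IsCompact.of_isClosed_subset
    (isCompact_univ.prod (isCompact_univ_pi fun i => isCompact_Icc (a := (0 : ℝ)) (b := M i)))
    isClosed_closure (closure_minimal ?_ ?_))
  · rintro _ ⟨y, -, rfl⟩
    exact ⟨mem_univ _, fun i _ => ⟨Q.gauge_nonneg _ _, (Q.gauge_le _ _).trans (hM _ _)⟩⟩
  · exact isClosed_univ.prod (isClosed_set_pi fun i _ => isClosed_Icc)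

/-- The regluing map of the cut surface. -/
def proj (z : Q.Carrier) : S := z.1.1

theorem continuous_proj : Continuous Q.proj := continuous_fst.comp continuous_subtype_val

/-- The boundary of the cut surface. -/
def bd : Set Q.Carrier := Q.proj ⁻¹' D

/-- The extension of the gauges to the boundary of a sector. -/
noncomputable def gaugeExt (j : Q.ι) : ℝ × ℝ≥0 → Q.ι → ℝ :=
  fun p i => extendFrom {p : ℝ × ℝ≥0 | 0 < p.2} (fun p => Q.gauge (Q.q j p) i) p

theorem continuous_gaugeExt (j : Q.ι) : Continuous (Q.gaugeExt j) :=
  continuous_pi fun i => continuous_extendFrom dense_inner fun p => Q.exists_tendsto_gauge i j p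

theorem continuousOn_gauge (i j : Q.ι) :
    ContinuousOn (fun p => Q.gauge (Q.q j p) i) {p | 0 < p.2} := by
  intro p hp
  obtain ⟨l, hl⟩ := Q.exists_tendsto_gauge i j p
  have : l = Q.gauge (Q.q j p) i := by
    have h1 : pure p ≤ 𝓝[{p : ℝ × ℝ≥0 | 0 < p.2}] p := pure_le_nhdsWithin hp
    exact (tendsto_nhds_unique (tendsto_pure_nhds _ _) (hl.mono_left h1)).symm
  rw [ContinuousWithinAt, ← this]
  exact hl

theorem gaugeExt_of_pos (j : Q.ι) {p : ℝ × ℝ≥0} (hp : 0 < p.2) :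
    Q.gaugeExt j p = Q.gauge (Q.q j p) :=
  funext fun i => extendFrom_extends (Q.continuousOn_gauge i j) _ hp

/-- The patch `q j`, lifted to the cut surface. -/
noncomputable def lift (j : Q.ι) (p : ℝ × ℝ≥0) : Q.Carrier :=
  ⟨(Q.q j p, Q.gaugeExt j p), by
    have hc : Continuous fun p => (Q.q j p, Q.gaugeExt j p) :=
      (Q.embedding j).continuous.prodMk (Q.continuous_gaugeExt j)
    have h1 := hc.closure_preimage_subset ((fun y => (y, Q.gauge y)) '' Dᶜ)
    refine h1 (closure_mono ?_ (dense_inner p))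
    intro r hr
    exact ⟨Q.q j r, Q.inner_disjoint ⟨r, hr, rfl⟩, by simp only [Q.gaugeExt_of_pos j hr]⟩⟩

theorem continuous_lift (j : Q.ι) : Continuous (Q.lift j) :=
  Continuous.subtype_mk ((Q.embedding j).continuous.prodMk (Q.continuous_gaugeExt j)) _

@[simp] theorem proj_lift (j : Q.ι) (p : ℝ × ℝ≥0) : Q.proj (Q.lift j p) = Q.q j p := rfl

theorem lift_mem_bd (j : Q.ι) (p : ℝ × ℝ≥0) : Q.lift j p ∈ Q.bd ↔ p.2 = 0 := Q.mem_iff j p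

theorem isEmbedding_lift (j : Q.ι) : IsEmbedding (Q.lift j) :=
  IsEmbedding.of_comp (Q.continuous_lift j) Q.continuous_proj (Q.embedding j)

theorem gaugeExt_self (j : Q.ι) (p : ℝ × ℝ≥0) : Q.gaugeExt j p j = Q.bump j (Q.q j p) := by
  have h : IsClosed {p : ℝ × ℝ≥0 | Q.gaugeExt j p j = Q.bump j (Q.q j p)} :=
    isClosed_eq ((continuous_apply j).comp (Q.continuous_gaugeExt j))
      ((Q.continuous_bump j).comp (Q.embedding j).continuous)
  refine closure_minimal ?_ h (dense_inner p)
  intro r hr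
  simp only [mem_ofPred_eq, Q.gaugeExt_of_pos j hr]
  exact Q.gauge_of_mem ⟨r, hr, rfl⟩

theorem gaugeExt_of_disjoint {i j : Q.ι} (hd : Disjoint (Q.inner i) (Q.inner j)) (p : ℝ × ℝ≥0) :
    Q.gaugeExt j p i = 0 := by
  have h : IsClosed {p : ℝ × ℝ≥0 | Q.gaugeExt j p i = 0} :=
    isClosed_eq ((continuous_apply i).comp (Q.continuous_gaugeExt j)) continuous_const
  refine closure_minimal ?_ h (dense_inner p)
  intro r hr
  simp only [mem_ofPred_eq, Q.gaugeExt_of_pos j hr]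
  exact Q.gauge_of_notMem fun hm => (disjoint_left.1 hd hm) ⟨r, hr, rfl⟩

/-- The lifts of regular points are dense in the cut surface, in the following form. -/
theorem exists_of_isOpen {O : Set Q.Carrier} (hO : IsOpen O) {z : Q.Carrier} (hz : z ∈ O) :
    ∃ w ∈ O, Q.proj w ∉ D ∧ w.1.2 = Q.gauge (Q.proj w) := by
  obtain ⟨O', hO', rfl⟩ := isOpen_induced_iff.1 hO
  obtain ⟨_, hx, ⟨y, hy, rfl⟩⟩ := mem_closure_iff.1 z.2 O' hO' hz
  exact ⟨⟨(y, Q.gauge y), subset_closure ⟨y, hy, rfl⟩⟩, hx, hy, rfl⟩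

/-- A point of the cut surface at which the gauge of a patch is positive lies on that patch. -/
theorem eq_lift_of_gauge_pos [T2Space S] {z : Q.Carrier} {i : Q.ι} (hz : 0 < z.1.2 i) :
    ∃ p, 0 < Q.bump i (Q.q i p) ∧ Q.lift i p = z := by
  have hcont : Continuous fun w : Q.Carrier => w.1.2 i :=
    (continuous_apply i).comp (continuous_snd.comp continuous_subtype_val)
  have hcl : Q.proj z ∈ closure (Q.inner i) := by
    rw [mem_closure_iff]
    intro N hN hzN
    obtain ⟨w, ⟨hw1, hw2⟩, hw, hwg⟩ := Q.exists_of_isOpen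
      ((hN.preimage Q.continuous_proj).inter (isOpen_lt continuous_const hcont)) ⟨hzN, hz⟩
    refine ⟨Q.proj w, hw1, Q.mem_inner_of_gauge_pos ?_⟩
    have : 0 < w.1.2 i := hw2
    rwa [hwg] at this
  have hle : z.1.2 i ≤ Q.bump i (Q.proj z) := by
    by_contra hlt
    push Not at hlt
    obtain ⟨w, hw1, hw, hwg⟩ := Q.exists_of_isOpen
      (isOpen_lt ((Q.continuous_bump i).comp Q.continuous_proj) hcont) hlt
    have h1 : Q.bump i (Q.proj w) < w.1.2 i := hw1
    rw [hwg] at h1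
    exact absurd h1 (not_lt.2 (Q.gauge_le _ _))
  obtain ⟨p, hp⟩ := Q.closure_inner i _ hcl (hz.trans_le hle)
  refine ⟨p, by rw [hp]; exact hz.trans_le hle, ?_⟩
  -- two disjoint neighbourhoods of the two points would contain a common regular point
  by_contra hne
  obtain ⟨A, A', hA, hA', hzA, hpA, hAA⟩ := t2_separation (Ne.symm hne)
  have h1 : Q.lift i ⁻¹' A' ∈ 𝓝 p := (hA'.preimage (Q.continuous_lift i)).mem_nhds hpA
  obtain ⟨N, hN, hNe⟩ := (Q.embedding i).isInducing.isOpen_iff.1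
    (hA'.preimage (Q.continuous_lift i))
  have hzN : Q.proj z ∈ N := by
    rw [← hp]; exact (hNe.symm ▸ (show p ∈ Q.lift i ⁻¹' A' from hpA) : p ∈ Q.q i ⁻¹' N)
  obtain ⟨w, ⟨⟨hw1, hw2⟩, hw3⟩, hw, hwg⟩ := Q.exists_of_isOpen
    (((hN.preimage Q.continuous_proj).inter (isOpen_lt continuous_const hcont)).inter hA)
    ⟨⟨hzN, hz⟩, hzA⟩
  have hwi : Q.proj w ∈ Q.inner i := Q.mem_inner_of_gauge_pos (by
    have : 0 < w.1.2 i := hw2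
    rwa [hwg] at this)
  obtain ⟨r, hr, hrw⟩ := hwi
  have hwl : w = Q.lift i r := by
    apply Subtype.ext
    refine Prod.ext hrw.symm ?_
    change w.1.2 = Q.gaugeExt i r
    rw [hwg, Q.gaugeExt_of_pos i hr, hrw]
  have : r ∈ Q.q i ⁻¹' N := by
    change Q.q i r ∈ N
    rw [hrw]; exact hw1
  rw [hNe] at this
  exact disjoint_left.1 hAA hw3 (hwl ▸ this)

/-- Where its bump function is positive, a lifted patch is an open map to the cut surface. -/
theorem isOpen_lift_image [T2Space S] (i : Q.ι) {O : Set (ℝ × ℝ≥0)} (hO : IsOpen O)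
    (hb : ∀ p ∈ O, 0 < Q.bump i (Q.q i p)) : IsOpen (Q.lift i '' O) := by
  obtain ⟨N, hN, rfl⟩ := (Q.isEmbedding_lift i).isInducing.isOpen_iff.1 hO
  have hcont : Continuous fun w : Q.Carrier => w.1.2 i :=
    (continuous_apply i).comp (continuous_snd.comp continuous_subtype_val)
  convert hN.inter (isOpen_lt continuous_const hcont) using 1
  ext z
  constructor
  · rintro ⟨p, hp, rfl⟩
    refine ⟨hp, ?_⟩
    change 0 < Q.gaugeExt i p i
    rw [Q.gaugeExt_self]
    exact hb p hp
  · rintro ⟨hz, hz'⟩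
    obtain ⟨p, -, rfl⟩ := Q.eq_lift_of_gauge_pos hz'
    exact ⟨p, hz, rfl⟩

/-- Each boundary point of the cut surface lies on one of the sectors at its image. -/
theorem exists_lift [T2Space S] {z : Q.Carrier} (hz : z ∈ Q.bd) :
    ∃ i ∈ Q.sectors (Q.proj z), ∃ p, p.2 = 0 ∧ Q.lift i p = z := by
  have hcont : ∀ i, Continuous fun w : Q.Carrier => w.1.2 i := fun i =>
    (continuous_apply i).comp (continuous_snd.comp continuous_subtype_val)
  by_cases h : ∃ i ∈ Q.sectors (Q.proj z), 0 < z.1.2 i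
  · obtain ⟨i, hi, hpos⟩ := h
    obtain ⟨p, -, rfl⟩ := Q.eq_lift_of_gauge_pos hpos
    exact ⟨i, hi, p, (Q.lift_mem_bd i p).1 hz, rfl⟩
  · push Not at h
    exfalso
    obtain ⟨A, hA, hAo, hzA⟩ := mem_nhds_iff.1 (Q.cover _ hz)
    -- near `z` all gauges of sectors at `proj z` are smaller than half the bump functions
    have hopen : IsOpen (⋂ i ∈ Q.sectors (Q.proj z),
        {w : Q.Carrier | w.1.2 i < Q.bump i (Q.proj w)}) :=
      isOpen_biInter_finset fun i _ =>
        isOpen_lt (hcont i) ((Q.continuous_bump i).comp Q.continuous_proj)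
    obtain ⟨w, ⟨hw1, hw2⟩, hw, hwg⟩ := Q.exists_of_isOpen
      (hopen.inter (hAo.preimage Q.continuous_proj)) (z := z) ⟨by
        simp only [mem_iInter]
        intro i hi
        exact (h i hi).trans_lt (Q.bump_pos _ hz i hi), hzA⟩
    obtain ⟨i, hi, hwi⟩ := hA hw2 hw
    simp only [mem_iInter] at hw1
    have h1 : w.1.2 i < Q.bump i (Q.proj w) := hw1 i hi
    rw [hwg, Q.gauge_of_mem hwi] at h1
    exact lt_irrefl _ h1

theorem lift_injOn_sectors {y : S} (hy : y ∈ D) {i j : Q.ι} (hi : i ∈ Q.sectors y)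
    (hj : j ∈ Q.sectors y) {p r : ℝ × ℝ≥0} (hp : Q.q i p = y) (hpr : Q.lift i p = Q.lift j r) :
    i = j := by
  by_contra hne
  have h1 : Q.gaugeExt i p i = Q.gaugeExt j r i := congrArg (fun z : Q.Carrier => z.1.2 i) hpr
  rw [Q.gaugeExt_self, Q.gaugeExt_of_disjoint (Q.disjoint_inner y hy i hi j hj hne), hp] at h1
  exact (Q.bump_pos y hy i hi).ne' h1

/-- The number of points of the cut surface over a point of `D` is the number of sectors there. -/
theorem ncard_fiber [T2Space S] {y : S} (hy : y ∈ D) :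
    (Q.proj ⁻¹' {y}).ncard = (Q.sectors y).card := by
  classical
  have h : ∀ i ∈ Q.sectors y, ∃ p, Q.q i p = y := Q.mem_range y hy
  choose! p hp using h
  have : Q.proj ⁻¹' {y} = (fun i => Q.lift i (p i)) '' (Q.sectors y : Set Q.ι) := by
    ext z
    constructor
    · rintro rfl
      obtain ⟨i, hi, r, -, rfl⟩ := Q.exists_lift (z := z) hy
      refine ⟨i, hi, ?_⟩
      have := (Q.embedding i).injective ((hp i hi).trans (Q.proj_lift i r))
      simp only [this]
    · rintro ⟨i, hi, rfl⟩
      exact hp i hi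
  rw [this, InjOn.ncard_image, ncard_coe_finset]
  intro i hi j hj hij
  exact Q.lift_injOn_sectors hy hi hj (hp i hi) hij

theorem finite_fiber [T2Space S] {y : S} (hy : y ∈ D) :
    (Q.proj ⁻¹' {y}).Finite := by
  refine finite_of_ncard_ne_zero ?_
  rw [Q.ncard_fiber hy]
  by_cases h : y ∈ V
  · rw [Q.card_crossing y h]; norm_num
  · rw [Q.card_edge y ⟨hy, h⟩]; norm_num

/-- Off the boundary the carrier is the graph of the gauge: near an interior point of a sector the
gauge is continuous, and elsewhere a point of the closure has vanishing coordinate. -/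
theorem eq_gauge {z : Q.Carrier} (hz : z ∉ Q.bd) :
    z.1.2 = Q.gauge (Q.proj z) := by
  classical
  have hcont : ∀ i, Continuous fun w : Q.Carrier => w.1.2 i := fun i =>
    (continuous_apply i).comp (continuous_snd.comp continuous_subtype_val)
  funext i
  have hbc : Continuous fun w : Q.Carrier => Q.bump i (Q.proj w) :=
    (Q.continuous_bump i).comp Q.continuous_proj
  by_contra hne
  by_cases hin : Q.proj z ∈ Q.inner i
  · rw [Q.gauge_of_mem hin] at hne
    obtain ⟨w, ⟨hw1, hw2⟩, -, hwg⟩ := Q.exists_of_isOpen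
      (((Q.isOpen_inner i).preimage Q.continuous_proj).inter
        (isClosed_eq (hcont i) hbc).isOpen_compl) (z := z) ⟨hin, hne⟩
    exact hw2 (by
      change w.1.2 i = Q.bump i (Q.proj w)
      rw [hwg, Q.gauge_of_mem hw1])
  · rw [Q.gauge_of_notMem hin] at hne
    by_cases hcl : Q.proj z ∈ closure (Q.inner i)
    · -- the bump function vanishes here, so the gauges are small nearby
      have hb : Q.bump i (Q.proj z) = 0 := by
        by_contra h0
        exact hin (Q.inner_of_closure hcl ((Q.bump_nonneg _ _).lt_of_ne' h0) hz)
      have hb' : ∀ w : Q.Carrier, |w.1.2 i| ≤ Q.bump i (Q.proj w) := by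
        intro w
        by_contra hlt
        push Not at hlt
        obtain ⟨w', hw1, -, hwg⟩ := Q.exists_of_isOpen (isOpen_lt hbc (hcont i).abs) hlt
        have h1 : Q.bump i (Q.proj w') < |w'.1.2 i| := hw1
        rw [hwg, abs_of_nonneg (Q.gauge_nonneg _ _)] at h1
        exact absurd h1 (not_lt.2 (Q.gauge_le _ _))
      have := hb' z
      rw [hb] at this
      exact hne (abs_nonpos_iff.1 this)
    · obtain ⟨w, ⟨hw1, hw2⟩, -, hwg⟩ := Q.exists_of_isOpen
        ((isClosed_closure.isOpen_compl.preimage Q.continuous_proj).inter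
          (isClosed_eq (hcont i) continuous_const).isOpen_compl) (z := z) ⟨hcl, hne⟩
      exact hw2 (by
        change w.1.2 i = 0
        rw [hwg, Q.gauge_of_notMem fun h => hw1 (subset_closure h)])

theorem injOn_proj : InjOn Q.proj Q.bdᶜ := by
  intro z hz w hw h
  refine Subtype.ext (Prod.ext h ?_)
  rw [Q.eq_gauge hz, Q.eq_gauge hw, h]

/-- Over the diagram there is always a sector, hence a point of the boundary. -/
theorem surjective_proj : Function.Surjective Q.proj := by
  intro y
  by_cases hy : y ∈ D
  · have : (Q.sectors y).Nonempty := by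
      rw [← Finset.card_pos]
      by_cases h : y ∈ V
      · rw [Q.card_crossing y h]; norm_num
      · rw [Q.card_edge y ⟨hy, h⟩]; norm_num
    obtain ⟨i, hi⟩ := this
    obtain ⟨p, hp⟩ := Q.mem_range y hy i hi
    exact ⟨Q.lift i p, hp⟩
  · exact ⟨⟨(y, Q.gauge y), subset_closure ⟨y, hy, rfl⟩⟩, rfl⟩

/-- Off the boundary, the regluing map is an open embedding. -/
theorem isOpenEmbedding_proj [CompactSpace S] [T2Space S] (hD : IsClosed D) :
    IsOpenEmbedding (fun z : {z : Q.Carrier // z ∉ Q.bd} => Q.proj z.1) := by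
  have h1 : IsClosedMap ((Dᶜ).restrictPreimage Q.proj) :=
    Q.continuous_proj.isClosedMap.restrictPreimage _
  have h2 : Function.Injective ((Dᶜ).restrictPreimage Q.proj) := fun z w h =>
    Subtype.ext (Q.injOn_proj z.2 w.2 (congrArg Subtype.val h))
  have h3 : IsClosedEmbedding ((Dᶜ).restrictPreimage Q.proj) :=
    IsClosedEmbedding.of_continuous_injective_isClosedMap
      (Q.continuous_proj.restrictPreimage) h2 h1
  have h4 : IsOpenEmbedding ((Dᶜ).restrictPreimage Q.proj) := by
    refine ⟨h3.isEmbedding, ?_⟩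
    rw [range_restrictPreimage, Q.surjective_proj.range_eq, preimage_univ]
    exact isOpen_univ
  exact hD.isOpen_compl.isOpenEmbedding_subtypeVal.comp h4

/-- The cut surface is a surface with boundary the preimage of `D`. -/
theorem isManifoldWithBoundary [CompactSpace S] (hS : IsManifoldWithBoundary 2 S ∅)
    (hD : IsClosed D) : IsManifoldWithBoundary 2 Q.Carrier Q.bd := by
  have := hS.t2
  have := hS.secondCountable
  refine ⟨inferInstance, inferInstance, fun z => ?_⟩
  by_cases hz : z ∈ Q.bd
  · obtain ⟨i, hi, p, hp, rfl⟩ := Q.exists_lift hz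
    have hopen : IsOpen {p | 0 < Q.bump i (Q.q i p)} :=
      isOpen_lt continuous_const ((Q.continuous_bump i).comp (Q.embedding i).continuous)
    refine exists_chart_of_isOpenEmbedding (T := {p | 0 < Q.bump i (Q.q i p)})
      (φ := fun p => Q.lift i p.1) (χ := fun p => _)
      ⟨(Q.isEmbedding_lift i).comp IsEmbedding.subtypeVal, ?_⟩
      (isOpenEmbedding_halfPlane.comp hopen.isOpenEmbedding_subtypeVal) ?_
      ⟨p, Q.bump_pos _ hz i hi⟩
    · convert Q.isOpen_lift_image i hopen (fun _ h => h) using 1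
      ext w
      simp
    · rintro ⟨⟨a, b⟩, h⟩
      rw [Q.lift_mem_bd]
      simp
  · obtain ⟨e, he, heB⟩ := hS.exists_chart (Q.proj z)
    have hbd : IsOpen (Q.bdᶜ ∩ Q.proj ⁻¹' e.source) :=
      (hD.preimage Q.continuous_proj).isOpen_compl.inter (e.open_source.preimage Q.continuous_proj)
    have h1 : IsOpenEmbedding (fun w : ↥(Q.bdᶜ ∩ Q.proj ⁻¹' e.source) => Q.proj w.1) := by
      have := (Q.isOpenEmbedding_proj hD).comp
        (f := fun w : ↥(Q.bdᶜ ∩ Q.proj ⁻¹' e.source) => (⟨w.1, w.2.1⟩ : {z // z ∉ Q.bd}))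
        (IsOpenEmbedding.of_comp _ (hD.preimage Q.continuous_proj).isOpen_compl.isOpenEmbedding_subtypeVal
          hbd.isOpenEmbedding_subtypeVal)
      exact this
    have h2 : IsOpenEmbedding (fun w : ↥(Q.bdᶜ ∩ Q.proj ⁻¹' e.source) =>
        (⟨Q.proj w.1, w.2.2⟩ : e.source)) :=
      IsOpenEmbedding.of_comp _ e.open_source.isOpenEmbedding_subtypeVal h1
    refine exists_chart_of_isOpenEmbedding (T := ↥(Q.bdᶜ ∩ Q.proj ⁻¹' e.source))
      (φ := Subtype.val) (χ := fun w => e (Q.proj w.1)) hbd.isOpenEmbedding_subtypeVal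
      (e.isOpenEmbedding_restrict.comp h2) ?_ ⟨z, hz, he⟩
    rintro ⟨w, hw, hw'⟩
    have := heB _ hw'
    simp only [mem_empty_iff_false, false_iff] at this
    exact ⟨fun h => absurd h hw, fun h => absurd h this⟩

/-- The involution of the cut surface covering `τ`. -/
def twistFun (z : Q.Carrier) : Q.Carrier :=
  ⟨(τ z.1.1, fun i => z.1.2 (Q.twist i)), by
    have hc : Continuous fun x : S × (Q.ι → ℝ) => (τ x.1, fun i => x.2 (Q.twist i)) := by
      fun_prop
    have h1 := hc.closure_preimage_subset ((fun y => (y, Q.gauge y)) '' Dᶜ)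
    refine h1 (closure_mono ?_ z.2)
    have hinner : ∀ i y, τ y ∈ Q.inner i ↔ y ∈ Q.inner (Q.twist i) := by
      intro i y
      constructor
      · rintro ⟨p, hp, h⟩
        refine ⟨p, hp, τ.injective ?_⟩
        rw [← Q.q_twist, Q.twist_twist, h]
      · rintro ⟨p, hp, rfl⟩
        exact ⟨p, hp, by rw [← Q.q_twist, Q.twist_twist]⟩
    rintro _ ⟨y, hy, rfl⟩
    refine ⟨τ y, ?_, ?_⟩
    · by_contra h
      have h : τ y ∈ D := not_not.1 h
      obtain ⟨z, rfl⟩ := Q.surjective_proj y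
      obtain ⟨i, hi⟩ : (Q.sectors (τ (Q.proj z))).Nonempty := by
        rw [← Finset.card_pos]
        by_cases h' : τ (Q.proj z) ∈ V
        · rw [Q.card_crossing _ h']; norm_num
        · rw [Q.card_edge _ ⟨h, h'⟩]; norm_num
      obtain ⟨p, hp⟩ := Q.mem_range _ h i hi
      have hp0 : p.2 = 0 := (Q.mem_iff i p).1 (hp ▸ h)
      refine hy ?_
      have : Q.proj z = Q.q (Q.twist i) p := by
        apply τ.injective
        rw [← Q.q_twist, Q.twist_twist, hp]
      rw [this, Q.mem_iff]
      exact hp0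
    · refine Prod.ext rfl (funext fun i => ?_)
      change Q.gauge (τ y) i = Q.gauge y (Q.twist i)
      by_cases h : τ y ∈ Q.inner i
      · rw [Q.gauge_of_mem h, Q.gauge_of_mem ((hinner i y).1 h)]
        conv_lhs => rw [← Q.twist_twist i, Q.bump_twist]
      · rw [Q.gauge_of_notMem h, Q.gauge_of_notMem fun h' => h ((hinner i y).2 h')]⟩

theorem continuous_twistFun : Continuous Q.twistFun :=
  Continuous.subtype_mk (by
    have hc : Continuous fun x : S × (Q.ι → ℝ) => (τ x.1, fun i => x.2 (Q.twist i)) := by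
      fun_prop
    exact hc.comp continuous_subtype_val) _

theorem twistFun_twistFun (hτ : ∀ y, τ (τ y) = y) (z : Q.Carrier) :
    Q.twistFun (Q.twistFun z) = z :=
  Subtype.ext (Prod.ext (hτ _) (funext fun i => congrArg z.1.2 (Q.twist_twist i)))

/-- The involution of the cut surface covering `τ`, as a homeomorphism. -/
def twistHomeo (hτ : ∀ y, τ (τ y) = y) : Q.Carrier ≃ₜ Q.Carrier where
  toFun := Q.twistFun
  invFun := Q.twistFun
  left_inv := Q.twistFun_twistFun hτ
  right_inv := Q.twistFun_twistFun hτ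
  continuous_toFun := Q.continuous_twistFun
  continuous_invFun := Q.continuous_twistFun

theorem proj_twistFun (z : Q.Carrier) : Q.proj (Q.twistFun z) = τ (Q.proj z) := rfl

end PatchSystem
/-! ### Equivariant collars -/

/-- A continuous map on a space `X` may be prescribed on a chart `q` (an open embedding of `R`) if
it agrees with a globally defined map outside a closed subset of the chart. -/
theorem exists_extend_chart {T X Y : Type*} [TopologicalSpace T] [TopologicalSpace X]
    [TopologicalSpace Y] {q : T → X} {R K : Set T} (hKR : K ⊆ R)
    (hopen : ∀ O : Set T, IsOpen O → IsOpen (q '' (O ∩ R))) (hinj : InjOn q R)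
    (hK : IsClosed (q '' K)) {g : T → Y} (hg : ContinuousOn g R) {h : X → Y} (hh : Continuous h)
    (hgh : ∀ x ∈ R, x ∉ K → g x = h (q x)) :
    ∃ F : X → Y, Continuous F ∧ (∀ x ∈ R, F (q x) = g x) ∧ ∀ z, z ∉ q '' R → F z = h z := by
  classical
  have hRo : IsOpen (q '' R) := by simpa using hopen univ isOpen_univ
  have hex : ∃ F : X → Y, (∀ x ∈ R, F (q x) = g x) ∧ ∀ z, z ∉ q '' R → F z = h z := by
    refine ⟨fun z => if hz : z ∈ q '' R then g hz.choose else h z, ?_, ?_⟩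
    · intro x hx
      have hz : q x ∈ q '' R := ⟨x, hx, rfl⟩
      simp only [hz, dif_pos]
      rw [hinj hz.choose_spec.1 hx hz.choose_spec.2]
    · intro z hz
      simp only [hz, dif_neg, not_false_eq_true]
  obtain ⟨F, hF1, hF2⟩ := hex
  refine ⟨F, continuous_iff_continuousAt.2 fun z => ?_, hF1, hF2⟩
  by_cases hz : z ∈ q '' R
  · obtain ⟨x, hx, rfl⟩ := hz
    intro N hN
    rw [hF1 x hx] at hN
    obtain ⟨O, hO, hxO, hON⟩ := mem_nhdsWithin.1 (hg x hx hN)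
    refine mem_map.2 (mem_of_superset ((hopen O hO).mem_nhds ⟨x, ⟨hxO, hx⟩, rfl⟩) ?_)
    rintro _ ⟨y, hy, rfl⟩
    rw [mem_preimage, hF1 y hy.2]
    exact hON hy
  · have hz' : z ∉ q '' K := fun h => hz (image_mono hKR h)
    refine (hh.continuousAt (x := z)).congr ?_
    filter_upwards [hK.isOpen_compl.mem_nhds hz'] with w hw
    by_cases hwR : w ∈ q '' R
    · obtain ⟨x, hx, rfl⟩ := hwR
      rw [hF1 x hx, hgh x hx fun hxK => hw ⟨x, hxK, rfl⟩]
    · exact (hF2 w hwR).symm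

variable {X : Type*} [TopologicalSpace X]

/-- A partial collar of height `f ≥ 0` of the subset `B` of `X`: an embedding `p` of `X` into itself
that pushes `B` inwards, and a parametrization `C` of the region between `B` and `p B` by
`{(x, r) | x ∈ B, 0 ≤ r ≤ f x}`.  Everything is equivariant under the involution `t`. -/
structure PartialCollar (B : Set X) (t : X → X) (f : X → ℝ) (p : X → X) (C : X → ℝ → X) :
    Prop where
  continuous_height : Continuous f
  nonneg : ∀ x ∈ B, 0 ≤ f x
  height_twist : ∀ x ∈ B, f (t x) = f x
  continuous_push : Continuous p
  push_injective : Function.Injective p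
  push_twist : ∀ x, p (t x) = t (p x)
  continuousOn_param : ContinuousOn (fun y : X × ℝ => C y.1 y.2)
    {y | y.1 ∈ B ∧ 0 ≤ y.2 ∧ y.2 ≤ f y.1}
  param_zero : ∀ x ∈ B, C x 0 = x
  param_end : ∀ x ∈ B, C x (f x) = p x
  param_inj : ∀ x ∈ B, ∀ x' ∈ B, ∀ r r', 0 ≤ r → r ≤ f x → 0 ≤ r' → r' ≤ f x' →
    C x r = C x' r' → x = x' ∧ r = r'
  param_eq_push : ∀ x ∈ B, ∀ r w, 0 ≤ r → r ≤ f x → C x r = p w → w = x ∧ r = f x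
  exhaust : ∀ z, (∃ w, p w = z) ∨ ∃ x ∈ B, ∃ r, 0 ≤ r ∧ r ≤ f x ∧ C x r = z
  param_twist : ∀ x ∈ B, ∀ r, 0 ≤ r → r ≤ f x → C (t x) r = t (C x r)

theorem PartialCollar.trivial (B : Set X) (t : X → X) :
    PartialCollar B t (fun _ => 0) id fun x _ => x where
  continuous_height := continuous_const
  nonneg _ _ := le_rfl
  height_twist _ _ := rfl
  continuous_push := continuous_id
  push_injective := Function.injective_id
  push_twist _ := rfl
  continuousOn_param := continuous_fst.continuousOn
  param_zero _ _ := rfl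
  param_end _ _ := rfl
  param_inj x _ x' _ r r' h1 h2 h3 h4 h := ⟨h, by linarith⟩
  param_eq_push x _ r w h1 h2 h := ⟨h.symm, by linarith⟩
  exhaust z := Or.inl ⟨z, rfl⟩
  param_twist _ _ _ _ _ := rfl

/-- Partial collars can be stacked: push inwards with the second one, then with the first. -/
theorem PartialCollar.comp {B : Set X} (hB : IsClosed B) {t : X → X}
    {f₁ f₂ : X → ℝ} {p₁ p₂ : X → X} {C₁ C₂ : X → ℝ → X} (h₁ : PartialCollar B t f₁ p₁ C₁)
    (h₂ : PartialCollar B t f₂ p₂ C₂) :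
    PartialCollar B t (fun x => f₁ x + f₂ x) (p₁ ∘ p₂)
      (fun x r => if r ≤ f₁ x then C₁ x r else p₁ (C₂ x (r - f₁ x))) := by
  -- the second formula also holds at the common boundary of the two regions
  have hge : ∀ x ∈ B, ∀ r, f₁ x ≤ r →
      (if r ≤ f₁ x then C₁ x r else p₁ (C₂ x (r - f₁ x))) = p₁ (C₂ x (r - f₁ x)) := by
    intro x hx r hr
    split_ifs with h
    · obtain rfl := le_antisymm h hr
      rw [h₁.param_end x hx, sub_self, h₂.param_zero x hx]
    · rfl
  refine ⟨h₁.continuous_height.add h₂.continuous_height,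
    fun x hx => add_nonneg (h₁.nonneg x hx) (h₂.nonneg x hx),
    fun x hx => by rw [h₁.height_twist x hx, h₂.height_twist x hx],
    h₁.continuous_push.comp h₂.continuous_push, h₁.push_injective.comp h₂.push_injective,
    fun x => by simp [h₂.push_twist, h₁.push_twist], ?_, ?_, ?_, ?_, ?_, ?_, ?_⟩
  · have hc1 : IsClosed {y : X × ℝ | y.1 ∈ B ∧ 0 ≤ y.2 ∧ y.2 ≤ f₁ y.1} :=
      (hB.preimage continuous_fst).inter ((isClosed_le continuous_const continuous_snd).inter
        (isClosed_le continuous_snd (h₁.continuous_height.comp continuous_fst)))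
    have hc2 : IsClosed {y : X × ℝ | y.1 ∈ B ∧ f₁ y.1 ≤ y.2 ∧ y.2 ≤ f₁ y.1 + f₂ y.1} :=
      (hB.preimage continuous_fst).inter
        ((isClosed_le (h₁.continuous_height.comp continuous_fst) continuous_snd).inter
        (isClosed_le continuous_snd ((h₁.continuous_height.comp continuous_fst).add
          (h₂.continuous_height.comp continuous_fst))))
    refine ContinuousOn.mono (s := {y : X × ℝ | y.1 ∈ B ∧ 0 ≤ y.2 ∧ y.2 ≤ f₁ y.1} ∪
      {y : X × ℝ | y.1 ∈ B ∧ f₁ y.1 ≤ y.2 ∧ y.2 ≤ f₁ y.1 + f₂ y.1}) ?_ ?_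
    · refine ContinuousOn.union_of_isClosed ?_ ?_ hc1 hc2
      · refine h₁.continuousOn_param.congr ?_
        rintro y ⟨-, -, hy⟩
        simp only [hy, if_true]
      · refine ContinuousOn.congr (f := fun y : X × ℝ => p₁ (C₂ y.1 (y.2 - f₁ y.1))) ?_ ?_
        · refine h₁.continuous_push.comp_continuousOn ?_
          have hcont : Continuous fun y : X × ℝ => (y.1, y.2 - f₁ y.1) :=
            continuous_fst.prodMk (continuous_snd.sub (h₁.continuous_height.comp continuous_fst))
          refine h₂.continuousOn_param.comp hcont.continuousOn ?_
          rintro y ⟨hy, hy1, hy2⟩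
          exact ⟨hy, by simpa using hy1, by simp only; linarith⟩
        · rintro y ⟨hy, hy1, -⟩
          exact hge _ hy _ hy1
    · rintro y ⟨hy, hy1, hy2⟩
      rcases le_total y.2 (f₁ y.1) with h | h
      · exact Or.inl ⟨hy, hy1, h⟩
      · exact Or.inr ⟨hy, h, hy2⟩
  · intro x hx
    simp only [h₁.nonneg x hx, if_true, h₁.param_zero x hx]
  · intro x hx
    rw [hge x hx _ (by linarith [h₂.nonneg x hx]), add_sub_cancel_left, h₂.param_end x hx]
    rfl
  · have aux : ∀ x ∈ B, ∀ x' ∈ B, ∀ r r', 0 ≤ r → r ≤ f₁ x → f₁ x' < r' →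
        r' ≤ f₁ x' + f₂ x' → C₁ x r ≠ p₁ (C₂ x' (r' - f₁ x')) := by
      intro x hx x' hx' r r' hr hr1 hr' hr2 h
      have h3 := (h₁.param_eq_push x hx r _ hr hr1 h).1
      have h4 := h₂.param_inj x' hx' x hx (r' - f₁ x') 0 (by linarith) (by linarith) le_rfl (h₂.nonneg x hx)
        (by rw [h3, h₂.param_zero x hx])
      linarith [h4.2]
    intro x hx x' hx' r r' h0 h1 h2 h3 h
    split_ifs at h with h4 h5 h5
    · exact h₁.param_inj x hx x' hx' r r' h0 h4 h2 h5 h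
    · exact absurd h (aux x hx x' hx' r r' h0 h4 (not_le.1 h5) h3)
    · exact absurd h.symm (aux x' hx' x hx r' r h2 h5 (not_le.1 h4) h1)
    · have h6 := h₂.param_inj x hx x' hx' _ _ (by linarith) (by linarith) (by linarith)
        (by linarith) (h₁.push_injective h)
      obtain ⟨rfl, h7⟩ := h6
      exact ⟨rfl, by linarith⟩
  · intro x hx r w h0 h1 h
    simp only [Function.comp] at h
    split_ifs at h with h4
    · obtain ⟨h5, h6⟩ := h₁.param_eq_push x hx r _ h0 h4 h
      have h7 := h₂.param_eq_push x hx 0 w le_rfl (h₂.nonneg x hx) (by rw [h₂.param_zero x hx, h5])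
      exact ⟨h7.1, by linarith [h7.2]⟩
    · have h7 := h₂.param_eq_push x hx _ w (by linarith) (by linarith) (h₁.push_injective h)
      exact ⟨h7.1, by linarith [h7.2]⟩
  · intro z
    rcases h₁.exhaust z with ⟨w, rfl⟩ | ⟨x, hx, r, h0, h1, rfl⟩
    · rcases h₂.exhaust w with ⟨w, rfl⟩ | ⟨x, hx, r, h0, h1, rfl⟩
      · exact Or.inl ⟨w, rfl⟩
      · refine Or.inr ⟨x, hx, f₁ x + r, by linarith [h₁.nonneg x hx], by linarith, ?_⟩
        rw [hge x hx _ (by linarith), add_sub_cancel_left]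
    · refine Or.inr ⟨x, hx, r, h0, by linarith [h₂.nonneg x hx], ?_⟩
      simp only [h1, if_true]
  · intro x hx r h0 h1
    rw [h₁.height_twist x hx]
    split_ifs with h2
    · exact h₁.param_twist x hx r h0 h2
    · rw [h₂.param_twist x hx _ (by linarith) (by linarith), h₁.push_twist]

/-- The half-open box on which collar charts are defined. -/
def collarBox : Set (Bool × ℝ × ℝ) := {y | |y.2.1| < 1 ∧ 0 ≤ y.2.2 ∧ y.2.2 < 1}

/-- The height of the local collar over a chart. -/
noncomputable def bumpHeight (s : ℝ) : ℝ := max 0 ((1 - 2 * |s|) / 4)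

theorem continuous_bumpHeight : Continuous bumpHeight := by unfold bumpHeight; fun_prop

theorem bumpHeight_nonneg (s : ℝ) : 0 ≤ bumpHeight s := le_max_left _ _

theorem bumpHeight_le (s : ℝ) : bumpHeight s ≤ 1 / 4 :=
  max_le (by norm_num) (by linarith [abs_nonneg s])

theorem bumpHeight_eq_zero {s : ℝ} (h : 1 / 2 < |s|) : bumpHeight s = 0 :=
  max_eq_left (by linarith)

/-- The local push: a homeomorphism of `[0, 1)` onto `[bumpHeight s, 1)`, the identity on
`[1/2, 1)`. -/
noncomputable def bumpPush (s ν : ℝ) : ℝ := max ν (bumpHeight s + ν * (1 - 2 * bumpHeight s))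

theorem bumpPush_strictMono (s : ℝ) : StrictMono (bumpPush s) := by
  intro a b hab
  have h1 := bumpHeight_le s
  have h2 := bumpHeight_nonneg s
  refine max_lt_max hab ?_
  nlinarith

theorem bumpPush_of_half_le {s ν : ℝ} (h : 1 / 2 ≤ ν) : bumpPush s ν = ν :=
  max_eq_left (by nlinarith [bumpHeight_nonneg s])

theorem bumpPush_zero (s : ℝ) : bumpPush s 0 = bumpHeight s := by
  simp [bumpPush, bumpHeight_nonneg]

/-- The partial collar supported in a pair of charts exchanged by the involution. -/
theorem PartialCollar.of_chart [T2Space X] {B : Set X} {t : X → X} (htt : ∀ x, t (t x) = x)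
    {q : Bool × ℝ × ℝ → X} (hq : Continuous q) (hinj : InjOn q collarBox)
    (hopen : ∀ O : Set (Bool × ℝ × ℝ), IsOpen O → IsOpen (q '' (O ∩ collarBox)))
    (hqB : ∀ y ∈ collarBox, q y ∈ B ↔ y.2.2 = 0)
    (hqt : ∀ b s ν, q (!b, s, ν) = t (q (b, s, ν))) :
    ∃ f p C, PartialCollar B t f p C ∧ 0 < f (q (false, 0, 0)) := by
  set K : Set (Bool × ℝ × ℝ) := univ ×ˢ (Icc (-(1 / 2)) (1 / 2) ×ˢ Icc 0 (1 / 2)) with hK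
  have hKc : IsCompact K := isCompact_univ.prod (isCompact_Icc.prod isCompact_Icc)
  have hKcl : IsClosed (q '' K) := (hKc.image hq).isClosed
  have hKR : K ⊆ collarBox := by
    rintro ⟨b, s, ν⟩ ⟨-, hs, hν⟩
    exact ⟨(abs_le.2 hs).trans_lt (by norm_num), hν.1, by linarith [hν.2]⟩
  have hnK : ∀ y ∈ collarBox, y ∉ K → bumpHeight y.2.1 = 0 ∨ 1 / 2 < y.2.2 := by
    rintro ⟨b, s, ν⟩ ⟨h1, h2, h3⟩ h
    by_contra! hne
    exact h ⟨mem_univ _, abs_le.1 (not_lt.1 fun h => hne.1 (bumpHeight_eq_zero h)), h2, hne.2⟩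
  have htR : ∀ z, z ∉ q '' collarBox → t z ∉ q '' collarBox := by
    rintro z hz ⟨⟨b, s, ν⟩, hy, h⟩
    refine hz ⟨(!b, s, ν), hy, ?_⟩
    rw [hqt, h, htt]
  -- the width `f`, the push `p` and the partial collar `C` are defined by formulas in the chart, and
  -- are `0`, the identity and constant outside the compact set `K`
  obtain ⟨f, hf, hf1, hf2⟩ := exists_extend_chart hKR hopen hinj hKcl
    (g := fun y => bumpHeight y.2.1 * max 0 (1 - 2 * y.2.2)) (h := fun _ => (0 : ℝ))
    (by have := continuous_bumpHeight; fun_prop) continuous_const (by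
      intro y hy hyK
      rcases hnK y hy hyK with h | h
      · simp [h]
      · rw [max_eq_left (by linarith), mul_zero])
  obtain ⟨p, hp, hp1, hp2⟩ := exists_extend_chart hKR hopen hinj hKcl
    (g := fun y => q (y.1, y.2.1, bumpPush y.2.1 y.2.2)) (h := id)
    (by
      have := continuous_bumpHeight
      unfold bumpPush
      fun_prop) continuous_id (by
      rintro ⟨b, s, ν⟩ hy hyK
      rcases hnK _ hy hyK with h | h
      · simp only at h
        simp [bumpPush, h]
      · simp only at h
        simp [bumpPush_of_half_le h.le])
  obtain ⟨C, hC, hC1, hC2⟩ := exists_extend_chart (q := Prod.map q (id : ℝ → ℝ))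
    (R := collarBox ×ˢ univ) (K := K ×ˢ univ) (prod_mono hKR subset_rfl) (by
      intro O hO
      rw [isOpen_iff_mem_nhds]
      rintro _ ⟨⟨y, r⟩, ⟨hyO, hy, -⟩, rfl⟩
      obtain ⟨A, A', hA, hA', hyA, hrA, hAA⟩ := isOpen_prod_iff.1 hO y r hyO
      refine mem_of_superset (((hopen A hA).prod hA').mem_nhds ⟨⟨y, ⟨hyA, hy⟩, rfl⟩, hrA⟩) ?_
      rintro ⟨_, r'⟩ ⟨⟨y', hy', rfl⟩, hr'⟩
      exact ⟨(y', r'), ⟨hAA ⟨hy'.1, hr'⟩, hy'.2, mem_univ _⟩, rfl⟩) (by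
      rintro ⟨y, r⟩ hy ⟨y', r'⟩ hy' h
      simp only [Prod.map, Prod.mk.injEq, id] at h
      exact Prod.ext (hinj hy.1 hy'.1 h.1) h.2) (by
      rw [prodMap_image_prod, image_id]
      exact hKcl.prod isClosed_univ)
    (g := fun y => q (y.1.1, y.1.2.1, max y.1.2.2 (min y.2
      (bumpHeight y.1.2.1 * max 0 (1 - 2 * y.1.2.2))))) (h := Prod.fst)
    (by have := continuous_bumpHeight; fun_prop) continuous_fst (by
      rintro ⟨⟨b, s, ν⟩, r⟩ ⟨hy, -⟩ hyK
      have h0 : (0 : ℝ) ≤ ν := hy.2.1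
      rcases hnK _ hy (fun h => hyK ⟨h, mem_univ _⟩) with h | h
      · simp only at h
        simp [h, h0]
      · simp only at h
        have : max 0 (1 - 2 * ν) = 0 := max_eq_left (by linarith)
        simp [this, h0])
  -- the formulas at boundary points
  have hfB : ∀ b s, |s| < 1 → f (q (b, s, 0)) = bumpHeight s := by
    intro b s hs
    rw [hf1 _ ⟨hs, le_rfl, one_pos⟩]; simp
  have hCB : ∀ b s r, |s| < 1 → 0 ≤ r → r ≤ bumpHeight s →
      C (q (b, s, 0), r) = q (b, s, r) := by
    intro b s r hs hr hr'
    have := hC1 ((b, s, 0), r) ⟨⟨hs, le_rfl, one_pos⟩, mem_univ _⟩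
    simp only [Prod.map, id] at this
    rw [this]
    simp [hr, hr']
  have hCo : ∀ z, z ∉ q '' collarBox → ∀ r, C (z, r) = z := by
    intro z hz r
    refine hC2 _ ?_
    rw [prodMap_image_prod]
    exact fun h => hz h.1
  have hBq : ∀ z ∈ B, z ∈ q '' collarBox → ∃ b s, |s| < 1 ∧ z = q (b, s, 0) := by
    rintro _ hz ⟨⟨b, s, ν⟩, hy, rfl⟩
    obtain rfl : ν = 0 := (hqB _ hy).1 hz
    exact ⟨b, s, hy.1, rfl⟩
  have hbox : ∀ {b s ν}, |s| < 1 → 0 ≤ ν → ν < 1 → (b, s, ν) ∈ collarBox :=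
    fun h1 h2 h3 => ⟨h1, h2, h3⟩
  have hlt : ∀ {s r : ℝ}, r ≤ bumpHeight s → r < 1 := fun {s r} h => by
    linarith [bumpHeight_le s]
  have hpR : ∀ b s ν, (b, s, ν) ∈ collarBox → (b, s, bumpPush s ν) ∈ collarBox := by
    intro b s ν hy
    refine ⟨hy.1, hy.2.1.trans (le_max_left _ _), ?_⟩
    have := bumpPush_strictMono s hy.2.2
    rwa [bumpPush_of_half_le (by norm_num : (1 : ℝ) / 2 ≤ 1)] at this
  -- each law holds by the formulas in the chart and is trivial outside it
  refine ⟨f, p, fun x r => C (x, r), ⟨hf, ?_, ?_, hp, ?_, ?_, hC.continuousOn, ?_, ?_, ?_, ?_, ?_,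
    ?_⟩, ?_⟩
  · intro x hx
    by_cases h : x ∈ q '' collarBox
    · obtain ⟨b, s, hs, rfl⟩ := hBq x hx h
      rw [hfB b s hs]; exact bumpHeight_nonneg s
    · rw [hf2 x h]
  · intro x hx
    by_cases h : x ∈ q '' collarBox
    · obtain ⟨b, s, hs, rfl⟩ := hBq x hx h
      rw [← hqt, hfB _ s hs, hfB _ s hs]
    · rw [hf2 x h, hf2 _ (htR x h)]
  · intro z w h
    by_cases hz : z ∈ q '' collarBox
    · obtain ⟨⟨b, s, ν⟩, hy, rfl⟩ := hz
      by_cases hw : w ∈ q '' collarBox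
      · obtain ⟨⟨b', s', ν'⟩, hy', rfl⟩ := hw
        rw [hp1 _ hy, hp1 _ hy'] at h
        have := hinj (hpR _ _ _ hy) (hpR _ _ _ hy') h
        simp only [Prod.mk.injEq] at this
        obtain ⟨rfl, rfl, h3⟩ := this
        rw [(bumpPush_strictMono s).injective h3]
      · rw [hp1 _ hy, hp2 w hw] at h
        exact absurd ⟨_, hpR _ _ _ hy, h⟩ hw
    · by_cases hw : w ∈ q '' collarBox
      · obtain ⟨⟨b', s', ν'⟩, hy', rfl⟩ := hw
        rw [hp1 _ hy', hp2 z hz] at h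
        exact absurd ⟨_, hpR _ _ _ hy', h.symm⟩ hz
      · rwa [hp2 z hz, hp2 w hw] at h
  · intro z
    by_cases hz : z ∈ q '' collarBox
    · obtain ⟨⟨b, s, ν⟩, hy, rfl⟩ := hz
      rw [← hqt, hp1 _ hy, hp1 (!b, s, ν) hy, ← hqt]
    · rw [hp2 z hz, hp2 _ (htR z hz)]; rfl
  · intro x hx
    by_cases h : x ∈ q '' collarBox
    · obtain ⟨b, s, hs, rfl⟩ := hBq x hx h
      exact hCB b s 0 hs le_rfl (bumpHeight_nonneg s)
    · exact hCo x h 0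
  · intro x hx
    by_cases h : x ∈ q '' collarBox
    · obtain ⟨b, s, hs, rfl⟩ := hBq x hx h
      rw [hfB b s hs, hCB b s _ hs (bumpHeight_nonneg s) le_rfl,
        hp1 _ (hbox hs le_rfl one_pos)]
      simp only [bumpPush_zero]
    · rw [hCo x h, hp2 x h]; rfl
  · intro x hx x' hx' r r' h0 h1 h2 h3 h
    by_cases hxq : x ∈ q '' collarBox
    · obtain ⟨b, s, hs, rfl⟩ := hBq x hx hxq
      rw [hfB b s hs] at h1
      simp only [hCB b s r hs h0 h1] at h
      by_cases hxq' : x' ∈ q '' collarBox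
      · obtain ⟨b', s', hs', rfl⟩ := hBq x' hx' hxq'
        rw [hfB b' s' hs'] at h3
        rw [hCB b' s' r' hs' h2 h3] at h
        have := hinj (hbox hs h0 (hlt h1)) (hbox hs' h2 (hlt h3)) h
        simp only [Prod.mk.injEq] at this
        obtain ⟨rfl, rfl, rfl⟩ := this
        exact ⟨rfl, rfl⟩
      · rw [hCo x' hxq'] at h
        exact absurd ⟨_, hbox hs h0 (hlt h1), h⟩ hxq'
    · rw [hf2 x hxq] at h1
      simp only [hCo x hxq] at h
      by_cases hxq' : x' ∈ q '' collarBox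
      · obtain ⟨b', s', hs', rfl⟩ := hBq x' hx' hxq'
        rw [hfB b' s' hs'] at h3
        rw [hCB b' s' r' hs' h2 h3] at h
        exact absurd ⟨_, hbox hs' h2 (hlt h3), h.symm⟩ hxq
      · rw [hf2 x' hxq'] at h3
        rw [hCo x' hxq'] at h
        exact ⟨h, by linarith⟩
  · intro x hx r w h0 h1 h
    by_cases hxq : x ∈ q '' collarBox
    · obtain ⟨b, s, hs, rfl⟩ := hBq x hx hxq
      rw [hfB b s hs] at h1 ⊢
      simp only [hCB b s r hs h0 h1] at h
      by_cases hw : w ∈ q '' collarBox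
      · obtain ⟨⟨b', s', ν'⟩, hy', rfl⟩ := hw
        rw [hp1 _ hy'] at h
        have := hinj (hbox hs h0 (hlt h1)) (hpR _ _ _ hy') h
        simp only [Prod.mk.injEq] at this
        obtain ⟨rfl, rfl, rfl⟩ := this
        have hν : ν' = 0 := by
          have h4 : (0 : ℝ) ≤ ν' := hy'.2.1
          rw [← bumpPush_zero] at h1
          exact le_antisymm ((bumpPush_strictMono s).le_iff_le.1 h1) h4
        subst hν
        exact ⟨rfl, bumpPush_zero s⟩
      · rw [hp2 w hw] at h
        exact absurd ⟨_, hbox hs h0 (hlt h1), h⟩ hw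
    · rw [hf2 x hxq] at h1 ⊢
      simp only [hCo x hxq] at h
      by_cases hw : w ∈ q '' collarBox
      · obtain ⟨⟨b', s', ν'⟩, hy', rfl⟩ := hw
        rw [hp1 _ hy'] at h
        exact absurd ⟨_, hpR _ _ _ hy', h.symm⟩ hxq
      · rw [hp2 w hw] at h
        exact ⟨h.symm, by linarith⟩
  · intro z
    by_cases hz : z ∈ q '' collarBox
    · obtain ⟨⟨b, s, ν⟩, hy, rfl⟩ := hz
      have h0 : (0 : ℝ) ≤ ν := hy.2.1
      rcases le_total ν (bumpHeight s) with h | h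
      · refine Or.inr ⟨q (b, s, 0), (hqB _ (hbox hy.1 le_rfl one_pos)).2 rfl, ν, h0, ?_, ?_⟩
        · rw [hfB b s hy.1]; exact h
        · exact hCB b s ν hy.1 h0 h
      · left
        have h4 := bumpHeight_le s
        have h5 := bumpHeight_nonneg s
        obtain ⟨ν', h6, h7⟩ : ∃ ν', (b, s, ν') ∈ collarBox ∧ bumpPush s ν' = ν := by
          rcases le_total (1 / 2) ν with h8 | h8
          · exact ⟨ν, hy, bumpPush_of_half_le h8⟩
          · have h9 : (0 : ℝ) < 1 - 2 * bumpHeight s := by linarith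
            have h10 : bumpHeight s + (ν - bumpHeight s) / (1 - 2 * bumpHeight s) *
                (1 - 2 * bumpHeight s) = ν := by
              rw [div_mul_cancel₀ _ h9.ne']; ring
            have h11 : (ν - bumpHeight s) / (1 - 2 * bumpHeight s) ≤ ν := by
              rw [div_le_iff₀ h9]; nlinarith
            refine ⟨(ν - bumpHeight s) / (1 - 2 * bumpHeight s),
              hbox hy.1 (div_nonneg (by linarith) h9.le) (h11.trans_lt hy.2.2), ?_⟩
            rw [bumpPush, h10]
            exact max_eq_right h11
        refine ⟨q (b, s, ν'), ?_⟩
        rw [hp1 _ h6, h7]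
    · exact Or.inl ⟨z, hp2 z hz⟩
  · intro x hx r h0 h1
    by_cases hxq : x ∈ q '' collarBox
    · obtain ⟨b, s, hs, rfl⟩ := hBq x hx hxq
      rw [hfB b s hs] at h1
      rw [← hqt, hCB b s r hs h0 h1, hCB _ s r hs h0 h1, hqt]
    · simp only [hCo x hxq, hCo _ (htR x hxq)]
  · rw [hfB false 0 (by simp)]
    norm_num [bumpHeight]

/-- An equivariant collar `c : B × [0, 1] → X` of the subset `B` of `X`. -/
structure IsCollar (B : Set X) (t : X → X) (c : X → ℝ → X) : Prop where
  continuousOn : ContinuousOn (fun y : X × ℝ => c y.1 y.2) (B ×ˢ Icc 0 1)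
  zero : ∀ x ∈ B, c x 0 = x
  inj : ∀ x ∈ B, ∀ x' ∈ B, ∀ u ∈ Icc (0 : ℝ) 1, ∀ u' ∈ Icc (0 : ℝ) 1, c x u = c x' u' →
    x = x' ∧ u = u'
  twist : ∀ x ∈ B, ∀ u ∈ Icc (0 : ℝ) 1, c (t x) u = t (c x u)
  isOpen : IsOpen ((fun y : X × ℝ => c y.1 y.2) '' (B ×ˢ Ico 0 1))

/-- A subset with charts that look like the boundary of the half-plane, locally and equivariantly,
has an equivariant collar: local collars are stacked. -/
theorem exists_isCollar [CompactSpace X] [T2Space X] {B : Set X} (hB : IsClosed B) {t : X → X}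
    (hloc : ∀ z ∈ B, ∃ f p C, PartialCollar B t f p C ∧ 0 < f z) :
    ∃ c, IsCollar B t c := by
  obtain ⟨f, p, C, h, hf⟩ : ∃ f p C, PartialCollar B t f p C ∧ ∀ z ∈ B, 0 < f z := by
    refine hB.isCompact.induction_on (p := fun s => ∃ f p C, PartialCollar B t f p C ∧
      ∀ z ∈ s ∩ B, 0 < f z) ?_ ?_ ?_ ?_ |>.imp fun f h => ?_
    · exact ⟨_, _, _, PartialCollar.trivial B t, by simp⟩
    · rintro s s' hs ⟨f, p, C, h, hf⟩
      exact ⟨f, p, C, h, fun z hz => hf z ⟨hs hz.1, hz.2⟩⟩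
    · rintro s s' ⟨f, p, C, h, hf⟩ ⟨f', p', C', h', hf'⟩
      refine ⟨_, _, _, h.comp hB h', ?_⟩
      rintro z ⟨hz | hz, hzB⟩
      · exact add_pos_of_pos_of_nonneg (hf z ⟨hz, hzB⟩) (h'.nonneg z hzB)
      · exact add_pos_of_nonneg_of_pos (h.nonneg z hzB) (hf' z ⟨hz, hzB⟩)
    · intro z hz
      obtain ⟨f, p, C, h, hfz⟩ := hloc z hz
      exact ⟨{w | 0 < f w}, mem_nhdsWithin_of_mem_nhds
        ((isOpen_lt continuous_const h.continuous_height).mem_nhds hfz), f, p, C, h,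
        fun w hw => hw.1⟩
    · simpa using h
  refine ⟨fun x u => C x (u * f x), ?_, ?_, ?_, ?_, ?_⟩
  · have hc : Continuous fun y : X × ℝ => (y.1, y.2 * f y.1) :=
      continuous_fst.prodMk (continuous_snd.mul (h.continuous_height.comp continuous_fst))
    refine h.continuousOn_param.comp hc.continuousOn ?_
    rintro ⟨x, u⟩ ⟨hx, hu⟩
    exact ⟨hx, mul_nonneg hu.1 (hf x hx).le, mul_le_of_le_one_left (hf x hx).le hu.2⟩
  · intro x hx
    simp only [zero_mul, h.param_zero x hx]
  · intro x hx x' hx' u hu u' hu' he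
    obtain ⟨rfl, h2⟩ := h.param_inj x hx x' hx' _ _ (mul_nonneg hu.1 (hf x hx).le)
      (mul_le_of_le_one_left (hf x hx).le hu.2) (mul_nonneg hu'.1 (hf x' hx').le)
      (mul_le_of_le_one_left (hf x' hx').le hu'.2) he
    exact ⟨rfl, mul_right_cancel₀ (hf x hx).ne' h2⟩
  · intro x hx u hu
    simp only [h.height_twist x hx]
    exact h.param_twist x hx _ (mul_nonneg hu.1 (hf x hx).le)
      (mul_le_of_le_one_left (hf x hx).le hu.2)
  · -- the image of the half-open collar is the complement of the image of the push
    convert (isCompact_range h.continuous_push).isClosed.isOpen_compl using 1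
    ext z
    constructor
    · rintro ⟨⟨x, u⟩, ⟨hx, hu⟩, rfl⟩ ⟨w, hw⟩
      have := (h.param_eq_push x hx _ w (mul_nonneg hu.1 (hf x hx).le)
        (mul_le_of_le_one_left (hf x hx).le hu.2.le) hw.symm).2
      have h3 := mul_lt_of_lt_one_left (hf x hx) hu.2
      exact absurd this h3.ne
    · intro hz
      rcases h.exhaust z with ⟨w, hw⟩ | ⟨x, hx, r, h0, h1, rfl⟩
      · exact absurd ⟨w, hw⟩ hz
      · have hne : r ≠ f x := by
          rintro rfl
          exact hz ⟨x, (h.param_end x hx).symm⟩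
        refine ⟨(x, r / f x), ⟨hx, div_nonneg h0 (hf x hx).le, ?_⟩, ?_⟩
        · rw [div_lt_one (hf x hx)]; exact lt_of_le_of_ne h1 hne
        · simp only [div_mul_cancel₀ _ (hf x hx).ne']

/-- The boundary of a cut surface has an equivariant collar. -/
theorem PatchSystem.exists_isCollar {S : Type*} [TopologicalSpace S] [CompactSpace S] [T2Space S]
    {D V : Set S} {τ : S ≃ₜ S} (Q : PatchSystem D V τ) (hD : IsClosed D)
    (hτ : ∀ y, τ (τ y) = y) (hfree : ∀ y, τ y ≠ y) : ∃ c, IsCollar Q.bd Q.twistFun c := by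
  refine LinkChunk.exists_isCollar (hD.preimage Q.continuous_proj) fun z hz => ?_
  obtain ⟨i, hi, ⟨a₀, b₀⟩, hp0, rfl⟩ := Q.exists_lift hz
  obtain rfl : b₀ = 0 := hp0
  -- a box around the point on which the patch is open and disjoint from its mirror image
  have hne : Q.twistFun (Q.lift i (a₀, 0)) ≠ Q.lift i (a₀, 0) := fun h =>
    hfree _ (congrArg Q.proj h)
  obtain ⟨A, A', hA, hA', hzA, hzA', hAA⟩ := t2_separation hne
  have hopen1 : IsOpen {p | 0 < Q.bump i (Q.q i p)} :=
    isOpen_lt continuous_const ((Q.continuous_bump i).comp (Q.embedding i).continuous)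
  have hopen2 : IsOpen (Q.lift i ⁻¹' (A' ∩ Q.twistFun ⁻¹' A)) :=
    (hA'.inter (hA.preimage Q.continuous_twistFun)).preimage (Q.continuous_lift i)
  obtain ⟨δ, hδ, hball⟩ := Metric.isOpen_iff.1 (hopen1.inter hopen2) (a₀, 0)
    ⟨Q.bump_pos _ hz i hi, hzA', hzA⟩
  set tw : Bool → Q.Carrier → Q.Carrier := fun b z => cond b (Q.twistFun z) z with htw
  set m : ℝ × ℝ → ℝ × ℝ≥0 := fun y => (a₀ + δ * y.1, Real.toNNReal (δ * y.2)) with hm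
  have hmball : ∀ s ν : ℝ, |s| < 1 → 0 ≤ ν → ν < 1 → m (s, ν) ∈ Metric.ball (a₀, (0 : ℝ≥0)) δ := by
    intro s ν hs h0 h1
    rw [Metric.mem_ball, Prod.dist_eq, max_lt_iff]
    constructor
    · simp only [hm, Real.dist_eq, add_sub_cancel_left, abs_mul, abs_of_pos hδ]
      nlinarith
    · simp only [hm, NNReal.dist_eq, NNReal.coe_zero, sub_zero]
      rw [Real.coe_toNNReal _ (by positivity), abs_of_nonneg (by positivity)]
      nlinarith
  have hmc : Continuous m := by simp only [hm]; fun_prop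
  have htwc : ∀ b, Continuous (tw b) := fun b => by
    cases b
    · exact continuous_id
    · exact Q.continuous_twistFun
  have htt := Q.twistFun_twistFun hτ
  have hminj : ∀ s ν s' ν' : ℝ, 0 ≤ ν → 0 ≤ ν' → m (s, ν) = m (s', ν') → s = s' ∧ ν = ν' := by
    intro s ν s' ν' h0 h0' h
    simp only [hm, Prod.mk.injEq, add_right_inj] at h
    refine ⟨mul_left_cancel₀ hδ.ne' h.1, mul_left_cancel₀ hδ.ne' ?_⟩
    have := congrArg NNReal.toReal h.2
    rwa [Real.coe_toNNReal _ (by positivity), Real.coe_toNNReal _ (by positivity)] at this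
  have hdisj : ∀ b b' : Bool, ∀ x ∈ Metric.ball (a₀, (0 : ℝ≥0)) δ,
      ∀ x' ∈ Metric.ball (a₀, (0 : ℝ≥0)) δ,
      tw b (Q.lift i x) = tw b' (Q.lift i x') → b = b' ∧ x = x' := by
    intro b b' x hx x' hx' h
    have h1 := (hball hx).2
    have h2 := (hball hx').2
    cases b <;> cases b'
    · exact ⟨rfl, (Q.isEmbedding_lift i).injective h⟩
    · exact absurd h1.1 (disjoint_left.1 hAA (by
        have h3 : Q.lift i x = Q.twistFun (Q.lift i x') := h
        rw [h3]; exact h2.2))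
    · exact absurd h2.1 (disjoint_left.1 hAA (by
        have h3 : Q.twistFun (Q.lift i x) = Q.lift i x' := h
        rw [← h3]; exact h1.2))
    · have := congrArg Q.twistFun h
      simp only [htw, cond_true, htt] at this
      exact ⟨rfl, (Q.isEmbedding_lift i).injective this⟩
  have := PartialCollar.of_chart (B := Q.bd) htt
    (q := fun y => tw y.1 (Q.lift i (m y.2))) ?_ ?_ ?_ ?_ ?_
  · obtain ⟨f, p, C, h, hf⟩ := this
    refine ⟨f, p, C, h, ?_⟩
    simpa [htw, hm] using hf
  · exact continuous_prod_of_discrete_left.2 fun b =>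
      (htwc b).comp ((Q.continuous_lift i).comp hmc)
  · rintro ⟨b, s, ν⟩ hy ⟨b', s', ν'⟩ hy' h
    obtain ⟨rfl, h2⟩ := hdisj b b' _ (hmball s ν hy.1 hy.2.1 hy.2.2) _
      (hmball s' ν' hy'.1 hy'.2.1 hy'.2.2) h
    obtain ⟨rfl, rfl⟩ := hminj s ν s' ν' hy.2.1 hy'.2.1 h2
    rfl
  · intro O hO
    have hslice : ∀ b, IsOpen (Q.lift i '' {p : ℝ × ℝ≥0 | (b, (p.1 - a₀) / δ, (p.2 : ℝ) / δ) ∈ O ∧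
        |(p.1 - a₀) / δ| < 1 ∧ (p.2 : ℝ) / δ < 1}) := by
      intro b
      refine Q.isOpen_lift_image i ?_ ?_
      · refine (hO.preimage (f := fun p : ℝ × ℝ≥0 => (b, (p.1 - a₀) / δ, (p.2 : ℝ) / δ))
          (by fun_prop)).inter (IsOpen.inter ?_ ?_)
        · exact isOpen_lt (f := fun p : ℝ × ℝ≥0 => |(p.1 - a₀) / δ|) (by fun_prop)
            continuous_const
        · exact isOpen_lt (f := fun p : ℝ × ℝ≥0 => (p.2 : ℝ) / δ) (by fun_prop)
            continuous_const
      · rintro ⟨a, e⟩ ⟨-, h1, h2⟩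
        have := (hball (hmball _ _ h1 (by positivity) h2)).1
        have h3 : m ((a - a₀) / δ, (e : ℝ) / δ) = (a, e) := by
          simp only [hm, mul_div_cancel₀ _ hδ.ne', add_sub_cancel, Real.toNNReal_coe]
        simp only at this
        rwa [h3] at this
    have htwo : ∀ b, ∀ U, IsOpen U → IsOpen (tw b '' U) := by
      intro b U hU
      cases b
      · simpa [htw] using hU
      · exact (Q.twistHomeo hτ).isOpenMap U hU
    convert isOpen_iUnion fun b => htwo b _ (hslice b) using 1
    ext w
    simp only [mem_image, mem_iUnion]
    constructor
    · rintro ⟨⟨b, s, ν⟩, ⟨hyO, hy⟩, rfl⟩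
      refine ⟨b, _, ⟨m (s, ν), ?_, rfl⟩, rfl⟩
      have h1 : ((m (s, ν)).1 - a₀) / δ = s := by simp only [hm]; field_simp; ring
      have h2 : ((m (s, ν)).2 : ℝ) / δ = ν := by
        simp only [hm]
        rw [Real.coe_toNNReal _ (mul_nonneg hδ.le hy.2.1)]; field_simp
      change (b, _, _) ∈ O ∧ _
      rw [h1, h2]
      exact ⟨hyO, hy.1, hy.2.2⟩
    · rintro ⟨b, _, ⟨⟨a, e⟩, ⟨h1, h2, h3⟩, rfl⟩, rfl⟩
      refine ⟨(b, (a - a₀) / δ, (e : ℝ) / δ), ⟨h1, h2, by positivity, h3⟩, ?_⟩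
      have h4 : m ((a - a₀) / δ, (e : ℝ) / δ) = (a, e) := by
        simp only [hm, mul_div_cancel₀ _ hδ.ne', add_sub_cancel, Real.toNNReal_coe]
      simp only [h4]
  · rintro ⟨b, s, ν⟩ hy
    have h1 : tw b (Q.lift i (m (s, ν))) ∈ Q.bd ↔ Q.lift i (m (s, ν)) ∈ Q.bd := by
      have hb : ∀ w, w ∈ Q.bd → Q.twistFun w ∈ Q.bd := by
        intro w hw
        obtain ⟨j, -, r, hr, rfl⟩ := Q.exists_lift hw
        have := (Q.mem_iff (Q.twist j) r).2 hr
        rw [Q.q_twist] at this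
        exact this
      cases b
      · rfl
      · exact ⟨fun h => htt (Q.lift i (m (s, ν))) ▸ hb _ h, hb _⟩
    change tw b (Q.lift i (m (s, ν))) ∈ Q.bd ↔ ν = 0
    rw [h1, Q.lift_mem_bd]
    simp only [hm, Real.toNNReal_eq_zero]
    constructor
    · intro h
      have h0 : (0 : ℝ) ≤ ν := hy.2.1
      nlinarith
    · rintro rfl
      simp
  · intro b s ν
    cases b
    · rfl
    · exact (htt _).symm

/-! ### The flow along the lifted link -/

theorem isLocalHomeomorph_of_isOpenMap {X Y : Type*} [TopologicalSpace X] [TopologicalSpace Y]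
    {f : X → Y} (hf : Continuous f) (ho : IsOpenMap f) (hi : ∀ x, ∃ U ∈ 𝓝 x, InjOn f U) :
    IsLocalHomeomorph f := by
  rw [isLocalHomeomorph_iff_isOpenEmbedding_restrict]
  intro x
  obtain ⟨U, hU, hinj⟩ := hi x
  obtain ⟨O, hOU, hO, hx⟩ := mem_nhds_iff.1 hU
  refine ⟨O, hO.mem_nhds hx, IsOpenEmbedding.of_continuous_injective_isOpenMap
    (hf.comp continuous_subtype_val) (injOn_iff_injective.1 (hinj.mono hOU)) ?_⟩
  exact ho.comp hO.isOpenMap_subtype_val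

namespace ProjectionSurface

variable {M : Type u} [TopologicalSpace M] {bM : Set M} {St : Type v} [TopologicalSpace St]
  (P : ProjectionSurface M bM St)

/-- The involution of `St × ℝ` whose orbits are the fibres of `nbhd`. -/
def flip (a : St × ℝ) : St × ℝ := (P.τ a.1, -a.2)

theorem nbhd_flip (a : St × ℝ) : P.nbhd (P.flip a) = P.nbhd a :=
  ((P.nbhd_eq_iff _ _).2 (Or.inr rfl)).symm

theorem nbhd_eq {a b : St × ℝ} : P.nbhd a = P.nbhd b ↔ b = a ∨ b = P.flip a := P.nbhd_eq_iff a b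

theorem continuous_flip : Continuous P.flip := by unfold flip; fun_prop

theorem flip_mem_lift {L : Set M} {a : St × ℝ} : P.flip a ∈ P.lift L ↔ a ∈ P.lift L := by
  simp only [lift, mem_preimage, nbhd_flip]

theorem exists_injOn_nbhd (a : St × ℝ) : ∃ U ∈ 𝓝 a, InjOn P.nbhd U := by
  have := P.isSurface.t2
  obtain ⟨A, A', hA, hA', hy, hy', hd⟩ := t2_separation (P.τ_ne a.1)
  refine ⟨Prod.fst ⁻¹' (A' ∩ P.τ ⁻¹' A), ((hA'.inter (hA.preimage P.τ.continuous)).preimage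
    continuous_fst).mem_nhds ⟨hy', hy⟩, ?_⟩
  rintro b ⟨hb, hb'⟩ c ⟨hc, -⟩ h
  rcases P.nbhd_eq.1 h with rfl | rfl
  · rfl
  · exact absurd hc (disjoint_left.1 hd hb')

theorem tau_mem_crossings {L : Set M} {y : St} : P.τ y ∈ P.crossings L ↔ y ∈ P.crossings L := by
  have aux : ∀ y, y ∈ P.crossings L → P.τ y ∈ P.crossings L := by
    rintro y ⟨t, t', h, h1, h2⟩
    exact ⟨-t', -t, by linarith, P.flip_mem_lift.2 h2, P.flip_mem_lift.2 h1⟩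
  exact ⟨fun h => P.τ_τ y ▸ aux _ h, aux y⟩

theorem crossings_subset_diagram {L : Set M} : P.crossings L ⊆ P.diagram L := by
  rintro y ⟨t, t', -, h, -⟩
  exact ⟨_, h, rfl⟩

theorem tau_mem_diagram {L : Set M} {y : St} : P.τ y ∈ P.diagram L ↔ y ∈ P.diagram L := by
  have aux : ∀ y, y ∈ P.diagram L → P.τ y ∈ P.diagram L := by
    rintro _ ⟨a, ha, rfl⟩
    exact ⟨P.flip a, P.flip_mem_lift.2 ha, rfl⟩
  exact ⟨fun h => P.τ_τ y ▸ aux _ h, aux y⟩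

theorem isClosed_link [T2Space M] {L : Set M} (hL : IsLink L) : IsClosed L := by
  obtain ⟨n, f, hf, -, rfl⟩ := hL
  exact (isCompact_range hf).isClosed

theorem isCompact_lift [T2Space M] {L : Set M} (hL : IsLink L) (hLN : L ⊆ P.thickening) :
    IsCompact (P.lift L) := by
  have := P.compact
  refine IsCompact.of_isClosed_subset (isCompact_univ.prod (isCompact_Icc (a := (-1 : ℝ)) (b := 1)))
    ((isClosed_link hL).preimage P.continuous_nbhd) ?_
  rintro ⟨y, t⟩ h
  obtain ⟨⟨y', t'⟩, ⟨-, ht⟩, h'⟩ := hLN h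
  refine ⟨mem_univ _, ?_⟩
  rcases P.nbhd_eq.1 h' with h | h
  · have : t = t' := congrArg Prod.snd h
    simpa only [this] using ht
  · have h2 : t = -t' := congrArg Prod.snd h
    have h3 : -1 ≤ t' ∧ t' ≤ 1 := ht
    simp only [mem_Icc, h2]
    constructor <;> linarith [h3.1, h3.2]

theorem isClosed_diagram [T2Space M] {L : Set M} (hL : IsLink L) (hLN : L ⊆ P.thickening) :
    IsClosed (P.diagram L) := by
  have := P.isSurface.t2
  exact ((P.isCompact_lift hL hLN).image continuous_fst).isClosed

/-- The flow along the lifted link: each component of the link is a circle, and rotation along the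
circles lifts to the double cover `P.lift L` of the link. -/
structure IsLinkFlow (L : Set M) (Φ : St × ℝ → ℝ → St × ℝ) : Prop where
  continuous : ∀ a ∈ P.lift L, Continuous (Φ a)
  mem : ∀ a ∈ P.lift L, ∀ θ, Φ a θ ∈ P.lift L
  zero : ∀ a ∈ P.lift L, Φ a 0 = a
  add : ∀ a ∈ P.lift L, ∀ θ θ', Φ (Φ a θ) θ' = Φ a (θ + θ')
  flip : ∀ a ∈ P.lift L, ∀ θ, Φ (P.flip a) θ = P.flip (Φ a θ)
  period : ∀ a ∈ P.lift L, ∀ θ θ', P.nbhd (Φ a θ) = P.nbhd (Φ a θ') ↔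
    ∃ m : ℤ, θ = θ' + m * (2 * Real.pi)
  hits : ∀ a ∈ P.lift L, ∃ θ, (Φ a θ).1 ∈ P.crossings L

/-- The rotations of the circles that make up the link lift to its double cover.  Every flow line
meets a crossing, since a flow line covers a whole component. -/
theorem exists_isLinkFlow [T2Space M] {L : Set M} (hL : IsLink L) (hLN : L ⊆ P.thickening)
    (hcr : ∀ x ∈ L, ∃ y t, y ∈ P.crossings L ∧ P.nbhd (y, t) ∈ connectedComponentIn L x) :
    ∃ Φ, P.IsLinkFlow L Φ := by
  have := P.isSurface.t2
  have := isCompact_iff_compactSpace.1 (P.isCompact_lift hL hLN)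
  obtain ⟨n, f, hf, hfi, hfL⟩ := hL
  let f' : Fin (n + 1) × Circle ≃ L :=
    (Equiv.ofInjective f hfi).trans (Equiv.setCongr hfL)
  have hf' : Continuous f' := Continuous.subtype_mk hf _
  let F : (Fin (n + 1) × Circle) ≃ₜ L := hf'.homeoOfEquivCompactToT2
  have hF : ∀ x, (F x : M) = f x := fun x => rfl
  -- the link is double covered by its lift
  let g : P.lift L → Fin (n + 1) × Circle := fun a => F.symm ⟨P.nbhd a, a.2⟩
  have hg : ∀ a, f (g a) = P.nbhd a := fun a => by
    rw [← hF]; simp [g]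
  have hres : IsLocalHomeomorph (L.restrictPreimage P.nbhd) := by
    refine isLocalHomeomorph_of_isOpenMap P.continuous_nbhd.restrictPreimage
      (P.isOpenMap_nbhd.restrictPreimage L) fun a => ?_
    obtain ⟨U, hU, hinj⟩ := P.exists_injOn_nbhd a.1
    exact ⟨Subtype.val ⁻¹' U, continuous_subtype_val.continuousAt hU, fun b hb c hc h =>
      Subtype.ext (hinj hb hc (congrArg Subtype.val h))⟩
  have hgl : IsLocalHomeomorph g := F.symm.isLocalHomeomorph.comp hres
  have hcov : IsCoveringMap g := isLocalHomeomorph_iff_isCoveringMap.1 hgl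
  let r : P.lift L → C(ℝ, Fin (n + 1) × Circle) := fun a =>
    ⟨fun θ => ((g a).1, Circle.exp θ * (g a).2), by fun_prop⟩
  -- the rotation lifts uniquely; uniqueness gives the group law and the compatibility with `flip`
  have hex : ∀ a, ∃! Γ : C(ℝ, P.lift L), Γ 0 = a ∧ g ∘ Γ = r a := fun a =>
    hcov.existsUnique_continuousMap_lifts (r a) 0 a (by simp [r])
  choose Γ hΓ hΓu using hex
  have hΓ0 : ∀ a, Γ a 0 = a := fun a => (hΓ a).1
  have hΓg : ∀ a θ, g (Γ a θ) = ((g a).1, Circle.exp θ * (g a).2) := fun a θ =>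
    congrFun (hΓ a).2 θ
  have hadd : ∀ a θ θ', Γ (Γ a θ) θ' = Γ a (θ + θ') := by
    intro a θ θ'
    have := hΓu (Γ a θ) ((Γ a).comp ⟨fun x => θ + x, by fun_prop⟩) ⟨by simp, by
      funext x
      simp [r, hΓg, add_comm θ x, mul_assoc]⟩
    rw [← this]
    rfl
  have hflm : ∀ a : P.lift L, P.flip a ∈ P.lift L := fun a => P.flip_mem_lift.2 a.2
  let fl : P.lift L → P.lift L := fun a => ⟨P.flip a, hflm a⟩
  have hflc : Continuous fl := Continuous.subtype_mk (P.continuous_flip.comp continuous_subtype_val) _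
  have hgfl : ∀ a, g (fl a) = g a := fun a => hfi (by rw [hg, hg]; exact P.nbhd_flip a)
  have hfl : ∀ a θ, Γ (fl a) θ = fl (Γ a θ) := by
    intro a θ
    have := hΓu (fl a) ((⟨fl, hflc⟩ : C(P.lift L, P.lift L)).comp (Γ a)) ⟨by simp [hΓ0], by
      funext x
      simp [r, hgfl, hΓg]⟩
    rw [← this]
    rfl
  classical
  refine ⟨fun a θ => if h : a ∈ P.lift L then Γ ⟨a, h⟩ θ else a, ?_, ?_, ?_, ?_, ?_, ?_, ?_⟩
  · intro a ha
    simp only [ha, dif_pos]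
    fun_prop
  · intro a ha θ
    simp only [ha, dif_pos]
    exact (Γ ⟨a, ha⟩ θ).2
  · intro a ha
    simp only [ha, dif_pos, hΓ0]
  · intro a ha θ θ'
    simp only [ha, dif_pos, (Γ ⟨a, ha⟩ θ).2, Subtype.coe_eta, hadd]
  · intro a ha θ
    have h2 : P.flip a ∈ P.lift L := P.flip_mem_lift.2 ha
    simp only [ha, dif_pos, h2]
    exact congrArg Subtype.val (hfl ⟨a, ha⟩ θ)
  · intro a ha θ θ'
    simp only [ha, dif_pos]
    rw [← hg, ← hg, hfi.eq_iff, hΓg, hΓg, Prod.mk.injEq, mul_left_inj, Circle.exp_eq_exp]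
    simp
  · intro a ha
    -- the component of the given point is its circle, and contains a point over a crossing
    obtain ⟨y, t, hy, hyt⟩ := hcr (P.nbhd a) ha
    have hytL : P.nbhd (y, t) ∈ L := connectedComponentIn_subset _ _ hyt
    rw [connectedComponentIn_eq_image (show P.nbhd a ∈ L from ha)] at hyt
    obtain ⟨x, hx, hxe⟩ := hyt
    have h1 : (F.symm x).1 = (F.symm ⟨P.nbhd a, ha⟩).1 := by
      have := (isPreconnected_connectedComponent (x := (⟨P.nbhd a, ha⟩ : L))).image
        (fun x => (F.symm x).1) (by fun_prop)
      exact this.subsingleton ⟨x, hx, rfl⟩ ⟨_, mem_connectedComponent, rfl⟩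
    obtain ⟨θ, hθ⟩ := Circle.exp_surjective ((F.symm x).2 / (g ⟨a, ha⟩).2)
    refine ⟨θ, ?_⟩
    simp only [ha, dif_pos]
    have h2 : P.nbhd (Γ ⟨a, ha⟩ θ) = P.nbhd (y, t) := by
      rw [← hg, hΓg, hθ, div_mul_cancel, ← hxe]
      have : ((g ⟨a, ha⟩).1, (F.symm x).2) = F.symm x := Prod.ext h1.symm rfl
      rw [this, ← hF]
      simp
    rcases P.nbhd_eq.1 h2 with h3 | h3
    · rw [← h3]; exact hy
    · rw [← P.tau_mem_crossings]
      have : y = P.τ (Γ ⟨a, ha⟩ θ : St × ℝ).1 := congrArg Prod.fst h3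
      rw [← this]; exact hy

/-! ### Crossings -/

/-- In each chart there is at most one crossing, and the diagram is compact. -/
theorem finite_crossings [T2Space M] {L : Set M} (hL : IsLink L) (hLN : L ⊆ P.thickening)
    (hdiag : P.IsGeneralisedDiagram L) : (P.crossings L).Finite := by
  have hcomp : IsCompact (P.diagram L) := (P.isCompact_lift hL hLN).image continuous_fst
  suffices h : ∀ s ⊆ P.diagram L, s = P.diagram L → (s ∩ P.crossings L).Finite by
    refine (h _ subset_rfl rfl).subset fun y hy => ⟨P.crossings_subset_diagram hy, hy⟩
  rintro _ - rfl
  refine hcomp.induction_on (p := fun s => (s ∩ P.crossings L).Finite) (by simp)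
    (fun s t hst ht => ht.subset (inter_subset_inter_left _ hst))
    (fun s t hs ht => by rw [union_inter_distrib_right]; exact hs.union ht) ?_
  intro y hy
  obtain ⟨h, hys, -, h0, hc | hc⟩ := hdiag y hy
  · obtain ⟨f, -, hf⟩ := hc
    refine ⟨h.source, mem_nhdsWithin_of_mem_nhds (h.open_source.mem_nhds hys), ?_⟩
    convert finite_empty
    rw [eq_empty_iff_forall_notMem]
    rintro z ⟨hz, t, t', htt, h1, h2⟩
    have h3 := ((hf z hz t).1 h1).2
    have h4 := ((hf z hz t').1 h2).2
    linarith
  · obtain ⟨f, g, -, -, hfg, hf⟩ := hc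
    refine ⟨h.source, mem_nhdsWithin_of_mem_nhds (h.open_source.mem_nhds hys), ?_⟩
    refine (finite_singleton y).subset ?_
    rintro z ⟨hz, t, t', htt, h1, h2⟩
    refine h.injOn hz hys ?_
    rw [h0]
    rcases (hf z hz t).1 h1 with ⟨h3, h4⟩ | ⟨h3, h4⟩ <;>
      rcases (hf z hz t').1 h2 with ⟨h5, h6⟩ | ⟨h5, h6⟩
    · linarith
    · exact Prod.ext h5 h3
    · exact Prod.ext h3 h5
    · linarith

/-- Over a crossing the lifted link has exactly two points. -/
theorem exists_heights {L : Set M} (hdiag : P.IsGeneralisedDiagram L) :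
    ∃ lo hi : St → ℝ, ∀ y ∈ P.crossings L, lo y < hi y ∧
      ∀ t, (y, t) ∈ P.lift L ↔ t = lo y ∨ t = hi y := by
  have : ∀ y, ∃ l : ℝ × ℝ, y ∈ P.crossings L → l.1 < l.2 ∧
      ∀ t, (y, t) ∈ P.lift L ↔ t = l.1 ∨ t = l.2 := by
    intro y
    by_cases hy : y ∈ P.crossings L
    · obtain ⟨h, hys, -, h0, hc | hc⟩ := hdiag y (P.crossings_subset_diagram hy)
      · obtain ⟨f, -, hf⟩ := hc
        obtain ⟨t, t', htt, h1, h2⟩ := hy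
        have h3 := ((hf y hys t).1 h1).2
        have h4 := ((hf y hys t').1 h2).2
        linarith
      · obtain ⟨f, g, -, -, hfg, hf⟩ := hc
        refine ⟨(f 0, g 0), fun _ => ⟨hfg, fun t => ?_⟩⟩
        rw [hf y hys, h0]
        simp
    · exact ⟨0, fun h => absurd h hy⟩
  choose l hl using this
  exact ⟨fun y => (l y).1, fun y => (l y).2, hl⟩

/-- `lo` and `hi` are the heights of the two strands of the link over the crossings. -/
def IsHeights (L : Set M) (lo hi : St → ℝ) : Prop :=
  ∀ y ∈ P.crossings L, lo y < hi y ∧ ∀ t, (y, t) ∈ P.lift L ↔ t = lo y ∨ t = hi y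

variable {P} {L : Set M} {lo hi : St → ℝ}

theorem IsHeights.lo_mem (hh : P.IsHeights L lo hi) {y : St} (hy : y ∈ P.crossings L) :
    (y, lo y) ∈ P.lift L := ((hh y hy).2 _).2 (Or.inl rfl)

theorem IsHeights.hi_mem (hh : P.IsHeights L lo hi) {y : St} (hy : y ∈ P.crossings L) :
    (y, hi y) ∈ P.lift L := ((hh y hy).2 _).2 (Or.inr rfl)

theorem IsHeights.isUnder_iff (hh : P.IsHeights L lo hi) {a : St × ℝ} :
    P.IsUnder L a ↔ a.1 ∈ P.crossings L ∧ a.2 = lo a.1 := by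
  obtain ⟨y, t⟩ := a
  constructor
  · rintro ⟨h, t', htt, h'⟩
    have hy : y ∈ P.crossings L := ⟨t, t', htt, h, h'⟩
    obtain ⟨h1, h2⟩ := hh y hy
    refine ⟨hy, ?_⟩
    simp only at h htt ⊢
    rcases (h2 t).1 h with h3 | h3
    · exact h3
    · rcases (h2 t').1 h' with h4 | h4 <;> linarith
  · rintro ⟨hy, h⟩
    obtain rfl : t = lo y := h
    exact ⟨hh.lo_mem hy, hi y, (hh y hy).1, hh.hi_mem hy⟩

theorem IsHeights.isOver_iff (hh : P.IsHeights L lo hi) {a : St × ℝ} :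
    P.IsOver L a ↔ a.1 ∈ P.crossings L ∧ a.2 = hi a.1 := by
  obtain ⟨y, t⟩ := a
  constructor
  · rintro ⟨h, t', htt, h'⟩
    have hy : y ∈ P.crossings L := ⟨t', t, htt, h', h⟩
    obtain ⟨h1, h2⟩ := hh y hy
    refine ⟨hy, ?_⟩
    simp only at h htt ⊢
    rcases (h2 t).1 h with h3 | h3
    · rcases (h2 t').1 h' with h4 | h4 <;> linarith
    · exact h3
  · rintro ⟨hy, h⟩
    obtain rfl : t = hi y := h
    exact ⟨hh.hi_mem hy, lo y, (hh y hy).1, hh.lo_mem hy⟩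

theorem IsHeights.under_or_over (hh : P.IsHeights L lo hi) {a : St × ℝ} (ha : a ∈ P.lift L)
    (hc : a.1 ∈ P.crossings L) : P.IsUnder L a ∨ P.IsOver L a := by
  rw [hh.isUnder_iff, hh.isOver_iff]
  rcases ((hh a.1 hc).2 a.2).1 ha with h | h
  · exact Or.inl ⟨hc, h⟩
  · exact Or.inr ⟨hc, h⟩

theorem IsHeights.not_under_over (hh : P.IsHeights L lo hi) {a : St × ℝ} (h1 : P.IsUnder L a)
    (h2 : P.IsOver L a) : False := by
  rw [hh.isUnder_iff] at h1
  rw [hh.isOver_iff] at h2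
  have := (hh a.1 h1.1).1
  linarith [h1.2, h2.2]

/-- The deck transformation exchanges the two strands at a crossing and turns them upside down. -/
theorem IsHeights.lo_tau (hh : P.IsHeights L lo hi) {y : St} (hy : y ∈ P.crossings L) :
    lo (P.τ y) = -hi y := by
  have hy' := P.tau_mem_crossings.2 hy
  have h1 : (P.τ y, -hi y) ∈ P.lift L := P.flip_mem_lift.2 (hh.hi_mem hy)
  have h2 : (P.τ y, -lo y) ∈ P.lift L := P.flip_mem_lift.2 (hh.lo_mem hy)
  have h3 := (hh y hy).1
  have h4 := (hh _ hy').1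
  rcases ((hh _ hy').2 _).1 h1 with h | h
  · exact h.symm
  · rcases ((hh _ hy').2 _).1 h2 with h' | h' <;> linarith

theorem IsHeights.hi_tau (hh : P.IsHeights L lo hi) {y : St} (hy : y ∈ P.crossings L) :
    hi (P.τ y) = -lo y := by
  have := hh.lo_tau (P.tau_mem_crossings.2 hy)
  rw [P.τ_τ] at this
  linarith

theorem height_unique {y : St} (hy : y ∉ P.crossings L) {t t' : ℝ} (h : (y, t) ∈ P.lift L)
    (h' : (y, t') ∈ P.lift L) : t = t' := by
  by_contra hne
  rcases lt_or_gt_of_ne hne with h1 | h1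
  · exact hy ⟨t, t', h1, h, h'⟩
  · exact hy ⟨t', t, h1, h', h⟩

end ProjectionSurface

namespace ProjectionSurface

variable {M : Type u} [TopologicalSpace M] {bM : Set M} {St : Type v} [TopologicalSpace St]
  {P : ProjectionSurface M bM St} {L : Set M} {lo hi : St → ℝ} {Φ : St × ℝ → ℝ → St × ℝ}

/-! ### Edges of the diagram -/

/-- `δ` is the first time at which the flow line from `a`, run with velocity `g = ±1`, passes
through a crossing. -/
def IsFirstHit (P : ProjectionSurface M bM St) (L : Set M) (Φ : St × ℝ → ℝ → St × ℝ)
    (a : St × ℝ) (g δ : ℝ) : Prop :=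
  0 < δ ∧ (Φ a (g * δ)).1 ∈ P.crossings L ∧ ∀ θ ∈ Ioo 0 δ, (Φ a (g * θ)).1 ∉ P.crossings L

theorem IsFirstHit.unique {a : St × ℝ} {g δ δ' : ℝ} (h : P.IsFirstHit L Φ a g δ)
    (h' : P.IsFirstHit L Φ a g δ') : δ = δ' := by
  rcases lt_trichotomy δ δ' with hlt | rfl | hlt
  · exact absurd h.2.1 (h'.2.2 _ ⟨h.1, hlt⟩)
  · rfl
  · exact absurd h'.2.1 (h.2.2 _ ⟨h'.1, hlt⟩)

theorem finite_lift_crossings (hh : P.IsHeights L lo hi) (hV : (P.crossings L).Finite) :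
    {a | a ∈ P.lift L ∧ a.1 ∈ P.crossings L}.Finite := by
  refine ((hV.image fun y => (y, lo y)).union (hV.image fun y => (y, hi y))).subset ?_
  rintro ⟨y, t⟩ ⟨h, hy⟩
  rcases ((hh y hy).2 t).1 h with rfl | rfl
  · exact Or.inl ⟨y, hy, rfl⟩
  · exact Or.inr ⟨y, hy, rfl⟩

/-- Whether the flow is over a crossing depends only on the time modulo the period. -/
theorem IsLinkFlow.period_hit (hΦ : P.IsLinkFlow L Φ) {a : St × ℝ} (ha : a ∈ P.lift L)
    {θ θ' : ℝ} (m : ℤ) (h : θ = θ' + m * (2 * Real.pi)) :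
    (Φ a θ).1 ∈ P.crossings L ↔ (Φ a θ').1 ∈ P.crossings L := by
  rcases P.nbhd_eq.1 ((hΦ.period a ha θ θ').2 ⟨m, h⟩) with h | h
  · rw [h]
  · rw [h]; exact P.tau_mem_crossings.symm

/-- A flow line does not meet itself, even in `M`, before a full period has passed. -/
theorem IsLinkFlow.eq_of_close (hΦ : P.IsLinkFlow L Φ) {a : St × ℝ} (ha : a ∈ P.lift L)
    {θ θ' : ℝ} (h : |θ - θ'| < 2 * Real.pi) (he : P.nbhd (Φ a θ) = P.nbhd (Φ a θ')) : θ = θ' := by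
  obtain ⟨m, hm⟩ := (hΦ.period a ha θ θ').1 he
  have hp := Real.two_pi_pos
  have h2 : |(m : ℝ)| * (2 * Real.pi) < 1 * (2 * Real.pi) := by
    rw [← abs_of_pos hp, ← abs_mul, abs_of_pos hp, one_mul]
    have h1 : (m : ℝ) * (2 * Real.pi) = θ - θ' := by rw [hm]; ring
    rwa [h1]
  have h3 : |(m : ℝ)| < 1 := lt_of_mul_lt_mul_right h2 hp.le
  have h4 : m = 0 := by
    rw [← Int.abs_lt_one_iff]
    exact_mod_cast h3
  rw [hm, h4]; simp

/-- Only finitely many times within one period are over a crossing, and at least one is. -/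
theorem IsLinkFlow.exists_firstHit (hΦ : P.IsLinkFlow L Φ) (hh : P.IsHeights L lo hi)
    (hV : (P.crossings L).Finite) {a : St × ℝ} (ha : a ∈ P.lift L) {g : ℝ} (hg : g = 1 ∨ g = -1) :
    ∃ δ ≤ 2 * Real.pi, P.IsFirstHit L Φ a g δ := by
  have hp := Real.two_pi_pos
  have hgg : g * g = 1 := by rcases hg with rfl | rfl <;> norm_num
  let A : Set ℝ := {θ | θ ∈ Ioc 0 (2 * Real.pi) ∧ (Φ a (g * θ)).1 ∈ P.crossings L}
  have hfin : A.Finite := by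
    refine Finite.of_finite_image (f := fun θ => P.nbhd (Φ a (g * θ)))
      (((finite_lift_crossings hh hV).image P.nbhd).subset ?_) ?_
    · rintro _ ⟨θ, hθ, rfl⟩
      exact ⟨_, ⟨hΦ.mem a ha _, hθ.2⟩, rfl⟩
    · intro θ hθ θ' hθ' he
      have h1 := hΦ.eq_of_close ha (θ := g * θ) (θ' := g * θ') ?_ he
      · calc θ = g * (g * θ) := by rw [← mul_assoc, hgg, one_mul]
          _ = g * (g * θ') := by rw [h1]
          _ = θ' := by rw [← mul_assoc, hgg, one_mul]
      · rw [← mul_sub, abs_mul]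
        have : |g| = 1 := by rcases hg with rfl | rfl <;> simp
        rw [this, one_mul, abs_lt]
        constructor <;> linarith [hθ.1.1, hθ.1.2, hθ'.1.1, hθ'.1.2]
  have hne : A.Nonempty := by
    obtain ⟨θ, hθ⟩ := hΦ.hits a ha
    refine ⟨toIocMod hp 0 (g * θ), by simpa using toIocMod_mem_Ioc hp 0 (g * θ), ?_⟩
    obtain ⟨m, hm⟩ : ∃ m : ℤ, (m : ℝ) = -g * toIocDiv hp 0 (g * θ) := by
      rcases hg with rfl | rfl
      · exact ⟨-toIocDiv hp 0 (1 * θ), by push_cast; ring⟩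
      · exact ⟨toIocDiv hp 0 (-1 * θ), by ring⟩
    refine (hΦ.period_hit ha m ?_).2 hθ
    have := self_sub_toIocDiv_zsmul hp 0 (g * θ)
    rw [← this, hm, mul_sub, ← mul_assoc, hgg, zsmul_eq_mul]
    ring
  obtain ⟨δ, hδ, hmin⟩ := exists_min_image A id hfin hne
  refine ⟨δ, hδ.1.2, hδ.1.1, hδ.2, fun θ hθ hc => ?_⟩
  have := hmin θ ⟨⟨hθ.1, hθ.2.le.trans hδ.1.2⟩, hc⟩
  exact absurd hθ.2 (not_lt.2 this)

/-- An alternating diagram: a flow line that leaves an under-crossing next meets an over-crossing,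
and vice versa. -/
theorem IsLinkFlow.alternates (hΦ : P.IsLinkFlow L Φ) (hh : P.IsHeights L lo hi)
    (hV : (P.crossings L).Finite) (halt : P.IsAlternating L) {a : St × ℝ} (ha : a ∈ P.lift L)
    {g : ℝ} (hg : g = 1 ∨ g = -1) {δ : ℝ} (hδ : P.IsFirstHit L Φ a g δ)
    (hc : a.1 ∈ P.crossings L) : P.IsOver L a ↔ P.IsUnder L (Φ a (g * δ)) := by
  obtain ⟨δ', hδ', h'⟩ := hΦ.exists_firstHit hh hV ha hg
  obtain rfl := hδ.unique h'
  have := halt (fun s => Φ a (g * (δ * s)))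
    ((hΦ.continuous a ha).comp (by fun_prop)) (fun s => hΦ.mem a ha _) ?_ ?_ ?_ ?_
  · simpa [hΦ.zero a ha] using this
  · intro s hs s' hs' he
    have h1 := hΦ.eq_of_close ha (θ := g * (δ * s)) (θ' := g * (δ * s')) ?_ (congrArg P.nbhd he)
    · have hg0 : g ≠ 0 := by rcases hg with rfl | rfl <;> norm_num
      exact Subtype.ext (mul_left_cancel₀ hδ.1.ne' (mul_left_cancel₀ hg0 h1))
    · have h2 : |g| = 1 := by rcases hg with rfl | rfl <;> simp
      rw [← mul_sub, ← mul_sub, abs_mul, h2, one_mul, abs_mul, abs_of_pos hδ.1]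
      have h3 : |(s : ℝ) - s'| < 1 := by
        have a1 : (0 : ℝ) < s := hs.1
        have a2 : (s : ℝ) < 1 := hs.2
        have a3 : (0 : ℝ) < s' := hs'.1
        have a4 : (s' : ℝ) < 1 := hs'.2
        rw [abs_lt]; constructor <;> linarith
      calc δ * |(s : ℝ) - s'| < δ * 1 := by gcongr; exact hδ.1
        _ ≤ _ := by rw [mul_one]; exact hδ'
  · intro s hs
    have a1 : (0 : ℝ) < s := hs.1
    have a2 : (s : ℝ) < 1 := hs.2
    exact hδ.2.2 _ ⟨mul_pos hδ.1 a1, by nlinarith [hδ.1]⟩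
  · simpa [hΦ.zero a ha] using hc
  · simpa using hδ.2.1

/-- The edges of a lifted alternating diagram, with the strands `μ` of the lifted link over them,
run from the under-crossing to the over-crossing.  The last field describes how the two edges
that start at a crossing leave it: they are the two halves of the strand that lies below. -/
structure EdgeSystem (P : ProjectionSurface M bM St) (L : Set M) (E : Type*) where
  μ : E → ℝ → St × ℝ
  continuous_μ : ∀ e, Continuous (μ e)
  mem : ∀ e s, μ e s ∈ P.lift L
  isUnder : ∀ e, P.IsUnder L (μ e 0)
  isOver : ∀ e, P.IsOver L (μ e 1)
  notMem : ∀ e, ∀ s ∈ Ioo (0 : ℝ) 1, (μ e s).1 ∉ P.crossings L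
  inj : ∀ e e', ∀ s ∈ Ioo (0 : ℝ) 1, ∀ s' ∈ Ioo (0 : ℝ) 1, (μ e s).1 = (μ e' s').1 →
    e = e' ∧ s = s'
  cover : ∀ y ∈ P.diagram L, y ∉ P.crossings L → ∃ e, ∃ s ∈ Ioo (0 : ℝ) 1, (μ e s).1 = y
  star : E → E
  μ_star : ∀ e s, μ (star e) s = P.flip (μ e (1 - s))
  start : ∀ y ∈ P.crossings L, ∃ e e', e ≠ e' ∧ (∀ d, (μ d 0).1 = y ↔ d = e ∨ d = e') ∧
    ∀ (h : OpenPartialHomeomorph St (ℝ × ℝ)) (f g : ℝ → ℝ), y ∈ h.source → h y = (0, 0) →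
      Continuous f → Continuous g → f 0 < g 0 →
      (∀ z ∈ h.source, ∀ t, ((z, t) ∈ P.lift L ↔
          ((h z).2 = 0 ∧ t = f (h z).1) ∨ ((h z).1 = 0 ∧ t = g (h z).2))) →
      ∃ d d', (d = e ∧ d' = e' ∨ d = e' ∧ d' = e) ∧
        (∀ᶠ s in 𝓝[>] (0 : ℝ), (μ d s).1 ∈ h.source ∧ 0 < (h (μ d s).1).1 ∧
          (h (μ d s).1).2 = 0) ∧
        (∀ᶠ s in 𝓝[>] (0 : ℝ), (μ d' s).1 ∈ h.source ∧ (h (μ d' s).1).1 < 0 ∧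
          (h (μ d' s).1).2 = 0)

/-- The strand below passes through a crossing along the first axis of a crossing chart. -/
theorem IsLinkFlow.exists_sign (hΦ : P.IsLinkFlow L Φ) (hh : P.IsHeights L lo hi) {y : St}
    (hy : y ∈ P.crossings L) (h : OpenPartialHomeomorph St (ℝ × ℝ)) {f g : ℝ → ℝ}
    (hys : y ∈ h.source) (h0 : h y = (0, 0)) (hg : Continuous g) (hfg : f 0 < g 0)
    (hL : ∀ z ∈ h.source, ∀ t, ((z, t) ∈ P.lift L ↔
      ((h z).2 = 0 ∧ t = f (h z).1) ∨ ((h z).1 = 0 ∧ t = g (h z).2))) :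
    ∃ σ : ℝ, (σ = 1 ∨ σ = -1) ∧ ∀ᶠ θ in 𝓝[>] (0 : ℝ),
      ((Φ (y, lo y) (σ * θ)).1 ∈ h.source ∧ 0 < (h (Φ (y, lo y) (σ * θ)).1).1 ∧
        (h (Φ (y, lo y) (σ * θ)).1).2 = 0) ∧
      ((Φ (y, lo y) (-σ * θ)).1 ∈ h.source ∧ (h (Φ (y, lo y) (-σ * θ)).1).1 < 0 ∧
        (h (Φ (y, lo y) (-σ * θ)).1).2 = 0) := by
  set a := (y, lo y) with ha_def
  have ha : a ∈ P.lift L := hh.lo_mem hy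
  have hlo : lo y = f 0 := by
    have h1 := (hL y hys (lo y)).1 (hh.lo_mem hy)
    have h2 := (hL y hys (hi y)).1 (hh.hi_mem hy)
    have h3 := (hh y hy).1
    simp only [h0, true_and] at h1 h2
    rcases h1 with h1 | h1
    · exact h1
    · rcases h2 with h2 | h2 <;> linarith
  have hΦc := hΦ.continuous a ha
  have hΦ0 := hΦ.zero a ha
  have hΦ1 : (Φ a 0).1 = y := by rw [hΦ0]
  -- near time `0` the flow line stays in the chart, below the other strand
  have ev1 : ∀ᶠ θ in 𝓝 (0 : ℝ), (Φ a θ).1 ∈ h.source :=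
    (continuous_fst.comp hΦc).continuousAt.eventually_mem
      (h.open_source.mem_nhds (show (Φ a 0).1 ∈ h.source by rwa [hΦ1]))
  have hcont : ContinuousAt (fun θ => h (Φ a θ).1) 0 := by
    have : ContinuousAt h ((Φ a 0).1) := h.continuousAt (by rwa [hΦ1])
    exact ContinuousAt.comp (f := fun θ => (Φ a θ).1) this
      (continuous_fst.comp hΦc).continuousAt
  have ev2 : ∀ᶠ θ in 𝓝 (0 : ℝ), (Φ a θ).2 < g (h (Φ a θ).1).2 := by
    have h1 : ContinuousAt (fun θ => g (h (Φ a θ).1).2) 0 :=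
      hg.continuousAt.comp (continuous_snd.continuousAt.comp hcont)
    refine (continuous_snd.comp hΦc).continuousAt.eventually_lt h1 ?_
    simp only [Function.comp, hΦ1, h0]
    rw [hΦ0, ha_def, hlo]
    exact hfg
  have ev3 : ∀ᶠ θ in 𝓝 (0 : ℝ), (Φ a θ).1 ∈ h.source ∧ (h (Φ a θ).1).2 = 0 ∧
      (Φ a θ).2 = f (h (Φ a θ).1).1 := by
    filter_upwards [ev1, ev2] with θ h1 h2
    rcases (hL _ h1 (Φ a θ).2).1 (hΦ.mem a ha θ) with h3 | h3
    · exact ⟨h1, h3⟩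
    · exact absurd h3.2 h2.ne
  obtain ⟨ε, hε, hev⟩ := Metric.eventually_nhds_iff.1 ev3
  set r := min (ε / 2) 1 with hr
  have hr0 : 0 < r := by positivity
  have hr1 : r ≤ 1 := min_le_right _ _
  have hmem : ∀ θ ∈ Icc (-r) r, (Φ a θ).1 ∈ h.source ∧ (h (Φ a θ).1).2 = 0 ∧
      (Φ a θ).2 = f (h (Φ a θ).1).1 := by
    intro θ hθ
    apply hev
    rw [Real.dist_eq, sub_zero]
    have := abs_le.2 ⟨hθ.1, hθ.2⟩
    have h2 : r ≤ ε / 2 := min_le_left _ _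
    linarith
  let x : ℝ → ℝ := fun θ => (h (Φ a θ).1).1
  have hxc : ContinuousOn x (Icc (-r) r) := by
    refine continuous_fst.comp_continuousOn (h.continuousOn.comp
      (continuous_fst.comp hΦc).continuousOn fun θ hθ => (hmem θ hθ).1)
  -- the first coordinate is injective along a short piece of the flow line, hence monotone
  have hxi : InjOn x (Icc (-r) r) := by
    intro θ hθ θ' hθ' he
    obtain ⟨h1, h2, h3⟩ := hmem θ hθ
    obtain ⟨h1', h2', h3'⟩ := hmem θ' hθ'
    have h4 : (Φ a θ).1 = (Φ a θ').1 := h.injOn h1 h1' (Prod.ext he (h2.trans h2'.symm))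
    have h5 : Φ a θ = Φ a θ' := Prod.ext h4 (by rw [h3, h3', h4])
    refine hΦ.eq_of_close ha ?_ (congrArg P.nbhd h5)
    have := Real.pi_gt_three
    rw [abs_lt]; constructor <;> linarith [hθ.1, hθ.2, hθ'.1, hθ'.2]
  have hx0 : x 0 = 0 := by simp only [x, hΦ1, h0]
  have hev0 : ∀ᶠ θ in 𝓝[>] (0 : ℝ), θ ∈ Ioc 0 r := Ioc_mem_nhdsGT hr0
  have h0m : (0 : ℝ) ∈ Icc (-r) r := ⟨by linarith, hr0.le⟩
  rcases hxc.strictMonoOn_of_injOn_Icc' (by linarith) hxi with hmono | hanti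
  · refine ⟨1, Or.inl rfl, ?_⟩
    filter_upwards [hev0] with θ hθ
    have m1 : 1 * θ ∈ Icc (-r) r := ⟨by linarith [hθ.1], by linarith [hθ.2]⟩
    have m2 : -1 * θ ∈ Icc (-r) r := ⟨by linarith [hθ.2], by linarith [hθ.1]⟩
    refine ⟨⟨(hmem _ m1).1, ?_, (hmem _ m1).2.1⟩, (hmem _ m2).1, ?_, (hmem _ m2).2.1⟩
    · have := hmono h0m m1 (by linarith [hθ.1])
      rwa [hx0] at this
    · have := hmono m2 h0m (by linarith [hθ.1])
      rwa [hx0] at this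
  · refine ⟨-1, Or.inr rfl, ?_⟩
    filter_upwards [hev0] with θ hθ
    have m1 : -1 * θ ∈ Icc (-r) r := ⟨by linarith [hθ.2], by linarith [hθ.1]⟩
    have m2 : - -1 * θ ∈ Icc (-r) r := ⟨by linarith [hθ.1], by linarith [hθ.2]⟩
    refine ⟨⟨(hmem _ m1).1, ?_, (hmem _ m1).2.1⟩, (hmem _ m2).1, ?_, (hmem _ m2).2.1⟩
    · have := hanti m1 h0m (by linarith [hθ.1])
      rwa [hx0] at this
    · have := hanti h0m m2 (by linarith [hθ.1])
      rwa [hx0] at this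

/-- The edges start at the under-crossings, one in each direction of the flow, and last until the
next crossing. -/
theorem IsLinkFlow.exists_edgeSystem (hΦ : P.IsLinkFlow L Φ) (hh : P.IsHeights L lo hi)
    (hV : (P.crossings L).Finite) (halt : P.IsAlternating L) :
    Nonempty (EdgeSystem P L (P.crossings L × Bool)) := by
  let E := P.crossings L × Bool
  let a : E → St × ℝ := fun e => (e.1.1, lo e.1.1)
  let g : E → ℝ := fun e => if e.2 then 1 else -1
  have ha : ∀ e, a e ∈ P.lift L := fun e => hh.lo_mem e.1.2
  have hg : ∀ e, g e = 1 ∨ g e = -1 := fun e => by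
    by_cases h : e.2 = true <;> simp [g, h]
  -- the length of each edge
  choose δ hδ2 hδ using fun e : E => hΦ.exists_firstHit hh hV (ha e) (hg e)
  have hund : ∀ e, P.IsUnder L (a e) := fun e => hh.isUnder_iff.2 ⟨e.1.2, rfl⟩
  have hover : ∀ e, P.IsOver L (Φ (a e) (g e * δ e)) := by
    intro e
    have h1 := hΦ.alternates hh hV halt (ha e) (hg e) (hδ e) e.1.2
    rcases hh.under_or_over (hΦ.mem _ (ha e) (g e * δ e)) (hδ e).2.1 with h2 | h2
    · exact (hh.not_under_over (hund e) (h1.2 h2)).elim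
    · exact h2
  have hE : ∀ b ∈ P.lift L, P.IsUnder L b → ∀ σ : ℝ, σ = 1 ∨ σ = -1 → ∃ e, a e = b ∧ g e = σ := by
    rintro ⟨y, t⟩ hb hbu σ hσ
    obtain ⟨hy, ht⟩ := hh.isUnder_iff.1 hbu
    refine ⟨(⟨y, hy⟩, decide (σ = 1)), Prod.ext rfl ht.symm, ?_⟩
    rcases hσ with rfl | rfl
    · simp [g]
    · have : ¬ ((-1 : ℝ) = 1) := by norm_num
      simp [g, this]
  have hinj : ∀ e e', a e = a e' → g e = g e' → e = e' := by
    rintro ⟨⟨y, hy⟩, b⟩ ⟨⟨y', hy'⟩, b'⟩ h1 h2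
    have h3 : y = y' := congrArg Prod.fst h1
    subst h3
    have h4 : b = b' := by
      cases b <;> cases b' <;> simp [g] at h2 ⊢ <;> norm_num at h2
    rw [h4]
  -- an edge traversed backwards
  have hback : ∀ e, ∀ θ ∈ Ioc 0 (δ e),
      P.IsFirstHit L Φ (Φ (a e) (g e * θ)) (-g e) θ := by
    intro e θ hθ
    refine ⟨hθ.1, ?_, fun θ' hθ' => ?_⟩
    · rw [hΦ.add _ (ha e), show g e * θ + -g e * θ = 0 by ring, hΦ.zero _ (ha e)]
      exact e.1.2
    · rw [hΦ.add _ (ha e), show g e * θ + -g e * θ' = g e * (θ - θ') by ring]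
      exact (hδ e).2.2 _ ⟨by linarith [hθ'.2], by linarith [hθ'.1, hθ.2]⟩
  have hforw : ∀ e, ∀ θ ∈ Ico 0 (δ e),
      P.IsFirstHit L Φ (Φ (a e) (g e * θ)) (g e) (δ e - θ) := by
    intro e θ hθ
    refine ⟨by linarith [hθ.2], ?_, fun θ' hθ' => ?_⟩
    · rw [hΦ.add _ (ha e), show g e * θ + g e * (δ e - θ) = g e * δ e by ring]
      exact (hδ e).2.1
    · rw [hΦ.add _ (ha e), show g e * θ + g e * θ' = g e * (θ + θ') by ring]
      exact (hδ e).2.2 _ ⟨by linarith [hθ'.1, hθ.1], by linarith [hθ'.2]⟩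
  have hIoo : ∀ e, ∀ s ∈ Ioo (0 : ℝ) 1, δ e * s ∈ Ioo 0 (δ e) := fun e s hs =>
    ⟨mul_pos (hδ e).1 hs.1, by nlinarith [(hδ e).1, hs.2]⟩
  -- the reversed image of an edge under the deck transformation is an edge
  have hstar : ∀ e, ∃ e', a e' = P.flip (Φ (a e) (g e * δ e)) ∧ g e' = -g e ∧ δ e' = δ e := by
    intro e
    have hm := P.flip_mem_lift.2 (hΦ.mem _ (ha e) (g e * δ e))
    obtain ⟨h1, h2⟩ := hh.isOver_iff.1 (hover e)
    obtain ⟨e', h3, h4⟩ := hE _ hm (hh.isUnder_iff.2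
      ⟨P.tau_mem_crossings.2 h1, by
        change -(Φ (a e) (g e * δ e)).2 = lo (P.τ (Φ (a e) (g e * δ e)).1)
        rw [hh.lo_tau h1, h2]⟩) (-g e)
      (by rcases hg e with h | h <;> simp [h])
    refine ⟨e', h3, h4, ?_⟩
    have h5 := hback e (δ e) ⟨(hδ e).1, le_rfl⟩
    refine (hδ e').unique ⟨h5.1, ?_, fun θ hθ => ?_⟩
    · rw [h3, h4, hΦ.flip _ (hΦ.mem _ (ha e) _)]
      exact P.tau_mem_crossings.2 h5.2.1
    · rw [h3, h4, hΦ.flip _ (hΦ.mem _ (ha e) _)]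
      exact fun h => h5.2.2 θ hθ (P.tau_mem_crossings.1 h)
  choose star hs1 hs2 hs3 using hstar
  refine ⟨⟨fun e s => Φ (a e) (g e * (δ e * s)), fun e => (hΦ.continuous _ (ha e)).comp (by fun_prop),
    fun e s => hΦ.mem _ (ha e) _, fun e => ?_, fun e => ?_, fun e s hs => ?_, ?_, ?_, star, ?_, ?_⟩⟩
  · simpa [hΦ.zero _ (ha e)] using hund e
  · simpa using hover e
  · exact (hδ e).2.2 _ (hIoo e s hs)
  · intro e e' s hs s' hs' he
    have hb := hIoo e s hs
    have hb' := hIoo e' s' hs'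
    have heq : Φ (a e) (g e * (δ e * s)) = Φ (a e') (g e' * (δ e' * s')) := by
      refine Prod.ext he (height_unique ((hδ e).2.2 _ hb)
        (hΦ.mem _ (ha e) (g e * (δ e * s))) ?_)
      rw [he]
      exact hΦ.mem _ (ha e') (g e' * (δ e' * s'))
    have h1 := hback e _ ⟨hb.1, hb.2.le⟩
    -- edges with a common point and the same direction start at the same point, and edges with
    -- opposite directions would have an under-crossing end that is an over-crossing end
    by_cases hgg : g e = g e'
    · have h2 := hback e' _ ⟨hb'.1, hb'.2.le⟩
      rw [← heq, ← hgg] at h2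
      have h3 := h1.unique h2
      have h4 : a e = a e' := by
        have := congrArg (fun p => Φ p (-g e * (δ e * s))) heq
        simp only [hΦ.add _ (ha _)] at this
        rw [h3, ← hgg, ← h3] at this
        simpa [hΦ.zero _ (ha _)] using this
      obtain rfl := hinj e e' h4 hgg
      exact ⟨rfl, mul_left_cancel₀ (hδ e).1.ne' h3⟩
    · exfalso
      have hgg' : g e' = -g e := by
        rcases hg e with h | h <;> rcases hg e' with h' | h' <;> simp_all
      have h2 := hforw e' _ ⟨hb'.1.le, hb'.2⟩
      rw [← heq, hgg'] at h2
      have h3 := h1.unique h2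
      refine hh.not_under_over (hund e) ?_
      have := congrArg (fun p => Φ p (-g e * (δ e * s))) heq
      simp only [hΦ.add _ (ha _)] at this
      rw [show g e * (δ e * s) + -g e * (δ e * s) = 0 by ring, hΦ.zero _ (ha e), h3, ← hgg',
        show g e' * (δ e' * s') + g e' * (δ e' - δ e' * s') = g e' * δ e' by ring] at this
      rw [this]
      exact hover e'
  · rintro _ ⟨p, hp, rfl⟩ hpc
    obtain ⟨δ₁, -, h1⟩ := hΦ.exists_firstHit hh hV hp (g := -1) (Or.inr rfl)
    obtain ⟨δ₂, -, h2⟩ := hΦ.exists_firstHit hh hV hp (g := 1) (Or.inl rfl)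
    have hpos : 0 < δ₁ + δ₂ := add_pos h1.1 h2.1
    -- the whole interval around the given point, in both directions
    have hno : ∀ θ ∈ Ioo (-δ₁) δ₂, (Φ p θ).1 ∉ P.crossings L := by
      intro θ hθ
      rcases lt_trichotomy θ 0 with h | rfl | h
      · have := h1.2.2 (-θ) ⟨by linarith, by linarith [hθ.1]⟩
        simpa using this
      · rwa [hΦ.zero p hp]
      · have := h2.2.2 θ ⟨h, hθ.2⟩
        simpa using this
    have hA : P.IsFirstHit L Φ (Φ p (-1 * δ₁)) 1 (δ₁ + δ₂) := by
      refine ⟨hpos, ?_, fun θ hθ => ?_⟩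
      · rw [hΦ.add p hp, show -1 * δ₁ + 1 * (δ₁ + δ₂) = 1 * δ₂ by ring]; exact h2.2.1
      · rw [hΦ.add p hp]; exact hno _ ⟨by linarith [hθ.1], by linarith [hθ.2]⟩
    have hB : P.IsFirstHit L Φ (Φ p (1 * δ₂)) (-1) (δ₁ + δ₂) := by
      refine ⟨hpos, ?_, fun θ hθ => ?_⟩
      · rw [hΦ.add p hp, show 1 * δ₂ + -1 * (δ₁ + δ₂) = -1 * δ₁ by ring]; exact h1.2.1
      · rw [hΦ.add p hp]; exact hno _ ⟨by linarith [hθ.2], by linarith [hθ.1]⟩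
    have hm1 := hΦ.mem p hp (-1 * δ₁)
    have hm2 := hΦ.mem p hp (1 * δ₂)
    have key : ∀ σ : ℝ, (σ = 1 ∨ σ = -1) → ∀ η > 0, η < δ₁ + δ₂ →
        P.IsFirstHit L Φ (Φ p (-σ * η)) σ (δ₁ + δ₂) → P.IsUnder L (Φ p (-σ * η)) →
        ∃ e, ∃ s ∈ Ioo (0 : ℝ) 1, (Φ (a e) (g e * (δ e * s))).1 = p.1 := by
      intro σ hσ η hη hη' hf hu
      obtain ⟨e, h3, h4⟩ := hE _ (hΦ.mem p hp _) hu σ hσ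
      have h5 : δ e = δ₁ + δ₂ := (hδ e).unique (by rw [h3, h4]; exact hf)
      refine ⟨e, η / δ e, ⟨div_pos hη (hδ e).1, (div_lt_one (hδ e).1).2 (by rw [h5]; exact hη')⟩, ?_⟩
      rw [mul_div_cancel₀ _ (hδ e).1.ne', h3, h4, hΦ.add p hp, show -σ * η + σ * η = 0 by ring,
        hΦ.zero p hp]
    rcases hh.under_or_over hm1 h1.2.1 with hu | ho
    · exact key 1 (Or.inl rfl) δ₁ h1.1 (by linarith [h2.1]) (by simpa using hA) (by simpa using hu)
    · have hu := (hΦ.alternates hh hV halt hm1 (Or.inl rfl) hA h1.2.1).1 ho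
      rw [hΦ.add p hp, show -1 * δ₁ + 1 * (δ₁ + δ₂) = 1 * δ₂ by ring] at hu
      exact key (-1) (Or.inr rfl) δ₂ h2.1 (by linarith [h1.1]) (by simpa using hB)
        (by simpa using hu)
  · intro e s
    rw [hs1, hs2, hs3, hΦ.flip _ (hΦ.mem _ (ha e) _), hΦ.add _ (ha e)]
    congr 2; ring
  · intro y hy
    have h0 : ∀ d, (Φ (a d) (g d * (δ d * 0))).1 = d.1.1 := fun d => by simp [hΦ.zero _ (ha d), a]
    refine ⟨(⟨y, hy⟩, true), (⟨y, hy⟩, false), by simp, fun d => ?_, ?_⟩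
    · rw [h0]
      obtain ⟨⟨y', hy'⟩, b⟩ := d
      cases b <;> simp
    · intro h f g' hys hy0 hf hg' hfg hL
      obtain ⟨σ, hσ, hev⟩ := hΦ.exists_sign hh hy h hys hy0 hg' hfg hL
      have hscale : ∀ d : E, Tendsto (fun s => δ d * s) (𝓝[>] 0) (𝓝[>] 0) := by
        intro d
        refine tendsto_nhdsWithin_iff.2 ⟨?_, ?_⟩
        · have : Tendsto (fun s => δ d * s) (𝓝 0) (𝓝 (δ d * 0)) := by
            apply Continuous.tendsto; fun_prop
          rw [mul_zero] at this
          exact this.mono_left nhdsWithin_le_nhds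
        · filter_upwards [self_mem_nhdsWithin] with s hs
          exact mul_pos (hδ d).1 hs
      rcases hσ with rfl | rfl
      · refine ⟨_, _, Or.inl ⟨rfl, rfl⟩, ?_, ?_⟩
        · filter_upwards [(hscale (⟨y, hy⟩, true)).eventually hev] with s hs using hs.1
        · filter_upwards [(hscale (⟨y, hy⟩, false)).eventually hev] with s hs using hs.2
      · refine ⟨_, _, Or.inr ⟨rfl, rfl⟩, ?_, ?_⟩
        · filter_upwards [(hscale (⟨y, hy⟩, false)).eventually hev] with s hs using hs.1
        · filter_upwards [(hscale (⟨y, hy⟩, true)).eventually hev] with s hs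
          simpa [g] using hs.2

end ProjectionSurface

/-! ### Patches from charts of the diagram -/

/-- The sign `±1` of a Boolean. -/
def sgn (b : Bool) : ℝ := if b then 1 else -1

theorem sgn_mul_self (b : Bool) : sgn b * sgn b = 1 := by cases b <;> simp [sgn]

theorem exists_sgn_pos {x : ℝ} (hx : x ≠ 0) : ∃ b, 0 < sgn b * x := by
  rcases lt_or_gt_of_ne hx with h | h
  · exact ⟨false, by simp [sgn, h]⟩
  · exact ⟨true, by simp [sgn, h]⟩

theorem sgn_eq_of_nonneg {x : ℝ} (hx : x ≠ 0) {b b' : Bool} (h : 0 ≤ sgn b * x)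
    (h' : 0 ≤ sgn b' * x) : b = b' := by
  rcases lt_or_gt_of_ne hx with h0 | h0 <;> cases b <;> cases b' <;> simp [sgn] at h h' ⊢ <;>
    linarith

/-- The model patch: for `c` false a half-plane bounded by the first axis, for `c` true a quadrant
with its corner straightened. -/
noncomputable def modelPatch (c s₁ s₂ : Bool) (p : ℝ × ℝ≥0) : ℝ × ℝ :=
  if c then (sgn s₁ * (p.2 + max p.1 0), sgn s₂ * (p.2 + max (-p.1) 0)) else (p.1, sgn s₂ * p.2)

/-- The closed half-plane or quadrant covered by the model patch. -/
def modelSector (c s₁ s₂ : Bool) : Set (ℝ × ℝ) :=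
  {v | (c = true → 0 ≤ sgn s₁ * v.1) ∧ 0 ≤ sgn s₂ * v.2}

/-- The interior of the model sector. -/
def modelInner (c s₁ s₂ : Bool) : Set (ℝ × ℝ) :=
  {v | (c = true → 0 < sgn s₁ * v.1) ∧ 0 < sgn s₂ * v.2}

/-- The first axis, or both axes. -/
def modelAxes (c : Bool) : Set (ℝ × ℝ) := {v | v.2 = 0 ∨ c = true ∧ v.1 = 0}

theorem continuous_modelPatch (c s₁ s₂ : Bool) : Continuous (modelPatch c s₁ s₂) := by
  cases c <;> unfold modelPatch <;> simp only [if_true, Bool.false_eq_true, if_false] <;> fun_prop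

theorem isEmbedding_modelPatch (c s₁ s₂ : Bool) : IsEmbedding (modelPatch c s₁ s₂) := by
  cases c
  · refine IsEmbedding.of_leftInverse
      (f := fun v : ℝ × ℝ => (v.1, Real.toNNReal (sgn s₂ * v.2))) ?_ (by fun_prop)
      (continuous_modelPatch _ _ _)
    rintro ⟨a, b⟩
    simp [modelPatch, ← mul_assoc, sgn_mul_self]
  · refine IsEmbedding.of_leftInverse
      (f := fun v : ℝ × ℝ => (sgn s₁ * v.1 - sgn s₂ * v.2,
        Real.toNNReal (min (sgn s₁ * v.1) (sgn s₂ * v.2)))) ?_ (by fun_prop)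
      (continuous_modelPatch _ _ _)
    rintro ⟨a, b⟩
    simp only [modelPatch, if_true, ← mul_assoc, sgn_mul_self, one_mul]
    rcases le_total a 0 with h | h
    · simp [h]
    · simp [h]

theorem modelPatch_mem_axes {c s₁ s₂ : Bool} {p : ℝ × ℝ≥0} :
    modelPatch c s₁ s₂ p ∈ modelAxes c ↔ p.2 = 0 := by
  obtain ⟨a, b⟩ := p
  have hs : ∀ s, sgn s ≠ 0 := fun s => by cases s <;> simp [sgn]
  cases c
  · simp [modelPatch, modelAxes, hs]
  · simp only [modelPatch, modelAxes, if_true, mem_ofPred_eq, mul_eq_zero, hs, false_or,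
      true_and]
    have hb : (0 : ℝ) ≤ b := b.2
    rw [← NNReal.coe_eq_zero]
    constructor
    · rintro (h | h)
      · linarith [le_max_right (-a) 0]
      · linarith [le_max_right a 0]
    · intro h
      rw [h]
      rcases le_total a 0 with h | h
      · right; simp [h]
      · left; simp [h]

theorem modelPatch_mem_sector (c s₁ s₂ : Bool) (p : ℝ × ℝ≥0) :
    modelPatch c s₁ s₂ p ∈ modelSector c s₁ s₂ := by
  cases c
  · simp [modelPatch, modelSector, ← mul_assoc, sgn_mul_self]
  · simp only [modelPatch, modelSector, if_true, mem_ofPred_eq, ← mul_assoc, sgn_mul_self, one_mul]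
    exact ⟨fun _ => by positivity, by positivity⟩

theorem exists_modelPatch {c s₁ s₂ : Bool} {v : ℝ × ℝ} (hv : v ∈ modelSector c s₁ s₂) :
    ∃ p, modelPatch c s₁ s₂ p = v := by
  obtain ⟨x, y⟩ := v
  obtain ⟨h1, h2⟩ := hv
  simp only at h1 h2
  cases c
  · refine ⟨(x, Real.toNNReal (sgn s₂ * y)), ?_⟩
    simp [modelPatch, Real.coe_toNNReal _ h2, ← mul_assoc, sgn_mul_self]
  · replace h1 := h1 rfl
    have h3 : 0 ≤ min (sgn s₁ * x) (sgn s₂ * y) := le_min h1 h2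
    refine ⟨(sgn s₁ * x - sgn s₂ * y, Real.toNNReal (min (sgn s₁ * x) (sgn s₂ * y))), ?_⟩
    simp only [modelPatch, if_true, Real.coe_toNNReal _ h3]
    rcases le_total (sgn s₁ * x) (sgn s₂ * y) with h | h
    · rw [min_eq_left h, max_eq_right (by linarith), max_eq_left (by linarith)]
      refine Prod.ext ?_ ?_
      · simp [← mul_assoc, sgn_mul_self]
      · simp only; ring_nf; rw [pow_two, sgn_mul_self, one_mul]
    · rw [min_eq_right h, max_eq_left (by linarith), max_eq_right (by linarith)]
      refine Prod.ext ?_ ?_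
      · simp only; ring_nf; rw [pow_two, sgn_mul_self, one_mul]
      · simp [← mul_assoc, sgn_mul_self]

theorem mem_modelInner_iff {c s₁ s₂ : Bool} {v : ℝ × ℝ} (hv : v ∈ modelSector c s₁ s₂) :
    v ∈ modelInner c s₁ s₂ ↔ v ∉ modelAxes c := by
  obtain ⟨h1, h2⟩ := hv
  have hs : ∀ s, sgn s ≠ 0 := fun s => by cases s <;> simp [sgn]
  constructor
  · rintro ⟨h3, h4⟩ (h | ⟨hc, h⟩)
    · rw [h, mul_zero] at h4; exact lt_irrefl _ h4
    · have := h3 hc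
      rw [h, mul_zero] at this; exact lt_irrefl _ this
  · intro h
    simp only [modelAxes, mem_ofPred_eq, not_or, not_and] at h
    exact ⟨fun hc => lt_of_le_of_ne (h1 hc) (mul_ne_zero (hs _) (h.2 hc)).symm,
      lt_of_le_of_ne h2 (mul_ne_zero (hs _) h.1).symm⟩

theorem modelInner_subset {c s₁ s₂ : Bool} : modelInner c s₁ s₂ ⊆ modelSector c s₁ s₂ :=
  fun _ h => ⟨fun hc => (h.1 hc).le, h.2.le⟩

theorem image_modelPatch_inner (c s₁ s₂ : Bool) :
    modelPatch c s₁ s₂ '' {p | 0 < p.2} = modelInner c s₁ s₂ := by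
  ext v
  constructor
  · rintro ⟨p, hp, rfl⟩
    rw [mem_modelInner_iff (modelPatch_mem_sector _ _ _ _), modelPatch_mem_axes]
    exact hp.ne'
  · intro hv
    obtain ⟨p, rfl⟩ := exists_modelPatch (modelInner_subset hv)
    rw [mem_modelInner_iff (modelPatch_mem_sector _ _ _ _), modelPatch_mem_axes] at hv
    exact ⟨p, pos_iff_ne_zero.2 hv, rfl⟩

theorem isOpen_modelInner (c s₁ s₂ : Bool) : IsOpen (modelInner c s₁ s₂) := by
  have h1 : IsOpen {v : ℝ × ℝ | 0 < sgn s₁ * v.1} := isOpen_lt (by fun_prop) (by fun_prop)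
  have h2 : IsOpen {v : ℝ × ℝ | 0 < sgn s₂ * v.2} := isOpen_lt (by fun_prop) (by fun_prop)
  cases c
  · simpa [modelInner] using h2
  · simpa [modelInner, ofPred_and] using h1.inter h2

theorem isClosed_modelSector (c s₁ s₂ : Bool) : IsClosed (modelSector c s₁ s₂) := by
  have h1 : IsClosed {v : ℝ × ℝ | 0 ≤ sgn s₁ * v.1} := isClosed_le (by fun_prop) (by fun_prop)
  have h2 : IsClosed {v : ℝ × ℝ | 0 ≤ sgn s₂ * v.2} := isClosed_le (by fun_prop) (by fun_prop)
  cases c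
  · simpa [modelSector] using h2
  · simpa [modelSector, ofPred_and] using h1.inter h2

/-- A chart at a point of `D` in which `D` is one line, or at a point of `V` in which it is two
lines. -/
structure IsDiagramChart {S : Type*} [TopologicalSpace S] (D V : Set S) (c : Bool) (y : S)
    (h : OpenPartialHomeomorph S (ℝ × ℝ)) : Prop where
  mem_source : y ∈ h.source
  target : h.target = univ
  center : h y = (0, 0)
  mem_iff : ∀ z ∈ h.source, z ∈ D ↔ h z ∈ modelAxes c
  mem_V : c = true → y ∈ V
  eq_center : ∀ z ∈ h.source, z ∈ V → c = true ∧ z = y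

section

variable {S : Type*} [TopologicalSpace S] {D V : Set S} {c : Bool} {y : S}
  {h : OpenPartialHomeomorph S (ℝ × ℝ)}

theorem IsDiagramChart.isOpenEmbedding_symm (hc : IsDiagramChart D V c y h) :
    IsOpenEmbedding h.symm :=
  h.symm.isOpenEmbedding (by rw [h.symm_source, hc.target])

theorem IsDiagramChart.symm_mem (hc : IsDiagramChart D V c y h) (v : ℝ × ℝ) :
    h.symm v ∈ h.source := h.map_target (by rw [hc.target]; trivial)

theorem IsDiagramChart.apply_symm (hc : IsDiagramChart D V c y h) (v : ℝ × ℝ) :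
    h (h.symm v) = v := h.right_inv (by rw [hc.target]; trivial)

theorem IsDiagramChart.mem_image (hc : IsDiagramChart D V c y h) {A : Set (ℝ × ℝ)} {z : S} :
    z ∈ h.symm '' A ↔ z ∈ h.source ∧ h z ∈ A := by
  constructor
  · rintro ⟨v, hv, rfl⟩
    exact ⟨hc.symm_mem v, by rwa [hc.apply_symm]⟩
  · rintro ⟨h1, h2⟩
    exact ⟨_, h2, h.left_inv h1⟩

theorem IsDiagramChart.mem_range (hc : IsDiagramChart D V c y h) {s₁ s₂ : Bool} {z : S} :
    z ∈ range (fun p => h.symm (modelPatch c s₁ s₂ p)) ↔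
      z ∈ h.source ∧ h z ∈ modelSector c s₁ s₂ := by
  constructor
  · rintro ⟨p, rfl⟩
    exact ⟨hc.symm_mem _, by rw [hc.apply_symm]; exact modelPatch_mem_sector _ _ _ _⟩
  · rintro ⟨h1, h2⟩
    obtain ⟨p, hp⟩ := exists_modelPatch h2
    exact ⟨p, by simp only [hp, h.left_inv h1]⟩

theorem image_symm_modelPatch (s₁ s₂ : Bool) :
    (fun p => h.symm (modelPatch c s₁ s₂ p)) '' {p | 0 < p.2} = h.symm '' modelInner c s₁ s₂ := by
  rw [← image_modelPatch_inner, image_image]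

theorem IsDiagramChart.mem_inner (hc : IsDiagramChart D V c y h) {s₁ s₂ : Bool} {z : S} :
    z ∈ (fun p => h.symm (modelPatch c s₁ s₂ p)) '' {p | 0 < p.2} ↔
      z ∈ h.source ∧ h z ∈ modelInner c s₁ s₂ := by
  rw [image_symm_modelPatch, hc.mem_image]

/-- The signs of the sectors of a diagram chart that contain a point `z` in their closure; for a
line chart only one of the two equal copies of each sector is listed. -/
def IsSector (c : Bool) (v : ℝ × ℝ) (s : Bool × Bool) : Prop :=
  (c = true ∨ s.1 = true) ∧ v ∈ modelSector c s.1 s.2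

theorem IsDiagramChart.disjoint_inner (hc : IsDiagramChart D V c y h) {v v' : ℝ × ℝ}
    {s s' : Bool × Bool} (hs : IsSector c v s) (hs' : IsSector c v' s') (hne : s ≠ s') :
    Disjoint ((fun p => h.symm (modelPatch c s.1 s.2 p)) '' {p | 0 < p.2})
      ((fun p => h.symm (modelPatch c s'.1 s'.2 p)) '' {p | 0 < p.2}) := by
  rw [disjoint_left]
  intro z hz hz'
  rw [hc.mem_inner] at hz hz'
  apply hne
  have h2 : s.2 = s'.2 := sgn_eq_of_nonneg (x := (h z).2)
    (fun h0 => by simpa [h0] using hz.2.2) hz.2.2.le hz'.2.2.le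
  refine Prod.ext ?_ h2
  cases c
  · simpa using hs.1.resolve_left (by simp) |>.trans (hs'.1.resolve_left (by simp)).symm
  · exact sgn_eq_of_nonneg (x := (h z).1)
      (fun h0 => by simpa [h0] using hz.2.1 rfl) (hz.2.1 rfl).le (hz'.2.1 rfl).le

theorem exists_isSector_of_ne {c : Bool} {v w : ℝ × ℝ} (hw : w ∉ modelAxes c)
    (h1 : 0 < v.1 → 0 < w.1) (h2 : v.1 < 0 → w.1 < 0) (h3 : 0 < v.2 → 0 < w.2)
    (h4 : v.2 < 0 → w.2 < 0) : ∃ s, IsSector c v s ∧ w ∈ modelInner c s.1 s.2 := by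
  have aux : ∀ {a b : ℝ}, (0 < a → 0 < b) → (a < 0 → b < 0) → ∀ s, 0 < sgn s * b →
      0 ≤ sgn s * a := by
    intro a b h1 h2 s hs
    cases s <;> simp [sgn] at hs ⊢
    · by_contra! h; linarith [h1 h]
    · by_contra! h; linarith [h2 h]
  simp only [modelAxes, mem_ofPred_eq, not_or, not_and] at hw
  obtain ⟨s₂, hs₂⟩ := exists_sgn_pos hw.1
  cases c
  · exact ⟨(true, s₂), ⟨Or.inr rfl, by simp, aux h3 h4 _ hs₂⟩, by simp, hs₂⟩
  · obtain ⟨s₁, hs₁⟩ := exists_sgn_pos (hw.2 rfl)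
    exact ⟨(s₁, s₂), ⟨Or.inl rfl, fun _ => aux h1 h2 _ hs₁, aux h3 h4 _ hs₂⟩, fun _ => hs₁, hs₂⟩

open Classical in
theorem card_isSector_zero : (Finset.univ.filter (IsSector true 0)).card = 4 := by
  have : Finset.univ.filter (IsSector true 0) = Finset.univ := by
    ext s; simp [IsSector, modelSector]
  rw [this]; rfl

open Classical in
theorem card_isSector_edge {c : Bool} {v : ℝ × ℝ} (hv : v ∈ modelAxes c)
    (h0 : c = true → v ≠ 0) : (Finset.univ.filter (IsSector c v)).card = 2 := by
  rw [Finset.card_eq_two]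
  cases c
  · have h2 : v.2 = 0 := by simpa [modelAxes] using hv
    refine ⟨(true, true), (true, false), by simp, ?_⟩
    ext ⟨a, b⟩
    cases a <;> cases b <;> simp [IsSector, modelSector, h2]
  · simp only [modelAxes, true_and, mem_ofPred_eq] at hv
    by_cases h2 : v.2 = 0
    · have h1 : v.1 ≠ 0 := fun h => h0 rfl (Prod.ext h h2)
      obtain ⟨s, hs⟩ := exists_sgn_pos h1
      refine ⟨(s, true), (s, false), by simp, ?_⟩
      ext ⟨a, b⟩
      have : 0 ≤ sgn a * v.1 ↔ a = s :=
        ⟨fun h => sgn_eq_of_nonneg h1 h hs.le, fun h => h ▸ hs.le⟩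
      cases b <;> simp [IsSector, modelSector, h2, this]
    · have h1 : v.1 = 0 := hv.resolve_left h2
      obtain ⟨s, hs⟩ := exists_sgn_pos h2
      refine ⟨(true, s), (false, s), by simp, ?_⟩
      ext ⟨b, a⟩
      have : 0 ≤ sgn a * v.2 ↔ a = s :=
        ⟨fun h => sgn_eq_of_nonneg h2 h hs.le, fun h => h ▸ hs.le⟩
      cases b <;> simp [IsSector, modelSector, h1, this]

/-- A closed subset `D` of a compact surface that looks locally like a line or, at the points of `V`,
like two crossing lines, has a patch system.  The patches at a point of `V` lie in different
quadrants of a given chart at that point. -/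
theorem exists_patchSystem [CompactSpace S] [T2Space S] (hD : IsClosed D) (hVD : V ⊆ D)
    {τ : S ≃ₜ S} (hτ : ∀ y, τ (τ y) = y) (hτD : ∀ y, τ y ∈ D ↔ y ∈ D)
    {T : S → OpenPartialHomeomorph S (ℝ × ℝ) → Prop}
    (hch : ∀ y ∈ D, ∃ c h, IsDiagramChart D V c y h ∧ (y ∈ V → T y h)) :
    ∃ Q : PatchSystem D V τ, ∀ y ∈ V, ∃ h, IsDiagramChart D V true y h ∧ T y h ∧
      ∃ σ : Q.ι → Bool × Bool, InjOn σ (Q.sectors y) ∧ ∀ i ∈ Q.sectors y, ∀ z ∈ range (Q.q i),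
        z ∈ h.source ∧ 0 ≤ sgn (σ i).1 * (h z).1 ∧ 0 ≤ sgn (σ i).2 * (h z).2 := by
  classical
  choose c h hch hT using fun y : D => hch y y.2
  -- finitely many charts suffice, with bump functions supported in them
  have hbump : ∀ y : D, ∃ f : C(S, ℝ), EqOn f 0 (h y).sourceᶜ ∧ EqOn f 1 {y.1} ∧
      ∀ x, f x ∈ Icc (0 : ℝ) 1 := fun y =>
    exists_continuous_zero_one_of_isClosed (h y).open_source.isClosed_compl isClosed_singleton
      (disjoint_singleton_right.2 fun hy => hy (hch y).mem_source)
  choose lam hl0 hl1 hlm using hbump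
  obtain ⟨t, ht⟩ := hD.isCompact.elim_finite_subcover (fun y : D => {z | 0 < lam y z})
    (fun y => isOpen_lt continuous_const (lam y).continuous)
    (fun y hy => mem_iUnion.2 ⟨⟨y, hy⟩, by simp [hl1 ⟨y, hy⟩ rfl]⟩)
  -- the centres of the chosen charts
  let o : Fin t.card → D := fun k => (t.equivFin.symm k).1
  have hcov : ∀ y ∈ D, ∃ k, 0 < lam (o k) y := by
    intro y hy
    obtain ⟨z, hz⟩ := mem_iUnion.1 (ht hy)
    obtain ⟨hzt, hz⟩ := mem_iUnion.1 hz
    exact ⟨t.equivFin ⟨z, hzt⟩, by simpa [o] using hz⟩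
  have hne : ∀ y ∈ D, Nonempty (Fin t.card) := fun y hy => ⟨(hcov y hy).choose⟩
  have hcov' : ∀ y, ∃ k : Option (Fin t.card), y ∈ D → ∃ k', k = some k' ∧ 0 < lam (o k') y := by
    intro y
    by_cases hy : y ∈ D
    · obtain ⟨k, hk⟩ := hcov y hy
      exact ⟨some k, fun _ => ⟨k, rfl, hk⟩⟩
    · exact ⟨none, fun h => absurd h hy⟩
  choose κ hκ using hcov'
  let C : Fin t.card → Bool := fun k => c (o k)
  let H : Fin t.card → OpenPartialHomeomorph S (ℝ × ℝ) := fun k => h (o k)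
  have hH : ∀ k, IsDiagramChart D V (C k) (o k) (H k) := fun k => hch _
  have hls : ∀ k y, 0 < lam (o k) y → y ∈ (H k).source := by
    intro k y hy
    by_contra hn
    rw [hl0 (o k) hn] at hy
    exact lt_irrefl _ hy
  -- to make the system invariant, each patch is used together with its image under `τ`
  let tw : Bool → S ≃ₜ S := fun b => if b then τ else Homeomorph.refl S
  have htw : ∀ b y, tw b (tw b y) = y := by
    intro b y; cases b <;> simp [tw, hτ]
  have htwD : ∀ b y, tw b y ∈ D ↔ y ∈ D := by
    intro b y; cases b <;> simp [tw, hτD]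
  -- a chart of a line has only two sectors: the bump functions of the superfluous patches vanish
  let q₀ : Fin t.card × Bool × Bool → ℝ × ℝ≥0 → S := fun i p =>
    (H i.1).symm (modelPatch (C i.1) i.2.1 i.2.2 p)
  let bump₀ : Fin t.card × Bool × Bool → S → ℝ := fun i y =>
    if C i.1 = true ∨ i.2.1 = true then lam (o i.1) y else 0
  -- all sectors at a point are taken from one chart, and from no image of a chart under `τ`
  let sec : S → Finset (Fin t.card × Bool × Bool) := fun y =>
    match κ y with
    | none => ∅
    | some k => (Finset.univ.filter (IsSector (C k) (H k y))).image fun s => (k, s)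
  have hsec : ∀ y ∈ D, ∃ k, 0 < lam (o k) y ∧
      sec y = (Finset.univ.filter (IsSector (C k) (H k y))).image fun s => (k, s) := by
    intro y hy
    obtain ⟨k, hk, hk'⟩ := hκ y hy
    exact ⟨k, hk', by simp only [sec, hk]⟩
  have hdbl : Function.Injective (fun i : Fin t.card × Bool × Bool => (false, i)) :=
    fun _ _ h => (Prod.ext_iff.1 h).2
  have hcard : ∀ (k : Fin t.card) (A : Finset (Bool × Bool)),
      ((A.image fun s => (k, s)).image fun i => (false, i)).card = A.card := by
    intro k A
    rw [Finset.card_image_of_injective _ hdbl,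
      Finset.card_image_of_injective _ fun _ _ h => (Prod.ext_iff.1 h).2]
  have himg : ∀ b i (A : Set (ℝ × ℝ≥0)), (fun p => tw b (q₀ i p)) '' A = tw b '' (q₀ i '' A) :=
    fun b i A => (image_image _ _ _).symm
  let Q : PatchSystem D V τ :=
    { ι := Bool × Fin t.card × Bool × Bool
      q := fun i p => tw i.1 (q₀ i.2 p)
      embedding := fun i => (tw i.1).isEmbedding.comp
        ((hH i.2.1).isOpenEmbedding_symm.isEmbedding.comp (isEmbedding_modelPatch _ _ _))
      isOpen_inner := fun i => by
        rw [himg]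
        refine (tw i.1).isOpenMap _ ?_
        rw [image_symm_modelPatch]
        exact (hH i.2.1).isOpenEmbedding_symm.isOpenMap _ (isOpen_modelInner _ _ _)
      mem_iff := fun i p => by
        rw [htwD, (hH i.2.1).mem_iff _ ((hH i.2.1).symm_mem _), (hH i.2.1).apply_symm,
          modelPatch_mem_axes]
      bump := fun i y => bump₀ i.2 (tw i.1 y)
      continuous_bump := fun i => by
        refine Continuous.comp (g := bump₀ i.2) ?_ (tw i.1).continuous
        simp only [bump₀]
        split_ifs
        · exact (lam _).continuous
        · exact continuous_const
      bump_nonneg := fun i y => by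
        simp only [bump₀]
        split_ifs
        · exact (hlm _ _).1
        · exact le_rfl
      closure_inner := fun i y hy hb => by
        rw [himg, ← (tw i.1).image_closure] at hy
        obtain ⟨z, hz, rfl⟩ := hy
        rw [htw] at hb
        simp only [bump₀] at hb
        split_ifs at hb with hci
        · have hzs := hls _ _ hb
          have : z ∈ range (q₀ i.2) := by
            refine (hH i.2.1).mem_range.2 ⟨hzs, ?_⟩
            by_contra hn
            have hopen : IsOpen ((H i.2.1).source ∩ H i.2.1 ⁻¹' (modelSector (C i.2.1) i.2.2.1 i.2.2.2)ᶜ) :=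
              (H i.2.1).continuousOn.isOpen_inter_preimage (H i.2.1).open_source
                (isClosed_modelSector _ _ _).isOpen_compl
            obtain ⟨w, ⟨-, hw⟩, hw'⟩ := mem_closure_iff.1 hz _ hopen ⟨hzs, hn⟩
            exact hw (modelInner_subset ((hH i.2.1).mem_inner.1 hw').2)
          obtain ⟨p, hp⟩ := this
          exact ⟨p, by simp only [hp]⟩
        · exact absurd hb (lt_irrefl _)
      twist := fun i => (!i.1, i.2)
      twist_twist := fun i => by simp
      q_twist := fun i p => by
        obtain ⟨b, i⟩ := i
        cases b <;> simp [tw, hτ]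
      bump_twist := fun i y => by
        obtain ⟨b, i⟩ := i
        cases b <;> simp [tw, hτ]
      sectors := fun y => (sec y).image fun i => (false, i)
      bump_pos := fun y hy i hi => by
        obtain ⟨i, hi', rfl⟩ := Finset.mem_image.1 hi
        obtain ⟨k, hk, hs⟩ := hsec y hy
        rw [hs] at hi'
        obtain ⟨s, hs', rfl⟩ := Finset.mem_image.1 hi'
        have := (Finset.mem_filter.1 hs').2.1
        simp only [bump₀, this, if_true]
        exact hk
      mem_range := fun y hy i hi => by
        obtain ⟨i, hi', rfl⟩ := Finset.mem_image.1 hi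
        obtain ⟨k, hk, hs⟩ := hsec y hy
        rw [hs] at hi'
        obtain ⟨s, hs', rfl⟩ := Finset.mem_image.1 hi'
        exact (hH k).mem_range.2 ⟨hls _ _ hk, (Finset.mem_filter.1 hs').2.2⟩
      disjoint_inner := fun y hy i hi j hj hij => by
        obtain ⟨i, hi', rfl⟩ := Finset.mem_image.1 hi
        obtain ⟨j, hj', rfl⟩ := Finset.mem_image.1 hj
        obtain ⟨k, hk, hs⟩ := hsec y hy
        rw [hs] at hi' hj'
        obtain ⟨s, hs1, rfl⟩ := Finset.mem_image.1 hi'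
        obtain ⟨s', hs2, rfl⟩ := Finset.mem_image.1 hj'
        exact (hH k).disjoint_inner (Finset.mem_filter.1 hs1).2 (Finset.mem_filter.1 hs2).2
          fun he => hij (congrArg (fun s => (false, k, s)) he)
      cover := fun y hy => by
        obtain ⟨k, hk, hs⟩ := hsec y hy
        have hys := hls _ _ hk
        have hc1 : ContinuousAt (fun z => (H k z).1) y :=
          continuous_fst.continuousAt.comp ((H k).continuousAt hys)
        have hc2 : ContinuousAt (fun z => (H k z).2) y :=
          continuous_snd.continuousAt.comp ((H k).continuousAt hys)
        have pos : ∀ {f : S → ℝ}, ContinuousAt f y → ∀ᶠ z in 𝓝 y, 0 < f y → 0 < f z := by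
          intro f hf
          by_cases h : 0 < f y
          · exact (hf.eventually_const_lt h).mono fun _ h _ => h
          · exact Eventually.of_forall fun _ h' => absurd h' h
        have neg : ∀ {f : S → ℝ}, ContinuousAt f y → ∀ᶠ z in 𝓝 y, f y < 0 → f z < 0 := by
          intro f hf
          by_cases h : f y < 0
          · exact (hf.eventually_lt_const h).mono fun _ h _ => h
          · exact Eventually.of_forall fun _ h' => absurd h' h
        filter_upwards [(H k).open_source.mem_nhds hys, pos hc1, neg hc1, pos hc2, neg hc2]
          with z hz h1 h2 h3 h4 hzD
        rw [(hH k).mem_iff z hz] at hzD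
        obtain ⟨s, hs1, hs2⟩ := exists_isSector_of_ne hzD h1 h2 h3 h4
        exact ⟨(false, k, s), Finset.mem_image_of_mem _
          (by rw [hs]; exact Finset.mem_image_of_mem _ (Finset.mem_filter.2 ⟨Finset.mem_univ _, hs1⟩)),
          (hH k).mem_inner.2 ⟨hz, hs2⟩⟩
      card_crossing := fun y hy => by
        obtain ⟨k, hk, hs⟩ := hsec y (hVD hy)
        obtain ⟨h1, h2⟩ := (hH k).eq_center y (hls _ _ hk) hy
        rw [hs, hcard, h1, h2, (hH k).center]
        exact card_isSector_zero
      card_edge := fun y hy => by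
        obtain ⟨k, hk, hs⟩ := hsec y hy.1
        rw [hs, hcard]
        refine card_isSector_edge (((hH k).mem_iff y (hls _ _ hk)).1 hy.1) fun hck h0 => hy.2 ?_
        have : y = o k := (H k).injOn (hls _ _ hk) (hH k).mem_source (by
          rw [h0, (hH k).center]; rfl)
        rw [this]
        exact (hH k).mem_V hck
      boundary_mem := fun y hy i hi => by
        obtain ⟨i, hi', rfl⟩ := Finset.mem_image.1 hi
        obtain ⟨k, hk, hs⟩ := hsec y hy.1
        rw [hs] at hi'
        obtain ⟨s, hs', rfl⟩ := Finset.mem_image.1 hi'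
        have hys := hls _ _ hk
        have hyr := (Finset.mem_filter.1 hs').2.2
        have hya := ((hH k).mem_iff y hys).1 hy.1
        have hc : ContinuousAt (H k) y := (H k).continuousAt hys
        have hev : ∀ᶠ z in 𝓝 y, H k z ∈ modelAxes (C k) → H k z ∈ modelSector (C k) s.1 s.2 := by
          by_cases hck : C k = true
          · have hne0 : H k y ≠ 0 := fun h0 => hy.2 (by
              have : y = o k := (H k).injOn hys (hH k).mem_source (by
                rw [h0, (hH k).center]; rfl)
              rw [this]
              exact (hH k).mem_V hck)
            obtain ⟨hr1, hr2⟩ := hyr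
            have hs0 : ∀ s, sgn s ≠ 0 := fun s => by cases s <;> simp [sgn]
            rcases hya with h2 | ⟨-, h1⟩
            · have h1 : (H k y).1 ≠ 0 := fun h => hne0 (Prod.ext h h2)
              have h3 : 0 < sgn s.1 * (H k y).1 :=
                lt_of_le_of_ne (hr1 hck) (mul_ne_zero (hs0 _) h1).symm
              have hc1 : ContinuousAt (fun z => sgn s.1 * (H k z).1) y :=
                continuousAt_const.mul (continuous_fst.continuousAt.comp hc)
              filter_upwards [hc1.eventually_const_lt h3] with z hz hza
              refine ⟨fun _ => hz.le, ?_⟩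
              rcases hza with h | ⟨-, h⟩
              · rw [h, mul_zero]
              · rw [h, mul_zero] at hz; exact absurd hz (lt_irrefl _)
            · have h2 : (H k y).2 ≠ 0 := fun h => hne0 (Prod.ext h1 h)
              have h3 : 0 < sgn s.2 * (H k y).2 :=
                lt_of_le_of_ne hr2 (mul_ne_zero (hs0 _) h2).symm
              have hc1 : ContinuousAt (fun z => sgn s.2 * (H k z).2) y :=
                continuousAt_const.mul (continuous_snd.continuousAt.comp hc)
              filter_upwards [hc1.eventually_const_lt h3] with z hz hza
              rcases hza with h | ⟨-, h⟩
              · rw [h, mul_zero] at hz; exact absurd hz (lt_irrefl _)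
              · exact ⟨fun _ => by rw [h, mul_zero], hz.le⟩
          · refine Eventually.of_forall fun z hza => ⟨fun h => absurd h hck, ?_⟩
            rw [hza.resolve_right fun h => hck h.1, mul_zero]
        rw [mem_nhdsWithin_iff_eventually]
        filter_upwards [hev, (H k).open_source.mem_nhds hys] with z hz hzs hzD
        have hza := ((hH k).mem_iff z hzs).1 hzD
        obtain ⟨p, hp⟩ := (hH k).mem_range.2 ⟨hzs, hz hza⟩
        refine ⟨p, ?_, hp⟩
        rw [← hp, (hH k).apply_symm, modelPatch_mem_axes] at hza
        exact hza }
  refine ⟨Q, fun y hy => ?_⟩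
  obtain ⟨k, hk, hs⟩ := hsec y (hVD hy)
  obtain ⟨h1, h2⟩ := (hH k).eq_center y (hls _ _ hk) hy
  have hok : o k = ⟨y, hVD hy⟩ := Subtype.ext h2.symm
  have hHk : H k = h ⟨y, hVD hy⟩ := by rw [← hok]
  refine ⟨h ⟨y, hVD hy⟩, ?_, hT ⟨y, hVD hy⟩ hy, fun i => (i.2.2.1, i.2.2.2), ?_, fun i hi => ?_⟩
  · have := hH k
    rw [h1, hHk, ← h2] at this
    exact this
  · intro i hi j hj hij
    obtain ⟨i, hi', rfl⟩ := Finset.mem_image.1 hi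
    obtain ⟨j, hj', rfl⟩ := Finset.mem_image.1 hj
    rw [hs] at hi' hj'
    obtain ⟨s, hs', rfl⟩ := Finset.mem_image.1 hi'
    obtain ⟨s', hs', rfl⟩ := Finset.mem_image.1 hj'
    exact congrArg (fun s => (false, k, s)) hij
  · obtain ⟨i, hi', rfl⟩ := Finset.mem_image.1 hi
    rw [hs] at hi'
    obtain ⟨s, hs', rfl⟩ := Finset.mem_image.1 hi'
    intro z hz
    obtain ⟨h3, h4⟩ := (hH k).mem_range.1 hz
    rw [hHk] at h3 h4
    exact ⟨h3, h4.1 h1, h4.2⟩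

end

/-! ### Sides of the cut surface -/

/-- A path into a compact space has a limit if its projection under a map with finite fibres has. -/
theorem exists_tendsto_of_finite_fiber {X Y : Type*} [TopologicalSpace X] [CompactSpace X]
    [T2Space X] [TopologicalSpace Y] [T2Space Y] {p : X → Y} (hp : Continuous p) {y : Y}
    (hy : (p ⁻¹' {y}).Finite) {g : ℝ → X} (hg : ContinuousOn g (Ioo 0 1))
    (hlim : Tendsto (fun s => p (g s)) (𝓝[>] 0) (𝓝 y)) :
    ∃ z, p z = y ∧ Tendsto g (𝓝[>] 0) (𝓝 z) := by
  have hcl : ∀ x, ClusterPt x (map g (𝓝[>] 0)) → p x = y := by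
    intro x hx
    have h1 : ClusterPt (p x) (map p (map g (𝓝[>] 0))) := hx.map hp.continuousAt tendsto_map
    have h2 : ClusterPt (p x) (𝓝 y) := h1.mono hlim
    by_contra hne
    exact h2.ne (disjoint_iff.1 (disjoint_nhds_nhds.2 hne))
  obtain ⟨U, hU, hUd⟩ := hy.t2_separation
  have hev : ∀ᶠ s in 𝓝[>] (0 : ℝ), g s ∈ ⋃ z ∈ p ⁻¹' {y}, U z := by
    by_contra hne
    have hO : IsOpen (⋃ z ∈ p ⁻¹' {y}, U z) := isOpen_biUnion fun z _ => (hU z).2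
    have : (map g (𝓝[>] 0) ⊓ 𝓟 (⋃ z ∈ p ⁻¹' {y}, U z)ᶜ).NeBot := by
      rw [← frequently_mem_iff_neBot]
      exact frequently_map.2 (not_eventually.1 hne)
    obtain ⟨x, hx⟩ := exists_clusterPt_of_compactSpace (map g (𝓝[>] 0) ⊓ 𝓟 (⋃ z ∈ p ⁻¹' {y}, U z)ᶜ)
    have h1 : x ∈ (⋃ z ∈ p ⁻¹' {y}, U z)ᶜ :=
      isClosed_iff_clusterPt.1 hO.isClosed_compl x (hx.mono inf_le_right)
    exact h1 (mem_biUnion (hcl x (hx.mono inf_le_left)) (hU x).1)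
  obtain ⟨r, hr, hrU⟩ := mem_nhdsGT_iff_exists_Ioo_subset.1 hev
  have hr : (0 : ℝ) < r := hr
  set δ := min r 1 with hδ
  have hδ0 : 0 < δ := lt_min hr one_pos
  have hδU : ∀ s ∈ Ioo 0 δ, g s ∈ ⋃ z ∈ p ⁻¹' {y}, U z := fun s hs =>
    hrU ⟨hs.1, hs.2.trans_le (min_le_left _ _)⟩
  obtain ⟨z, hz, hzU⟩ := mem_iUnion₂.1 (hδU (δ / 2) ⟨by linarith, by linarith⟩)
  -- the path stays in one of the disjoint open sets
  have hsub : g '' Ioo 0 δ ⊆ U z := by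
    have hpre : IsPreconnected (g '' Ioo 0 δ) :=
      isPreconnected_Ioo.image _ (hg.mono (Ioo_subset_Ioo_right (min_le_right _ _)))
    have hO' : IsOpen (⋃ w ∈ p ⁻¹' {y} \ {z}, U w) := isOpen_biUnion fun w _ => (hU w).2
    refine hpre.subset_left_of_subset_union (hU z).2 hO' ?_ ?_ ⟨_, ⟨δ / 2, ⟨by linarith, by linarith⟩, rfl⟩, hzU⟩
    · refine disjoint_iUnion₂_right.2 fun w hw => hUd hz hw.1 ?_
      exact fun h => hw.2 h.symm
    · rintro _ ⟨s, hs, rfl⟩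
      obtain ⟨w, hw, hwU⟩ := mem_iUnion₂.1 (hδU s hs)
      by_cases h : w = z
      · exact Or.inl (h ▸ hwU)
      · exact Or.inr (mem_biUnion (show w ∈ p ⁻¹' {y} \ {z} from ⟨hw, h⟩) hwU)
  refine ⟨z, hz, le_nhds_of_unique_clusterPt fun x hx => ?_⟩
  by_contra hne
  have h1 : U x ∈ 𝓝 x := (hU x).2.mem_nhds (hU x).1
  have h2 : U z ∈ map g (𝓝[>] 0) := by
    rw [mem_map]
    filter_upwards [Ioo_mem_nhdsGT hδ0] with s hs using hsub ⟨s, hs, rfl⟩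
  obtain ⟨w, hw1, hw2⟩ := (clusterPt_iff_nonempty.1 hx) h1 h2
  exact disjoint_left.1 (hUd (hcl x hx) hz hne) hw1 hw2

namespace PatchSystem

variable {S : Type*} [TopologicalSpace S] {D V : Set S} {τ : S ≃ₜ S}

/-- The paths `γ e` are the edges of the graph `D` with vertex set `V`: they run along `D` from
vertices to vertices, cover `D \ V`, and are permuted, up to reversal, by `τ`.  At each vertex exactly
two of them start, and no sector contains initial segments of both. -/
structure IsEdges (Q : PatchSystem D V τ) {E : Type*} (γ : E → ℝ → S) : Prop where
  continuous : ∀ e, Continuous (γ e)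
  mem : ∀ e s, γ e s ∈ D
  zero_mem : ∀ e, γ e 0 ∈ V
  one_mem : ∀ e, γ e 1 ∈ V
  notMem : ∀ e, ∀ s ∈ Ioo (0 : ℝ) 1, γ e s ∉ V
  inj : ∀ e e', ∀ s ∈ Ioo (0 : ℝ) 1, ∀ s' ∈ Ioo (0 : ℝ) 1, γ e s = γ e' s' → e = e' ∧ s = s'
  cover : ∀ y ∈ D, y ∉ V → ∃ e, ∃ s ∈ Ioo (0 : ℝ) 1, γ e s = y
  star : ∀ e, ∃ e', ∀ s, γ e' s = τ (γ e (1 - s))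
  start : ∀ y ∈ V, ∃ e e', e ≠ e' ∧ (∀ d, γ d 0 = y ↔ d = e ∨ d = e') ∧
    ∀ i ∈ Q.sectors y, ¬ ((∀ᶠ s in 𝓝[>] (0 : ℝ), γ e s ∈ range (Q.q i)) ∧
      ∀ᶠ s in 𝓝[>] (0 : ℝ), γ e' s ∈ range (Q.q i))

variable {Q : PatchSystem D V τ}

/-- Each patch of the cut surface is embedded in the surface, up to its boundary. -/
theorem exists_nhds_injOn_proj [T2Space S] {z : Q.Carrier} (hz : z ∈ Q.bd) :
    ∃ U, IsOpen U ∧ z ∈ U ∧ InjOn Q.proj U := by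
  obtain ⟨i, hi, p, hp, rfl⟩ := Q.exists_lift hz
  refine ⟨Q.lift i '' {p | 0 < Q.bump i (Q.q i p)}, Q.isOpen_lift_image i
    (isOpen_lt continuous_const ((Q.continuous_bump i).comp (Q.embedding i).continuous))
    fun p hp => hp, ⟨p, Q.bump_pos _ hz i hi, rfl⟩, ?_⟩
  rintro _ ⟨a, -, rfl⟩ _ ⟨b, -, rfl⟩ h
  rw [(Q.embedding i).injective h]

theorem isCoveringMap_proj [CompactSpace S] [T2Space S] :
    IsCoveringMap ((D \ V).restrictPreimage Q.proj) := by
  have hlocal : IsLocalHomeomorph ((D \ V).restrictPreimage Q.proj) := by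
    refine isLocalHomeomorph_of_isOpenMap Q.continuous_proj.restrictPreimage ?_ ?_
    · rw [isOpenMap_iff_nhds_le]
      rintro ⟨z, hzD, hzV⟩ A hA
      obtain ⟨i, hi, p, hp, rfl⟩ := Q.exists_lift (show z ∈ Q.bd from hzD)
      have h1 := mem_map.1 hA
      obtain ⟨N, hN, hNA⟩ := (mem_nhds_subtype _ _ _).1 h1
      have h2 : Q.lift i ⁻¹' N ∈ 𝓝 p := (Q.continuous_lift i).continuousAt hN
      rw [(Q.embedding i).isInducing.nhds_eq_comap] at h2
      obtain ⟨N', hN', hN'N⟩ := mem_comap.1 h2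
      have h3 := Q.boundary_mem _ ⟨hzD, hzV⟩ i hi
      have h4 : N' ∩ Q.q i '' {p | p.2 = 0} ∈ 𝓝[D] (Q.q i p) :=
        inter_mem (mem_nhdsWithin_of_mem_nhds hN') h3
      obtain ⟨O, hO, hOs⟩ := mem_nhdsWithin_iff_exists_mem_nhds_inter.1 h4
      refine (mem_nhds_subtype _ _ _).2 ⟨O, hO, ?_⟩
      rintro ⟨y, hyD, hyV⟩ hyO
      obtain ⟨hyN, r, hr, rfl⟩ := hOs ⟨hyO, hyD⟩
      exact hNA (show Q.lift i r ∈ N from hN'N hyN) (a := ⟨Q.lift i r, hyD, hyV⟩)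
    · rintro ⟨z, hz⟩
      obtain ⟨U, hU, hzU, hinj⟩ := exists_nhds_injOn_proj (Q := Q) (z := z) hz.1
      exact ⟨Subtype.val ⁻¹' U, (hU.preimage continuous_subtype_val).mem_nhds hzU,
        fun a ha b hb h => Subtype.ext (hinj ha hb (congrArg Subtype.val h))⟩
  rw [isCoveringMap_iff_isCoveringMapOn_univ]
  refine (Q.continuous_proj.isClosedMap.restrictPreimage _).isCoveringMapOn_of_isLocalHomeomorphOn
    ?_ ?_
  · rintro ⟨y, hy⟩ -
    refine Finite.of_finite_image (f := Subtype.val) ((Q.finite_fiber hy.1).subset ?_)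
      Subtype.val_injective.injOn
    rintro _ ⟨z, hz, rfl⟩
    exact congrArg Subtype.val hz
  · intro z _
    exact hlocal z

/-- `c` is a lift to the cut surface of the path `g`, defined on the unit interval. -/
def IsSide (Q : PatchSystem D V τ) (g : ℝ → S) (c : ℝ → Q.Carrier) : Prop :=
  ContinuousOn c (Icc 0 1) ∧ ∀ s ∈ Icc (0 : ℝ) 1, Q.proj (c s) = g s

/-- Two sides over the same edge that agree at an interior point agree. -/
theorem IsSide.eqOn [CompactSpace S] [T2Space S] {g : ℝ → S} {c c' : ℝ → Q.Carrier}
    (hgD : ∀ s ∈ Ioo (0 : ℝ) 1, g s ∈ D \ V) (hc : Q.IsSide g c) (hc' : Q.IsSide g c') {s : ℝ}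
    (hs : s ∈ Ioo (0 : ℝ) 1) (h : c s = c' s) : EqOn c c' (Icc 0 1) := by
  have hI : ∀ s : Ioo (0 : ℝ) 1, s.1 ∈ Icc (0 : ℝ) 1 := fun s => Ioo_subset_Icc_self s.2
  have := isPreconnected_iff_preconnectedSpace.1 (isPreconnected_Ioo (a := (0 : ℝ)) (b := 1))
  have key := isCoveringMap_proj (Q := Q) |>.eq_of_comp_eq
    (g₁ := fun s : Ioo (0 : ℝ) 1 => (⟨c s, show Q.proj (c s) ∈ D \ V from
      (hc.2 s (hI s)).symm ▸ hgD s s.2⟩ : Q.proj ⁻¹' (D \ V)))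
    (g₂ := fun s : Ioo (0 : ℝ) 1 => (⟨c' s, show Q.proj (c' s) ∈ D \ V from
      (hc'.2 s (hI s)).symm ▸ hgD s s.2⟩ : Q.proj ⁻¹' (D \ V)))
    (Continuous.subtype_mk (hc.1.comp_continuous continuous_subtype_val hI) _)
    (Continuous.subtype_mk (hc'.1.comp_continuous continuous_subtype_val hI) _)
    (by
      funext s
      exact Subtype.ext ((hc.2 s (hI s)).trans (hc'.2 s (hI s)).symm)) ⟨s, hs⟩ (Subtype.ext h)
  have h1 : EqOn c c' (Ioo 0 1) := fun t ht => congrArg Subtype.val (congrFun key ⟨t, ht⟩)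
  refine h1.of_subset_closure hc.1 hc'.1 Ioo_subset_Icc_self ?_
  rw [closure_Ioo zero_ne_one]

/-- Over the interior of an edge a lift exists because the boundary covers the diagram there; it
extends to the ends because the fibres over the vertices are finite. -/
theorem exists_isSide [CompactSpace S] [T2Space S] {g : ℝ → S} (hg : Continuous g)
    (hgD : ∀ s ∈ Ioo (0 : ℝ) 1, g s ∈ D \ V) (h0 : g 0 ∈ D) (h1 : g 1 ∈ D) {s : ℝ}
    (hs : s ∈ Ioo (0 : ℝ) 1) {z : Q.Carrier} (hz : Q.proj z = g s) :
    ∃ c, Q.IsSide g c ∧ c s = z := by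
  classical
  have hc1 : ContractibleSpace (Ioo (0 : ℝ) 1) :=
    (convex_Ioo (0 : ℝ) 1).contractibleSpace ⟨s, hs⟩
  have hc2 : LocallyPathConnectedSpace (Ioo (0 : ℝ) 1) := isOpen_Ioo.locallyPathConnectedSpace
  obtain ⟨Γ, ⟨hΓs, hΓ⟩, -⟩ := (isCoveringMap_proj (Q := Q)).existsUnique_continuousMap_lifts
    (⟨fun s : Ioo (0 : ℝ) 1 => (⟨g s, hgD s s.2⟩ : ↑(D \ V)), by fun_prop⟩) ⟨s, hs⟩
    ⟨z, show Q.proj z ∈ D \ V from hz ▸ hgD s hs⟩ (Subtype.ext hz)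
  let c₀ : ℝ → Q.Carrier := fun s => if h : s ∈ Ioo (0 : ℝ) 1 then (Γ ⟨s, h⟩).1 else z
  have hc₀ : ContinuousOn c₀ (Ioo 0 1) := by
    rw [continuousOn_iff_continuous_domRestrict]
    have : (Ioo (0 : ℝ) 1).domRestrict c₀ = fun s => (Γ s).1 := by
      funext s
      simp [c₀, domRestrict, s.2.1, s.2.2]
    rw [this]
    fun_prop
  have hp₀ : ∀ t ∈ Ioo (0 : ℝ) 1, Q.proj (c₀ t) = g t := by
    intro t ht
    have := congrArg Subtype.val (congrFun hΓ ⟨t, ht⟩)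
    simp only [c₀, ht, dif_pos]
    exact this
  obtain ⟨a, ha, hla⟩ := exists_tendsto_of_finite_fiber Q.continuous_proj (Q.finite_fiber h0) hc₀
    (by
      have h2 : Tendsto g (𝓝[>] 0) (𝓝 (g 0)) := hg.continuousAt.mono_left nhdsWithin_le_nhds
      refine h2.congr' ?_
      filter_upwards [Ioo_mem_nhdsGT one_pos] with t ht using (hp₀ t ht).symm)
  have hrefl : Tendsto (fun s : ℝ => 1 - s) (𝓝[>] 0) (𝓝[<] 1) := by
    refine tendsto_nhdsWithin_iff.2 ⟨?_, ?_⟩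
    · have : Tendsto (fun s : ℝ => 1 - s) (𝓝 0) (𝓝 (1 - 0)) := by
        apply Continuous.tendsto; fun_prop
      rw [sub_zero] at this
      exact this.mono_left nhdsWithin_le_nhds
    · filter_upwards [self_mem_nhdsWithin] with s hs
      have : (0 : ℝ) < s := hs
      exact show 1 - s < 1 by linarith
  have hrefl' : Tendsto (fun s : ℝ => 1 - s) (𝓝[<] 1) (𝓝[>] 0) := by
    refine tendsto_nhdsWithin_iff.2 ⟨?_, ?_⟩
    · have : Tendsto (fun s : ℝ => 1 - s) (𝓝 1) (𝓝 (1 - 1)) := by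
        apply Continuous.tendsto; fun_prop
      rw [sub_self] at this
      exact this.mono_left nhdsWithin_le_nhds
    · filter_upwards [self_mem_nhdsWithin] with s hs
      have : s < (1 : ℝ) := hs
      exact show 0 < 1 - s by linarith
  obtain ⟨b, hb, hlb⟩ := exists_tendsto_of_finite_fiber Q.continuous_proj (Q.finite_fiber h1)
    (g := fun s => c₀ (1 - s))
    (hc₀.comp (by fun_prop) fun s hs => ⟨by linarith [hs.2], by linarith [hs.1]⟩)
    (by
      have h2 : Tendsto g (𝓝[<] 1) (𝓝 (g 1)) := hg.continuousAt.mono_left nhdsWithin_le_nhds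
      refine (h2.comp hrefl).congr' ?_
      filter_upwards [Ioo_mem_nhdsGT one_pos] with t ht
      exact (hp₀ _ ⟨by linarith [ht.2], by linarith [ht.1]⟩).symm)
  have hlb' : Tendsto c₀ (𝓝[<] 1) (𝓝 b) := by
    refine (hlb.comp hrefl').congr fun s => ?_
    simp
  have hcont : ContinuousOn (extendFrom (Ioo 0 1) c₀) (Icc 0 1) :=
    continuousOn_Icc_extendFrom_Ioo hc₀ hla hlb'
  have heq : ∀ t ∈ Ioo (0 : ℝ) 1, extendFrom (Ioo 0 1) c₀ t = c₀ t := fun t ht =>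
    extendFrom_extends hc₀ t ht
  refine ⟨extendFrom (Ioo 0 1) c₀, ⟨hcont, ?_⟩, ?_⟩
  · have h3 : EqOn (fun t => Q.proj (extendFrom (Ioo 0 1) c₀ t)) g (Ioo 0 1) := fun t ht => by
      simp only [heq t ht, hp₀ t ht]
    refine h3.of_subset_closure (Q.continuous_proj.comp_continuousOn hcont) hg.continuousOn
      Ioo_subset_Icc_self ?_
    rw [closure_Ioo zero_ne_one]
  · rw [heq s hs]
    simp only [c₀, hs, dif_pos, hΓs]

end PatchSystem

namespace PatchSystem

variable {S : Type*} [TopologicalSpace S] {D V : Set S} {τ : S ≃ₜ S} {Q : PatchSystem D V τ}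
  {E : Type*} {γ : E → ℝ → S}

/-- The two copies in the cut surface of each edge, one path for each corner: the side that
starts there. -/
structure IsSides (Q : PatchSystem D V τ) (γ : E → ℝ → S) (edge : Q.Carrier → E)
    (side : Q.Carrier → ℝ → Q.Carrier) : Prop where
  isSide : ∀ α, Q.proj α ∈ V → Q.IsSide (γ (edge α)) (side α)
  zero : ∀ α, Q.proj α ∈ V → side α 0 = α
  unique : ∀ α, Q.proj α ∈ V → ∀ e c, Q.IsSide (γ e) c → c 0 = α →
    e = edge α ∧ EqOn c (side α) (Icc 0 1)

theorem IsEdges.mem_diff (hγ : Q.IsEdges γ) (e : E) : ∀ s ∈ Ioo (0 : ℝ) 1, γ e s ∈ D \ V :=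
  fun s hs => ⟨hγ.mem e s, hγ.notMem e s hs⟩

/-- The side that starts at a corner is unique. -/
theorem IsEdges.side_unique [CompactSpace S] [T2Space S] (hγ : Q.IsEdges γ) {e e' : E}
    {c c' : ℝ → Q.Carrier} (hc : Q.IsSide (γ e) c) (hc' : Q.IsSide (γ e') c') (h0 : c 0 = c' 0) :
    e = e' ∧ EqOn c c' (Icc 0 1) := by
  have hI0 : (0 : ℝ) ∈ Icc (0 : ℝ) 1 := ⟨le_rfl, zero_le_one⟩
  have hV0 : Q.proj (c 0) ∈ V := by rw [hc.2 0 hI0]; exact hγ.zero_mem e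
  have hD0 : c 0 ∈ Q.bd := show Q.proj (c 0) ∈ D by rw [hc.2 0 hI0]; exact hγ.mem e 0
  -- both sides start in the same patch
  obtain ⟨i, hi, p, hp, hpc⟩ := Q.exists_lift hD0
  set O := Q.lift i '' {p | 0 < Q.bump i (Q.q i p)} with hO
  have hOo : IsOpen O := Q.isOpen_lift_image i
    (isOpen_lt continuous_const ((Q.continuous_bump i).comp (Q.embedding i).continuous))
    fun p hp => hp
  have hcO : c 0 ∈ O := ⟨p, by
    have := Q.bump_pos _ hD0 i hi
    rwa [← hpc] at this, hpc⟩
  have hle : 𝓝[>] (0 : ℝ) ≤ 𝓝[Icc 0 1] 0 := by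
    rw [← nhdsWithin_Ioc_eq_nhdsGT (zero_lt_one' ℝ)]
    exact nhdsWithin_mono _ Ioc_subset_Icc_self
  have ev : ∀ᶠ s in 𝓝[>] (0 : ℝ), c s ∈ O :=
    hle ((hc.1 0 hI0).eventually_mem (hOo.mem_nhds hcO))
  have ev' : ∀ᶠ s in 𝓝[>] (0 : ℝ), c' s ∈ O :=
    hle ((hc'.1 0 hI0).eventually_mem (hOo.mem_nhds (h0 ▸ hcO)))
  have evI : ∀ᶠ s in 𝓝[>] (0 : ℝ), s ∈ Ioo (0 : ℝ) 1 := Ioo_mem_nhdsGT one_pos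
  obtain rfl : e = e' := by
    by_contra hne
    obtain ⟨d, d', hdd, hd, hsep⟩ := hγ.start _ hV0
    have h1 := (hd e).1 (hc.2 0 hI0).symm
    have h2 := (hd e').1 (by rw [h0]; exact (hc'.2 0 hI0).symm)
    have h3 : ∀ᶠ s in 𝓝[>] (0 : ℝ), γ e s ∈ range (Q.q i) := by
      filter_upwards [ev, evI] with s hr hs
      obtain ⟨r, -, hr⟩ := hr
      exact ⟨r, by rw [← hc.2 s (Ioo_subset_Icc_self hs), ← hr]; rfl⟩
    have h4 : ∀ᶠ s in 𝓝[>] (0 : ℝ), γ e' s ∈ range (Q.q i) := by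
      filter_upwards [ev', evI] with s hr hs
      obtain ⟨r, -, hr⟩ := hr
      exact ⟨r, by rw [← hc'.2 s (Ioo_subset_Icc_self hs), ← hr]; rfl⟩
    rcases h1 with rfl | rfl <;> rcases h2 with rfl | rfl
    · exact hne rfl
    · exact hsep i hi ⟨h3, h4⟩
    · exact hsep i hi ⟨h4, h3⟩
    · exact hne rfl
  refine ⟨rfl, ?_⟩
  obtain ⟨s, ⟨r, -, hr⟩, ⟨r', -, hr'⟩, hs⟩ := (ev.and (ev'.and evI)).exists
  refine hc.eqOn (hγ.mem_diff e) hc' hs ?_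
  have : Q.q i r = Q.q i r' := by
    rw [← Q.proj_lift, ← Q.proj_lift, hr, hr', hc.2 s (Ioo_subset_Icc_self hs),
      hc'.2 s (Ioo_subset_Icc_self hs)]
  rw [← hr, ← hr', (Q.embedding i).injective this]

/-- Counting shows that a side starts at each corner: over a vertex there are four corners, and
two edges start there, each of which has two copies. -/
theorem IsEdges.exists_sides [CompactSpace S] [T2Space S] [Nonempty E] (hγ : Q.IsEdges γ) (hVD : V ⊆ D) :
    ∃ edge side, Q.IsSides γ edge side := by
  classical
  have hhalf : (1 / 2 : ℝ) ∈ Ioo (0 : ℝ) 1 := by norm_num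
  have key : ∀ α, Q.proj α ∈ V → ∃ e c, Q.IsSide (γ e) c ∧ c 0 = α := by
    intro α hα
    set y := Q.proj α with hy
    obtain ⟨e₁, e₂, hne, hstart, -⟩ := hγ.start y hα
    have hfib : ∀ e, ∃ A : Finset Q.Carrier, A.card = 2 ∧ ∀ z ∈ A, Q.proj z = γ e (1 / 2) := by
      intro e
      have h := Q.finite_fiber (hγ.mem e (1 / 2))
      refine ⟨h.toFinset, ?_, fun z hz => by simpa using hz⟩
      rw [← ncard_eq_toFinset_card _ h, Q.ncard_fiber (hγ.mem e (1 / 2))]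
      exact Q.card_edge _ (hγ.mem_diff e _ hhalf)
    choose A hA2 hA using hfib
    have hside : ∀ e : E, ∀ z : Q.Carrier, ∃ c, z ∈ A e → Q.IsSide (γ e) c ∧ c (1 / 2) = z := by
      intro e z
      by_cases hz : z ∈ A e
      · obtain ⟨c, hc⟩ := exists_isSide (hγ.continuous e) (hγ.mem_diff e)
          (hγ.mem e 0) (hγ.mem e 1) hhalf (hA e z hz)
        exact ⟨c, fun _ => hc⟩
      · exact ⟨fun _ => z, fun h => absurd h hz⟩
    choose c hc using hside
    let B : Finset (Σ _ : E, Q.Carrier) := ({e₁, e₂} : Finset E).sigma A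
    have hB : B.card = 4 := by
      rw [Finset.card_sigma, Finset.sum_pair hne, hA2, hA2]
    have hBd : ∀ x ∈ B, (x.1 = e₁ ∨ x.1 = e₂) ∧ x.2 ∈ A x.1 := by
      intro x hx
      simpa [B] using hx
    have hfin := Q.finite_fiber (hVD hα)
    have himg : B.image (fun x => c x.1 x.2 0) = hfin.toFinset := by
      refine Finset.eq_of_subset_of_card_le ?_ ?_
      · intro z hz
        obtain ⟨x, hx, rfl⟩ := Finset.mem_image.1 hz
        obtain ⟨h1, h2⟩ := hBd x hx
        simp only [Finite.mem_toFinset, mem_preimage, mem_singleton_iff]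
        rw [(hc _ _ h2).1.2 0 ⟨le_rfl, zero_le_one⟩]
        exact (hstart x.1).2 h1
      · rw [← ncard_eq_toFinset_card _ hfin, Q.ncard_fiber (hVD hα), Q.card_crossing _ hα,
          Finset.card_image_of_injOn, hB]
        rintro ⟨e, z⟩ hx ⟨e', z'⟩ hx' h
        obtain ⟨h1, h2⟩ := hBd _ hx
        obtain ⟨h1', h2'⟩ := hBd _ hx'
        obtain ⟨h3, h4⟩ := hγ.side_unique (hc _ _ h2).1 (hc _ _ h2').1 h
        simp only at h3 h2 h2' h4
        subst h3
        have := h4 (Ioo_subset_Icc_self hhalf)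
        rw [(hc _ _ h2).2, (hc _ _ h2').2] at this
        rw [this]
    have : α ∈ hfin.toFinset := by simp [hy]
    rw [← himg] at this
    obtain ⟨x, hx, hxα⟩ := Finset.mem_image.1 this
    obtain ⟨-, h2⟩ := hBd x hx
    exact ⟨_, _, (hc _ _ h2).1, hxα⟩
  have key' : ∀ α, ∃ e c, Q.proj α ∈ V → Q.IsSide (γ e) c ∧ c 0 = α := by
    intro α
    by_cases hα : Q.proj α ∈ V
    · obtain ⟨e, c, h⟩ := key α hα
      exact ⟨e, c, fun _ => h⟩
    · exact ⟨Classical.arbitrary E, fun _ => α, fun h => absurd h hα⟩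
  choose edge side h using key'
  exact ⟨edge, side, fun α hα => (h α hα).1, fun α hα => (h α hα).2, fun α hα e c hc h0 =>
    hγ.side_unique hc (h α hα).1 (h0.trans (h α hα).2.symm)⟩

/-- Translation along the boundary circles of the cut surface, which are parametrised so that each
side has length one and is traversed in the direction of its edge.  It moves each corner to the
next one in unit time, and is reversed by the involution that covers `τ`. -/
structure IsFlow (Q : PatchSystem D V τ) (γ : E → ℝ → S) (edge : Q.Carrier → E)
    (R : ℝ → Q.Carrier → Q.Carrier) : Prop where
  continuousOn : ContinuousOn (fun p : ℝ × Q.Carrier => R p.1 p.2) (univ ×ˢ Q.bd)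
  mem : ∀ t, ∀ z ∈ Q.bd, R t z ∈ Q.bd
  zero : ∀ z ∈ Q.bd, R 0 z = z
  add : ∀ s t, ∀ z ∈ Q.bd, R s (R t z) = R (t + s) z
  one_mem : ∀ z, Q.proj z ∈ V → Q.proj (R 1 z) ∈ V
  exists_eq : ∀ z ∈ Q.bd, ∃ α, Q.proj α ∈ V ∧ ∃ s ∈ Ico (0 : ℝ) 1, R s α = z
  inj : ∀ α β, Q.proj α ∈ V → Q.proj β ∈ V → ∀ s ∈ Ico (0 : ℝ) 1, ∀ t ∈ Ico (0 : ℝ) 1,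
    R s α = R t β → α = β ∧ s = t
  proj_eq : ∀ α, Q.proj α ∈ V → ∀ s ∈ Icc (0 : ℝ) 1, Q.proj (R s α) = γ (edge α) s
  twist : ∀ t, ∀ z ∈ Q.bd, Q.twistFun (R t z) = R (-t) (Q.twistFun z)
  edge_fiber : ∀ e, ∃ α β, α ≠ β ∧ ∀ z, (Q.proj z ∈ V ∧ edge z = e) ↔ z = α ∨ z = β

/-- Since `τ` reverses the edges, the end of a side is the image under the involution of a corner
where another side starts.  So the map from corners to the ends of their sides is a permutation,
and the sides can be strung together, end to end, to lines that parametrise the boundary. -/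
theorem IsSides.exists_isFlow [CompactSpace S] [T2Space S] {edge : Q.Carrier → E}
    {side : Q.Carrier → ℝ → Q.Carrier} (hs : Q.IsSides γ edge side) (hγ : Q.IsEdges γ)
    (hVD : V ⊆ D) (hV : V.Finite) (hτ : ∀ y, τ (τ y) = y) (hτV : ∀ y, y ∈ V → τ y ∈ V) :
    ∃ R, Q.IsFlow γ edge R := by
  classical
  have hI0 : (0 : ℝ) ∈ Icc (0 : ℝ) 1 := ⟨le_rfl, zero_le_one⟩
  have hI1 : (1 : ℝ) ∈ Icc (0 : ℝ) 1 := ⟨zero_le_one, le_rfl⟩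
  let F := {α : Q.Carrier // Q.proj α ∈ V}
  have hFfin : {α : Q.Carrier | Q.proj α ∈ V}.Finite := by
    have : {α : Q.Carrier | Q.proj α ∈ V} = ⋃ y ∈ V, Q.proj ⁻¹' {y} := by ext; simp
    rw [this]
    exact hV.biUnion fun y hy => Q.finite_fiber (hVD hy)
  have : Finite F := hFfin.to_subtype
  have hproj : ∀ α : F, ∀ s ∈ Icc (0 : ℝ) 1, Q.proj (side α s) = γ (edge α) s := fun α =>
    (hs.isSide α α.2).2
  have hbd : ∀ α : F, ∀ s ∈ Icc (0 : ℝ) 1, side α s ∈ Q.bd := fun α s hsI =>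
    show Q.proj _ ∈ D from (hproj α s hsI).symm ▸ hγ.mem _ _
  have hzero : ∀ α : F, side α 0 = α := fun α => hs.zero α α.2
  -- the end of each side, and the involution of the corners that it induces
  let ω : F → F := fun α => ⟨side α 1, by rw [hproj α 1 hI1]; exact hγ.one_mem _⟩
  let tw : F → F := fun α => ⟨Q.twistFun α, hτV _ α.2⟩
  have htw : ∀ α, tw (tw α) = α := fun α => Subtype.ext (Q.twistFun_twistFun hτ _)
  have hrev : ∀ α : F, ∀ s ∈ Icc (0 : ℝ) 1, Q.twistFun (side α (1 - s)) = side (tw (ω α)) s := by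
    intro α
    obtain ⟨e', he'⟩ := hγ.star (edge α)
    refine (hs.unique (tw (ω α)) (tw (ω α)).2 e' (fun s => Q.twistFun (side α (1 - s)))
      ⟨?_, ?_⟩ ?_).2
    · exact Q.continuous_twistFun.comp_continuousOn ((hs.isSide α α.2).1.comp (by fun_prop)
        fun s hs => ⟨by linarith [hs.2], by linarith [hs.1]⟩)
    · intro s hs
      rw [he', Q.proj_twistFun, hproj α _ ⟨by linarith [hs.2], by linarith [hs.1]⟩]
    · simp [ω, tw]
  have hω : ∀ α, tw (ω (tw (ω α))) = α := by
    intro α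
    refine Subtype.ext ?_
    change Q.twistFun (side (tw (ω α)) 1) = α
    rw [← hrev α 1 hI1, Q.twistFun_twistFun hτ, sub_self, hzero]
  let Ω : Equiv.Perm F :=
    { toFun := ω
      invFun := fun α => tw (ω (tw α))
      left_inv := fun α => hω α
      right_inv := fun α => by
        have := hω (tw α)
        rw [← htw (ω (tw (ω (tw α)))), this, htw] }
  -- the line through a corner, on which the corners are the integers
  let line : F → ℝ → Q.Carrier := fun α x => side ((Ω ^ ⌊x⌋) α) (Int.fract x)
  have hline_add : ∀ α (x : ℝ) (n : ℤ), line α (x + n) = line ((Ω ^ n) α) x := by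
    intro α x n
    simp only [line, Int.floor_add_intCast, Int.fract_add_intCast, zpow_add, Equiv.Perm.mul_apply]
  have hline : ∀ α, ∀ x ∈ Icc (0 : ℝ) 1, line α x = side α x := by
    intro α x hx
    rcases hx.2.lt_or_eq with h | rfl
    · have h1 : ⌊x⌋ = 0 := Int.floor_eq_zero_iff.2 ⟨hx.1, h⟩
      have h2 : Int.fract x = x := Int.fract_eq_self.2 ⟨hx.1, h⟩
      simp [line, h1, h2]
    · have := hzero (ω α)
      simpa [line, Ω, ω] using this
  have hline0 : ∀ α : F, line α 0 = α := fun α => (hline α 0 hI0).trans (hzero α)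
  have hlineC : ∀ α, Continuous (line α) := by
    have h1 : ∀ α, ContinuousOn (line α) (Icc 0 1) := fun α =>
      (hs.isSide α α.2).1.congr fun x hx => hline α x hx
    have h2 : ∀ α, ContinuousOn (line α) (Icc (-1) 0) := by
      intro α
      have : EqOn (line α) (fun x => line ((Ω ^ (-1 : ℤ)) α) (x + 1)) (Icc (-1) 0) := by
        intro x hx
        have := hline_add α (x + 1) (-1)
        simp only [Int.cast_neg, Int.cast_one, add_neg_cancel_right] at this
        exact this
      refine ContinuousOn.congr ((h1 _).comp (by fun_prop) ?_) this
      exact fun x hx => ⟨by linarith [hx.1], by linarith [hx.2]⟩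
    have h3 : ∀ α, ContinuousOn (line α) (Icc (-1) 1) := by
      intro α
      have := (h2 α).union_of_isClosed (h1 α) isClosed_Icc isClosed_Icc
      rwa [Icc_union_Icc_eq_Icc (by norm_num) (by norm_num)] at this
    intro α
    rw [continuous_iff_continuousAt]
    intro x
    have h4 : line α = fun y => line ((Ω ^ ⌊x⌋) α) (y - ⌊x⌋) := by
      funext y
      rw [← hline_add, sub_add_cancel]
    rw [h4]
    refine ContinuousAt.comp (g := line ((Ω ^ ⌊x⌋) α)) ?_ (by fun_prop)
    refine (h3 _).continuousAt (Icc_mem_nhds ?_ ?_)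
    · linarith [Int.floor_le x]
    · linarith [Int.lt_floor_add_one x]
  have hinj : ∀ α β : F, ∀ s ∈ Ico (0 : ℝ) 1, ∀ t ∈ Ico (0 : ℝ) 1, side α s = side β t →
      α = β ∧ s = t := by
    intro α β s hsI t htI h
    have hp : γ (edge α) s = γ (edge β) t := by
      rw [← hproj α s (Ico_subset_Icc_self hsI), ← hproj β t (Ico_subset_Icc_self htI), h]
    rcases hsI.1.eq_or_lt with rfl | hs0 <;> rcases htI.1.eq_or_lt with rfl | ht0
    · rw [hzero, hzero] at h
      exact ⟨Subtype.ext h, rfl⟩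
    · exact absurd (hp ▸ hγ.zero_mem (edge α)) (hγ.notMem _ _ ⟨ht0, htI.2⟩)
    · exact absurd (hp ▸ hγ.zero_mem (edge β)) (hγ.notMem _ _ ⟨hs0, hsI.2⟩)
    · obtain ⟨he, rfl⟩ := hγ.inj _ _ s ⟨hs0, hsI.2⟩ t ⟨ht0, htI.2⟩ hp
      refine ⟨Subtype.ext ?_, rfl⟩
      have hβ := hs.isSide β β.2
      rw [← he] at hβ
      have := (hs.isSide α α.2).eqOn (hγ.mem_diff _) hβ ⟨hs0, hsI.2⟩ h hI0
      rwa [hzero, hzero] at this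
  have hex : ∀ z ∈ Q.bd, ∃ α : F, ∃ s ∈ Ico (0 : ℝ) 1, side α s = z := by
    intro z hz
    by_cases hzV : Q.proj z ∈ V
    · exact ⟨⟨z, hzV⟩, 0, ⟨le_rfl, one_pos⟩, hzero _⟩
    · obtain ⟨e, s, hsI, he⟩ := hγ.cover _ hz hzV
      obtain ⟨c, hc, hcz⟩ := exists_isSide (hγ.continuous e) (hγ.mem_diff e) (hγ.mem e 0)
        (hγ.mem e 1) hsI he.symm
      have hc0 : Q.proj (c 0) ∈ V := by rw [hc.2 0 hI0]; exact hγ.zero_mem e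
      refine ⟨⟨c 0, hc0⟩, s, ⟨hsI.1.le, hsI.2⟩, ?_⟩
      rw [← hcz]
      exact ((hs.unique _ hc0 e c hc rfl).2 (Ioo_subset_Icc_self hsI)).symm
  -- coordinates of the boundary points, by which the flow is defined
  have hco : ∀ z, ∃ αs : Option (F × ℝ), z ∈ Q.bd → ∃ α s, αs = some (α, s) ∧
      s ∈ Ico (0 : ℝ) 1 ∧ side α s = z := by
    intro z
    by_cases hz : z ∈ Q.bd
    · obtain ⟨α, s, h1, h2⟩ := hex z hz
      exact ⟨some (α, s), fun _ => ⟨α, s, rfl, h1, h2⟩⟩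
    · exact ⟨none, fun h => absurd h hz⟩
  choose co hco using hco
  let R : ℝ → Q.Carrier → Q.Carrier := fun t z =>
    match co z with
    | none => z
    | some (α, s) => line α (s + t)
  have hline_bd : ∀ α x, line α x ∈ Q.bd := fun α x =>
    hbd _ _ ⟨Int.fract_nonneg x, (Int.fract_lt_one x).le⟩
  have hR : ∀ t α x, R t (line α x) = line α (x + t) := by
    intro t α x
    obtain ⟨β, s, h1, h2, h3⟩ := hco (line α x) (hline_bd α x)
    simp only [R, h1]
    obtain ⟨h4, h5⟩ := hinj β _ s h2 (Int.fract x) ⟨Int.fract_nonneg x, Int.fract_lt_one x⟩ h3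
    rw [h4, h5, ← hline_add]
    congr 1
    have := Int.fract_add_floor x
    linarith
  have hsurj : ∀ z ∈ Q.bd, ∃ α : F, ∃ s ∈ Ico (0 : ℝ) 1, line α s = z := by
    intro z hz
    obtain ⟨α, s, h1, h2⟩ := hex z hz
    exact ⟨α, s, h1, (hline α s (Ico_subset_Icc_self h1)).trans h2⟩
  have hR0 : ∀ t (α : F), R t α = line α t := by
    intro t α
    have := hR t α 0
    rwa [hline0, zero_add] at this
  refine ⟨R, ?_, ?_, ?_, ?_, ?_, ?_, ?_, ?_, ?_, ?_⟩
  · -- the boundary is a quotient of finitely many intervals, even after taking the product with `ℝ`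
    let g : F × Icc (0 : ℝ) 1 → Q.bd := fun p => ⟨line p.1 p.2, hline_bd _ _⟩
    have hgc : Continuous g := Continuous.subtype_mk
      (continuous_prod_of_discrete_left.2 fun α => (hlineC α).comp continuous_subtype_val) _
    have hgs : Function.Surjective g := by
      rintro ⟨z, hz⟩
      obtain ⟨α, s, h1, h2⟩ := hsurj z hz
      exact ⟨(α, ⟨s, Ico_subset_Icc_self h1⟩), Subtype.ext h2⟩
    have hq : IsQuotientMap (Prod.map (id : ℝ → ℝ) g) :=
      ((isProperMap_id.prodMap hgc.isProperMap).isClosedMap).isQuotientMap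
        (continuous_id.prodMap hgc) (Function.surjective_id.prodMap hgs)
    have hcont : Continuous fun p : ℝ × Q.bd => R p.1 p.2 := by
      rw [hq.continuous_iff]
      have : (fun p : ℝ × Q.bd => R p.1 p.2) ∘ Prod.map id g =
          fun p : ℝ × F × Icc (0 : ℝ) 1 => line p.2.1 (p.2.2 + p.1) := by
        funext p
        exact hR _ _ _
      rw [this]
      have h2 : Continuous fun p : F × (ℝ × Icc (0 : ℝ) 1) => line p.1 (p.2.2 + p.2.1) :=
        continuous_prod_of_discrete_left.2 fun α => (hlineC α).comp (by fun_prop)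
      exact h2.comp (f := fun p : ℝ × F × Icc (0 : ℝ) 1 => (p.2.1, (p.1, p.2.2))) (by fun_prop)
    rw [continuousOn_iff_continuous_domRestrict]
    exact hcont.comp (f := fun p : (univ ×ˢ Q.bd : Set (ℝ × Q.Carrier)) =>
      (p.1.1, (⟨p.1.2, p.2.2⟩ : Q.bd))) (by fun_prop)
  · intro t z hz
    obtain ⟨α, s, -, rfl⟩ := hsurj z hz
    rw [hR]; exact hline_bd _ _
  · intro z hz
    obtain ⟨α, s, -, rfl⟩ := hsurj z hz
    rw [hR, add_zero]
  · intro s t z hz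
    obtain ⟨α, x, -, rfl⟩ := hsurj z hz
    rw [hR, hR, hR, add_assoc]
  · intro z hz
    have h1 := hR0 1 ⟨z, hz⟩
    simp only at h1
    rw [h1, hline _ 1 hI1]
    exact (ω ⟨z, hz⟩).2
  · intro z hz
    obtain ⟨α, x, hx, rfl⟩ := hsurj z hz
    exact ⟨α, α.2, x, hx, hR0 x α⟩
  · intro α β hα hβ s hs t ht h
    have h1 := hR0 s ⟨α, hα⟩
    have h2 := hR0 t ⟨β, hβ⟩
    simp only at h1 h2
    rw [h1, h2, hline _ _ (Ico_subset_Icc_self hs), hline _ _ (Ico_subset_Icc_self ht)] at h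
    obtain ⟨h3, h4⟩ := hinj _ _ s hs t ht h
    exact ⟨congrArg Subtype.val h3, h4⟩
  · intro α hα s hs
    have h1 := hR0 s ⟨α, hα⟩
    simp only at h1
    rw [h1, hline _ _ hs, hproj _ _ hs]
  · -- a point of a side and its image under the involution
    have h1 : ∀ α : F, ∀ x : ℝ, Q.twistFun (line α x) = line (tw α) (-x) := by
      have h2 : ∀ α : F, ∀ x ∈ Icc (0 : ℝ) 1, Q.twistFun (line α x) = line (tw α) (-x) := by
        intro α x hx
        have h4 := hline_add (tw α) (1 - x) (-1)
        have h5 := hrev α (1 - x) ⟨by linarith [hx.2], by linarith [hx.1]⟩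
        have h6 : (Ω ^ (-1 : ℤ)) (tw α) = tw (ω α) := by
          rw [zpow_neg_one]
          exact congrArg (fun β => tw (ω β)) (htw α)
        rw [sub_sub_cancel] at h5
        rw [h6, hline (tw (ω α)) _ ⟨by linarith [hx.2], by linarith [hx.1]⟩, ← h5] at h4
        rw [hline _ _ hx, ← h4]
        congr 1; push_cast; ring
      let T : Equiv.Perm F := ⟨tw, tw, htw, htw⟩
      have h7 : SemiconjBy T Ω Ω⁻¹ := by
        refine Equiv.ext fun β => ?_
        exact congrArg (fun β => tw (ω β)) (htw β).symm
      intro α x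
      have h8 : tw ((Ω ^ ⌊x⌋) α) = (Ω ^ (-⌊x⌋)) (tw α) := by
        rw [zpow_neg, ← inv_zpow]
        exact Equiv.congr_fun (h7.zpow_right ⌊x⌋) α
      have h9 := hline_add α (Int.fract x) ⌊x⌋
      have h10 := hline_add (tw α) (-Int.fract x) (-⌊x⌋)
      rw [Int.fract_add_floor] at h9
      rw [h9, h2 _ _ ⟨Int.fract_nonneg x, (Int.fract_lt_one x).le⟩, h8, ← h10]
      congr 1
      have := Int.fract_add_floor x
      push_cast
      linarith
    intro t z hz
    obtain ⟨α, x, hx, rfl⟩ := hsurj z hz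
    rw [hR, h1, h1, hR]
    congr 1; ring
  · intro e
    -- the corners with a given edge correspond to the two points over the middle of the edge
    have hhalf : (1 / 2 : ℝ) ∈ Ioo (0 : ℝ) 1 := by norm_num
    have hcard := Q.ncard_fiber (hγ.mem e (1 / 2))
    rw [Q.card_edge _ (hγ.mem_diff e _ hhalf), ncard_eq_two] at hcard
    obtain ⟨z, w, hzw, hset⟩ := hcard
    have hz : z ∈ Q.proj ⁻¹' {γ e (1 / 2)} := by rw [hset]; simp
    have hw : w ∈ Q.proj ⁻¹' {γ e (1 / 2)} := by rw [hset]; simp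
    obtain ⟨c, hc, hcz⟩ := exists_isSide (hγ.continuous e) (hγ.mem_diff e) (hγ.mem e 0)
      (hγ.mem e 1) hhalf hz
    obtain ⟨d, hd, hdw⟩ := exists_isSide (hγ.continuous e) (hγ.mem_diff e) (hγ.mem e 0)
      (hγ.mem e 1) hhalf hw
    refine ⟨c 0, d 0, fun h => hzw ?_, fun x => ⟨?_, ?_⟩⟩
    · rw [← hcz, ← hdw]
      exact (hγ.side_unique hc hd h).2 (Ioo_subset_Icc_self hhalf)
    · rintro ⟨hx, rfl⟩
      have hxs := hs.isSide x hx
      have : side x (1 / 2) ∈ Q.proj ⁻¹' {γ (edge x) (1 / 2)} := hxs.2 _ (Ioo_subset_Icc_self hhalf)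
      rw [hset] at this
      rcases this with h | h
      · left
        rw [← hs.zero x hx]
        exact hxs.eqOn (hγ.mem_diff _) hc hhalf (h.trans hcz.symm) hI0
      · right
        rw [← hs.zero x hx]
        exact hxs.eqOn (hγ.mem_diff _) hd hhalf (h.trans hdw.symm) hI0
    · have haux : ∀ c, Q.IsSide (γ e) c → Q.proj (c 0) ∈ V ∧ edge (c 0) = e := by
        intro c hc
        have hc0 : Q.proj (c 0) ∈ V := by rw [hc.2 0 hI0]; exact hγ.zero_mem e
        exact ⟨hc0, (hs.unique _ hc0 e c hc rfl).1.symm⟩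
      rintro (rfl | rfl)
      · exact haux c hc
      · exact haux d hd

end PatchSystem

/-! ### The diagram cut open -/

/-- No two sectors at a crossing contain the same pair of an edge that starts at the crossing
(below) and a reversed edge that ends there (above). -/
def PatchSystem.SeparatesCorners {S : Type*} [TopologicalSpace S] {D V : Set S} {τ : S ≃ₜ S}
    (Q : PatchSystem D V τ) {E : Type*} (γ : E → ℝ → S) : Prop :=
  ∀ y ∈ V, ∀ i ∈ Q.sectors y, ∀ j ∈ Q.sectors y, ∀ e e', γ e 0 = y → γ e' 0 = τ y →
    (∀ᶠ s in 𝓝[>] (0 : ℝ), γ e s ∈ range (Q.q i) ∧ γ e s ∈ range (Q.q j) ∧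
      τ (γ e' s) ∈ range (Q.q i) ∧ τ (γ e' s) ∈ range (Q.q j)) → i = j

namespace ProjectionSurface

variable {M : Type u} [TopologicalSpace M] {bM : Set M} {St : Type v} [TopologicalSpace St]
  {P : ProjectionSurface M bM St} {L : Set M} {E : Type*}

/-- The diagram of the link has a patch system.  In a crossing chart the strand below is the first
axis and the strand above is the second; the edges that start at the crossing are the two halves of
the first, and the edges that end there are the two halves of the second. -/
theorem EdgeSystem.exists_patchSystem [T2Space M] (G : P.EdgeSystem L E) (hL : IsLink L)
    (hLN : L ⊆ P.thickening) (hdiag : P.IsGeneralisedDiagram L) :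
    ∃ Q : PatchSystem (P.diagram L) (P.crossings L) P.τ,
      Q.IsEdges (fun e s => (G.μ e s).1) ∧ Q.SeparatesCorners fun e s => (G.μ e s).1 := by
  have := P.compact
  have := P.isSurface.t2
  obtain ⟨lo, up, hh'⟩ := P.exists_heights hdiag
  have hh : P.IsHeights L lo up := hh'
  -- the crossing charts that the patches come from are those adapted to the link
  let T : St → OpenPartialHomeomorph St (ℝ × ℝ) → Prop := fun y h =>
    ∃ f g : ℝ → ℝ, Continuous f ∧ Continuous g ∧ f 0 < g 0 ∧
      ∀ z ∈ h.source, ∀ t, ((z, t) ∈ P.lift L ↔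
        ((h z).2 = 0 ∧ t = f (h z).1) ∨ ((h z).1 = 0 ∧ t = g (h z).2))
  have hch : ∀ y ∈ P.diagram L, ∃ c h,
      IsDiagramChart (P.diagram L) (P.crossings L) c y h ∧ (y ∈ P.crossings L → T y h) := by
    intro y hy
    obtain ⟨h, hys, ht, h0, hc⟩ := hdiag y hy
    rcases hc with hc | hc
    · obtain ⟨f, -, hf⟩ := hc
      have hno : ∀ z ∈ h.source, z ∉ P.crossings L := by
        rintro z hz ⟨t, t', htt, h1, h2⟩
        linarith [((hf z hz t).1 h1).2, ((hf z hz t').1 h2).2]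
      refine ⟨false, h, ⟨hys, ht, h0, fun z hz => ?_, by simp, fun z hz hzV => absurd hzV (hno z hz)⟩,
        fun hyV => absurd hyV (hno y hys)⟩
      simp only [modelAxes, Bool.false_eq_true, false_and, or_false, mem_ofPred_eq]
      constructor
      · rintro ⟨⟨z', t⟩, hzt, rfl⟩
        exact ((hf _ hz t).1 hzt).1
      · intro h2
        exact ⟨(z, f (h z).1), (hf z hz _).2 ⟨h2, rfl⟩, rfl⟩
    · obtain ⟨f, g, hf, hg, hfg, hl⟩ := hc
      refine ⟨true, h, ⟨hys, ht, h0, fun z hz => ?_, fun _ => ?_, fun z hz hzV => ⟨rfl, ?_⟩⟩,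
        fun _ => ⟨f, g, hf, hg, hfg, hl⟩⟩
      · simp only [modelAxes, true_and, mem_ofPred_eq]
        constructor
        · rintro ⟨⟨z', t⟩, hzt, rfl⟩
          exact ((hl _ hz t).1 hzt).imp And.left And.left
        · rintro (h2 | h2)
          · exact ⟨(z, f (h z).1), (hl z hz _).2 (Or.inl ⟨h2, rfl⟩), rfl⟩
          · exact ⟨(z, g (h z).2), (hl z hz _).2 (Or.inr ⟨h2, rfl⟩), rfl⟩
      · exact ⟨f 0, g 0, hfg, (hl y hys _).2 (by simp [h0]), (hl y hys _).2 (by simp [h0])⟩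
      · refine h.injOn hz hys ?_
        rw [h0]
        obtain ⟨t, t', htt, h1, h2⟩ := hzV
        rcases (hl z hz t).1 h1 with ⟨h3, h4⟩ | ⟨h3, h4⟩ <;>
          rcases (hl z hz t').1 h2 with ⟨h5, h6⟩ | ⟨h5, h6⟩
        · linarith
        · exact Prod.ext h5 h3
        · exact Prod.ext h3 h5
        · linarith
  obtain ⟨Q, hQ⟩ := LinkChunk.exists_patchSystem (P.isClosed_diagram hL hLN)
    P.crossings_subset_diagram P.τ_τ (fun y => P.tau_mem_diagram) hch
  have h0V : ∀ e, (G.μ e 0).1 ∈ P.crossings L := fun e => (hh.isUnder_iff.1 (G.isUnder e)).1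
  refine ⟨Q, ⟨fun e => continuous_fst.comp (G.continuous_μ e), fun e s => ⟨_, G.mem e s, rfl⟩,
    h0V, fun e => (hh.isOver_iff.1 (G.isOver e)).1, G.notMem, G.inj, G.cover,
    fun e => ⟨G.star e, fun s => by rw [G.μ_star]; rfl⟩, ?_⟩, ?_⟩
  · intro y hy
    obtain ⟨e, e', hne, hst, hop⟩ := G.start y hy
    refine ⟨e, e', hne, hst, ?_⟩
    obtain ⟨h, hch, ⟨f, g, hf, hg, hfg, hl⟩, σ, -, hσ⟩ := hQ y hy
    obtain ⟨d, d', hdd, hd, hd'⟩ := hop h f g hch.mem_source hch.center hf hg hfg hl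
    rintro i hi ⟨h1, h2⟩
    have h3 : ∀ᶠ s in 𝓝[>] (0 : ℝ), (G.μ d s).1 ∈ range (Q.q i) := by
      rcases hdd with ⟨rfl, rfl⟩ | ⟨rfl, rfl⟩
      exacts [h1, h2]
    have h4 : ∀ᶠ s in 𝓝[>] (0 : ℝ), (G.μ d' s).1 ∈ range (Q.q i) := by
      rcases hdd with ⟨rfl, rfl⟩ | ⟨rfl, rfl⟩
      exacts [h2, h1]
    -- the two edges leave the crossing on different sides of the second axis
    obtain ⟨s, ⟨a1, a2⟩, a3, a4⟩ := ((hd.and hd').and (h3.and h4)).exists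
    have b1 := (hσ i hi _ a3).2.1
    have b2 := (hσ i hi _ a4).2.1
    have c1 := a1.2.1
    have c2 := a2.2.1
    cases hsg : (σ i).1 <;> simp [hsg, sgn] at b1 b2 <;> linarith
  · intro y hy i hi j hj e e' he he' hev
    replace he' : (G.μ e' 0).1 = P.τ y := he'
    obtain ⟨h, hch, ⟨f, g, hf, hg, hfg, hl⟩, σ, hσi, hσ⟩ := hQ y hy
    have hys := hch.mem_source
    refine hσi hi hj (Prod.ext ?_ ?_)
    · -- the strand below leaves the crossing along the first axis
      obtain ⟨e₁, e₂, hne, hst, hop⟩ := G.start y hy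
      obtain ⟨d, d', hdd, hd, hd'⟩ := hop h f g hch.mem_source hch.center hf hg hfg hl
      have hx : ∀ᶠ s in 𝓝[>] (0 : ℝ), (h (G.μ e s).1).1 ≠ 0 := by
        have : e = d ∨ e = d' := by
          rcases (hst e).1 he with rfl | rfl <;> rcases hdd with ⟨rfl, rfl⟩ | ⟨rfl, rfl⟩ <;> simp
        rcases this with rfl | rfl
        · filter_upwards [hd] with s hs using hs.2.1.ne'
        · filter_upwards [hd'] with s hs using hs.2.1.ne
      obtain ⟨s, hs, hs'⟩ := (hx.and hev).exists
      exact sgn_eq_of_nonneg hs (hσ i hi _ hs'.1).2.1 (hσ j hj _ hs'.2.1).2.1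
    · -- the strand above leaves the crossing along the second axis
      have hc1 : Continuous fun s => P.τ (G.μ e' s).1 :=
        P.τ.continuous.comp (continuous_fst.comp (G.continuous_μ e'))
      have h00 : P.τ (G.μ e' 0).1 = y := by rw [he', P.τ_τ]
      have hlo : (G.μ e' 0).2 = lo (P.τ y) := by
        rw [← he']; exact (hh.isUnder_iff.1 (G.isUnder e')).2
      have hghi : g 0 = up y := by
        have h1 := (hl y hys (lo y)).1 (hh.lo_mem hy)
        have h2 := (hl y hys (up y)).1 (hh.hi_mem hy)
        have h3 := (hh y hy).1
        simp only [hch.center, true_and] at h1 h2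
        rcases h2 with h2 | h2
        · rcases h1 with h1 | h1 <;> linarith
        · exact h2.symm
      have ev1 : ∀ᶠ s in 𝓝 (0 : ℝ), P.τ (G.μ e' s).1 ∈ h.source :=
        hc1.continuousAt.eventually_mem (h.open_source.mem_nhds (by rwa [h00]))
      have ev2 : ∀ᶠ s in 𝓝 (0 : ℝ), f (h (P.τ (G.μ e' s).1)).1 < -(G.μ e' s).2 := by
        have hc2 : ContinuousAt (fun s => h (P.τ (G.μ e' s).1)) 0 :=
          ContinuousAt.comp (f := fun s => P.τ (G.μ e' s).1)
            (h.continuousAt (by rwa [h00])) hc1.continuousAt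
        have hc3 : ContinuousAt (fun s => f (h (P.τ (G.μ e' s).1)).1) 0 :=
          hf.continuousAt.comp (continuous_fst.continuousAt.comp hc2)
        refine hc3.eventually_lt (continuous_snd.comp (G.continuous_μ e')).neg.continuousAt ?_
        simp only [h00, hch.center, hlo, hh.lo_tau hy, neg_neg, ← hghi]
        exact hfg
      have evI : ∀ᶠ s in 𝓝[>] (0 : ℝ), s ∈ Ioo (0 : ℝ) 1 := Ioo_mem_nhdsGT one_pos
      obtain ⟨s, ⟨⟨h1, h2⟩, h3⟩, h4⟩ := (((ev1.filter_mono nhdsWithin_le_nhds).and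
        (ev2.filter_mono nhdsWithin_le_nhds)).and evI).and hev |>.exists
      have hax : (h (P.τ (G.μ e' s).1)).1 = 0 := by
        rcases (hl _ h1 (-(G.μ e' s).2)).1 (P.flip_mem_lift.2 (G.mem e' s)) with h5 | h5
        · exact absurd h5.2 h2.ne'
        · exact h5.1
      have hne : (h (P.τ (G.μ e' s).1)).2 ≠ 0 := by
        intro h5
        have : P.τ (G.μ e' s).1 = y := h.injOn h1 hys (by rw [hch.center]; exact Prod.ext hax h5)
        refine G.notMem e' s h3 ?_
        rw [← P.tau_mem_crossings, this]
        exact hy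
      exact sgn_eq_of_nonneg hne (hσ i hi _ h4.2.2.1).2.2 (hσ j hj _ h4.2.2.2).2.2

end ProjectionSurface

namespace PatchSystem

variable {S : Type*} [TopologicalSpace S] {D V : Set S} {τ : S ≃ₜ S} {Q : PatchSystem D V τ}
  {E : Type*} {γ : E → ℝ → S}

/-- A corner is determined by the edges along its two sides. -/
theorem SeparatesCorners.eq [T2Space S] (hsep : Q.SeparatesCorners γ) (hVD : V ⊆ D)
    (hτ : ∀ y, τ (τ y) = y)
    (hτV : ∀ y, y ∈ V → τ y ∈ V) {edge : Q.Carrier → E} {R : ℝ → Q.Carrier → Q.Carrier}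
    (hR : Q.IsFlow γ edge R) {α β : Q.Carrier} (hα : Q.proj α ∈ V) (hαβ : Q.proj β = Q.proj α)
    (h1 : edge α = edge β) (h2 : edge (Q.twistFun α) = edge (Q.twistFun β)) : α = β := by
  have hβ : Q.proj β ∈ V := hαβ ▸ hα
  have hαD : α ∈ Q.bd := hVD hα
  have hβD : β ∈ Q.bd := hVD hβ
  obtain ⟨i, hi, p, hp, hpα⟩ := Q.exists_lift hαD
  obtain ⟨j, hj, r, hr, hrβ⟩ := Q.exists_lift hβD
  have h0 : ∀ α, Q.proj α ∈ V → γ (edge α) 0 = Q.proj α := by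
    intro α hα
    rw [← hR.proj_eq α hα 0 ⟨le_rfl, zero_le_one⟩, hR.zero α (hVD hα)]
  have htw : ∀ α, Q.proj α ∈ V → Q.proj (Q.twistFun α) ∈ V := fun α hα => hτV _ hα
  -- the boundary runs inside the patch on both sides of a corner
  have key : ∀ α, Q.proj α ∈ V → ∀ i ∈ Q.sectors (Q.proj α), ∀ p, Q.lift i p = α →
      ∀ᶠ s in 𝓝[>] (0 : ℝ), γ (edge α) s ∈ range (Q.q i) ∧
        τ (γ (edge (Q.twistFun α)) s) ∈ range (Q.q i) := by
    intro α hα i hi p hpα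
    have hαD : α ∈ Q.bd := hVD hα
    have hOo := Q.isOpen_lift_image i (O := {p | 0 < Q.bump i (Q.q i p)})
      (isOpen_lt continuous_const ((Q.continuous_bump i).comp (Q.embedding i).continuous))
      fun p hp => hp
    have hc : Continuous fun t => R t α := by
      have := hR.continuousOn.comp_continuous (f := fun t : ℝ => (t, α)) (by fun_prop)
        fun t => ⟨mem_univ _, hαD⟩
      exact this
    have hmem : R 0 α ∈ Q.lift i '' {p | 0 < Q.bump i (Q.q i p)} := by
      rw [hR.zero α hαD]
      exact ⟨p, by have := Q.bump_pos _ hαD i hi; rwa [← hpα] at this, hpα⟩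
    have ev : ∀ᶠ t in 𝓝 (0 : ℝ), R t α ∈ Q.lift i '' {p | 0 < Q.bump i (Q.q i p)} :=
      hc.continuousAt.eventually_mem (hOo.mem_nhds hmem)
    have ev' : ∀ᶠ t in 𝓝 (0 : ℝ), R (-t) α ∈ Q.lift i '' {p | 0 < Q.bump i (Q.q i p)} := by
      have : Tendsto (fun t : ℝ => -t) (𝓝 0) (𝓝 0) := by
        simpa using (continuous_neg.tendsto (0 : ℝ))
      exact this.eventually ev
    have evI : ∀ᶠ s in 𝓝[>] (0 : ℝ), s ∈ Ioo (0 : ℝ) 1 := Ioo_mem_nhdsGT one_pos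
    filter_upwards [ev.filter_mono nhdsWithin_le_nhds, ev'.filter_mono nhdsWithin_le_nhds, evI]
      with s hs hs' hsI
    obtain ⟨a, -, ha⟩ := hs
    obtain ⟨b, -, hb⟩ := hs'
    have hsI' := Ioo_subset_Icc_self hsI
    refine ⟨⟨a, ?_⟩, ⟨b, ?_⟩⟩
    · rw [← hR.proj_eq α hα s hsI', ← ha, Q.proj_lift]
    · rw [← hR.proj_eq _ (htw α hα) s hsI', ← Q.proj_lift, hb]
      have := hR.twist s (Q.twistFun α) (hVD (htw α hα))
      rw [Q.twistFun_twistFun hτ] at this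
      rw [← this]
      exact Q.proj_twistFun _
  have k1 := key α hα i hi p hpα
  have k2 := key β hβ j hj r hrβ
  rw [← h1, ← h2] at k2
  rw [hαβ] at hj
  have hij := hsep _ hα i hi j hj (edge α) (edge (Q.twistFun α)) (h0 α hα)
    ((h0 _ (htw α hα)).trans (Q.proj_twistFun α)) (by
      filter_upwards [k1, k2] with s a1 a2 using ⟨a1.1, a2.1, a1.2, a2.2⟩)
  subst hij
  have : Q.q i p = Q.q i r := by
    rw [← Q.proj_lift, ← Q.proj_lift, hpα, hrβ, hαβ]
  rw [← hpα, ← hrβ, (Q.embedding i).injective this]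

end PatchSystem

/-! ### Maps that are defined separately on a collar and off it -/

section Collar

variable {X : Type*} [TopologicalSpace X] {B : Set X} {t : X → X} {c : X → ℝ → X} {Y : Type*}

open Classical in
/-- The map that is `g x u` at the point `c x u` of the collar and `h` elsewhere. -/
noncomputable def glueCollar (B : Set X) (c : X → ℝ → X) (g : X → ℝ → Y) (h : X → Y) (w : X) : Y :=
  if hw : ∃ p : X × ℝ, p ∈ B ×ˢ Icc (0 : ℝ) 1 ∧ c p.1 p.2 = w then
    g hw.choose.1 hw.choose.2 else h w

theorem IsCollar.glueCollar_apply (hc : IsCollar B t c) (g : X → ℝ → Y) (h : X → Y) {x : X}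
    (hx : x ∈ B) {u : ℝ} (hu : u ∈ Icc (0 : ℝ) 1) : glueCollar B c g h (c x u) = g x u := by
  have hw : ∃ p : X × ℝ, p ∈ B ×ˢ Icc (0 : ℝ) 1 ∧ c p.1 p.2 = c x u := ⟨(x, u), ⟨hx, hu⟩, rfl⟩
  obtain ⟨h1, h2⟩ := hw.choose_spec
  obtain ⟨h3, h4⟩ := hc.inj _ h1.1 _ hx _ h1.2 _ hu h2
  rw [glueCollar, dif_pos hw, h3, h4]

/-- The half-open collar. -/
def openCollar (B : Set X) (c : X → ℝ → X) : Set X :=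
  (fun y : X × ℝ => c y.1 y.2) '' (B ×ˢ Ico 0 1)

theorem mem_or_openCollar {X : Type*} (B : Set X) (c : X → ℝ → X) (w : X) :
    (∃ x ∈ B, ∃ u ∈ Ico (0 : ℝ) 1, c x u = w) ∨ w ∉ openCollar B c := by
  by_cases h : w ∈ openCollar B c
  · obtain ⟨⟨x, u⟩, ⟨hx, hu⟩, rfl⟩ := h
    exact Or.inl ⟨x, hx, u, hu, rfl⟩
  · exact Or.inr h

theorem IsCollar.mem_iff (hc : IsCollar B t c) {x : X} (hx : x ∈ B) {u : ℝ}
    (hu : u ∈ Icc (0 : ℝ) 1) : c x u ∈ B ↔ u = 0 := by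
  constructor
  · intro h
    exact (hc.inj _ hx _ h _ hu 0 ⟨le_rfl, zero_le_one⟩ (hc.zero _ h).symm).2
  · rintro rfl
    rwa [hc.zero _ hx]

theorem IsCollar.glueCollar_core (hc : IsCollar B t c) {g : X → ℝ → Y} {h : X → Y}
    (hgh : ∀ x ∈ B, g x 1 = h (c x 1)) {w : X} (hw : w ∉ openCollar B c) :
    glueCollar B c g h w = h w := by
  by_cases hw' : ∃ p : X × ℝ, p ∈ B ×ˢ Icc (0 : ℝ) 1 ∧ c p.1 p.2 = w
  · obtain ⟨⟨x, u⟩, ⟨hx, hu⟩, rfl⟩ := hw'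
    rw [hc.glueCollar_apply g h hx hu]
    rcases hu.2.lt_or_eq with h1 | h1
    · exact absurd ⟨(x, u), ⟨hx, hu.1, h1⟩, rfl⟩ hw
    · obtain rfl : u = 1 := h1
      exact hgh x hx
  · rw [glueCollar, dif_neg hw']

/-- Maps that are glued along the end of the collar are continuous, jointly in a parameter. -/
theorem IsCollar.continuous_glueCollar [CompactSpace X] [T2Space X] (hc : IsCollar B t c)
    (hB : IsClosed B) {A : Type*} [TopologicalSpace A] [TopologicalSpace Y] {g : A → X → ℝ → Y}
    {h : A → X → Y}
    (hg : ContinuousOn (fun p : A × X × ℝ => g p.1 p.2.1 p.2.2) (univ ×ˢ B ×ˢ Icc 0 1))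
    (hh : Continuous fun p : A × X => h p.1 p.2) (hgh : ∀ a, ∀ x ∈ B, g a x 1 = h a (c x 1)) :
    Continuous fun p : A × X => glueCollar B c (g p.1) (h p.1) p.2 := by
  let K := B ×ˢ Icc (0 : ℝ) 1
  have hK : IsCompact K := hB.isCompact.prod isCompact_Icc
  have hKc : CompactSpace K := isCompact_iff_compactSpace.1 hK
  let k : K → X := fun p => c p.1.1 p.1.2
  have hk : IsClosedEmbedding k := by
    refine Continuous.isClosedEmbedding
      (hc.continuousOn.comp_continuous continuous_subtype_val fun p => p.2) ?_
    intro p q hpq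
    obtain ⟨h1, h2⟩ := hc.inj _ p.2.1 _ q.2.1 _ p.2.2 _ q.2.2 hpq
    exact Subtype.ext (Prod.ext h1 h2)
  -- on the collar the map factors through the inverse of the parametrisation
  have h1 : ContinuousOn (fun p : A × X => glueCollar B c (g p.1) (h p.1) p.2)
      (univ ×ˢ range k) := by
    have hq : IsQuotientMap (Prod.map (id : A → A) (rangeFactorization k)) := by
      let e : K ≃ₜ range k := hk.isEmbedding.toHomeomorph
      exact ((Homeomorph.refl A).prodCongr e).isQuotientMap
    have h2 : Continuous fun p : A × range k => glueCollar B c (g p.1) (h p.1) p.2.1 := by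
      rw [hq.continuous_iff]
      have h3 : Continuous fun p : A × K => g p.1 p.2.1.1 p.2.1.2 :=
        hg.comp_continuous (f := fun p : A × K => (p.1, p.2.1.1, p.2.1.2)) (by fun_prop)
          fun p => ⟨mem_univ _, p.2.2.1, p.2.2.2⟩
      refine h3.congr fun p => ?_
      exact (hc.glueCollar_apply (g p.1) (h p.1) p.2.2.1 p.2.2.2).symm
    rw [continuousOn_iff_continuous_domRestrict]
    exact h2.comp (f := fun p : ↥((univ : Set A) ×ˢ range k) =>
      ((p.1.1, ⟨p.1.2, p.2.2⟩) : A × range k)) (by fun_prop)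
  have h2 : ContinuousOn (fun p : A × X => glueCollar B c (g p.1) (h p.1) p.2)
      (univ ×ˢ (openCollar B c)ᶜ) := by
    refine hh.continuousOn.congr ?_
    rintro ⟨a, w⟩ ⟨-, hw⟩
    exact hc.glueCollar_core (hgh a) hw
  rw [← continuousOn_univ]
  refine (h1.union_of_isClosed h2 (isClosed_univ.prod hk.isClosed_range)
    (isClosed_univ.prod hc.isOpen.isClosed_compl)).mono ?_
  rintro ⟨a, w⟩ -
  by_cases hw : w ∈ openCollar B c
  · obtain ⟨⟨x, u⟩, ⟨hx, hu⟩, rfl⟩ := hw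
    exact Or.inl ⟨mem_univ _, ⟨(x, u), hx, Ico_subset_Icc_self hu⟩, rfl⟩
  · exact Or.inr ⟨mem_univ _, hw⟩

theorem IsCollar.twist_openCollar (hc : IsCollar B t c) (ht : ∀ x, t (t x) = x)
    (htB : ∀ x ∈ B, t x ∈ B) {w : X} : t w ∈ openCollar B c ↔ w ∈ openCollar B c := by
  have h : ∀ w, w ∈ openCollar B c → t w ∈ openCollar B c := by
    rintro _ ⟨⟨x, u⟩, ⟨hx, hu⟩, rfl⟩
    exact ⟨(t x, u), ⟨htB x hx, hu⟩, hc.twist x hx u (Ico_subset_Icc_self hu)⟩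
  exact ⟨fun hw => by simpa [ht] using h _ hw, h w⟩

end Collar

namespace PatchSystem

variable {S : Type*} [TopologicalSpace S] {D V : Set S} {τ : S ≃ₜ S} {Q : PatchSystem D V τ}
  {E : Type*} {γ : E → ℝ → S} {edge : Q.Carrier → E} {R : ℝ → Q.Carrier → Q.Carrier}
  {c : Q.Carrier → ℝ → Q.Carrier}

/-- The level curves of the collar are moved along themselves: the curve through `c x u` by the
time `φ x u`. -/
noncomputable def shear (Q : PatchSystem D V τ) (R : ℝ → Q.Carrier → Q.Carrier)
    (c : Q.Carrier → ℝ → Q.Carrier) (φ : Q.Carrier → ℝ → ℝ) : Q.Carrier → Q.Carrier :=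
  glueCollar Q.bd c (fun x u => c (R (φ x u) x) u) id

section Shear

variable (hR : Q.IsFlow γ edge R) (hc : IsCollar Q.bd Q.twistFun c)
include hR hc

omit hR in
theorem shear_apply (φ : Q.Carrier → ℝ → ℝ) {x : Q.Carrier} (hx : x ∈ Q.bd) {u : ℝ}
    (hu : u ∈ Icc (0 : ℝ) 1) : Q.shear R c φ (c x u) = c (R (φ x u) x) u :=
  hc.glueCollar_apply _ _ hx hu

theorem shear_core {φ : Q.Carrier → ℝ → ℝ} (hφ : ∀ x ∈ Q.bd, φ x 1 = 0) {w : Q.Carrier}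
    (hw : w ∉ openCollar Q.bd c) : Q.shear R c φ w = w := by
  refine hc.glueCollar_core (fun x hx => ?_) hw
  simp only [hφ x hx, hR.zero x hx, id]

theorem continuous_shear [CompactSpace S] [T2Space S] (hD : IsClosed D) {A : Type*}
    [TopologicalSpace A] {φ : A → Q.Carrier → ℝ → ℝ}
    (hφ : ContinuousOn (fun p : A × Q.Carrier × ℝ => φ p.1 p.2.1 p.2.2)
      (univ ×ˢ Q.bd ×ˢ Icc 0 1)) (hφ1 : ∀ a, ∀ x ∈ Q.bd, φ a x 1 = 0) :
    Continuous fun p : A × Q.Carrier => Q.shear R c (φ p.1) p.2 := by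
  refine hc.continuous_glueCollar (g := fun a x u => c (R (φ a x u) x) u) (h := fun _ => id)
    (hD.preimage Q.continuous_proj) ?_ continuous_snd ?_
  · have h1 : ContinuousOn (fun p : A × Q.Carrier × ℝ => R (φ p.1 p.2.1 p.2.2) p.2.1)
        (univ ×ˢ Q.bd ×ˢ Icc 0 1) :=
      hR.continuousOn.comp (f := fun p : A × Q.Carrier × ℝ => (φ p.1 p.2.1 p.2.2, p.2.1))
        (hφ.prodMk (by fun_prop)) fun p hp => ⟨mem_univ _, hp.2.1⟩
    exact hc.continuousOn.comp (f := fun p : A × Q.Carrier × ℝ =>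
      (R (φ p.1 p.2.1 p.2.2) p.2.1, p.2.2)) (h1.prodMk (by fun_prop))
      fun p hp => ⟨hR.mem _ _ hp.2.1, hp.2.2⟩
  · intro a x hx
    simp only [hφ1 a x hx, hR.zero x hx, id]

end Shear

/-- The rotation of the faces by the time `s`: the boundary moves at unit speed, and the speed
decreases linearly to zero across the collar. -/
noncomputable def rotate (Q : PatchSystem D V τ) (R : ℝ → Q.Carrier → Q.Carrier)
    (c : Q.Carrier → ℝ → Q.Carrier) (s : ℝ) : Q.Carrier → Q.Carrier :=
  Q.shear R c fun _ u => s * (1 - u)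

section Rotate

variable (hR : Q.IsFlow γ edge R) (hc : IsCollar Q.bd Q.twistFun c)
include hR hc

omit hR in
theorem rotate_apply (s : ℝ) {x : Q.Carrier} (hx : x ∈ Q.bd) {u : ℝ} (hu : u ∈ Icc (0 : ℝ) 1) :
    Q.rotate R c s (c x u) = c (R (s * (1 - u)) x) u :=
  shear_apply hc _ hx hu

theorem rotate_core (s : ℝ) {w : Q.Carrier} (hw : w ∉ openCollar Q.bd c) :
    Q.rotate R c s w = w :=
  shear_core hR hc (by simp) hw

theorem rotate_bd (s : ℝ) {x : Q.Carrier} (hx : x ∈ Q.bd) : Q.rotate R c s x = R s x := by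
  have := rotate_apply (R := R) hc s hx (u := 0) ⟨le_rfl, zero_le_one⟩
  rwa [hc.zero x hx, sub_zero, mul_one, hc.zero _ (hR.mem _ x hx)] at this

theorem rotate_rotate (s s' : ℝ) (w : Q.Carrier) :
    Q.rotate R c s (Q.rotate R c s' w) = Q.rotate R c (s' + s) w := by
  rcases mem_or_openCollar Q.bd c w with ⟨x, hx, u, hu, rfl⟩ | hw
  · have hu' := Ico_subset_Icc_self hu
    rw [rotate_apply hc _ hx hu', rotate_apply hc _ (hR.mem _ x hx) hu',
      rotate_apply hc _ hx hu', hR.add _ _ x hx]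
    ring_nf
  · rw [rotate_core hR hc _ hw, rotate_core hR hc _ hw, rotate_core hR hc _ hw]

theorem rotate_zero (w : Q.Carrier) : Q.rotate R c 0 w = w := by
  rcases mem_or_openCollar Q.bd c w with ⟨x, hx, u, hu, rfl⟩ | hw
  · rw [rotate_apply hc _ hx (Ico_subset_Icc_self hu), zero_mul, hR.zero x hx]
  · rw [rotate_core hR hc _ hw]

theorem continuous_rotate [CompactSpace S] [T2Space S] (hD : IsClosed D) :
    Continuous fun p : ℝ × Q.Carrier => Q.rotate R c p.1 p.2 :=
  continuous_shear hR hc hD (φ := fun s _ u => s * (1 - u)) (by fun_prop) (by simp)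

/-- The rotation of the faces, as a homeomorphism. -/
noncomputable def rotateHomeo [CompactSpace S] [T2Space S] (hD : IsClosed D) (s : ℝ) :
    Q.Carrier ≃ₜ Q.Carrier where
  toFun := Q.rotate R c s
  invFun := Q.rotate R c (-s)
  left_inv w := by rw [rotate_rotate hR hc, add_neg_cancel, rotate_zero hR hc]
  right_inv w := by rw [rotate_rotate hR hc, neg_add_cancel, rotate_zero hR hc]
  continuous_toFun := (continuous_rotate hR hc hD).comp (.prodMk_right s)
  continuous_invFun := (continuous_rotate hR hc hD).comp (.prodMk_right (-s))

end Rotate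

/-- The regluing of the faces: the involution covering `τ`, followed by the rotation that moves each
corner to the next one. -/
noncomputable def regluing (Q : PatchSystem D V τ) (R : ℝ → Q.Carrier → Q.Carrier)
    (c : Q.Carrier → ℝ → Q.Carrier) (w : Q.Carrier) : Q.Carrier :=
  Q.rotate R c 1 (Q.twistFun w)

section Regluing

variable (hR : Q.IsFlow γ edge R) (hc : IsCollar Q.bd Q.twistFun c)
  (hτD : ∀ y, τ y ∈ D ↔ y ∈ D)
include hR hc hτD

omit hR in
theorem regluing_apply {x : Q.Carrier} (hx : x ∈ Q.bd) {u : ℝ} (hu : u ∈ Icc (0 : ℝ) 1) :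
    Q.regluing R c (c x u) = c (R (1 - u) (Q.twistFun x)) u := by
  rw [regluing, ← hc.twist x hx u hu,
    rotate_apply hc _ (show Q.twistFun x ∈ Q.bd from (hτD _).2 hx) hu, one_mul]

theorem regluing_core (hτ : ∀ y, τ (τ y) = y) {w : Q.Carrier} (hw : w ∉ openCollar Q.bd c) :
    Q.regluing R c w = Q.twistFun w :=
  rotate_core hR hc _ (mt (hc.twist_openCollar (Q.twistFun_twistFun hτ)
    (fun _ hx => (hτD _).2 hx)).1 hw)

theorem regluing_regluing (hτ : ∀ y, τ (τ y) = y) (w : Q.Carrier) :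
    Q.regluing R c (Q.regluing R c w) = w := by
  rcases mem_or_openCollar Q.bd c w with ⟨x, hx, u, hu, rfl⟩ | hw
  · have hx' : Q.twistFun x ∈ Q.bd := (hτD _).2 hx
    have hu' := Ico_subset_Icc_self hu
    rw [regluing_apply hc hτD hx hu', regluing_apply hc hτD (hR.mem _ _ hx') hu',
      hR.twist _ _ hx', Q.twistFun_twistFun hτ, hR.add _ _ _ hx, neg_add_cancel, hR.zero _ hx]
  · have hw' := mt (hc.twist_openCollar (Q.twistFun_twistFun hτ)
      (fun _ hx => (hτD _).2 hx)).1 hw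
    rw [regluing_core hR hc hτD hτ hw, regluing_core hR hc hτD hτ hw', Q.twistFun_twistFun hτ]

/-- A fixed point of the regluing, rotated back half the way, would be a fixed point of `τ`. -/
theorem regluing_ne (hτ : ∀ y, τ (τ y) = y) (hfree : ∀ y, τ y ≠ y) (w : Q.Carrier) :
    Q.regluing R c w ≠ w := by
  intro h
  rcases mem_or_openCollar Q.bd c w with ⟨x, hx, u, hu, rfl⟩ | hw
  · have hx' : Q.twistFun x ∈ Q.bd := (hτD _).2 hx
    have hu' := Ico_subset_Icc_self hu
    rw [regluing_apply hc hτD hx hu'] at h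
    have h1 := (hc.inj _ (hR.mem _ _ hx') _ hx _ hu' _ hu' h).1
    have h2 : Q.twistFun (R (-(1 - u) / 2) x) = R (-(1 - u) / 2) x := by
      conv_rhs => rw [← h1]
      rw [hR.twist _ _ hx, hR.add _ _ _ hx']
      congr 1
      ring
    exact hfree _ (congrArg Q.proj h2)
  · rw [regluing_core hR hc hτD hτ hw] at h
    exact hfree _ (congrArg Q.proj h)

end Regluing

end PatchSystem

namespace PatchSystem

/-! ### Functions on the graph, and the phase -/

variable {S : Type*} [TopologicalSpace S] {D V : Set S} {τ : S ≃ₜ S} {Q : PatchSystem D V τ}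
  {E : Type*} {γ : E → ℝ → S} {edge : Q.Carrier → E} {R : ℝ → Q.Carrier → Q.Carrier}

/-- Edges meet only at their ends. -/
theorem IsEdges.eq_of_eq (hγ : Q.IsEdges γ) {e e' : E} {s s' : ℝ} (hs : s ∈ Icc (0 : ℝ) 1)
    (hs' : s' ∈ Icc (0 : ℝ) 1) (h : γ e s = γ e' s') :
    (e = e' ∧ s = s') ∨ ((s = 0 ∨ s = 1) ∧ (s' = 0 ∨ s' = 1)) := by
  have hV : ∀ e, ∀ s ∈ Icc (0 : ℝ) 1, s ∉ Ioo (0 : ℝ) 1 → (s = 0 ∨ s = 1) ∧ γ e s ∈ V := by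
    intro e s hs hs'
    have : s = 0 ∨ s = 1 := by
      by_contra! hne
      exact hs' ⟨lt_of_le_of_ne hs.1 hne.1.symm, lt_of_le_of_ne hs.2 hne.2⟩
    rcases this with rfl | rfl
    · exact ⟨Or.inl rfl, hγ.zero_mem e⟩
    · exact ⟨Or.inr rfl, hγ.one_mem e⟩
  by_cases h1 : s ∈ Ioo (0 : ℝ) 1
  · by_cases h2 : s' ∈ Ioo (0 : ℝ) 1
    · exact Or.inl (hγ.inj e e' s h1 s' h2 h)
    · exact absurd (h ▸ (hV e' s' hs' h2).2) (hγ.notMem e s h1)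
  · by_cases h2 : s' ∈ Ioo (0 : ℝ) 1
    · exact absurd (h ▸ (hV e s hs h1).2) (hγ.notMem e' s' h2)
    · exact Or.inr ⟨(hV e s hs h1).1, (hV e' s' hs' h2).1⟩

theorem IsEdges.exists_eq (hγ : Q.IsEdges γ) {y : S} (hy : y ∈ D) :
    ∃ e, ∃ s ∈ Ico (0 : ℝ) 1, γ e s = y := by
  by_cases hyV : y ∈ V
  · obtain ⟨e, e', -, h, -⟩ := hγ.start y hyV
    exact ⟨e, 0, ⟨le_rfl, zero_lt_one⟩, (h e).2 (Or.inl rfl)⟩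
  · obtain ⟨e, s, hs, h⟩ := hγ.cover y hy hyV
    exact ⟨e, s, Ioo_subset_Ico_self hs, h⟩

/-- Continuous functions along the edges that agree at the vertices come from a continuous function
on the surface. -/
theorem IsEdges.exists_extension [Finite E] [CompactSpace S] [T2Space S] (hγ : Q.IsEdges γ)
    (hD : IsClosed D) (val : S → ℝ) (φ : E → ℝ → ℝ) (hφ : ∀ e, ContinuousOn (φ e) (Icc 0 1))
    (h0 : ∀ e, φ e 0 = val (γ e 0)) (h1 : ∀ e, φ e 1 = val (γ e 1)) :
    ∃ g : S → ℝ, Continuous g ∧ ∀ e, ∀ s ∈ Icc (0 : ℝ) 1, g (γ e s) = φ e s := by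
  let _ : TopologicalSpace E := ⊥
  have : DiscreteTopology E := ⟨rfl⟩
  have key : ∀ e e', ∀ s ∈ Icc (0 : ℝ) 1, ∀ s' ∈ Icc (0 : ℝ) 1, γ e s = γ e' s' →
      φ e s = φ e' s' := by
    intro e e' s hs s' hs' h
    rcases hγ.eq_of_eq hs hs' h with ⟨rfl, rfl⟩ | ⟨h2, h3⟩
    · rfl
    · have hv : ∀ e s, s = 0 ∨ s = 1 → φ e s = val (γ e s) := by
        rintro e s (rfl | rfl)
        · exact h0 e
        · exact h1 e
      rw [hv e s h2, hv e' s' h3, h]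
  let q : E × Icc (0 : ℝ) 1 → D := fun p => ⟨γ p.1 p.2, hγ.mem _ _⟩
  have hq : Continuous q := by
    refine Continuous.subtype_mk ?_ _
    rw [continuous_prod_of_discrete_left]
    exact fun e => (hγ.continuous e).comp continuous_subtype_val
  have hsurj : Function.Surjective q := by
    rintro ⟨y, hy⟩
    obtain ⟨e, s, hs, h⟩ := hγ.exists_eq hy
    exact ⟨(e, ⟨s, Ico_subset_Icc_self hs⟩), Subtype.ext h⟩
  have hquot : IsQuotientMap q := hq.isClosedMap.isQuotientMap hq hsurj
  choose l hl using hsurj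
  have hf : ∀ p, φ (l (q p)).1 (l (q p)).2 = φ p.1 p.2 := fun p =>
    key _ _ _ (l (q p)).2.2 _ p.2.2 (congrArg Subtype.val (hl (q p)))
  have hfc : Continuous fun y : D => φ (l y).1 (l y).2 := by
    rw [hquot.continuous_iff]
    refine Continuous.congr (f := fun p : E × Icc (0 : ℝ) 1 => φ p.1 p.2) ?_ fun p => (hf p).symm
    rw [continuous_prod_of_discrete_left]
    exact fun e => continuousOn_iff_continuous_domRestrict.1 (hφ e)
  obtain ⟨g, hg⟩ := ContinuousMap.exists_restrict_eq hD ⟨_, hfc⟩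
  refine ⟨g, g.continuous, fun e s hs => ?_⟩
  have := congrArg (fun f : C(D, ℝ) => f (q (e, ⟨s, hs⟩))) hg
  exact this.trans (hf (e, ⟨s, hs⟩))

/-- The phase of a boundary point: twice the distance to the closest corner, along the side. -/
structure IsPhase (Q : PatchSystem D V τ) (R : ℝ → Q.Carrier → Q.Carrier)
    (κ : Q.Carrier → ℝ) : Prop where
  continuous : Continuous κ
  apply : ∀ α, Q.proj α ∈ V → ∀ s ∈ Icc (0 : ℝ) 1, κ (R s α) = 1 - |2 * s - 1|

theorem IsFlow.exists_isPhase [Finite E] [CompactSpace S] [T2Space S] (hR : Q.IsFlow γ edge R)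
    (hγ : Q.IsEdges γ) (hD : IsClosed D) : ∃ κ, Q.IsPhase R κ := by
  obtain ⟨g, hg, h⟩ := hγ.exists_extension hD 0 (fun _ s => 1 - |2 * s - 1|)
    (fun _ => by fun_prop) (by simp) (fun _ => by norm_num)
  refine ⟨g ∘ Q.proj, hg.comp Q.continuous_proj, fun α hα s hs => ?_⟩
  rw [Function.comp_apply, hR.proj_eq α hα s hs, h _ s hs]

section Phase

variable (hR : Q.IsFlow γ edge R) (hVD : V ⊆ D) (hτ : ∀ y, τ (τ y) = y)
  (hτV : ∀ y, y ∈ V → τ y ∈ V)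
include hR hVD hτ hτV

theorem IsFlow.neg_one_mem {α : Q.Carrier} (hα : Q.proj α ∈ V) : Q.proj (R (-1) α) ∈ V := by
  have h1 : Q.proj (Q.twistFun α) ∈ V := hτV _ hα
  have h2 := hτV _ (hR.one_mem _ h1)
  rw [← Q.proj_twistFun, hR.twist _ _ (hVD h1), Q.twistFun_twistFun hτ] at h2
  exact h2

/-- Corners are moved to corners in integral times. -/
theorem IsFlow.int_mem (n : ℤ) {α : Q.Carrier} (hα : Q.proj α ∈ V) : Q.proj (R n α) ∈ V := by
  induction n using Int.induction_on with
  | zero => rw [Int.cast_zero, hR.zero _ (hVD hα)]; exact hα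
  | succ n ih =>
    have := hR.one_mem _ ih
    rw [hR.add _ _ _ (hVD hα)] at this
    exact_mod_cast this
  | pred n ih =>
    have := hR.neg_one_mem hVD hτ hτV ih
    rw [hR.add _ _ _ (hVD hα)] at this
    convert this using 3
    push_cast
    ring

variable {κ : Q.Carrier → ℝ} (hκ : Q.IsPhase R κ)
include hκ

/-- On a boundary circle, parametrised so that the corners are the integers, the phase is twice the
distance to the closest integer. -/
theorem IsPhase.eq_round {α : Q.Carrier} (hα : Q.proj α ∈ V) (x : ℝ) :
    κ (R x α) = 2 * |x - round x| := by
  have h1 := hR.int_mem hVD hτ hτV ⌊x⌋ hα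
  have h2 := hκ.apply _ h1 (Int.fract x) ⟨Int.fract_nonneg x, (Int.fract_lt_one x).le⟩
  rw [hR.add _ _ _ (hVD hα), Int.floor_add_fract] at h2
  rw [h2, abs_sub_round_eq_min]
  rcases le_total (Int.fract x) (1 - Int.fract x) with h | h
  · rw [min_eq_left h, abs_of_nonpos (by linarith)]; ring
  · rw [min_eq_right h, abs_of_nonneg (by linarith)]; ring

theorem IsPhase.mem_Icc {z : Q.Carrier} (hz : z ∈ Q.bd) : κ z ∈ Icc (0 : ℝ) 1 := by
  obtain ⟨α, hα, s, hs, rfl⟩ := hR.exists_eq z hz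
  rw [hκ.eq_round hR hVD hτ hτV hα]
  have := abs_sub_round s
  exact ⟨by positivity, by linarith⟩

theorem IsPhase.twist {z : Q.Carrier} (hz : z ∈ Q.bd) : κ (Q.twistFun z) = κ z := by
  obtain ⟨α, hα, s, hs, rfl⟩ := hR.exists_eq z hz
  have h1 : Q.proj (Q.twistFun α) ∈ V := hτV _ hα
  have h2 := hR.neg_one_mem hVD hτ hτV h1
  have h3 := hκ.apply _ h2 (1 - s) ⟨by linarith [hs.2], by linarith [hs.1]⟩
  rw [hR.add _ _ _ (hVD h1)] at h3
  rw [hR.twist _ _ (hVD hα), hκ.apply _ hα s (Ico_subset_Icc_self hs)]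
  convert h3 using 2
  · ring_nf
  · rw [abs_sub_comm]; congr 1; ring

omit hτ hτV in
theorem IsPhase.half {z : Q.Carrier} (hz : z ∈ Q.bd) : κ (R (1 / 2) z) = 1 - κ z := by
  obtain ⟨α, hα, s, hs, rfl⟩ := hR.exists_eq z hz
  rw [hR.add _ _ _ (hVD hα), hκ.apply _ hα s (Ico_subset_Icc_self hs)]
  rcases le_or_gt s (1 / 2) with h | h
  · rw [hκ.apply _ hα _ ⟨by linarith [hs.1], by linarith⟩, abs_of_nonneg (by linarith [hs.1]),
      abs_of_nonpos (by linarith)]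
    ring
  · have h3 := hκ.apply _ (hR.one_mem α hα) (s - 1 / 2) ⟨by linarith, by linarith [hs.2]⟩
    rw [hR.add _ _ _ (hVD hα)] at h3
    rw [show s + 1 / 2 = 1 + (s - 1 / 2) by ring, h3, abs_of_nonpos (by linarith [hs.2]),
      abs_of_nonneg (by linarith)]
    ring

/-- The phase changes at most at twice the rate of the flow. -/
theorem IsPhase.lipschitz {z : Q.Carrier} (hz : z ∈ Q.bd) (a : ℝ) :
    |κ (R a z) - κ z| ≤ 2 * |a| := by
  obtain ⟨α, hα, s, hs, rfl⟩ := hR.exists_eq z hz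
  rw [hR.add _ _ _ (hVD hα), hκ.eq_round hR hVD hτ hτV hα, hκ.eq_round hR hVD hτ hτV hα]
  have key : ∀ x y : ℝ, |x - round x| ≤ |y - round y| + |x - y| := by
    intro x y
    calc |x - round x| ≤ |x - round y| := round_le x _
      _ = |(y - round y) + (x - y)| := by ring_nf
      _ ≤ _ := abs_add_le _ _
  have h1 := key (s + a) s
  have h2 := key s (s + a)
  rw [show s + a - s = a by ring] at h1
  rw [show s - (s + a) = -a by ring, abs_neg] at h2
  rw [abs_le]
  constructor <;> linarith

end Phase

end PatchSystem

namespace PatchSystem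

/-! ### Sweeping the faces over the product -/

variable {S : Type*} [TopologicalSpace S] {D V : Set S} {τ : S ≃ₜ S} {Q : PatchSystem D V τ}
  {E : Type*} {γ : E → ℝ → S} {edge : Q.Carrier → E} {R : ℝ → Q.Carrier → Q.Carrier}
  {c : Q.Carrier → ℝ → Q.Carrier} {κ : Q.Carrier → ℝ} {k : S → ℝ}

/-- The standing assumptions on the edges of `D`, the flow, the collar and the phase, and on the
length `k` of the vertical segments above height `1`. -/
structure IsFaceData (Q : PatchSystem D V τ) (γ : E → ℝ → S) (edge : Q.Carrier → E)
    (R : ℝ → Q.Carrier → Q.Carrier) (c : Q.Carrier → ℝ → Q.Carrier) (κ : Q.Carrier → ℝ)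
    (k : S → ℝ) : Prop where
  closed : IsClosed D
  subset : V ⊆ D
  invol : ∀ y, τ (τ y) = y
  free : ∀ y, τ y ≠ y
  tau_mem_diag : ∀ y, τ y ∈ D ↔ y ∈ D
  tau_mem_vert : ∀ y, y ∈ V → τ y ∈ V
  edges : Q.IsEdges γ
  flow : Q.IsFlow γ edge R
  collar : IsCollar Q.bd Q.twistFun c
  phase : Q.IsPhase R κ
  continuous_len : Continuous k
  len_pos : ∀ y, 0 < k y

/-- The source map: over the point at parameter `ε` of the segment over `w` lies the point of the
face that is pushed there. -/
noncomputable def src (Q : PatchSystem D V τ) (R : ℝ → Q.Carrier → Q.Carrier)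
    (c : Q.Carrier → ℝ → Q.Carrier) (κ : Q.Carrier → ℝ) (ε : ℝ) : Q.Carrier → Q.Carrier :=
  Q.shear R c fun x u => (1 - u) * (1 - ε) * κ (R (u * (1 - ε) / 4) x) / 2

/-- The target map: the base point of the vertical line to which the point is pushed. -/
noncomputable def tgt (Q : PatchSystem D V τ) (R : ℝ → Q.Carrier → Q.Carrier)
    (c : Q.Carrier → ℝ → Q.Carrier) (κ : Q.Carrier → ℝ) (ε : ℝ) : Q.Carrier → Q.Carrier :=
  Q.shear R c fun x u => -((1 - u) * (1 - ε) * κ (R (u * (1 - ε) / 4) x) / 2)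

/-- The height to which the point is pushed, up to the term with `k`. -/
noncomputable def preHeight (Q : PatchSystem D V τ) (R : ℝ → Q.Carrier → Q.Carrier)
    (c : Q.Carrier → ℝ → Q.Carrier) (κ : Q.Carrier → ℝ) (ε : ℝ) : Q.Carrier → ℝ :=
  glueCollar Q.bd c (fun x u => 1 - 2 * ((1 - u) * (1 - ε)) * κ (R (u * (1 - ε) / 4) x) -
    u * (1 - ε)) fun _ => ε

/-- The height to which the point is pushed. -/
noncomputable def height (Q : PatchSystem D V τ) (R : ℝ → Q.Carrier → Q.Carrier)
    (c : Q.Carrier → ℝ → Q.Carrier) (κ : Q.Carrier → ℝ) (k : S → ℝ) (ε : ℝ) (w : Q.Carrier) : ℝ :=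
  Q.preHeight R c κ ε w + k (Q.proj (Q.tgt R c κ ε w)) * ε

namespace IsFaceData

variable (h : Q.IsFaceData γ edge R c κ k)
include h

theorem phase_mem {z : Q.Carrier} (hz : z ∈ Q.bd) : κ z ∈ Icc (0 : ℝ) 1 :=
  h.phase.mem_Icc h.flow h.subset h.invol h.tau_mem_vert hz

theorem phase_sub_le {z : Q.Carrier} (hz : z ∈ Q.bd) (a : ℝ) : |κ (R a z) - κ z| ≤ 2 * |a| :=
  h.phase.lipschitz h.flow h.subset h.invol h.tau_mem_vert hz a

theorem phase_twist {z : Q.Carrier} (hz : z ∈ Q.bd) : κ (Q.twistFun z) = κ z :=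
  h.phase.twist h.flow h.subset h.invol h.tau_mem_vert hz

theorem phase_half {z : Q.Carrier} (hz : z ∈ Q.bd) : κ (R (1 / 2) z) = 1 - κ z :=
  h.phase.half h.flow h.subset hz

theorem twist_mem {z : Q.Carrier} (hz : z ∈ Q.bd) : Q.twistFun z ∈ Q.bd :=
  (h.tau_mem_diag _).2 hz

omit h in
/-- A point off the boundary is determined by its image. -/
theorem eq_of_proj {z w : Q.Carrier} (hz : z ∉ Q.bd) (hzw : Q.proj z = Q.proj w) : z = w :=
  Q.injOn_proj hz (fun hw => hz (show Q.proj z ∈ D by rw [hzw]; exact hw)) hzw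

theorem continuousOn_offset_phase : ContinuousOn (fun p : ℝ × Q.Carrier × ℝ =>
    κ (R (p.2.2 * (1 - p.1) / 4) p.2.1)) (univ ×ˢ Q.bd ×ˢ Icc 0 1) := by
  refine h.phase.continuous.comp_continuousOn ?_
  exact h.flow.continuousOn.comp (f := fun p : ℝ × Q.Carrier × ℝ =>
    (p.2.2 * (1 - p.1) / 4, p.2.1)) (by fun_prop) fun p hp => ⟨mem_univ _, hp.2.1⟩

section Continuity

variable [CompactSpace S] [T2Space S]

theorem continuous_src : Continuous fun p : ℝ × Q.Carrier => Q.src R c κ p.1 p.2 := by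
  have h1 := h.continuousOn_offset_phase
  exact continuous_shear h.flow h.collar h.closed
    (φ := fun ε x u => (1 - u) * (1 - ε) * κ (R (u * (1 - ε) / 4) x) / 2)
    ((ContinuousOn.mul (by fun_prop) h1).div_const 2) (by simp)

theorem continuous_tgt : Continuous fun p : ℝ × Q.Carrier => Q.tgt R c κ p.1 p.2 := by
  have h1 := h.continuousOn_offset_phase
  exact continuous_shear h.flow h.collar h.closed
    (φ := fun ε x u => -((1 - u) * (1 - ε) * κ (R (u * (1 - ε) / 4) x) / 2))
    ((ContinuousOn.mul (by fun_prop) h1).div_const 2).neg (by simp)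

theorem continuous_height : Continuous fun p : ℝ × Q.Carrier => Q.height R c κ k p.1 p.2 := by
  have h1 := h.continuousOn_offset_phase
  have h2 : Continuous fun p : ℝ × Q.Carrier => Q.preHeight R c κ p.1 p.2 :=
    h.collar.continuous_glueCollar (h.closed.preimage Q.continuous_proj)
      (g := fun ε x u => 1 - 2 * ((1 - u) * (1 - ε)) * κ (R (u * (1 - ε) / 4) x) - u * (1 - ε))
      (h := fun ε _ => ε)
      ((continuousOn_const.sub (ContinuousOn.mul (by fun_prop) h1)).sub (by fun_prop))
      (by fun_prop) (by intros; ring)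
  exact h2.add (((h.continuous_len.comp Q.continuous_proj).comp h.continuous_tgt).mul
    continuous_fst)

end Continuity

/-- In the collar, the level at `u` is best described by the point at which the phase is taken. -/
theorem cases (ε : ℝ) (w : Q.Carrier) :
    (∃ z ∈ Q.bd, ∃ u ∈ Ico (0 : ℝ) 1, c (R (-(u * (1 - ε) / 4)) z) u = w) ∨
      w ∉ openCollar Q.bd c := by
  rcases mem_or_openCollar Q.bd c w with ⟨x, hx, u, hu, rfl⟩ | hw
  · refine Or.inl ⟨R (u * (1 - ε) / 4) x, h.flow.mem _ _ hx, u, hu, ?_⟩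
    rw [h.flow.add _ _ _ hx, add_neg_cancel, h.flow.zero _ hx]
  · exact Or.inr hw

theorem src_apply (ε : ℝ) {z : Q.Carrier} (hz : z ∈ Q.bd) {u : ℝ} (hu : u ∈ Icc (0 : ℝ) 1) :
    Q.src R c κ ε (c (R (-(u * (1 - ε) / 4)) z) u) =
      c (R ((1 - u) * (1 - ε) * κ z / 2 - u * (1 - ε) / 4) z) u := by
  rw [src, shear_apply h.collar _ (h.flow.mem _ _ hz) hu, h.flow.add _ _ _ hz,
    h.flow.add _ _ _ hz, neg_add_cancel, h.flow.zero _ hz]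
  congr 2
  ring

theorem tgt_apply (ε : ℝ) {z : Q.Carrier} (hz : z ∈ Q.bd) {u : ℝ} (hu : u ∈ Icc (0 : ℝ) 1) :
    Q.tgt R c κ ε (c (R (-(u * (1 - ε) / 4)) z) u) =
      c (R (-((1 - u) * (1 - ε) * κ z / 2) - u * (1 - ε) / 4) z) u := by
  rw [tgt, shear_apply h.collar _ (h.flow.mem _ _ hz) hu, h.flow.add _ _ _ hz,
    h.flow.add _ _ _ hz, neg_add_cancel, h.flow.zero _ hz]
  congr 2
  ring

theorem preHeight_apply (ε : ℝ) {z : Q.Carrier} (hz : z ∈ Q.bd) {u : ℝ}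
    (hu : u ∈ Icc (0 : ℝ) 1) :
    Q.preHeight R c κ ε (c (R (-(u * (1 - ε) / 4)) z) u) =
      1 - 2 * ((1 - u) * (1 - ε)) * κ z - u * (1 - ε) := by
  rw [preHeight, h.collar.glueCollar_apply _ _ (h.flow.mem _ _ hz) hu, h.flow.add _ _ _ hz,
    neg_add_cancel, h.flow.zero _ hz]

theorem src_core (ε : ℝ) {w : Q.Carrier} (hw : w ∉ openCollar Q.bd c) : Q.src R c κ ε w = w :=
  shear_core h.flow h.collar (by simp) hw

theorem tgt_core (ε : ℝ) {w : Q.Carrier} (hw : w ∉ openCollar Q.bd c) : Q.tgt R c κ ε w = w :=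
  shear_core h.flow h.collar (by simp) hw

theorem preHeight_core (ε : ℝ) {w : Q.Carrier} (hw : w ∉ openCollar Q.bd c) :
    Q.preHeight R c κ ε w = ε :=
  h.collar.glueCollar_core (by intros; ring) hw

theorem mem_bd_of_apply {z : Q.Carrier} (hz : z ∈ Q.bd) {u : ℝ} (hu : u ∈ Ico (0 : ℝ) 1) {a b : ℝ}
    (hc : c (R a z) u ∈ Q.bd) : c (R b z) u ∈ Q.bd := by
  rw [h.collar.mem_iff (h.flow.mem _ _ hz) (Ico_subset_Icc_self hu)] at hc ⊢
  exact hc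

theorem src_mem {ε : ℝ} {w : Q.Carrier} : Q.src R c κ ε w ∈ Q.bd ↔ w ∈ Q.bd := by
  rcases h.cases ε w with ⟨z, hz, u, hu, rfl⟩ | hw
  · rw [h.src_apply ε hz (Ico_subset_Icc_self hu)]
    exact ⟨h.mem_bd_of_apply hz hu, h.mem_bd_of_apply hz hu⟩
  · rw [h.src_core ε hw]

theorem tgt_mem {ε : ℝ} {w : Q.Carrier} : Q.tgt R c κ ε w ∈ Q.bd ↔ w ∈ Q.bd := by
  rcases h.cases ε w with ⟨z, hz, u, hu, rfl⟩ | hw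
  · rw [h.tgt_apply ε hz (Ico_subset_Icc_self hu)]
    exact ⟨h.mem_bd_of_apply hz hu, h.mem_bd_of_apply hz hu⟩
  · rw [h.tgt_core ε hw]

/-! ### The sweep off the boundary -/

omit [TopologicalSpace S] h in
/-- The factor by which the phase is damped at depth `u` of the collar and at parameter `ε` of the
product.  It is less than `1` off the boundary, which is what makes the sweep injective there. -/
theorem slack_lt {u ε : ℝ} (hu : u ∈ Ico (0 : ℝ) 1) (hu0 : u ≠ 0) (hε : ε ∈ Icc (0 : ℝ) 1) :
    0 ≤ (1 - u) * (1 - ε) ∧ (1 - u) * (1 - ε) < 1 := by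
  have : 0 < u := lt_of_le_of_ne hu.1 hu0.symm
  constructor
  · exact mul_nonneg (by linarith [hu.2]) (by linarith [hε.2])
  · nlinarith [hu.2, hε.1, hε.2]

/-- Off the boundary the source map is injective, since the phase is Lipschitz. -/
theorem eq_of_src_eq {ε : ℝ} (hε : ε ∈ Icc (0 : ℝ) 1) {w w' : Q.Carrier} (hw : w ∉ Q.bd)
    (hww : Q.src R c κ ε w = Q.src R c κ ε w') : w = w' := by
  have hcoll : ∀ z ∈ Q.bd, ∀ u ∈ Ico (0 : ℝ) 1, ∀ a, c (R a z) u ∈ openCollar Q.bd c :=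
    fun z hz u hu a => ⟨(R a z, u), ⟨h.flow.mem _ _ hz, hu⟩, rfl⟩
  rcases h.cases ε w with ⟨z, hz, u, hu, rfl⟩ | hwc <;>
    rcases h.cases ε w' with ⟨z', hz', u', hu', rfl⟩ | hwc'
  · have hI := Ico_subset_Icc_self hu
    have hI' := Ico_subset_Icc_self hu'
    rw [h.src_apply ε hz hI, h.src_apply ε hz' hI'] at hww
    obtain ⟨h1, rfl⟩ := h.collar.inj _ (h.flow.mem _ _ hz) _ (h.flow.mem _ _ hz') _ hI _ hI' hww
    have hu0 : u ≠ 0 := fun h0 => hw ((h.collar.mem_iff (h.flow.mem _ _ hz) hI).2 h0)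
    obtain ⟨m0, m1⟩ := slack_lt hu hu0 hε
    set m := (1 - u) * (1 - ε)
    have h2 : R (m * (κ z - κ z') / 2) z = z' := by
      have := congrArg (R (-(m * κ z' / 2 - u * (1 - ε) / 4))) h1
      rw [h.flow.add _ _ _ hz, h.flow.add _ _ _ hz', add_neg_cancel, h.flow.zero _ hz'] at this
      refine Eq.trans ?_ this
      congr 1
      ring
    have h3 := h.phase_sub_le hz (m * (κ z - κ z') / 2)
    rw [h2, abs_div, abs_mul, abs_of_nonneg m0, abs_two, abs_sub_comm] at h3
    have h4 : κ z = κ z' := by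
      by_contra hne
      have : 0 < |κ z - κ z'| := abs_pos.2 (sub_ne_zero.2 hne)
      nlinarith
    rw [h4, sub_self, mul_zero, zero_div, h.flow.zero _ hz] at h2
    rw [h2]
  · rw [h.src_apply ε hz (Ico_subset_Icc_self hu), h.src_core ε hwc'] at hww
    exact absurd (hww ▸ hcoll z hz u hu _) hwc'
  · rw [h.src_apply ε hz' (Ico_subset_Icc_self hu'), h.src_core ε hwc] at hww
    exact absurd (hww ▸ hcoll z' hz' u' hu' _) hwc
  · rwa [h.src_core ε hwc, h.src_core ε hwc'] at hww

/-- Off the boundary the sweep is injective. -/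
theorem eq_of_tgt_eq {ε ε' : ℝ} (hε : ε ∈ Icc (0 : ℝ) 1) (hε' : ε' ∈ Icc (0 : ℝ) 1)
    {w w' : Q.Carrier} (hw : w ∉ Q.bd) (hww : Q.tgt R c κ ε w = Q.tgt R c κ ε' w')
    (hh : Q.height R c κ k ε w = Q.height R c κ k ε' w') : w = w' ∧ ε = ε' := by
  have hcoll : ∀ z ∈ Q.bd, ∀ u ∈ Ico (0 : ℝ) 1, ∀ a, c (R a z) u ∈ openCollar Q.bd c :=
    fun z hz u hu a => ⟨(R a z, u), ⟨h.flow.mem _ _ hz, hu⟩, rfl⟩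
  wlog hle : ε ≤ ε' generalizing ε ε' w w'
  · have hw' : w' ∉ Q.bd := fun hb => hw (h.tgt_mem.1 (hww ▸ h.tgt_mem.2 hb))
    obtain ⟨h1, h2⟩ := this hε' hε hw' hww.symm hh.symm (le_of_not_ge hle)
    exact ⟨h1.symm, h2.symm⟩
  rw [height, height, ← hww] at hh
  have hk := h.len_pos (Q.proj (Q.tgt R c κ ε w))
  set K := k (Q.proj (Q.tgt R c κ ε w))
  rcases h.cases ε w with ⟨z, hz, u, hu, rfl⟩ | hwc <;>
    rcases h.cases ε' w' with ⟨z', hz', u', hu', rfl⟩ | hwc'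
  · have hI := Ico_subset_Icc_self hu
    have hI' := Ico_subset_Icc_self hu'
    rw [h.tgt_apply ε hz hI, h.tgt_apply ε' hz' hI'] at hww
    obtain ⟨h1, rfl⟩ := h.collar.inj _ (h.flow.mem _ _ hz) _ (h.flow.mem _ _ hz') _ hI _ hI' hww
    have hu0 : u ≠ 0 := fun h0 => hw ((h.collar.mem_iff (h.flow.mem _ _ hz) hI).2 h0)
    rw [h.preHeight_apply ε hz hI, h.preHeight_apply ε' hz' hI'] at hh
    obtain ⟨m0, m1⟩ := slack_lt hu hu0 hε
    obtain ⟨m0', m1'⟩ := slack_lt hu hu0 hε'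
    have hmm : (1 - u) * (1 - ε') ≤ (1 - u) * (1 - ε) :=
      mul_le_mul_of_nonneg_left (by linarith) (by linarith [hu.2])
    have hoo : u * (1 - ε') ≤ u * (1 - ε) := mul_le_mul_of_nonneg_left (by linarith) hu.1
    set m := (1 - u) * (1 - ε)
    set m' := (1 - u) * (1 - ε')
    set δ := (-(m * κ z / 2) - u * (1 - ε) / 4) - (-(m' * κ z' / 2) - u * (1 - ε') / 4) with hδ
    have h2 : R δ z = z' := by
      have := congrArg (R (-(-(m' * κ z' / 2) - u * (1 - ε') / 4))) h1
      rw [h.flow.add _ _ _ hz, h.flow.add _ _ _ hz', add_neg_cancel, h.flow.zero _ hz'] at this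
      rw [← this]
      congr 1
    have hδ4 : 4 * δ = K * (ε' - ε) := by rw [hδ]; linarith
    have hδ0 : 0 ≤ δ := by nlinarith
    have h3 := h.phase_sub_le hz δ
    rw [h2, abs_of_nonneg hδ0] at h3
    have h4 := (abs_le.1 h3).2
    have hκ := (h.phase_mem hz).1
    have h5 : δ ≤ m' * δ := by nlinarith [mul_le_mul_of_nonneg_right hmm hκ]
    have h6 : δ = 0 := by nlinarith
    have h7 : ε = ε' := by
      rw [h6, mul_zero] at hδ4
      rcases mul_eq_zero.1 hδ4.symm with h8 | h8 <;> linarith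
    rw [h6, h.flow.zero _ hz] at h2
    rw [h2, h7]
    exact ⟨rfl, rfl⟩
  · rw [h.tgt_apply ε hz (Ico_subset_Icc_self hu), h.tgt_core ε' hwc'] at hww
    exact absurd (hww ▸ hcoll z hz u hu _) hwc'
  · rw [h.tgt_apply ε' hz' (Ico_subset_Icc_self hu'), h.tgt_core ε hwc] at hww
    exact absurd (hww ▸ hcoll z' hz' u' hu' _) hwc
  · rw [h.preHeight_core ε hwc, h.preHeight_core ε' hwc'] at hh
    rw [h.tgt_core ε hwc, h.tgt_core ε' hwc'] at hww
    exact ⟨hww, by nlinarith⟩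

/-- The source at parameter `0` of the point opposite to a given one is reglued to the source of
the latter. -/
theorem src_opposite {z : Q.Carrier} (hz : z ∈ Q.bd) {u : ℝ} (hu : u ∈ Icc (0 : ℝ) 1) :
    Q.src R c κ 0 (c (R (-(u * (1 - 0) / 4)) (R (1 / 2) (Q.twistFun z))) u) =
      Q.regluing R c (Q.src R c κ 0 (c (R (-(u * (1 - 0) / 4)) z) u)) := by
  have hz' := h.twist_mem hz
  rw [h.src_apply 0 (h.flow.mem _ _ hz') hu, h.src_apply 0 hz hu,
    regluing_apply h.collar h.tau_mem_diag (h.flow.mem _ _ hz) hu, h.flow.twist _ _ hz,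
    h.flow.add _ _ _ hz', h.flow.add _ _ _ hz', h.phase_half hz', h.phase_twist hz]
  congr 2
  ring

/-- Off the boundary, opposite points of the sweep come from faces that are glued. -/
theorem regluing_of_tgt_eq {ε ε' : ℝ} (hε : ε ∈ Icc (0 : ℝ) 1) (hε' : ε' ∈ Icc (0 : ℝ) 1)
    {w w' : Q.Carrier} (hw : w ∉ Q.bd)
    (hww : Q.tgt R c κ ε' w' = Q.twistFun (Q.tgt R c κ ε w))
    (hh : Q.height R c κ k ε' w' = -Q.height R c κ k ε w) :
    ε = 0 ∧ ε' = 0 ∧ Q.src R c κ 0 w' = Q.regluing R c (Q.src R c κ 0 w) := by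
  have hcoll : ∀ z ∈ Q.bd, ∀ u ∈ Ico (0 : ℝ) 1, ∀ a, c (R a z) u ∈ openCollar Q.bd c :=
    fun z hz u hu a => ⟨(R a z, u), ⟨h.flow.mem _ _ hz, hu⟩, rfl⟩
  have htw : ∀ {w}, Q.twistFun w ∈ openCollar Q.bd c ↔ w ∈ openCollar Q.bd c :=
    h.collar.twist_openCollar (Q.twistFun_twistFun h.invol) fun _ => h.twist_mem
  rw [height, height] at hh
  have hK := h.len_pos (Q.proj (Q.tgt R c κ ε w))
  have hK' := h.len_pos (Q.proj (Q.tgt R c κ ε' w'))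
  set K := k (Q.proj (Q.tgt R c κ ε w))
  set K' := k (Q.proj (Q.tgt R c κ ε' w'))
  have hKε : 0 ≤ K * ε := mul_nonneg hK.le hε.1
  have hKε' : 0 ≤ K' * ε' := mul_nonneg hK'.le hε'.1
  have hzero : K * ε + K' * ε' = 0 → ε = 0 ∧ ε' = 0 := fun h0 =>
    ⟨(mul_eq_zero.1 (by linarith : K * ε = 0)).resolve_left hK.ne',
      (mul_eq_zero.1 (by linarith : K' * ε' = 0)).resolve_left hK'.ne'⟩
  rcases h.cases ε w with ⟨z, hz, u, hu, rfl⟩ | hwc <;>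
    rcases h.cases ε' w' with ⟨z', hz', u', hu', rfl⟩ | hwc'
  · have hI := Ico_subset_Icc_self hu
    have hI' := Ico_subset_Icc_self hu'
    have htz := h.twist_mem hz
    rw [h.tgt_apply ε hz hI, h.tgt_apply ε' hz' hI', ← h.collar.twist _ (h.flow.mem _ _ hz) _ hI,
      h.flow.twist _ _ hz] at hww
    obtain ⟨h1, rfl⟩ := h.collar.inj _ (h.flow.mem _ _ hz') _ (h.flow.mem _ _ htz) _ hI' _ hI hww
    have hu0 : u' ≠ 0 := fun h0 => hw ((h.collar.mem_iff (h.flow.mem _ _ hz) hI).2 h0)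
    have hupos : 0 < u' := lt_of_le_of_ne hu.1 hu0.symm
    rw [h.preHeight_apply ε hz hI, h.preHeight_apply ε' hz' hI'] at hh
    have hM : ∀ ε ∈ Icc (0 : ℝ) 1, (1 - u') * (1 - ε) ≤ 1 - u' ∧ u' * (1 - ε) ≤ u' := by
      intro ε hε
      constructor <;> nlinarith [hε.1, hu.2]
    obtain ⟨hm, ho⟩ := hM ε hε
    obtain ⟨hm', ho'⟩ := hM ε' hε'
    set P := -((1 - u') * (1 - ε) * κ z / 2) - u' * (1 - ε) / 4 with hP
    set P' := -((1 - u') * (1 - ε') * κ z' / 2) - u' * (1 - ε') / 4 with hP'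
    set Δ := (K * ε + K' * ε') / 4 with hΔ
    have hΔ0 : 0 ≤ Δ := by positivity
    have hPP : -P - P' = 1 / 2 + Δ := by rw [hP, hP', hΔ]; linarith
    have h2 : z' = R Δ (R (1 / 2) (Q.twistFun z)) := by
      have := congrArg (R (-P')) h1
      rw [h.flow.add _ _ _ hz', add_neg_cancel, h.flow.zero _ hz', h.flow.add _ _ _ htz] at this
      rw [this, h.flow.add _ _ _ htz, ← hPP]
      congr 1
    have h3 := h.phase_sub_le (h.flow.mem (1 / 2) _ htz) Δ
    rw [← h2, abs_of_nonneg hΔ0, h.phase_half htz, h.phase_twist hz] at h3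
    have h4 := (abs_le.1 h3).2
    have hκ := (h.phase_mem hz).1
    have hκ' := (h.phase_mem hz').1
    -- the two phases nearly add up to one, and the push is a fraction of them
    have h5 : Δ ≤ (1 - u') * Δ := by
      have e1 := mul_le_mul_of_nonneg_right hm hκ
      have e2 := mul_le_mul_of_nonneg_right hm' hκ'
      have e3 := mul_le_mul_of_nonneg_left h4 (by linarith [hu.2] : 0 ≤ 1 - u')
      rw [hP, hP'] at hPP
      nlinarith
    have h6 : Δ = 0 := by nlinarith
    obtain ⟨rfl, rfl⟩ := hzero (by rw [hΔ] at h6; linarith)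
    refine ⟨rfl, rfl, ?_⟩
    rw [h2, h6, h.flow.zero _ (h.flow.mem _ _ htz)]
    exact h.src_opposite hz hI
  · rw [h.tgt_apply ε hz (Ico_subset_Icc_self hu), h.tgt_core ε' hwc'] at hww
    exact absurd (hww ▸ htw.2 (hcoll z hz u hu _)) hwc'
  · rw [h.tgt_apply ε' hz' (Ico_subset_Icc_self hu'), h.tgt_core ε hwc] at hww
    exact absurd (htw.1 (hww ▸ hcoll z' hz' u' hu' _)) hwc
  · rw [h.preHeight_core ε hwc, h.preHeight_core ε' hwc'] at hh
    rw [h.tgt_core ε hwc, h.tgt_core ε' hwc'] at hww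
    obtain ⟨rfl, rfl⟩ := hzero (by linarith [hε.1, hε'.1])
    refine ⟨rfl, rfl, ?_⟩
    rw [h.src_core 0 hwc, h.src_core 0 hwc',
      regluing_core h.flow h.collar h.tau_mem_diag h.invol hwc, hww]

end IsFaceData
end PatchSystem

namespace PatchSystem

/-! ### The sweep over the boundary of the faces -/

variable {S : Type*} [TopologicalSpace S] {D V : Set S} {τ : S ≃ₜ S} {Q : PatchSystem D V τ}
  {E : Type*} {γ : E → ℝ → S} {edge : Q.Carrier → E} {R : ℝ → Q.Carrier → Q.Carrier}
  {c : Q.Carrier → ℝ → Q.Carrier} {κ : Q.Carrier → ℝ} {k : S → ℝ}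

/-- Where it has not yet reached the end of the side, the source map is injective on a side, at a
fixed parameter of the product. -/
theorem eq_of_add_phase_eq {m p p' : ℝ} (h0 : 0 ≤ m) (h1 : m ≤ 1)
    (hs : p + m * (1 - |2 * p - 1|) / 2 < 1)
    (h : p + m * (1 - |2 * p - 1|) / 2 = p' + m * (1 - |2 * p' - 1|) / 2) : p = p' := by
  rcases abs_cases (2 * p - 1) with ⟨h2, h3⟩ | ⟨h2, h3⟩ <;>
    rcases abs_cases (2 * p' - 1) with ⟨h4, h5⟩ | ⟨h4, h5⟩ <;> rw [h2, h4] at h <;>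
    rw [h2] at hs
  · have hm : m ≠ 1 := by rintro rfl; linarith
    have : (1 - m) * (p - p') = 0 := by linarith
    rcases mul_eq_zero.1 this with h6 | h6
    · exact absurd (by linarith) hm
    · linarith
  · have hm : m < 1 := lt_of_le_of_ne h1 (by rintro rfl; linarith)
    nlinarith
  · nlinarith
  · have : (1 + m) * (p - p') = 0 := by linarith
    rcases mul_eq_zero.1 this with h6 | h6 <;> linarith

/-- On a side, the target together with the height determines the point and the parameter. -/
theorem eq_of_sub_phase_eq {K ε ε' p p' : ℝ} (hK : 0 < K) (hε : ε ∈ Icc (0 : ℝ) 1)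
    (hε' : ε' ∈ Icc (0 : ℝ) 1) (hp : p ∈ Icc (0 : ℝ) 1) (hp' : p' ∈ Icc (0 : ℝ) 1)
    (h : p - (1 - ε) * (1 - |2 * p - 1|) / 2 = p' - (1 - ε') * (1 - |2 * p' - 1|) / 2)
    (hh : K * ε - 4 * p = K * ε' - 4 * p') : p = p' ∧ ε = ε' := by
  wlog hle : ε' ≤ ε generalizing ε ε' p p'
  · obtain ⟨h1, h2⟩ := this hε' hε hp' hp h.symm hh.symm (le_of_not_ge hle)
    exact ⟨h1.symm, h2.symm⟩
  have hpp : p' ≤ p := by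
    have := mul_nonneg hK.le (sub_nonneg.2 hle)
    linarith
  have h1 : (1 - |2 * p - 1|) - (1 - |2 * p' - 1|) ≤ 2 * (p - p') := by
    have := abs_sub_abs_le_abs_sub (2 * p' - 1) (2 * p - 1)
    rw [show 2 * p' - 1 - (2 * p - 1) = -(2 * (p - p')) by ring, abs_neg,
      abs_of_nonneg (show 0 ≤ 2 * (p - p') by linarith)] at this
    linarith
  have h2 : 0 ≤ 1 - |2 * p' - 1| := by
    have := abs_le.2 (⟨by linarith [hp'.1], by linarith [hp'.2]⟩ :
      -1 ≤ 2 * p' - 1 ∧ 2 * p' - 1 ≤ 1)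
    linarith
  have h3 : ε * (p - p') ≤ 0 := by
    nlinarith [mul_le_mul_of_nonneg_left h1 (by linarith [hε.2] : 0 ≤ 1 - ε),
      mul_le_mul_of_nonneg_right hle h2]
  have h4 : p = p' := by
    by_contra hne
    have h5 : 0 < p - p' := sub_pos.2 (lt_of_le_of_ne hpp (Ne.symm hne))
    have h6 : ε ≤ 0 := by
      by_contra h7
      exact absurd (mul_pos (not_le.1 h7) h5) (not_lt.2 h3)
    have h7 : ε = ε' := le_antisymm (h6.trans hε'.1) hle
    rw [h7] at hh
    linarith
  refine ⟨h4, ?_⟩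
  have : K * (ε - ε') = 0 := by rw [h4] at hh; linarith
  rcases mul_eq_zero.1 this with h5 | h5 <;> linarith

/-- Two points of the surface, off the vertices, are identified by the regluing of a face. -/
def FaceRel (Q : PatchSystem D V τ) (R : ℝ → Q.Carrier → Q.Carrier)
    (c : Q.Carrier → ℝ → Q.Carrier) (a b : {y : S // y ∉ V}) : Prop :=
  ∃ z, Q.proj z = a ∧ Q.proj (Q.regluing R c z) = b

/-- At each vertex some edge ends: the reversed image under `τ` of an edge is an edge. -/
theorem IsEdges.exists_end (hγ : Q.IsEdges γ) (hτ : ∀ y, τ (τ y) = y)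
    (hτV : ∀ y, y ∈ V → τ y ∈ V) {y : S} (hy : y ∈ V) : ∃ e, γ e 1 = y := by
  obtain ⟨e, e', -, he, -⟩ := hγ.start _ (hτV y hy)
  obtain ⟨d, hd⟩ := hγ.star e
  refine ⟨d, ?_⟩
  rw [hd, sub_self, (he e).2 (Or.inl rfl), hτ]

namespace IsFaceData

variable (h : Q.IsFaceData γ edge R c κ k)
include h

theorem src_bd (ε : ℝ) {z : Q.Carrier} (hz : z ∈ Q.bd) :
    Q.src R c κ ε z = R ((1 - ε) * κ z / 2) z := by
  have := h.src_apply ε hz (u := 0) ⟨le_rfl, zero_le_one⟩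
  simp only [zero_mul, zero_div, neg_zero, h.flow.zero _ hz, h.collar.zero _ hz, sub_zero,
    one_mul] at this
  rw [this, h.collar.zero _ (h.flow.mem _ _ hz)]

theorem tgt_bd (ε : ℝ) {z : Q.Carrier} (hz : z ∈ Q.bd) :
    Q.tgt R c κ ε z = R (-((1 - ε) * κ z / 2)) z := by
  have := h.tgt_apply ε hz (u := 0) ⟨le_rfl, zero_le_one⟩
  simp only [zero_mul, zero_div, neg_zero, h.flow.zero _ hz, h.collar.zero _ hz, sub_zero,
    one_mul] at this
  rw [this, h.collar.zero _ (h.flow.mem _ _ hz)]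

theorem preHeight_bd (ε : ℝ) {z : Q.Carrier} (hz : z ∈ Q.bd) :
    Q.preHeight R c κ ε z = 1 - 2 * (1 - ε) * κ z := by
  have := h.preHeight_apply ε hz (u := 0) ⟨le_rfl, zero_le_one⟩
  simp only [zero_mul, zero_div, neg_zero, h.flow.zero _ hz, h.collar.zero _ hz, sub_zero,
    one_mul] at this
  exact this

omit h in
/-- The phase at parameter `p` of a side is at most twice the distance to either end. -/
theorem phase_bounds {p : ℝ} (hp : p ∈ Icc (0 : ℝ) 1) :
    0 ≤ 1 - |2 * p - 1| ∧ 1 - |2 * p - 1| ≤ 2 * p ∧ 1 - |2 * p - 1| ≤ 2 * (1 - p) := by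
  rcases abs_cases (2 * p - 1) with ⟨h2, h3⟩ | ⟨h2, h3⟩ <;> rw [h2] <;>
    refine ⟨?_, ?_, ?_⟩ <;> linarith [hp.1, hp.2]

/-- The sweep at the point at `p` on its side: the target is at `s`, and the source is at the mirror
image of `s` in `p`. -/
theorem side_eval {ε : ℝ} (hε : ε ∈ Icc (0 : ℝ) 1) {α : Q.Carrier} (hα : Q.proj α ∈ V) {p s : ℝ}
    (hp : p ∈ Icc (0 : ℝ) 1) (hs : p - (1 - ε) * (1 - |2 * p - 1|) / 2 = s) :
    Q.proj (Q.tgt R c κ ε (R p α)) = γ (edge α) s ∧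
      Q.proj (Q.src R c κ ε (R p α)) = γ (edge α) (2 * p - s) ∧
      Q.preHeight R c κ ε (R p α) = 1 - 4 * (p - s) := by
  have hαD : α ∈ Q.bd := h.subset hα
  have hz : R p α ∈ Q.bd := h.flow.mem _ _ hαD
  have hκ : κ (R p α) = 1 - |2 * p - 1| := h.phase.apply α hα p hp
  obtain ⟨h1, h2, h3⟩ := phase_bounds hp
  set φ := 1 - |2 * p - 1|
  have hle : (1 - ε) * φ ≤ φ := mul_le_of_le_one_left h1 (by linarith [hε.1])
  have hge : 0 ≤ (1 - ε) * φ := mul_nonneg (by linarith [hε.2]) h1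
  refine ⟨?_, ?_, ?_⟩
  · rw [h.tgt_bd ε hz, hκ, h.flow.add _ _ _ hαD, ← h.flow.proj_eq α hα s
      ⟨by linarith, by linarith [hp.2]⟩]
    congr 2
  · rw [h.src_bd ε hz, hκ, h.flow.add _ _ _ hαD, ← h.flow.proj_eq α hα (2 * p - s)
      ⟨by linarith [hp.1], by linarith⟩]
    congr 2
    linarith
  · rw [h.preHeight_bd ε hz, hκ]
    linarith

/-- The target of a boundary point lies on a side, at a parameter `s < 1`, and the point itself
lies on the same side, at a parameter `p ≥ s`. -/
theorem exists_base {ε : ℝ} (hε : ε ∈ Icc (0 : ℝ) 1) {w : Q.Carrier} (hw : w ∈ Q.bd) :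
    ∃ α, Q.proj α ∈ V ∧ ∃ s ∈ Ico (0 : ℝ) 1, ∃ p ∈ Icc s 1,
      p - (1 - ε) * (1 - |2 * p - 1|) / 2 = s ∧ w = R p α ∧
      Q.proj (Q.tgt R c κ ε w) = γ (edge α) s ∧
      Q.proj (Q.src R c κ ε w) = γ (edge α) (2 * p - s) ∧
      Q.preHeight R c κ ε w = 1 - 4 * (p - s) := by
  obtain ⟨α, hα, s, hs, hst⟩ := h.flow.exists_eq _ (h.tgt_mem (ε := ε).2 hw)
  have hαD : α ∈ Q.bd := h.subset hα
  rw [h.tgt_bd ε hw] at hst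
  have hκ := h.phase_mem hw
  set p := s + (1 - ε) * κ w / 2 with hp
  have hpw : w = R p α := by
    have := congrArg (R ((1 - ε) * κ w / 2)) hst
    rw [h.flow.add _ _ _ hαD, h.flow.add _ _ _ hw, neg_add_cancel, h.flow.zero _ hw] at this
    exact this.symm
  have hm0 : 0 ≤ (1 - ε) * κ w := mul_nonneg (by linarith [hε.2]) hκ.1
  have hm1 : (1 - ε) * κ w ≤ 1 := mul_le_one₀ (by linarith [hε.1]) hκ.1 hκ.2
  have hps : s ≤ p := by linarith
  have hp1 : p ≤ 1 := by
    by_contra hlt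
    push Not at hlt
    have h1 := h.phase.apply _ (h.flow.one_mem α hα) (p - 1) ⟨by linarith, by linarith [hs.2]⟩
    rw [h.flow.add _ _ _ hαD, show 1 + (p - 1) = p by ring, ← hpw,
      abs_of_nonpos (by linarith [hs.2])] at h1
    rw [h1] at hp
    nlinarith [hs.2, hε.1]
  have hpI : p ∈ Icc (0 : ℝ) 1 := ⟨hs.1.trans hps, hp1⟩
  have hκp : κ w = 1 - |2 * p - 1| := by rw [hpw]; exact h.phase.apply α hα p hpI
  have hs' : p - (1 - ε) * (1 - |2 * p - 1|) / 2 = s := by rw [← hκp]; linarith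
  have := h.side_eval hε hα hpI hs'
  rw [← hpw] at this
  exact ⟨α, hα, s, hs, p, ⟨hps, hp1⟩, hs', hpw, this⟩

/-! ### Well-definedness of the sweep -/

/-- Points of the product with the same source have the same target, except over the vertices. -/
theorem tgt_eq_of_src_eq {ε : ℝ} (hε : ε ∈ Icc (0 : ℝ) 1) {w w' : Q.Carrier}
    (hww : Q.proj (Q.src R c κ ε w) = Q.proj (Q.src R c κ ε w'))
    (hV : ¬ (ε = 0 ∧ Q.proj (Q.src R c κ ε w) ∈ V)) :
    Q.proj (Q.tgt R c κ ε w) = Q.proj (Q.tgt R c κ ε w') ∧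
      Q.height R c κ k ε w = Q.height R c κ k ε w' := by
  by_cases hw : w ∈ Q.bd
  · have hw' : w' ∈ Q.bd := by
      rw [← h.src_mem (ε := ε)] at hw ⊢
      exact show Q.proj _ ∈ D from hww ▸ hw
    suffices hs : Q.proj (Q.tgt R c κ ε w) = Q.proj (Q.tgt R c κ ε w') ∧
        Q.preHeight R c κ ε w = Q.preHeight R c κ ε w' by
      refine ⟨hs.1, ?_⟩
      rw [height, height, hs.1, hs.2]
    obtain ⟨α, hα, s, hs, p, hp, hps, -, h1, h2, h3⟩ := h.exists_base hε hw
    obtain ⟨α', hα', s', hs', p', hp', hps', -, h1', h2', h3'⟩ := h.exists_base hε hw'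
    rw [h2, h2'] at hww
    rw [h2] at hV
    rw [h1, h1', h3, h3']
    have hpI : p ∈ Icc (0 : ℝ) 1 := ⟨hs.1.trans hp.1, hp.2⟩
    have hpI' : p' ∈ Icc (0 : ℝ) 1 := ⟨hs'.1.trans hp'.1, hp'.2⟩
    obtain ⟨a1, a2, a3⟩ := phase_bounds hpI
    obtain ⟨a1', a2', a3'⟩ := phase_bounds hpI'
    -- the end of a side is the source of something only at parameter `0`
    have hend : ∀ p s : ℝ, s ∈ Ico (0 : ℝ) 1 → p ∈ Icc (0 : ℝ) 1 → 1 - |2 * p - 1| ≤ 2 * (1 - p) →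
        p - (1 - ε) * (1 - |2 * p - 1|) / 2 = s → 2 * p - s = 1 → ε = 0 := by
      intro p s hs hp a3 hps he
      by_contra hne
      have : 0 < ε := lt_of_le_of_ne hε.1 (Ne.symm hne)
      have h4 := mul_le_mul_of_nonneg_left a3 (by linarith [hε.2] : 0 ≤ 1 - ε)
      nlinarith [hp.2, hs.2]
    have hq1 : 2 * p - s ≠ 1 := fun he => hV ⟨hend p s hs hpI a3 hps he, he ▸ h.edges.one_mem _⟩
    have hb : ∀ p s : ℝ, 0 ≤ 1 - |2 * p - 1| → 1 - |2 * p - 1| ≤ 2 * (1 - p) →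
        p - (1 - ε) * (1 - |2 * p - 1|) / 2 = s → 2 * p - s ≤ 1 := by
      intro p s a1 a3 hps
      have := mul_le_of_le_one_left a1 (by linarith [hε.1] : 1 - ε ≤ 1)
      linarith
    have hq : 2 * p - s ∈ Icc (0 : ℝ) 1 := ⟨by linarith [hp.1, hpI.1], hb p s a1 a3 hps⟩
    have hq' : 2 * p' - s' ∈ Icc (0 : ℝ) 1 := ⟨by linarith [hp'.1, hpI'.1], hb p' s' a1' a3' hps'⟩
    -- either both sources are at the same point of an edge, or both are at a vertex
    rcases h.edges.eq_of_eq hq hq' hww with ⟨he, hqq⟩ | ⟨hv, hv'⟩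
    · have hpp : p = p' := eq_of_add_phase_eq (m := 1 - ε) (by linarith [hε.2])
        (by linarith [hε.1]) (by
          have := lt_of_le_of_ne hq.2 hq1
          linarith) (by linarith)
      subst hpp
      obtain rfl : s = s' := by linarith
      rw [he]
      exact ⟨rfl, rfl⟩
    · have hv0 := hv.resolve_right hq1
      have hv0' : 2 * p' - s' = 0 := by
        refine hv'.resolve_right fun he => hV ⟨hend p' s' hs' hpI' a3' hps' he, ?_⟩
        rw [hww, he]
        exact h.edges.one_mem _
      obtain rfl : p = 0 := by linarith [hp.1, hpI.1]
      obtain rfl : p' = 0 := by linarith [hp'.1, hpI'.1]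
      obtain rfl : s = 0 := by linarith
      obtain rfl : s' = 0 := by linarith
      simp only [mul_zero, sub_zero] at hww ⊢
      exact ⟨hww, trivial⟩
  · have : w = w' := h.eq_of_src_eq hε hw (eq_of_proj (mt h.src_mem.1 hw) hww)
    rw [this]
    exact ⟨rfl, rfl⟩

/-- The points that are pushed into the link are those over the vertices. -/
theorem mem_link_iff {ε : ℝ} (hε : ε ∈ Icc (0 : ℝ) 1) (w : Q.Carrier) :
    (ε = 0 ∧ Q.proj (Q.src R c κ ε w) ∈ V) ↔ ∃ e, ∃ s ∈ Icc (0 : ℝ) 1,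
      Q.proj (Q.tgt R c κ ε w) = γ e s ∧ Q.height R c κ k ε w = 2 * s - 1 := by
  constructor
  · rintro ⟨rfl, hV⟩
    have hw : w ∈ Q.bd := h.src_mem.1 (h.subset hV)
    obtain ⟨α, hα, s, hs, p, hp, hps, -, h1, h2, h3⟩ := h.exists_base hε hw
    have hpI : p ∈ Icc (0 : ℝ) 1 := ⟨hs.1.trans hp.1, hp.2⟩
    obtain ⟨a1, a2, a3⟩ := phase_bounds hpI
    rw [h2] at hV
    rw [h1, height, h3]
    have hq : 2 * p - s = 0 ∨ 2 * p - s = 1 := by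
      by_contra! hne
      refine h.edges.notMem _ _ ⟨lt_of_le_of_ne ?_ hne.1.symm, lt_of_le_of_ne ?_ hne.2⟩ hV
      · linarith [hp.1, hpI.1]
      · linarith
    -- a source at the start of a side gives the upper strand there, where another edge ends, and
    -- a source at its end gives the strand over the side
    rcases hq with hq | hq
    · obtain rfl : p = 0 := by linarith [hp.1, hpI.1]
      obtain rfl : s = 0 := by linarith
      obtain ⟨e, he⟩ := h.edges.exists_end h.invol h.tau_mem_vert (h.edges.zero_mem (edge α))
      exact ⟨e, 1, ⟨zero_le_one, le_rfl⟩, he.symm, by ring⟩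
    · exact ⟨edge α, s, Ico_subset_Icc_self hs, rfl, by linarith⟩
  · rintro ⟨e, t, ht, h1, h2⟩
    have hw : w ∈ Q.bd := h.tgt_mem (ε := ε).1 (show Q.proj _ ∈ D from h1 ▸ h.edges.mem e t)
    obtain ⟨α, hα, s, hs, p, hp, hps, -, h3, h4, h5⟩ := h.exists_base hε hw
    have hpI : p ∈ Icc (0 : ℝ) 1 := ⟨hs.1.trans hp.1, hp.2⟩
    obtain ⟨a1, a2, a3⟩ := phase_bounds hpI
    rw [height, h5] at h2
    have hK := h.len_pos (Q.proj (Q.tgt R c κ ε w))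
    set K := k (Q.proj (Q.tgt R c κ ε w))
    have hKε : 0 ≤ K * ε := mul_nonneg hK.le hε.1
    have hmφ := mul_le_of_le_one_left a1 (by linarith [hε.1] : 1 - ε ≤ 1)
    rw [h4]
    have hmain : s = t → ε = 0 ∧ γ (edge α) (2 * p - s) ∈ V := by
      rintro rfl
      have h6 : K * ε = 0 := by linarith
      refine ⟨(mul_eq_zero.1 h6).resolve_left hK.ne', ?_⟩
      rw [show 2 * p - s = 1 by linarith]
      exact h.edges.one_mem _
    rw [h3] at h1
    rcases h.edges.eq_of_eq (Ico_subset_Icc_self hs) ht h1 with ⟨-, h6⟩ | ⟨h6, h7⟩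
    · exact hmain h6
    · have h8 : s = 0 := h6.resolve_right hs.2.ne
      subst h8
      rcases h7 with rfl | rfl
      · exact hmain rfl
      · -- above the start of the side, at height `1`, only the corner itself remains
        have h9 := mul_le_mul_of_nonneg_left a2 (by linarith [hε.2] : 0 ≤ 1 - ε)
        have h10 : ε * p ≤ 0 := by linarith
        have h11 : ε = 0 := by
          by_contra hne
          have hpos : 0 < ε := lt_of_le_of_ne hε.1 (Ne.symm hne)
          have : p = 0 := by
            by_contra hp0
            exact absurd (mul_pos hpos (lt_of_le_of_ne hpI.1 (Ne.symm hp0))) (not_lt.2 h10)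
          rw [this] at h2
          have : 0 < K * ε := mul_pos hK hpos
          linarith
        have h12 : p = 0 := by rw [h11] at h2; linarith
        rw [h12]
        simp only [mul_zero, sub_zero]
        exact ⟨h11, h.edges.zero_mem _⟩

/-- The sweep stays between height `-1` and the upper end of the vertical segments. -/
theorem height_bounds {ε : ℝ} (hε : ε ∈ Icc (0 : ℝ) 1) (w : Q.Carrier) :
    -1 ≤ Q.height R c κ k ε w ∧
      Q.height R c κ k ε w ≤ 1 + k (Q.proj (Q.tgt R c κ ε w)) * ε := by
  have hK := mul_nonneg (h.len_pos (Q.proj (Q.tgt R c κ ε w))).le hε.1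
  have : -1 ≤ Q.preHeight R c κ ε w ∧ Q.preHeight R c κ ε w ≤ 1 := by
    rcases h.cases ε w with ⟨z, hz, u, hu, rfl⟩ | hw
    · rw [h.preHeight_apply ε hz (Ico_subset_Icc_self hu)]
      obtain ⟨k0, k1⟩ := h.phase_mem hz
      have h1 : 0 ≤ (1 - u) * (1 - ε) := mul_nonneg (by linarith [hu.2]) (by linarith [hε.2])
      have h2 : 0 ≤ u * (1 - ε) := mul_nonneg hu.1 (by linarith [hε.2])
      have h3 := mul_le_of_le_one_right h1 k1
      have h4 := mul_nonneg h1 k0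
      have h5 : (1 - u) * (1 - ε) + u * (1 - ε) ≤ 1 := by linarith [hε.1]
      have h6 : (1 - u) * (1 - ε) ≤ 1 := by linarith
      constructor <;> linarith
    · rw [h.preHeight_core ε hw]
      exact ⟨by linarith [hε.1], hε.2⟩
  rw [height]
  exact ⟨by linarith, by linarith⟩

/-- At the top of the product nothing is moved. -/
theorem eval_one (w : Q.Carrier) : Q.src R c κ 1 w = w ∧ Q.tgt R c κ 1 w = w ∧
    Q.height R c κ k 1 w = 1 + k (Q.proj w) := by
  have : Q.src R c κ 1 w = w ∧ Q.tgt R c κ 1 w = w ∧ Q.preHeight R c κ 1 w = 1 := by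
    rcases h.cases 1 w with ⟨z, hz, u, hu, rfl⟩ | hw
    · have hI := Ico_subset_Icc_self hu
      rw [h.src_apply 1 hz hI, h.tgt_apply 1 hz hI, h.preHeight_apply 1 hz hI]
      simp
    · exact ⟨h.src_core 1 hw, h.tgt_core 1 hw, h.preHeight_core 1 hw⟩
  refine ⟨this.1, this.2.1, ?_⟩
  rw [height, this.2.1, this.2.2, mul_one]

/-! ### Points of the sweep with the same target -/

/-- The side of a face is glued to the side that starts at the next corner and runs backwards. -/
theorem faceRel_edge [T2Space S] (hsep : Q.SeparatesCorners γ) {e e' : E}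
    (hee : γ e' 0 = τ (γ e 0)) {s : ℝ} (hs : s ∈ Ioo (0 : ℝ) 1) :
    Q.FaceRel R c ⟨γ e s, h.edges.notMem e s hs⟩
      ⟨γ e' (1 - s), h.edges.notMem e' _ ⟨by linarith [hs.2], by linarith [hs.1]⟩⟩ := by
  classical
  set y := γ e 0 with hy
  have hyV : y ∈ V := h.edges.zero_mem e
  have h0 : ∀ α, Q.proj α ∈ V → γ (edge α) 0 = Q.proj α := by
    intro α hα
    rw [← h.flow.proj_eq α hα 0 ⟨le_rfl, zero_le_one⟩, h.flow.zero α (h.subset hα)]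
  -- the four corners at a vertex realise the four pairs of edges
  obtain ⟨α, hα, h1, h2⟩ : ∃ α, Q.proj α = y ∧ edge α = e ∧ edge (Q.twistFun α) = e' := by
    obtain ⟨e₁, e₂, hne, hst, -⟩ := h.edges.start y hyV
    obtain ⟨d₁, d₂, hne', hst', -⟩ := h.edges.start _ (h.tau_mem_vert y hyV)
    have hfin := Q.finite_fiber (h.subset hyV)
    let f : Q.Carrier → E × E := fun α => (edge α, edge (Q.twistFun α))
    have hsub : hfin.toFinset.image f ⊆ ({e₁, e₂} : Finset E) ×ˢ ({d₁, d₂} : Finset E) := by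
      intro x hx
      obtain ⟨α, hα, rfl⟩ := Finset.mem_image.1 hx
      have hα : Q.proj α = y := by simpa using hα
      have hα' : Q.proj (Q.twistFun α) = τ y := by rw [Q.proj_twistFun, hα]
      have h3 := (hst (edge α)).1 (by rw [h0 α (hα ▸ hyV), hα])
      have h4 := (hst' (edge (Q.twistFun α))).1
        (by rw [h0 _ (hα' ▸ h.tau_mem_vert y hyV), hα'])
      simpa [f] using ⟨h3, h4⟩
    have hcard : (hfin.toFinset.image f).card = 4 := by
      rw [Finset.card_image_of_injOn, ← ncard_eq_toFinset_card _ hfin,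
        Q.ncard_fiber (h.subset hyV), Q.card_crossing y hyV]
      intro α hα β hβ hab
      have hα : Q.proj α = y := by simpa using hα
      have hβ : Q.proj β = y := by simpa using hβ
      exact hsep.eq h.subset h.invol h.tau_mem_vert h.flow (hα ▸ hyV) (hβ.trans hα.symm)
        (congrArg Prod.fst hab) (congrArg Prod.snd hab)
    have heq := Finset.eq_of_subset_of_card_le hsub (by
      rw [hcard, Finset.card_product]
      exact Nat.mul_le_mul Finset.card_le_two Finset.card_le_two)
    have hmem : (e, e') ∈ hfin.toFinset.image f := by
      rw [heq]
      simpa using ⟨(hst e).1 rfl, (hst' e').1 hee⟩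
    obtain ⟨α, hα, hf⟩ := Finset.mem_image.1 hmem
    exact ⟨α, by simpa using hα, congrArg Prod.fst hf, congrArg Prod.snd hf⟩
  have hαV : Q.proj α ∈ V := hα ▸ hyV
  have hαD : α ∈ Q.bd := h.subset hαV
  have hβV : Q.proj (Q.twistFun α) ∈ V := h.tau_mem_vert _ hαV
  refine ⟨R s α, ?_, ?_⟩
  · change Q.proj (R s α) = γ e s
    rw [h.flow.proj_eq α hαV s (Ioo_subset_Icc_self hs), h1]
  · change Q.proj (Q.regluing R c (R s α)) = γ e' (1 - s)
    rw [regluing, rotate_bd h.flow h.collar _ (h.twist_mem (h.flow.mem _ _ hαD)),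
      h.flow.twist _ _ hαD, h.flow.add _ _ _ (h.subset hβV), ← h2,
      ← h.flow.proj_eq _ hβV (1 - s) ⟨by linarith [hs.2], by linarith [hs.1]⟩]
    congr 2
    ring

/-- Points of the product with the same target, off the link, have the same source, or sources that
are identified by the regluing of the faces: four edges are glued to each crossing arc. -/
theorem src_eq_of_tgt_eq [T2Space S] (hsep : Q.SeparatesCorners γ) {ε ε' : ℝ}
    (hε : ε ∈ Icc (0 : ℝ) 1) (hε' : ε' ∈ Icc (0 : ℝ) 1) {w w' : Q.Carrier}
    (hww : Q.proj (Q.tgt R c κ ε w) = Q.proj (Q.tgt R c κ ε' w'))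
    (hh : Q.height R c κ k ε w = Q.height R c κ k ε' w')
    (hV : ¬ (ε = 0 ∧ Q.proj (Q.src R c κ ε w) ∈ V)) :
    (Q.proj (Q.src R c κ ε w) = Q.proj (Q.src R c κ ε' w') ∧ ε = ε') ∨
      ε = 0 ∧ ε' = 0 ∧ ∃ ha hb, Relation.EqvGen (Q.FaceRel R c)
        ⟨Q.proj (Q.src R c κ ε w), ha⟩ ⟨Q.proj (Q.src R c κ ε' w'), hb⟩ := by
  by_cases hw : w ∈ Q.bd
  · have hw' : w' ∈ Q.bd := by
      rw [← h.tgt_mem (ε := ε)] at hw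
      rw [← h.tgt_mem (ε := ε')]
      exact show Q.proj _ ∈ D from hww ▸ hw
    obtain ⟨α, hα, s, hs, p, hp, hps, -, h1, h2, h3⟩ := h.exists_base hε hw
    obtain ⟨α', hα', s', hs', p', hp', hps', -, h1', h2', h3'⟩ := h.exists_base hε' hw'
    rw [height, height, ← hww, h3, h3'] at hh
    have hK := h.len_pos (Q.proj (Q.tgt R c κ ε w))
    set K := k (Q.proj (Q.tgt R c κ ε w))
    rw [h1, h1'] at hww
    have hpI : p ∈ Icc (0 : ℝ) 1 := ⟨hs.1.trans hp.1, hp.2⟩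
    have hpI' : p' ∈ Icc (0 : ℝ) 1 := ⟨hs'.1.trans hp'.1, hp'.2⟩
    rw [h2] at hV
    have hss : s = s' := by
      rcases h.edges.eq_of_eq (Ico_subset_Icc_self hs) (Ico_subset_Icc_self hs') hww with
        ⟨-, h4⟩ | ⟨h4, h5⟩
      · exact h4
      · rw [h4.resolve_right hs.2.ne, h5.resolve_right hs'.2.ne]
    subst hss
    obtain ⟨rfl, rfl⟩ := eq_of_sub_phase_eq hK hε hε' hpI hpI' (hps.trans hps'.symm) (by linarith)
    -- either the targets are on the same edge, or both are the common starting point of two edges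
    rcases h.edges.eq_of_eq (Ico_subset_Icc_self hs) (Ico_subset_Icc_self hs') hww with
      ⟨h4, -⟩ | ⟨h4, -⟩
    · exact Or.inl ⟨by rw [h2, h2', h4], rfl⟩
    · obtain rfl : s = 0 := h4.resolve_right hs.2.ne
      obtain ⟨a1, a2, a3⟩ := phase_bounds hpI
      by_cases hp0 : p = 0
      · subst hp0
        refine Or.inl ⟨?_, rfl⟩
        rw [h2, h2']
        simpa using hww
      · have hppos : 0 < p := lt_of_le_of_ne hpI.1 (Ne.symm hp0)
        have h9 := mul_le_mul_of_nonneg_left a2 (by linarith [hε.2] : 0 ≤ 1 - ε)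
        have hε0 : ε = 0 := by nlinarith [hε.1]
        subst hε0
        have hp2 : 2 * p ≠ 1 := by
          intro h5
          refine hV ⟨rfl, ?_⟩
          rw [sub_zero, h5]
          exact h.edges.one_mem _
        have hI : 2 * p - 0 ∈ Ioo (0 : ℝ) 1 := by
          refine ⟨by linarith, ?_⟩
          rw [sub_zero]
          refine lt_of_le_of_ne ?_ hp2
          linarith
        simp only [h2, h2']
        refine Or.inr ⟨trivial, trivial, h.edges.notMem _ _ hI, h.edges.notMem _ _ hI, ?_⟩
        -- both edges are glued to one that starts at the image of the vertex under `τ`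
        obtain ⟨d, _, -, hd, -⟩ := h.edges.start _ (h.tau_mem_vert _ (h.edges.zero_mem (edge α)))
        have hd0 := (hd d).2 (Or.inl rfl)
        refine (Relation.EqvGen.rel _ _ (h.faceRel_edge hsep hd0 hI)).trans _ _ _
          (Relation.EqvGen.symm _ _ (Relation.EqvGen.rel _ _ (h.faceRel_edge hsep ?_ hI)))
        rw [hd0, hww]
  · obtain ⟨rfl, rfl⟩ := h.eq_of_tgt_eq hε hε' hw (eq_of_proj (mt h.tgt_mem.1 hw) hww) hh
    exact Or.inl ⟨rfl, rfl⟩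

/-- Points of the product with opposite targets, off the link, have sources that are identified by
the regluing of the faces. -/
theorem src_rel_of_tgt_eq [T2Space S] (hsep : Q.SeparatesCorners γ) {ε ε' : ℝ}
    (hε : ε ∈ Icc (0 : ℝ) 1) (hε' : ε' ∈ Icc (0 : ℝ) 1) {w w' : Q.Carrier}
    (hww : Q.proj (Q.tgt R c κ ε' w') = τ (Q.proj (Q.tgt R c κ ε w)))
    (hh : Q.height R c κ k ε' w' = -Q.height R c κ k ε w)
    (hV : ¬ (ε = 0 ∧ Q.proj (Q.src R c κ ε w) ∈ V)) :
    ε = 0 ∧ ε' = 0 ∧ ∃ ha hb, Relation.EqvGen (Q.FaceRel R c)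
        ⟨Q.proj (Q.src R c κ ε w), ha⟩ ⟨Q.proj (Q.src R c κ ε' w'), hb⟩ := by
  by_cases hw : w ∈ Q.bd
  · have hw' : w' ∈ Q.bd := by
      rw [← h.tgt_mem (ε := ε)] at hw
      rw [← h.tgt_mem (ε := ε')]
      exact show Q.proj _ ∈ D from hww ▸ (h.tau_mem_diag _).2 hw
    obtain ⟨α, hα, s, hs, p, hp, hps, -, h1, h2, h3⟩ := h.exists_base hε hw
    obtain ⟨α', hα', s', hs', p', hp', hps', -, h1', h2', h3'⟩ := h.exists_base hε' hw'
    rw [height, height, h3, h3'] at hh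
    have hK := h.len_pos (Q.proj (Q.tgt R c κ ε w))
    have hK' := h.len_pos (Q.proj (Q.tgt R c κ ε' w'))
    set K := k (Q.proj (Q.tgt R c κ ε w))
    set K' := k (Q.proj (Q.tgt R c κ ε' w'))
    have hKε : 0 ≤ K * ε := mul_nonneg hK.le hε.1
    have hKε' : 0 ≤ K' * ε' := mul_nonneg hK'.le hε'.1
    have hz : K * ε = 0 → ε = 0 := fun h0 => (mul_eq_zero.1 h0).resolve_left hK.ne'
    have hz' : K' * ε' = 0 → ε' = 0 := fun h0 => (mul_eq_zero.1 h0).resolve_left hK'.ne'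
    rw [h1, h1'] at hww
    have hpI : p ∈ Icc (0 : ℝ) 1 := ⟨hs.1.trans hp.1, hp.2⟩
    have hpI' : p' ∈ Icc (0 : ℝ) 1 := ⟨hs'.1.trans hp'.1, hp'.2⟩
    obtain ⟨a1, a2, a3⟩ := phase_bounds hpI
    obtain ⟨a1', a2', a3'⟩ := phase_bounds hpI'
    have b1 := mul_le_of_le_one_left a1 (by linarith [hε.1] : 1 - ε ≤ 1)
    have b1' := mul_le_of_le_one_left a1' (by linarith [hε'.1] : 1 - ε' ≤ 1)
    simp only [h2, h2'] at hV ⊢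
    obtain ⟨d, hd⟩ := h.edges.star (edge α)
    have hww' : γ (edge α') s' = γ d (1 - s) := by rw [hww, hd]; ring_nf
    rcases h.edges.eq_of_eq (Ico_subset_Icc_self hs') ⟨by linarith [hs.2], by linarith [hs.1]⟩ hww'
      with ⟨-, h4⟩ | ⟨h4, h5⟩
    · -- above an interior point of an edge only the link is swept twice
      have h6 : ε = 0 := hz (by linarith)
      have h7 : 2 * p - s = 1 := by linarith
      exact absurd ⟨h6, h7 ▸ h.edges.one_mem _⟩ hV
    · -- both targets lie on the same crossing arc, seen from opposite sides
      obtain rfl : s' = 0 := h4.resolve_right hs'.2.ne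
      obtain rfl : s = 0 := by
        rcases h5 with h5 | h5
        · linarith [hs.2]
        · linarith
      have hpε : ∀ p ε : ℝ, p ∈ Icc (0 : ℝ) 1 → ε ∈ Icc (0 : ℝ) 1 → 1 - |2 * p - 1| ≤ 2 * p →
          p - (1 - ε) * (1 - |2 * p - 1|) / 2 = 0 → ε = 0 ∨ p = 0 := by
        intro p ε hp hε a2 hps
        have h9 := mul_le_mul_of_nonneg_left a2 (by linarith [hε.2] : 0 ≤ 1 - ε)
        have h10 : 0 ≤ ε * p := mul_nonneg hε.1 hp.1
        exact mul_eq_zero.1 (le_antisymm (by linarith) h10)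
      have hε0 : ε = 0 := by
        rcases hpε p ε hpI hε a2 hps with h6 | rfl
        · exact h6
        · exact hz (by linarith)
      have hε0' : ε' = 0 := by
        rcases hpε p' ε' hpI' hε' a2' hps' with h6 | rfl
        · exact h6
        · exact hz' (by linarith)
      subst hε0 hε0'
      have hpp : 2 * p' - 0 = 1 - (2 * p - 0) := by linarith
      have hI : 2 * p - 0 ∈ Ioo (0 : ℝ) 1 := by
        constructor
        · refine lt_of_le_of_ne (by linarith [hpI.1]) fun h6 => hV ⟨rfl, ?_⟩
          rw [← h6]
          exact h.edges.zero_mem _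
        · refine lt_of_le_of_ne (by linarith) fun h6 => hV ⟨rfl, ?_⟩
          rw [h6]
          exact h.edges.one_mem _
      have hI' : 2 * p' - 0 ∈ Ioo (0 : ℝ) 1 := by
        rw [hpp]
        exact ⟨by linarith [hI.2], by linarith [hI.1]⟩
      refine ⟨rfl, rfl, h.edges.notMem _ _ hI, h.edges.notMem _ _ hI', ?_⟩
      have := Relation.EqvGen.rel _ _ (h.faceRel_edge hsep hww hI)
      simp only [hpp]
      exact this
  · have hb := mt (h.tgt_mem (ε := ε)).1 hw
    have hww' : Q.tgt R c κ ε' w' = Q.twistFun (Q.tgt R c κ ε w) := by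
      refine (eq_of_proj ?_ ?_).symm
      · exact mt (h.tau_mem_diag _).1 hb
      · rw [hww, Q.proj_twistFun]
    obtain ⟨rfl, rfl, h1⟩ := h.regluing_of_tgt_eq hε hε' hw hww' hh
    have hw' : w' ∉ Q.bd := by
      rw [← h.tgt_mem (ε := 0), hww']
      exact mt (h.tau_mem_diag _).1 hb
    refine ⟨rfl, rfl, fun hm => hw (h.src_mem.1 (h.subset hm)),
      fun hm => hw' (h.src_mem.1 (h.subset hm)), Relation.EqvGen.rel _ _ ⟨_, rfl, ?_⟩⟩
    rw [← h1]

/-! ### Surjectivity of the sweep -/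

/-- A displacement proportional to the phase reaches every boundary point, by the intermediate
value theorem. -/
theorem exists_flow_eq {b : Q.Carrier} (hb : b ∈ Q.bd) {m : ℝ} (hm : m ∈ Icc (0 : ℝ) 1) :
    ∃ z ∈ Q.bd, R (m * κ z / 2) z = b := by
  have hcont : Continuous fun p : ℝ => p + m * κ (R p b) / 2 := by
    have h1 : Continuous fun p : ℝ => R p b :=
      h.flow.continuousOn.comp_continuous (f := fun p : ℝ => (p, b)) (by fun_prop)
        fun p => ⟨mem_univ _, hb⟩
    have h2 := h.phase.continuous.comp h1
    exact continuous_id.add ((continuous_const.mul h2).div_const 2)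
  have hκ : ∀ p, κ (R p b) ∈ Icc (0 : ℝ) 1 := fun p => h.phase_mem (h.flow.mem p b hb)
  obtain ⟨p, -, hp⟩ := intermediate_value_Icc (by norm_num : (-1 / 2 : ℝ) ≤ 0)
    hcont.continuousOn (show (0 : ℝ) ∈ Icc _ _ by
      have h1 := hκ (-1 / 2)
      have h2 := hκ 0
      have h3 := mul_le_one₀ hm.2 h1.1 h1.2
      have h4 := mul_nonneg hm.1 h2.1
      exact ⟨by linarith, by linarith⟩)
  refine ⟨R p b, h.flow.mem p b hb, ?_⟩
  simp only at hp
  rw [h.flow.add _ _ _ hb, hp, h.flow.zero _ hb]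

/-- Every point of a face, and the point that it is reglued to, are the sources of points with
opposite targets. -/
theorem exists_opposite (z : Q.Carrier) : ∃ w w', Q.src R c κ 0 w = z ∧
    Q.src R c κ 0 w' = Q.regluing R c z ∧
    Q.proj (Q.tgt R c κ 0 w') = τ (Q.proj (Q.tgt R c κ 0 w)) ∧
    Q.height R c κ k 0 w' = -Q.height R c κ k 0 w := by
  rcases mem_or_openCollar Q.bd c z with ⟨b, hb, u, hu, rfl⟩ | hz
  · have hI := Ico_subset_Icc_self hu
    obtain ⟨z, hz, hzb⟩ := h.exists_flow_eq (h.flow.mem (u / 4) b hb) (m := 1 - u)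
      ⟨by linarith [hu.2], by linarith [hu.1]⟩
    have htz := h.twist_mem hz
    have hsrc : Q.src R c κ 0 (c (R (-(u * (1 - 0) / 4)) z) u) = c b u := by
      rw [h.src_apply 0 hz hI]
      congr 1
      have := congrArg (R (-(u / 4))) hzb
      rw [h.flow.add _ _ _ hz, h.flow.add _ _ _ hb, add_neg_cancel, h.flow.zero _ hb] at this
      refine Eq.trans ?_ this
      congr 1
      ring
    refine ⟨_, c (R (-(u * (1 - 0) / 4)) (R (1 / 2) (Q.twistFun z))) u, hsrc, ?_, ?_, ?_⟩
    · rw [h.src_opposite hz hI, hsrc]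
    · rw [h.tgt_apply 0 hz hI, h.tgt_apply 0 (h.flow.mem _ _ htz) hI, ← Q.proj_twistFun,
        ← h.collar.twist _ (h.flow.mem _ _ hz) _ hI, h.flow.twist _ _ hz, h.flow.add _ _ _ htz,
        h.phase_half htz, h.phase_twist hz]
      congr 3
      ring
    · rw [height, height, mul_zero, mul_zero, h.preHeight_apply 0 hz hI,
        h.preHeight_apply 0 (h.flow.mem _ _ htz) hI, h.phase_half htz, h.phase_twist hz]
      ring
  · have hz' : Q.twistFun z ∉ openCollar Q.bd c :=
      mt (h.collar.twist_openCollar (Q.twistFun_twistFun h.invol) fun _ => h.twist_mem).1 hz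
    refine ⟨z, Q.twistFun z, h.src_core 0 hz, ?_, ?_, ?_⟩
    · rw [h.src_core 0 hz', regluing_core h.flow h.collar h.tau_mem_diag h.invol hz]
    · rw [h.tgt_core 0 hz, h.tgt_core 0 hz', Q.proj_twistFun]
    · rw [height, height, h.preHeight_core 0 hz, h.preHeight_core 0 hz']
      ring

/-- At each parameter of the product the source map is onto. -/
theorem surjective_src {ε : ℝ} (hε : ε ∈ Icc (0 : ℝ) 1) (z : Q.Carrier) :
    ∃ w, Q.src R c κ ε w = z := by
  rcases mem_or_openCollar Q.bd c z with ⟨b, hb, u, hu, rfl⟩ | hz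
  · have hI := Ico_subset_Icc_self hu
    obtain ⟨z, hz, hzb⟩ := h.exists_flow_eq (h.flow.mem (u * (1 - ε) / 4) b hb)
      (m := (1 - u) * (1 - ε)) ⟨mul_nonneg (by linarith [hu.2]) (by linarith [hε.2]),
        mul_le_one₀ (by linarith [hu.1]) (by linarith [hε.2]) (by linarith [hε.1])⟩
    refine ⟨c (R (-(u * (1 - ε) / 4)) z) u, ?_⟩
    rw [h.src_apply ε hz hI]
    congr 1
    have := congrArg (R (-(u * (1 - ε) / 4))) hzb
    rwa [h.flow.add _ _ _ hz, h.flow.add _ _ _ hb, add_neg_cancel, h.flow.zero _ hb,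
      ← sub_eq_add_neg] at this
  · exact ⟨z, h.src_core ε hz⟩

/-- The sweep, together with its mirror image, fills the part of the line bundle below the
upper end of the vertical segments. -/
theorem exists_tgt {y : S} {t : ℝ} (ht : t ≤ 1 + k y) (ht' : -t ≤ 1 + k (τ y)) :
    ∃ ε ∈ Icc (0 : ℝ) 1, ∃ w,
      (Q.proj (Q.tgt R c κ ε w) = y ∧ Q.height R c κ k ε w = t) ∨
      (Q.proj (Q.tgt R c κ ε w) = τ y ∧ Q.height R c κ k ε w = -t) := by
  obtain ⟨z₀, rfl⟩ := Q.surjective_proj y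
  rcases mem_or_openCollar Q.bd c z₀ with ⟨b, hb, u, hu, rfl⟩ | hz
  · have hI := Ico_subset_Icc_self hu
    -- the point over `b` at height `t` is reached when the backward push of the right length
    -- starts at a point with the right phase
    have key : ∀ b ∈ Q.bd, ∀ t, t ≤ 1 + k (Q.proj (c b u)) →
        (1 - t) / 4 - (1 - u) * κ (R ((1 - t) / 4) b) / 2 - u / 4 ≤ 0 →
        ∃ ε ∈ Icc (0 : ℝ) 1, ∃ w, Q.tgt R c κ ε w = c b u ∧ Q.height R c κ k ε w = t := by
      intro b hb t ht hneg
      set K := k (Q.proj (c b u)) with hK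
      have hcont : Continuous fun ε : ℝ => (1 + K * ε - t) / 4 -
          (1 - u) * (1 - ε) * κ (R ((1 + K * ε - t) / 4) b) / 2 - u * (1 - ε) / 4 := by
        have h1 : Continuous fun ε : ℝ => R ((1 + K * ε - t) / 4) b :=
          h.flow.continuousOn.comp_continuous (f := fun ε : ℝ => ((1 + K * ε - t) / 4, b))
            (by fun_prop) fun p => ⟨mem_univ _, hb⟩
        have h2 := h.phase.continuous.comp h1
        refine Continuous.sub (Continuous.sub (by fun_prop) ?_) (by fun_prop)
        exact (Continuous.mul (by fun_prop) h2).div_const 2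
      obtain ⟨ε, hε, hG⟩ := intermediate_value_Icc (zero_le_one (α := ℝ)) hcont.continuousOn
        (show (0 : ℝ) ∈ Icc _ _ by
          refine ⟨?_, ?_⟩
          · simpa using hneg
          · simp only [sub_self, mul_zero, zero_mul, zero_div, sub_zero, mul_one]
            linarith)
      simp only at hG
      set p := (1 + K * ε - t) / 4 with hp
      have hz : R p b ∈ Q.bd := h.flow.mem p b hb
      have htgt : Q.tgt R c κ ε (c (R (-(u * (1 - ε) / 4)) (R p b)) u) = c b u := by
        rw [h.tgt_apply ε hz hI, h.flow.add _ _ _ hb]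
        conv_rhs => rw [← h.flow.zero b hb]
        congr 2
        linarith
      refine ⟨ε, hε, _, htgt, ?_⟩
      rw [height, htgt, h.preHeight_apply ε hz hI, ← hK]
      linarith
    have htb := h.twist_mem hb
    have hsum : κ (R ((1 - -t) / 4) (Q.twistFun b)) = 1 - κ (R ((1 - t) / 4) b) := by
      have h1 := h.flow.mem (-((1 - -t) / 4)) b hb
      have h2 := h.flow.twist (-((1 - -t) / 4)) b hb
      rw [neg_neg] at h2
      rw [← h2, h.phase_twist h1]
      have h3 := h.phase_half h1
      rw [h.flow.add _ _ _ hb] at h3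
      have : -((1 - -t) / 4) + 1 / 2 = (1 - t) / 4 := by ring
      rw [this] at h3
      linarith
    rcases le_total ((1 - t) / 4 - (1 - u) * κ (R ((1 - t) / 4) b) / 2 - u / 4) 0 with hle | hle
    · obtain ⟨ε, hε, w, h1, h2⟩ := key b hb t ht hle
      exact ⟨ε, hε, w, Or.inl ⟨by rw [h1], h2⟩⟩
    · have hpt : Q.proj (c (Q.twistFun b) u) = τ (Q.proj (c b u)) := by
        rw [h.collar.twist _ hb _ hI, Q.proj_twistFun]
      obtain ⟨ε, hε, w, h1, h2⟩ := key _ htb (-t) (by rw [hpt]; exact ht') (by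
        rw [hsum]
        linarith)
      exact ⟨ε, hε, w, Or.inr ⟨by rw [h1, hpt], h2⟩⟩
  · have key : ∀ z ∉ openCollar Q.bd c, ∀ t, 0 ≤ t → t ≤ 1 + k (Q.proj z) →
        ∃ ε ∈ Icc (0 : ℝ) 1, Q.tgt R c κ ε z = z ∧ Q.height R c κ k ε z = t := by
      intro z hz t h0 h1
      have hK := h.len_pos (Q.proj z)
      have hK1 : 0 < 1 + k (Q.proj z) := by linarith
      refine ⟨t / (1 + k (Q.proj z)), ⟨by positivity, (div_le_one hK1).2 h1⟩, h.tgt_core _ hz, ?_⟩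
      rw [height, h.tgt_core _ hz, h.preHeight_core _ hz]
      field_simp
    have hz' : Q.twistFun z₀ ∉ openCollar Q.bd c :=
      mt (h.collar.twist_openCollar (Q.twistFun_twistFun h.invol) fun _ => h.twist_mem).1 hz
    rcases le_total 0 t with h0 | h0
    · obtain ⟨ε, hε, h1, h2⟩ := key z₀ hz t h0 ht
      exact ⟨ε, hε, z₀, Or.inl ⟨by rw [h1], h2⟩⟩
    · obtain ⟨ε, hε, h1, h2⟩ := key _ hz' (-t) (by linarith) (by rw [Q.proj_twistFun]; exact ht')
      exact ⟨ε, hε, _, Or.inr ⟨by rw [h1, Q.proj_twistFun], h2⟩⟩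

/-- Each edge is pushed onto the vertical segment over its starting point. -/
theorem exists_edge (e : E) {s : ℝ} (hs : s ∈ Icc (0 : ℝ) 1) : ∃ w,
    Q.proj (Q.src R c κ 0 w) = γ e s ∧ Q.proj (Q.tgt R c κ 0 w) = γ e 0 ∧
      Q.height R c κ k 0 w = 1 - 2 * s := by
  obtain ⟨α, _, -, hα⟩ := h.flow.edge_fiber e
  obtain ⟨hαV, rfl⟩ := (hα α).2 (Or.inl rfl)
  have hp : s / 2 ∈ Icc (0 : ℝ) 1 := ⟨by linarith [hs.1], by linarith [hs.2]⟩
  obtain ⟨h1, h2, h3⟩ := h.side_eval (ε := 0) ⟨le_rfl, zero_le_one⟩ hαV hp (s := 0) (by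
    rw [abs_of_nonpos (by linarith [hs.2])]
    ring)
  refine ⟨R (s / 2) α, ?_, h1, ?_⟩
  · rw [h2]
    congr 1
    ring
  · rw [height, h3]
    ring

end IsFaceData
end PatchSystem

namespace ProjectionSurface

/-! ### Heights of the link -/

variable {M : Type u} [TopologicalSpace M] {bM : Set M} {St : Type v} [TopologicalSpace St]
  {P : ProjectionSurface M bM St} {L : Set M} {E : Type*} {lo hi : St → ℝ}

/-- The edge of the diagram under a strand of the lifted link. -/
abbrev EdgeSystem.path (G : P.EdgeSystem L E) (e : E) (s : ℝ) : St := (G.μ e s).1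

/-- The lifted link is the union of its strands. -/
theorem EdgeSystem.mem_lift_iff (G : P.EdgeSystem L E) (hh : P.IsHeights L lo hi) {a : St × ℝ} :
    a ∈ P.lift L ↔ ∃ e, ∃ s ∈ Icc (0 : ℝ) 1, G.μ e s = a := by
  constructor
  · intro ha
    by_cases hV : a.1 ∈ P.crossings L
    · have start : ∀ y ∈ P.crossings L, ∃ e, G.μ e 0 = (y, lo y) := by
        intro y hy
        obtain ⟨e, _, -, he, -⟩ := G.start y hy
        have h1 := (he e).2 (Or.inl rfl)
        have h2 := (hh.isUnder_iff.1 (G.isUnder e)).2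
        exact ⟨e, Prod.ext h1 (by rw [h2, h1])⟩
      rcases ((hh a.1 hV).2 a.2).1 ha with h1 | h1
      · obtain ⟨e, he⟩ := start _ hV
        exact ⟨e, 0, ⟨le_rfl, zero_le_one⟩, he.trans (Prod.ext rfl h1.symm)⟩
      · obtain ⟨e, he⟩ := start _ (P.tau_mem_crossings.2 hV)
        refine ⟨G.star e, 1, ⟨zero_le_one, le_rfl⟩, ?_⟩
        rw [G.μ_star, sub_self, he]
        refine Prod.ext (P.τ_τ _) ?_
        change -lo (P.τ a.1) = a.2
        rw [hh.lo_tau hV, neg_neg, h1]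
    · obtain ⟨e, s, hs, h⟩ := G.cover a.1 ⟨a, ha, rfl⟩ hV
      refine ⟨e, s, Ioo_subset_Icc_self hs, Prod.ext h ?_⟩
      have := G.mem e s
      rw [← Prod.mk.eta (p := G.μ e s), h] at this
      exact height_unique hV this ha
  · rintro ⟨e, s, -, rfl⟩
    exact G.mem e s

/-- Fibrewise affine coordinates in which the link runs along each edge from height `-1` to height
`1` at constant speed: the height of the link is `C + r * (2 * s - 1)`.  All of the link lies
below height `H`, and the vertical segments from height `1` to there have length `k`. -/
structure IsHeightData (G : P.EdgeSystem L E) (C r k : St → ℝ) (H : ℝ) : Prop where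
  continuous_center : Continuous C
  continuous_radius : Continuous r
  center_tau : ∀ y, C (P.τ y) = -C y
  radius_tau : ∀ y, r (P.τ y) = r y
  radius_pos : ∀ y, 0 < r y
  eq : ∀ e, ∀ s ∈ Icc (0 : ℝ) 1, (G.μ e s).2 = C (G.path e s) + r (G.path e s) * (2 * s - 1)
  one_lt : 1 < H
  continuous_len : Continuous k
  len_pos : ∀ y, 0 < k y
  top : ∀ y, C y + r y * (1 + k y) = H

/-- At a crossing the radius has to be half the distance of the two strands and the centre has to
be their midpoint.  With the radius extended to the whole surface, the heights of the strands
prescribe the centre on the diagram. -/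
theorem EdgeSystem.exists_isHeightData [Finite E] (G : P.EdgeSystem L E)
    (hh : P.IsHeights L lo hi) (hV : (P.crossings L).Finite) (hD : IsClosed (P.diagram L))
    {Q : PatchSystem (P.diagram L) (P.crossings L) P.τ} (hγ : Q.IsEdges G.path) :
    ∃ C r k H, IsHeightData G C r k H := by
  have := P.compact
  have := P.isSurface.t2
  have : Nonempty St := P.connected.toNonempty
  have hτc := P.τ.continuous
  -- half the distance of the strands at the crossings, extended to a positive function
  obtain ⟨r, hr, hrτ, hrpos, hrV⟩ : ∃ r : St → ℝ, Continuous r ∧ (∀ y, r (P.τ y) = r y) ∧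
      (∀ y, 0 < r y) ∧ ∀ y ∈ P.crossings L, r y = (hi y - lo y) / 2 := by
    have : Finite (P.crossings L) := hV.to_subtype
    obtain ⟨g, hg⟩ := ContinuousMap.exists_restrict_eq hV.isClosed
      (⟨fun y => Real.log ((hi y - lo y) / 2), continuous_of_discreteTopology⟩ :
        C(P.crossings L, ℝ))
    have hgV : ∀ y ∈ P.crossings L, Real.exp (g y) = (hi y - lo y) / 2 := by
      intro y hy
      have h1 := congrArg (fun f : C(P.crossings L, ℝ) => f ⟨y, hy⟩) hg
      have h2 : g y = Real.log ((hi y - lo y) / 2) := h1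
      rw [h2, Real.exp_log]
      linarith [(hh y hy).1]
    have hgc := g.continuous
    refine ⟨fun y => (Real.exp (g y) + Real.exp (g (P.τ y))) / 2, by fun_prop, ?_, ?_, ?_⟩
    · intro y
      simp only [P.τ_τ]
      ring
    · intro y
      positivity
    · intro y hy
      simp only
      rw [hgV y hy, hgV _ (P.tau_mem_crossings.2 hy), hh.lo_tau hy, hh.hi_tau hy]
      ring
  have hunder : ∀ e, (G.μ e 0).2 = lo (G.path e 0) := fun e => (hh.isUnder_iff.1 (G.isUnder e)).2
  have hover : ∀ e, (G.μ e 1).2 = hi (G.path e 1) := fun e => (hh.isOver_iff.1 (G.isOver e)).2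
  obtain ⟨g, hgc, hg⟩ := hγ.exists_extension hD (fun y => (hi y + lo y) / 2)
    (fun e s => (G.μ e s).2 - r (G.path e s) * (2 * s - 1))
    (fun e => by
      have := G.continuous_μ e
      have h1 : Continuous fun s => r (G.path e s) := hr.comp (continuous_fst.comp this)
      fun_prop)
    (fun e => by
      rw [hunder, hrV _ (hγ.zero_mem e)]
      ring)
    (fun e => by
      rw [hover, hrV _ (hγ.one_mem e)]
      ring)
  have hgτ : ∀ e, ∀ s ∈ Icc (0 : ℝ) 1, g (P.τ (G.path e s)) = -g (G.path e s) := by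
    intro e s hs
    have h1 : G.μ (G.star e) (1 - s) = P.flip (G.μ e s) := by rw [G.μ_star]; ring_nf
    have h2 := hg (G.star e) (1 - s) ⟨by linarith [hs.2], by linarith [hs.1]⟩
    have h3 : G.path (G.star e) (1 - s) = P.τ (G.path e s) := congrArg Prod.fst h1
    have h4 : (G.μ (G.star e) (1 - s)).2 = -(G.μ e s).2 := congrArg Prod.snd h1
    rw [h3, h4, hrτ] at h2
    rw [h2, hg e s hs]
    ring
  -- the centre has to be odd, so that it is antisymmetrised; `H` is chosen above the link
  have hCc : Continuous fun y => (g y - g (P.τ y)) / 2 := by fun_prop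
  obtain ⟨H, hH⟩ := (isCompact_range (hCc.add hr)).bddAbove
  refine ⟨fun y => (g y - g (P.τ y)) / 2, r,
    fun y => (max H 1 + 1 - (g y - g (P.τ y)) / 2) / r y - 1, max H 1 + 1, hCc, hr, ?_, hrτ,
    hrpos, ?_, ?_, ?_, ?_, ?_⟩
  · intro y
    simp only [P.τ_τ]
    ring
  · intro e s hs
    rw [hgτ e s hs, hg e s hs]
    ring
  · linarith [le_max_right H 1]
  · exact ((continuous_const.sub hCc).div hr fun y => (hrpos y).ne').sub continuous_const
  · intro y
    have h1 : (g y - g (P.τ y)) / 2 + r y ≤ H := hH ⟨y, rfl⟩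
    rw [sub_pos, lt_div_iff₀ (hrpos y)]
    linarith [le_max_left H 1]
  · intro y
    have := (hrpos y).ne'
    field_simp
    ring

/-! ### The sweep in the 3-manifold -/

theorem isClosed_compl_tube (P : ProjectionSurface M bM St) (a : ℝ) :
    IsClosed {x : M | x ∉ P.nbhd '' (univ ×ˢ Ioo (-a) a)} :=
  ((P.isOpenMap_nbhd _ (isOpen_univ.prod isOpen_Ioo)).isClosed_compl)

/-- A symmetric tube about `S` is described by the second coordinate, since the two lifts of a
point have opposite heights. -/
theorem nbhd_mem_tube {a : ℝ} {y : St} {t : ℝ} :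
    P.nbhd (y, t) ∈ P.nbhd '' (univ ×ˢ Ioo (-a) a) ↔ t ∈ Ioo (-a) a := by
  constructor
  · rintro ⟨⟨y', t'⟩, ⟨-, ht'⟩, h⟩
    rcases P.nbhd_eq.1 h with h1 | h1
    · rw [show t = t' from congrArg Prod.snd h1]
      exact ht'
    · rw [show t = -t' from congrArg Prod.snd h1]
      exact ⟨by linarith [ht'.2], by linarith [ht'.1]⟩
  · intro ht
    exact ⟨(y, t), ⟨mem_univ _, ht⟩, rfl⟩

/-- Above the surface the map from the product to `M` is injective. -/
theorem eq_of_nbhd_eq {y y' : St} {t t' : ℝ} (ht : 0 < t) (ht' : 0 < t')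
    (h : P.nbhd (y, t) = P.nbhd (y', t')) : y = y' ∧ t = t' := by
  rcases P.nbhd_eq.1 h with h1 | h1
  · exact ⟨(congrArg Prod.fst h1).symm, (congrArg Prod.snd h1).symm⟩
  · have h2 : t' = -t := congrArg Prod.snd h1
    linarith

theorem injective_toCut : Function.Injective P.toCut := fun _ _ h =>
  (eq_of_nbhd_eq one_pos one_pos (congrArg Subtype.val h)).1

theorem continuous_toCut : Continuous P.toCut :=
  Continuous.subtype_mk (P.continuous_nbhd.comp (by fun_prop)) _

/-- The part of `M` outside the collars that are swept. -/
abbrev Outside (P : ProjectionSurface M bM St) (H : ℝ) : Type u :=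
  {x : M // x ∉ P.nbhd '' (univ ×ˢ Ioo (-H) H)}

variable {G : P.EdgeSystem L E} {Q : PatchSystem (P.diagram L) (P.crossings L) P.τ}
  {edge : Q.Carrier → E} {R : ℝ → Q.Carrier → Q.Carrier} {c : Q.Carrier → ℝ → Q.Carrier}
  {κ : Q.Carrier → ℝ} {k C r : St → ℝ} {H : ℝ}

/-- The product of the cut surface with the interval, together with the outside, parametrises
`M \\ S`, by means of the source map. -/
noncomputable def sweepSource (Q : PatchSystem (P.diagram L) (P.crossings L) P.τ)
    (R : ℝ → Q.Carrier → Q.Carrier) (c : Q.Carrier → ℝ → Q.Carrier) (κ : Q.Carrier → ℝ) (H : ℝ) :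
    (unitInterval × Q.Carrier) ⊕ P.Outside H → M :=
  Sum.elim (fun p => P.nbhd (Q.proj (Q.src R c κ p.1 p.2), 1 + p.1 * (H - 1))) Subtype.val

/-- The same space parametrises `M`, by means of the target map. -/
noncomputable def sweepTarget (Q : PatchSystem (P.diagram L) (P.crossings L) P.τ)
    (R : ℝ → Q.Carrier → Q.Carrier) (c : Q.Carrier → ℝ → Q.Carrier) (κ : Q.Carrier → ℝ)
    (k C r : St → ℝ) (H : ℝ) : (unitInterval × Q.Carrier) ⊕ P.Outside H → M :=
  Sum.elim (fun p => P.nbhd (Q.proj (Q.tgt R c κ p.1 p.2), C (Q.proj (Q.tgt R c κ p.1 p.2)) +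
    r (Q.proj (Q.tgt R c κ p.1 p.2)) * Q.height R c κ k p.1 p.2)) Subtype.val

/-- The identifications of points of `M \\ S` off the ideal vertices by the regluing of the
faces. -/
def CutRel (Q : PatchSystem (P.diagram L) (P.crossings L) P.τ)
    (R : ℝ → Q.Carrier → Q.Carrier) (c : Q.Carrier → ℝ → Q.Carrier)
    (x y : {x : P.Cut // x ∉ P.toCut '' P.crossings L}) : Prop :=
  ∃ z, P.toCut (Q.proj z) = x.1 ∧ P.toCut (Q.proj (Q.regluing R c z)) = y.1

theorem notMem_image_toCut {y : St} (hy : y ∉ P.crossings L) :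
    P.toCut y ∉ P.toCut '' P.crossings L := by
  rwa [injective_toCut.mem_set_image]

theorem eqvGen_cutRel {a b : {y : St // y ∉ P.crossings L}}
    (h : Relation.EqvGen (Q.FaceRel R c) a b) : Relation.EqvGen (CutRel Q R c)
      ⟨P.toCut a.1, notMem_image_toCut a.2⟩ ⟨P.toCut b.1, notMem_image_toCut b.2⟩ := by
  induction h with
  | rel a b h =>
    obtain ⟨z, h1, h2⟩ := h
    exact Relation.EqvGen.rel _ _ ⟨z, congrArg P.toCut h1, congrArg P.toCut h2⟩
  | refl a => exact Relation.EqvGen.refl _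
  | symm a b _ ih => exact Relation.EqvGen.symm _ _ ih
  | trans a b d _ _ ih1 ih2 => exact Relation.EqvGen.trans _ _ _ ih1 ih2

section Sweep

variable (h : Q.IsFaceData G.path edge R c κ k) (hC : IsHeightData G C r k H)
  (hh : P.IsHeights L lo hi)

include h in
theorem continuous_sweepSource : Continuous (sweepSource Q R c κ H) := by
  have := P.compact
  have := P.isSurface.t2
  refine Continuous.sumElim (P.continuous_nbhd.comp (Continuous.prodMk ?_ (by fun_prop)))
    continuous_subtype_val
  exact Q.continuous_proj.comp (h.continuous_src.comp (f := fun p : unitInterval × Q.Carrier =>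
    ((p.1 : ℝ), p.2)) (by fun_prop))

include h hC in
theorem continuous_sweepTarget : Continuous (sweepTarget Q R c κ k C r H) := by
  have := P.compact
  have := P.isSurface.t2
  have h1 : Continuous fun p : unitInterval × Q.Carrier => Q.proj (Q.tgt R c κ p.1 p.2) :=
    Q.continuous_proj.comp (h.continuous_tgt.comp (f := fun p : unitInterval × Q.Carrier =>
      ((p.1 : ℝ), p.2)) (by fun_prop))
  have h2 : Continuous fun p : unitInterval × Q.Carrier => Q.height R c κ k p.1 p.2 :=
    h.continuous_height.comp (f := fun p : unitInterval × Q.Carrier => ((p.1 : ℝ), p.2))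
      (by fun_prop)
  exact Continuous.sumElim (P.continuous_nbhd.comp (h1.prodMk
    ((hC.continuous_center.comp h1).add ((hC.continuous_radius.comp h1).mul h2))))
    continuous_subtype_val

include hC in
theorem sweepSource_mem (ω : (unitInterval × Q.Carrier) ⊕ P.Outside H) :
    sweepSource Q R c κ H ω ∉ P.nbhd '' (univ ×ˢ Ioo (-1) 1) := by
  have h1 := hC.one_lt
  rcases ω with ⟨ε, w⟩ | ⟨x, hx⟩
  · rw [sweepSource, Sum.elim_inl, nbhd_mem_tube]
    intro h2
    have := mul_nonneg ε.2.1 (by linarith : 0 ≤ H - 1)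
    exact absurd h2.2 (by linarith)
  · intro h2
    refine hx (image_mono (prod_mono subset_rfl ?_) h2)
    exact Ioo_subset_Ioo (by linarith) h1.le

include h hC in
/-- The source map is onto `M \\ S`: the product covers the collar below height `H`. -/
theorem exists_sweepSource {x : M} (hx : x ∉ P.nbhd '' (univ ×ˢ Ioo (-1) 1)) :
    ∃ ω, sweepSource Q R c κ H ω = x := by
  have := P.compact
  have := P.isSurface.t2
  have h1 := hC.one_lt
  by_cases hxH : x ∈ P.nbhd '' (univ ×ˢ Ioo (-H) H)
  · have key : ∀ y t, 1 ≤ t → t < H → ∃ ω, sweepSource Q R c κ H ω = P.nbhd (y, t) := by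
      intro y t ht1 htH
      obtain ⟨z, rfl⟩ := Q.surjective_proj y
      have hI : (t - 1) / (H - 1) ∈ unitInterval :=
        ⟨div_nonneg (by linarith) (by linarith), (div_le_one (by linarith)).2 (by linarith)⟩
      obtain ⟨w, hw⟩ := h.surjective_src hI z
      refine ⟨Sum.inl (⟨_, hI⟩, w), ?_⟩
      rw [sweepSource, Sum.elim_inl, hw]
      congr 2
      simp only
      rw [div_mul_cancel₀ _ (by linarith)]
      ring
    obtain ⟨⟨y, t⟩, ⟨-, ht⟩, rfl⟩ := hxH
    rw [nbhd_mem_tube] at hx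
    rcases le_or_gt 1 t with h2 | h2
    · exact key y t h2 ht.2
    · rw [← P.nbhd_flip]
      refine key _ _ ?_ (by linarith [ht.1])
      by_contra h3
      exact hx ⟨by linarith, h2⟩
  · exact ⟨Sum.inr ⟨x, hxH⟩, rfl⟩

include h hC in
/-- The target map is onto `M`: the product and its mirror image cover the tube of height `H`. -/
theorem surjective_sweepTarget : Function.Surjective (sweepTarget Q R c κ k C r H) := by
  have := P.compact
  have := P.isSurface.t2
  intro x
  by_cases hxH : x ∈ P.nbhd '' (univ ×ˢ Ioo (-H) H)
  · obtain ⟨⟨y, t⟩, ⟨-, ht⟩, rfl⟩ := hxH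
    have hr := hC.radius_pos y
    have h1 := hC.top y
    have h2 := hC.top (P.τ y)
    rw [hC.center_tau, hC.radius_tau] at h2
    obtain ⟨ε, hε, w, hw⟩ := h.exists_tgt (y := y) (t := (t - C y) / r y)
      (by rw [div_le_iff₀ hr]; linarith [ht.2])
      (by rw [← neg_div, div_le_iff₀ hr]; linarith [ht.1])
    have ht' : C y + r y * ((t - C y) / r y) = t := by
      field_simp
      ring
    refine ⟨Sum.inl (⟨ε, hε⟩, w), ?_⟩
    rw [sweepTarget, Sum.elim_inl]
    rcases hw with ⟨hw1, hw2⟩ | ⟨hw1, hw2⟩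
    · simp only [hw1, hw2, ht']
    · simp only [hw1, hw2, hC.center_tau, hC.radius_tau]
      rw [← P.nbhd_flip, flip]
      simp only [P.τ_τ]
      congr 2
      linarith
  · exact ⟨Sum.inr ⟨x, hxH⟩, rfl⟩

include h hC hh in
/-- The points that are swept into the link are those that start at the ideal vertices. -/
theorem sweepTarget_mem_link (hLN : L ⊆ P.thickening)
    (ω : (unitInterval × Q.Carrier) ⊕ P.Outside H) :
    sweepTarget Q R c κ k C r H ω ∈ L ↔
      ∃ y ∈ P.crossings L, P.nbhd (y, 1) = sweepSource Q R c κ H ω := by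
  have h1 := hC.one_lt
  rcases ω with ⟨ε, w⟩ | ⟨x, hx⟩
  · rw [sweepTarget, sweepSource, Sum.elim_inl, Sum.elim_inl]
    simp only
    set y := Q.proj (Q.tgt R c κ ε w)
    set N := Q.height R c κ k ε w
    have e1 : P.nbhd (y, C y + r y * N) ∈ L ↔ ∃ e, ∃ s ∈ Icc (0 : ℝ) 1,
        y = G.path e s ∧ N = 2 * s - 1 := by
      rw [← mem_preimage, show P.nbhd ⁻¹' L = P.lift L from rfl, G.mem_lift_iff hh]
      constructor
      · rintro ⟨e, s, hs, he⟩
        have h2 := hC.eq e s hs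
        have h3 : G.path e s = y := congrArg Prod.fst he
        have h4 : (G.μ e s).2 = C y + r y * N := congrArg Prod.snd he
        rw [h3, h4] at h2
        exact ⟨e, s, hs, h3.symm, mul_left_cancel₀ (hC.radius_pos y).ne' (by linarith)⟩
      · rintro ⟨e, s, hs, h2, h3⟩
        exact ⟨e, s, hs, Prod.ext h2.symm (by rw [hC.eq e s hs, ← h2, h3])⟩
    rw [e1, ← h.mem_link_iff ε.2]
    have hε := mul_nonneg ε.2.1 (by linarith : 0 ≤ H - 1)
    constructor
    · rintro ⟨h2, h3⟩
      exact ⟨_, h3, by rw [h2]; simp⟩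
    · rintro ⟨y', hy', he⟩
      obtain ⟨rfl, h3⟩ := eq_of_nbhd_eq one_pos (by linarith) he
      refine ⟨?_, hy'⟩
      have : (ε : ℝ) * (H - 1) = 0 := by linarith
      exact (mul_eq_zero.1 this).resolve_right (by linarith)
  · rw [sweepTarget, sweepSource, Sum.elim_inr, Sum.elim_inr]
    constructor
    · intro hL
      obtain ⟨⟨y, t⟩, ⟨-, ht⟩, rfl⟩ := hLN hL
      refine absurd ?_ hx
      rw [nbhd_mem_tube]
      exact ⟨by linarith [ht.1], by linarith [ht.2]⟩
    · rintro ⟨y, -, he⟩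
      refine absurd ?_ hx
      rw [show x = P.nbhd (y, 1) from he.symm, nbhd_mem_tube]
      exact ⟨by linarith, h1⟩

include h hC in
/-- The swept part meets the outside only at the upper end of the segments, where the source and
the target agree. -/
theorem sweep_eq_outside {ε : unitInterval} {w : Q.Carrier} {x : P.Outside H}
    (he : sweepSource Q R c κ H (Sum.inl (ε, w)) = x.1 ∨
      sweepTarget Q R c κ k C r H (Sum.inl (ε, w)) = x.1) :
    sweepSource Q R c κ H (Sum.inl (ε, w)) = x.1 ∧
      sweepTarget Q R c κ k C r H (Sum.inl (ε, w)) = x.1 := by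
  have h1 := hC.one_lt
  have hε : (ε : ℝ) = 1 := by
    by_contra hne
    have hlt : (ε : ℝ) < 1 := lt_of_le_of_ne ε.2.2 hne
    refine x.2 ?_
    rcases he with he | he
    · rw [← he, sweepSource, Sum.elim_inl, nbhd_mem_tube]
      have := mul_nonneg ε.2.1 (by linarith : 0 ≤ H - 1)
      constructor <;> nlinarith
    · rw [← he, sweepTarget, Sum.elim_inl, nbhd_mem_tube]
      simp only
      obtain ⟨h2, h3⟩ := h.height_bounds ε.2 w
      set y := Q.proj (Q.tgt R c κ ε w)
      set N := Q.height R c κ k ε w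
      have hr := hC.radius_pos y
      have h4 := hC.top y
      have h5 := hC.top (P.τ y)
      rw [hC.center_tau, hC.radius_tau] at h5
      have h6 := mul_pos hr (hC.len_pos y)
      have h7 := mul_pos hr (hC.len_pos (P.τ y))
      have h8 := mul_le_mul_of_nonneg_left h2 hr.le
      have h9 := mul_le_mul_of_nonneg_left h3 hr.le
      have h10 := mul_lt_of_lt_one_right h6 hlt
      constructor
      · linarith
      · linarith
  have h2 : ∀ w, sweepSource Q R c κ H (Sum.inl (ε, w)) =
      sweepTarget Q R c κ k C r H (Sum.inl (ε, w)) := by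
    intro w
    obtain ⟨h3, h4, h5⟩ := h.eval_one w
    rw [sweepSource, sweepTarget, Sum.elim_inl, Sum.elim_inl]
    simp only [hε, h3, h4, h5, hC.top]
    congr 2
    ring
  rw [h2 w, or_self] at he
  exact ⟨(h2 w).trans he, he⟩

include h hC in
/-- Off the ideal vertices, the target depends only on the source. -/
theorem sweepTarget_eq {ω ω' : (unitInterval × Q.Carrier) ⊕ P.Outside H}
    (he : sweepSource Q R c κ H ω = sweepSource Q R c κ H ω')
    (hV : ¬ ∃ y ∈ P.crossings L, P.nbhd (y, 1) = sweepSource Q R c κ H ω) :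
    sweepTarget Q R c κ k C r H ω = sweepTarget Q R c κ k C r H ω' := by
  rcases ω with ⟨ε, w⟩ | x <;> rcases ω' with ⟨ε', w'⟩ | x'
  · have h1 := hC.one_lt
    rw [sweepSource, Sum.elim_inl, Sum.elim_inl] at he
    rw [sweepSource, Sum.elim_inl] at hV
    have hε := mul_nonneg ε.2.1 (by linarith : 0 ≤ H - 1)
    have hε' := mul_nonneg ε'.2.1 (by linarith : 0 ≤ H - 1)
    obtain ⟨h2, h3⟩ := eq_of_nbhd_eq (by linarith) (by linarith) he
    have h4 : ε = ε' := Subtype.ext (mul_right_cancel₀ (by linarith : H - 1 ≠ 0) (by linarith))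
    subst h4
    simp only at h2
    obtain ⟨h5, h6⟩ := h.tgt_eq_of_src_eq ε.2 h2 fun h7 => hV ⟨_, h7.2, by
      simp only [h7.1, zero_mul, add_zero]⟩
    rw [sweepTarget, Sum.elim_inl, Sum.elim_inl]
    simp only [h5, h6]
  · exact (sweep_eq_outside h hC (Or.inl he)).2
  · exact (sweep_eq_outside h hC (Or.inl he.symm)).2.symm
  · exact he

include h hC in
/-- Points of `M \\ S` that are swept to the same place are identified by the regluing. -/
theorem eqvGen_of_sweepTarget_eq (hsep : Q.SeparatesCorners G.path)
    {ω ω' : (unitInterval × Q.Carrier) ⊕ P.Outside H}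
    (he : sweepTarget Q R c κ k C r H ω = sweepTarget Q R c κ k C r H ω')
    {x x' : {x : P.Cut // x ∉ P.toCut '' P.crossings L}}
    (hx : sweepSource Q R c κ H ω = x.1.1) (hx' : sweepSource Q R c κ H ω' = x'.1.1) :
    Relation.EqvGen (CutRel Q R c) x x' := by
  have := P.isSurface.t2
  have h1 := hC.one_lt
  have of_eq : sweepSource Q R c κ H ω = sweepSource Q R c κ H ω' →
      Relation.EqvGen (CutRel Q R c) x x' := by
    intro h2
    have : x = x' := Subtype.ext (Subtype.ext (by rw [← hx, ← hx', h2]))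
    rw [this]
    exact Relation.EqvGen.refl _
  rcases ω with ⟨ε, w⟩ | ω <;> rcases ω' with ⟨ε', w'⟩ | ω'
  · have hV : ¬ ((ε : ℝ) = 0 ∧ Q.proj (Q.src R c κ ε w) ∈ P.crossings L) := by
      rintro ⟨h2, h3⟩
      refine x.2 ⟨_, h3, Subtype.ext ?_⟩
      rw [← hx, sweepSource, Sum.elim_inl]
      change P.nbhd (_, 1) = _
      simp only [h2, zero_mul, add_zero]
    -- points that are identified by the regluing lie at parameter `0`
    have of_rel : (ε : ℝ) = 0 ∧ (ε' : ℝ) = 0 ∧ (∃ ha hb, Relation.EqvGen (Q.FaceRel R c)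
        ⟨Q.proj (Q.src R c κ ε w), ha⟩ ⟨Q.proj (Q.src R c κ ε' w'), hb⟩) →
        Relation.EqvGen (CutRel Q R c) x x' := by
      rintro ⟨h2, h3, ha, hb, h4⟩
      have h5 : x = ⟨P.toCut (Q.proj (Q.src R c κ ε w)), notMem_image_toCut ha⟩ := by
        refine Subtype.ext (Subtype.ext ?_)
        rw [← hx, sweepSource, Sum.elim_inl]
        change _ = P.nbhd (_, 1)
        simp only [h2, zero_mul, add_zero]
      have h6 : x' = ⟨P.toCut (Q.proj (Q.src R c κ ε' w')), notMem_image_toCut hb⟩ := by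
        refine Subtype.ext (Subtype.ext ?_)
        rw [← hx', sweepSource, Sum.elim_inl]
        change _ = P.nbhd (_, 1)
        simp only [h3, zero_mul, add_zero]
      rw [h5, h6]
      exact eqvGen_cutRel h4
    rw [sweepTarget, Sum.elim_inl, Sum.elim_inl, P.nbhd_eq] at he
    rcases he with he | he
    · have h2 := congrArg Prod.fst he
      have h3 := congrArg Prod.snd he
      simp only at h2 h3
      rw [h2] at h3
      have h4 := mul_left_cancel₀ (hC.radius_pos _).ne' (add_left_cancel h3)
      rcases h.src_eq_of_tgt_eq hsep ε.2 ε'.2 h2.symm h4.symm hV with ⟨h5, h6⟩ | h5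
      · obtain rfl : ε = ε' := Subtype.ext h6
        refine of_eq ?_
        rw [sweepSource, Sum.elim_inl, Sum.elim_inl]
        simp only [h5]
      · exact of_rel h5
    · have h2 := congrArg Prod.fst he
      have h3 := congrArg Prod.snd he
      simp only [flip] at h2 h3
      rw [h2, hC.center_tau, hC.radius_tau] at h3
      have h4 : Q.height R c κ k ε' w' = -Q.height R c κ k ε w :=
        mul_left_cancel₀ (hC.radius_pos (Q.proj (Q.tgt R c κ ε w))).ne' (by linarith)
      exact of_rel (h.src_rel_of_tgt_eq hsep ε.2 ε'.2 h2 h4 hV)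
  · exact of_eq (sweep_eq_outside h hC (Or.inr he)).1
  · exact of_eq (sweep_eq_outside h hC (Or.inr he.symm)).1.symm
  · exact of_eq he

/-- A closed surjective continuous map restricts to a quotient map on the preimage of any set. -/
theorem isQuotientMap_restrict {X Y : Type*} [TopologicalSpace X] [TopologicalSpace Y] {f : X → Y}
    (hf : Continuous f) (hcl : IsClosedMap f) (hs : Function.Surjective f) (A : Set Y) :
    IsQuotientMap (A.restrictPreimage f) :=
  (hcl.restrictPreimage A).isQuotientMap hf.restrictPreimage (hs.restrictPreimage A)

include h hC hh in
/-- The sweep descends to a quotient map from `M \\ S` without the ideal vertices to the complement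
of the link, whose fibres are the classes of the regluing.  Each edge is taken affinely to the
crossing arc at its starting point, from the upper to the lower strand. -/
theorem exists_quot [CompactSpace M] [T2Space M] (hLN : L ⊆ P.thickening)
    (hsep : Q.SeparatesCorners G.path) :
    ∃ q : {x : P.Cut // x ∉ P.toCut '' P.crossings L} → {x : M // x ∉ L}, IsQuotientMap q ∧
      (∀ x y, q x = q y ↔ Relation.EqvGen (CutRel Q R c) x y) ∧
      ∀ e, ∀ s ∈ Ioo (0 : ℝ) 1, ∀ hx, (q ⟨P.toCut (G.path e s), hx⟩ : M) =
        P.nbhd (G.path e 0, hi (G.path e 0) + s * (lo (G.path e 0) - hi (G.path e 0))) := by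
  have := P.compact
  have := P.isSurface.t2
  have : CompactSpace (P.Outside H) :=
    isCompact_iff_compactSpace.1 (P.isClosed_compl_tube H).isCompact
  let Ω := (unitInterval × Q.Carrier) ⊕ P.Outside H
  let σ : Ω → P.Cut := fun ω => ⟨sweepSource Q R c κ H ω, sweepSource_mem hC ω⟩
  let θ : Ω → M := sweepTarget Q R c κ k C r H
  have hσ : Continuous σ := Continuous.subtype_mk (continuous_sweepSource h) _
  have hθ : Continuous θ := continuous_sweepTarget h hC
  have hσs : Function.Surjective σ := by
    rintro ⟨x, hx⟩
    obtain ⟨ω, hω⟩ := exists_sweepSource h hC hx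
    exact ⟨ω, Subtype.ext hω⟩
  have hθs : Function.Surjective θ := surjective_sweepTarget h hC
  have hσV : ∀ ω, σ ω ∈ P.toCut '' P.crossings L ↔
      ∃ y ∈ P.crossings L, P.nbhd (y, 1) = sweepSource Q R c κ H ω := by
    intro ω
    constructor
    · rintro ⟨y, hy, he⟩
      exact ⟨y, hy, congrArg Subtype.val he⟩
    · rintro ⟨y, hy, he⟩
      exact ⟨y, hy, Subtype.ext he⟩
  have hmem : ∀ ω, θ ω ∈ L ↔ σ ω ∈ P.toCut '' P.crossings L := fun ω =>
    (sweepTarget_mem_link h hC hh hLN ω).trans (hσV ω).symm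
  -- the map is well defined by any choice of a point over each point of `M \\ S`
  obtain ⟨l, hl⟩ := hσs.hasRightInverse
  let q : {x : P.Cut // x ∉ P.toCut '' P.crossings L} → {x : M // x ∉ L} := fun x =>
    ⟨θ (l x.1), fun hm => x.2 (by rw [hmem, hl] at hm; exact hm)⟩
  have hq : ∀ x ω, σ ω = x.1 → (q x : M) = θ ω := by
    intro x ω hω
    refine sweepTarget_eq h hC (congrArg Subtype.val ((hl x.1).trans hω.symm)) ?_
    rw [← hσV, hl]
    exact x.2
  refine ⟨q, ?_, fun x y => ⟨fun hxy => ?_, fun hxy => ?_⟩, ?_⟩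
  · -- both parametrisations are quotient maps, by compactness, and correspond off the link
    have q1 := isQuotientMap_restrict hσ hσ.isClosedMap hσs (P.toCut '' P.crossings L)ᶜ
    have q2 := isQuotientMap_restrict hθ hθ.isClosedMap hθs Lᶜ
    let j : ↥(σ ⁻¹' (P.toCut '' P.crossings L)ᶜ) ≃ₜ ↥(θ ⁻¹' Lᶜ) :=
      Homeomorph.setCongr (by
        ext ω
        exact (not_congr (hmem ω)).symm)
    have hcomp : q ∘ (P.toCut '' P.crossings L)ᶜ.restrictPreimage σ =
        Lᶜ.restrictPreimage θ ∘ j := by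
      funext ω
      exact Subtype.ext (hq _ ω.1 rfl)
    have q3 : IsQuotientMap (q ∘ (P.toCut '' P.crossings L)ᶜ.restrictPreimage σ) := by
      rw [hcomp]
      exact q2.comp j.isQuotientMap
    exact IsQuotientMap.of_comp q1.continuous (q1.continuous_iff.2 q3.continuous) q3
  · refine eqvGen_of_sweepTarget_eq h hC hsep (ω := l x.1) (ω' := l y.1)
      (congrArg Subtype.val hxy) (congrArg Subtype.val (hl _)) (congrArg Subtype.val (hl _))
  · induction hxy with
    | rel x y hxy =>
      obtain ⟨z, h1, h2⟩ := hxy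
      obtain ⟨w, w', h3, h4, h5, h6⟩ := h.exists_opposite z
      have e1 : σ (Sum.inl (0, w)) = x.1 := by
        rw [← h1, ← h3]
        refine Subtype.ext ?_
        change P.nbhd (_, _) = P.nbhd (_, 1)
        simp
      have e2 : σ (Sum.inl (0, w')) = y.1 := by
        rw [← h2, ← h4]
        refine Subtype.ext ?_
        change P.nbhd (_, _) = P.nbhd (_, 1)
        simp
      refine Subtype.ext ((hq x _ e1).trans (Eq.trans ?_ (hq y _ e2).symm))
      change P.nbhd (_, _) = P.nbhd (_, _)
      simp only [Icc.coe_zero, h5, h6, hC.center_tau, hC.radius_tau]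
      rw [← P.nbhd_flip, flip]
      congr 2
      ring
    | refl x => rfl
    | symm x y _ ih => exact ih.symm
    | trans x y z _ _ ih1 ih2 => exact ih1.trans ih2
  · intro e s hs hx
    obtain ⟨w, h1, h2, h3⟩ := h.exists_edge e (Ioo_subset_Icc_self hs)
    have e1 : σ (Sum.inl (0, w)) = P.toCut (G.path e s) := by
      rw [← h1]
      refine Subtype.ext ?_
      change P.nbhd (_, _) = P.nbhd (_, 1)
      simp
    rw [hq ⟨_, hx⟩ _ e1]
    change P.nbhd (_, _) = P.nbhd (_, _)
    simp only [Icc.coe_zero, h2, h3]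
    set y := G.path e 0 with hy
    have hyV : y ∈ P.crossings L := h.edges.zero_mem e
    have hlo : lo y = C y - r y := by
      have h4 := hC.eq e 0 ⟨le_rfl, zero_le_one⟩
      rw [(hh.isUnder_iff.1 (G.isUnder e)).2, ← hy] at h4
      change lo y = _ at h4
      linarith
    have hhi : hi y = C y + r y := by
      obtain ⟨d, hd⟩ := h.edges.exists_end P.τ_τ (fun _ => P.tau_mem_crossings.2) hyV
      have h4 := hC.eq d 1 ⟨zero_le_one, le_rfl⟩
      rw [(hh.isOver_iff.1 (G.isOver d)).2, hd] at h4
      change hi (G.path d 1) = _ at h4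
      rw [hd] at h4
      linarith
    rw [hlo, hhi]
    congr 2
    ring

end Sweep

end ProjectionSurface

namespace ProjectionSurface

/-! ### The manifold cut along the surface -/

variable {M : Type u} [TopologicalSpace M] {bM : Set M} {St : Type v} [TopologicalSpace St]

/-- Three-dimensional half-space as the product of a plane and a half-line. -/
theorem isOpenEmbedding_halfSpace :
    IsOpenEmbedding (fun p : EuclideanSpace ℝ (Fin 2) × ℝ≥0 =>
      (⟨!₂[(p.2 : ℝ), p.1 0, p.1 1], by simp⟩ : EuclideanHalfSpace 3)) := by
  have hc : Continuous (fun p : EuclideanSpace ℝ (Fin 2) × ℝ≥0 =>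
      (⟨!₂[(p.2 : ℝ), p.1 0, p.1 1], by simp⟩ : EuclideanHalfSpace 3)) := by
    refine Continuous.subtype_mk ?_ _
    refine (PiLp.continuous_toLp 2 _).comp (continuous_pi fun i => ?_)
    fin_cases i <;> simp <;> fun_prop
  have hg : Continuous (fun x : EuclideanHalfSpace 3 =>
      ((!₂[x.1 1, x.1 2], ⟨x.1 0, x.2⟩) : EuclideanSpace ℝ (Fin 2) × ℝ≥0)) := by
    refine Continuous.prodMk ?_ (Continuous.subtype_mk (by fun_prop) _)
    refine (PiLp.continuous_toLp 2 _).comp (continuous_pi fun i => ?_)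
    fin_cases i <;> simp <;> fun_prop
  let e : (EuclideanSpace ℝ (Fin 2) × ℝ≥0) ≃ₜ EuclideanHalfSpace 3 :=
    { toFun := _
      invFun := fun x => ((!₂[x.1 1, x.1 2], ⟨x.1 0, x.2⟩) : EuclideanSpace ℝ (Fin 2) × ℝ≥0)
      left_inv := fun p => by
        refine Prod.ext ?_ rfl
        ext i
        fin_cases i <;> rfl
      right_inv := fun x => by
        apply Subtype.ext
        ext i
        fin_cases i <;> rfl
      continuous_toFun := hc
      continuous_invFun := hg }
  exact e.isOpenEmbedding

/-- A chart of a surface without boundary is an open embedding into the plane. -/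
theorem isOpenEmbedding_chart {e : OpenPartialHomeomorph St (EuclideanHalfSpace 2)}
    (he : ∀ y ∈ e.source, (e y).1 0 ≠ 0) :
    IsOpenEmbedding (fun y : e.source => (e y).1) := by
  refine ⟨IsEmbedding.subtypeVal.comp e.isOpenEmbedding_restrict.isEmbedding, ?_⟩
  obtain ⟨U, hU, hUt⟩ := isOpen_induced_iff.1 e.open_target
  have h1 : IsOpen {v : EuclideanSpace ℝ (Fin 2) | 0 < v 0} :=
    isOpen_lt continuous_const (by fun_prop)
  convert hU.inter h1 using 1
  ext v
  constructor
  · rintro ⟨y, rfl⟩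
    refine ⟨?_, lt_of_le_of_ne (e y).2 (he y y.2).symm⟩
    have := e.map_source y.2
    rw [← hUt] at this
    exact this
  · rintro ⟨hv, hv0⟩
    have hv0' : 0 < v 0 := hv0
    have h2 : (⟨v, hv0'.le⟩ : EuclideanHalfSpace 2) ∈ e.target := by
      rw [← hUt]
      exact hv
    exact ⟨⟨e.symm ⟨v, hv0'.le⟩, e.map_target h2⟩, by simp only [e.right_inv h2]⟩

variable {P : ProjectionSurface M bM St}

/-- A point of `M \\ S` in the closed thickening lies on its boundary. -/
theorem mem_range_toCut {x : P.Cut} (hx : x.1 ∈ P.nbhd '' (univ ×ˢ Icc (-1) 1)) :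
    x ∈ range P.toCut := by
  obtain ⟨⟨y, t⟩, ⟨-, ht⟩, h⟩ := hx
  have h1 : t ∉ Ioo (-1 : ℝ) 1 := by
    rw [← nbhd_mem_tube (P := P) (y := y), h]
    exact x.2
  have h2 : t = -1 ∨ t = 1 := by
    by_contra! hne
    exact h1 ⟨lt_of_le_of_ne ht.1 hne.1.symm, lt_of_le_of_ne ht.2 hne.2⟩
  rcases h2 with rfl | rfl
  · refine ⟨P.τ y, Subtype.ext ?_⟩
    rw [← h, ← P.nbhd_flip (y, -1), flip]
    simp [toCut]
  · exact ⟨y, Subtype.ext h⟩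

theorem toCut_mem (y : St) : (P.toCut y).1 ∈ P.nbhd '' (univ ×ˢ Icc (-1) 1) :=
  ⟨(y, 1), ⟨mem_univ _, by norm_num⟩, rfl⟩

theorem isClosed_thickening [T2Space M] : IsClosed (P.nbhd '' (univ ×ˢ Icc (-1) 1)) := by
  have := P.compact
  exact ((isCompact_univ.prod isCompact_Icc).image P.continuous_nbhd).isClosed

theorem compactSpace_cut [CompactSpace M] : CompactSpace P.Cut :=
  isCompact_iff_compactSpace.1 (P.isClosed_compl_tube 1).isCompact

/-- Every half of a separation of `M \\ S` that misses the connected surface `St` would also be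
half of a separation of `M`. -/
theorem connectedSpace_cut [ConnectedSpace M] [T2Space M] : ConnectedSpace P.Cut := by
  have := P.connected
  have : Nonempty St := P.connected.toNonempty
  have hcl := P.isClosed_compl_tube 1
  have key : ∀ s : Set P.Cut, IsClopen s → range P.toCut ⊆ s → s = univ := by
    intro s hs hsub
    have h1 : IsClosed (Subtype.val '' sᶜ) :=
      hcl.isClosedEmbedding_subtypeVal.isClosedMap _ hs.compl.isClosed
    have h2 : IsOpen (Subtype.val '' sᶜ) := by
      obtain ⟨U, hU, hUs⟩ := isOpen_induced_iff.1 hs.compl.isOpen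
      convert hU.inter (P.isClosed_thickening).isOpen_compl using 1
      ext x
      constructor
      · rintro ⟨x, hx, rfl⟩
        refine ⟨?_, fun hm => hx (hsub (mem_range_toCut hm))⟩
        rw [← hUs] at hx
        exact hx
      · rintro ⟨hxU, hx⟩
        have hx' : x ∉ P.nbhd '' (univ ×ˢ Ioo (-1) 1) := fun hm =>
          hx (image_mono (prod_mono subset_rfl Ioo_subset_Icc_self) hm)
        refine ⟨⟨x, hx'⟩, ?_, rfl⟩
        rw [← hUs]
        exact hxU
    rcases isClopen_iff.1 ⟨h1, h2⟩ with h3 | h3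
    · rw [image_eq_empty, compl_empty_iff] at h3
      exact h3
    · obtain ⟨y⟩ := ‹Nonempty St›
      have h4 : P.nbhd (y, 0) ∈ Subtype.val '' sᶜ := h3 ▸ mem_univ _
      obtain ⟨x, -, hx⟩ := h4
      refine absurd ?_ x.2
      rw [hx, nbhd_mem_tube]
      norm_num
  have : PreconnectedSpace P.Cut := by
    rw [preconnectedSpace_iff_clopen]
    intro s hs
    have h1 := isClopen_iff.1 (hs.preimage P.continuous_toCut)
    rcases h1 with h1 | h1
    · left
      rw [← compl_univ_iff]
      refine key _ hs.compl ?_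
      rintro _ ⟨y, rfl⟩ hy
      exact (h1 ▸ hy : y ∈ (∅ : Set St))
    · right
      refine key _ hs ?_
      rintro _ ⟨y, rfl⟩
      exact (h1 ▸ mem_univ y : y ∈ P.toCut ⁻¹' s)
  exact ⟨(range_nonempty P.toCut).nonempty⟩

/-- The collar of the part of the boundary of `M \\ S` along `S`. -/
def cutCollar (P : ProjectionSurface M bM St) (p : St × ℝ≥0) : P.Cut :=
  ⟨P.nbhd (p.1, 1 + p.2), by
    rw [nbhd_mem_tube]
    exact fun h => absurd h.2 (by linarith [p.2.coe_nonneg])⟩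

theorem cutCollar_zero (y : St) : P.cutCollar (y, 0) = P.toCut y :=
  Subtype.ext (by simp [cutCollar, toCut])

/-- Above height `1` the line bundle is an open collar of the boundary of `M \\ S` along `S`. -/
theorem isOpenEmbedding_cutCollar : IsOpenEmbedding P.cutCollar := by
  refine IsOpenEmbedding.of_continuous_injective_isOpenMap ?_ ?_ ?_
  · exact Continuous.subtype_mk (P.continuous_nbhd.comp (by fun_prop)) _
  · rintro ⟨y, s⟩ ⟨y', s'⟩ h
    obtain ⟨h1, h2⟩ := eq_of_nbhd_eq (by positivity) (by positivity) (congrArg Subtype.val h)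
    exact Prod.ext h1 (NNReal.coe_injective (add_left_cancel h2))
  · intro O hO
    have hemb : IsEmbedding (fun p : St × ℝ≥0 => (p.1, 1 + (p.2 : ℝ))) := by
      refine IsEmbedding.id.prodMap (f := id) (g := fun s : ℝ≥0 => 1 + (s : ℝ)) ?_
      exact (Homeomorph.addLeft (1 : ℝ)).isEmbedding.comp IsEmbedding.subtypeVal
    obtain ⟨O', hO', rfl⟩ := hemb.isInducing.isOpen_iff.1 hO
    have h1 : IsOpen (O' ∩ univ ×ˢ Ioi 0) := hO'.inter (isOpen_univ.prod isOpen_Ioi)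
    convert (P.isOpenMap_nbhd _ h1).preimage continuous_subtype_val using 1
    ext x
    constructor
    · rintro ⟨⟨y, s⟩, hp, rfl⟩
      exact ⟨(y, 1 + s), ⟨hp, mem_univ _, show (0 : ℝ) < 1 + s by positivity⟩, rfl⟩
    · rintro ⟨⟨y, t⟩, ⟨hp, -, ht⟩, hx⟩
      have ht0 : (0 : ℝ) < t := ht
      have h2 := x.2
      rw [← hx, nbhd_mem_tube] at h2
      have h3 : 0 ≤ t - 1 := by
        by_contra h4
        exact h2 ⟨by linarith, by linarith⟩
      have h4 : 1 + ((⟨t - 1, h3⟩ : ℝ≥0) : ℝ) = t := by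
        change 1 + (t - 1) = t
        ring
      refine ⟨(y, ⟨t - 1, h3⟩), ?_, Subtype.ext ?_⟩
      · change (y, 1 + ((⟨t - 1, h3⟩ : ℝ≥0) : ℝ)) ∈ O'
        rwa [h4]
      · change P.nbhd (y, 1 + ((⟨t - 1, h3⟩ : ℝ≥0) : ℝ)) = x.1
        rwa [h4]

/-- Charts of `M \\ S` along `S` come from charts of the surface by means of the collar; elsewhere
they are restrictions of charts of `M`. -/
theorem isManifoldWithBoundary_cut (hM : IsManifoldWithBoundary 3 M bM) :
    IsManifoldWithBoundary 3 P.Cut P.cutBoundary := by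
  have := hM.t2
  have := hM.secondCountable
  refine ⟨inferInstance, IsEmbedding.subtypeVal.secondCountableTopology, fun x => ?_⟩
  by_cases hx : x.1 ∈ P.nbhd '' (univ ×ˢ Icc (-1) 1)
  · obtain ⟨y, rfl⟩ := mem_range_toCut hx
    obtain ⟨e, hy, he⟩ := P.isSurface.exists_chart y
    have he' : ∀ y ∈ e.source, (e y).1 0 ≠ 0 := fun y hy h0 => (he y hy).2 h0
    have h1 := (isOpenEmbedding_cutCollar (P := P)).comp
      (e.open_source.isOpenEmbedding_subtypeVal.prodMap (IsOpenEmbedding.id (X := ℝ≥0)))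
    have h2 := isOpenEmbedding_halfSpace.comp
      ((isOpenEmbedding_chart he').prodMap (IsOpenEmbedding.id (X := ℝ≥0)))
    obtain ⟨e', h3, h4⟩ := exists_chart_of_isOpenEmbedding (B := P.cutBoundary) h1 h2 (fun p => by
      obtain ⟨z, s⟩ := p
      change _ ↔ (s : ℝ) = 0
      constructor
      · rintro (⟨y', h⟩ | h)
        · have := (eq_of_nbhd_eq one_pos (by positivity) (congrArg Subtype.val h)).2
          simp only [Prod.map_snd, id] at this
          linarith
        · exact absurd h (P.nbhd_not_mem _)
      · intro hs
        refine Or.inl ⟨z, Subtype.ext ?_⟩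
        change P.nbhd (_, _) = P.nbhd (_, 1 + (s : ℝ))
        rw [hs, add_zero]
        rfl) (⟨y, hy⟩, 0)
    refine ⟨e', ?_, h4⟩
    convert h3 using 1
    refine Subtype.ext ?_
    change P.nbhd (_, 1) = P.nbhd (y, 1 + ((0 : ℝ≥0) : ℝ))
    simp
  · obtain ⟨e, hxe, he⟩ := hM.exists_chart x.1
    let T := ↥(e.source ∩ (P.nbhd '' (univ ×ˢ Icc (-1) 1))ᶜ)
    have hopen : IsOpen (e.source ∩ (P.nbhd '' (univ ×ˢ Icc (-1) 1))ᶜ) :=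
      e.open_source.inter P.isClosed_thickening.isOpen_compl
    let φ : T → P.Cut := fun t => ⟨t.1, fun hm =>
      t.2.2 (image_mono (prod_mono subset_rfl Ioo_subset_Icc_self) hm)⟩
    have hφc : Continuous φ := Continuous.subtype_mk continuous_subtype_val _
    have hφ : IsOpenEmbedding φ := by
      refine ⟨IsEmbedding.of_comp hφc continuous_subtype_val IsEmbedding.subtypeVal, ?_⟩
      convert hopen.preimage (continuous_subtype_val (p := fun x => x ∉ P.nbhd ''
        (univ ×ˢ Ioo (-1 : ℝ) 1))) using 1
      ext z
      constructor
      · rintro ⟨t, rfl⟩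
        exact t.2
      · intro hz
        exact ⟨⟨z.1, hz⟩, rfl⟩
    have hχ : IsOpenEmbedding (fun t : T => e t.1) := by
      refine e.isOpenEmbedding_restrict.comp (f := fun t : T => (⟨t.1, t.2.1⟩ : e.source)) ?_
      exact IsOpenEmbedding.of_comp _ e.open_source.isOpenEmbedding_subtypeVal
        hopen.isOpenEmbedding_subtypeVal
    refine exists_chart_of_isOpenEmbedding hφ hχ ?_ ⟨x.1, hxe, hx⟩
    intro t
    rw [← he t.1 t.2.1]
    constructor
    · rintro (⟨y, h⟩ | h)
      · refine absurd (P.toCut_mem y) ?_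
        rw [h]
        exact t.2.2
      · exact h
    · exact fun h => Or.inr h

/-- `M \\ S` is orientable as a subspace of `M`. -/
theorem orientable_cut (hor : Orientable 3 M) : Orientable 3 P.Cut := by
  rintro ⟨h, hc, hi, A, hA, hh⟩
  exact hor ⟨fun p => (h p).1, continuous_subtype_val.comp hc,
    fun t x y hxy => hi t (Subtype.ext hxy), A, hA, fun x => congrArg Subtype.val (hh x)⟩

/-- The inclusion of `M \\ S` into the complement of `S`. -/
def cutIncl (x : P.Cut) : {x : M // x ∉ P.surface} :=
  ⟨x.1, fun hm => x.2 (image_mono (prod_mono subset_rfl (by simp)) hm)⟩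

theorem isEmbedding_cutIncl : IsEmbedding (P.cutIncl) :=
  IsEmbedding.of_comp (Continuous.subtype_mk continuous_subtype_val _) continuous_subtype_val
    IsEmbedding.subtypeVal

/-- Maps to the complement of `S` that avoid the open collar of `S` are maps to `M \\ S`. -/
theorem exists_cutIncl_eq {A : Type*} [TopologicalSpace A] {g : A → {x : M // x ∉ P.surface}}
    {s : Set A} (hg : ContinuousOn g s)
    (hgs : ∀ a ∈ s, (g a).1 ∉ P.nbhd '' (univ ×ˢ Ioo (-1) 1)) :
    ∃ g' : A → P.Cut, ContinuousOn g' s ∧ ∀ a ∈ s, P.cutIncl (g' a) = g a := by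
  classical
  have : Nonempty St := P.connected.toNonempty
  obtain ⟨y⟩ := this
  let g' : A → P.Cut := fun a =>
    if h : (g a).1 ∉ P.nbhd '' (univ ×ˢ Ioo (-1) 1) then ⟨(g a).1, h⟩ else P.toCut y
  have hg' : ∀ a ∈ s, P.cutIncl (g' a) = g a := by
    intro a ha
    refine Subtype.ext ?_
    simp only [g', dif_pos (hgs a ha), cutIncl]
  refine ⟨g', ?_, hg'⟩
  rw [P.isEmbedding_cutIncl.isInducing.continuousOn_iff]
  exact hg.congr hg'

/-- A ball in the complement of `S` whose boundary sphere lies outside the collar of `S` does not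
meet the connected punctured collar, since it would contain it, and `S` in its closure. -/
theorem irreducible_cut [T2Space M] : Irreducible3 P.Cut := by
  have := P.connected
  have : Nonempty St := P.connected.toNonempty
  intro f hf hfi
  have hιc := P.isEmbedding_cutIncl.continuous
  obtain ⟨g, hg, hgi, hgo, hgs⟩ := P.irreducible_compl (P.cutIncl ∘ f) (hιc.comp_continuousOn hf)
    (P.isEmbedding_cutIncl.injective.comp_injOn hfi)
  let g₁ : EuclideanSpace ℝ (Fin 3) → M := fun x => (g x).1
  have hg₁ : ContinuousOn g₁ (Metric.closedBall 0 1) := continuous_subtype_val.comp_continuousOn hg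
  have hball : Metric.ball (0 : EuclideanSpace ℝ (Fin 3)) 1 ⊆ Metric.closedBall 0 1 :=
    Metric.ball_subset_closedBall
  have hclosed : IsClosed (g₁ '' Metric.closedBall 0 1) :=
    ((isCompact_closedBall _ _).image_of_continuousOn hg₁).isClosed
  have hsurf : IsClosed P.surface := by
    have := P.compact
    exact ((isCompact_univ.prod isCompact_singleton).image P.continuous_nbhd).isClosed
  have hopen : IsOpen (g₁ '' Metric.ball 0 1) := by
    have := hsurf.isOpen_compl.isOpenEmbedding_subtypeVal.isOpenMap _ hgo
    have e : g₁ '' Metric.ball 0 1 = Subtype.val '' (g '' Metric.ball 0 1) :=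
      (image_image _ _ _).symm
    rw [e]
    exact this
  have hsph : ∀ x ∈ Metric.sphere (0 : EuclideanSpace ℝ (Fin 3)) 1,
      g₁ x ∉ P.nbhd '' (univ ×ˢ Ioo (-1) 1) := by
    intro x hx
    have h1 : g x ∈ g '' Metric.sphere 0 1 := ⟨x, hx, rfl⟩
    rw [hgs] at h1
    obtain ⟨x', -, h2⟩ := h1
    have h3 : (f x').1 = g₁ x := congrArg Subtype.val h2
    rw [← h3]
    exact (f x').2
  -- the punctured collar
  have hW : IsPreconnected (P.nbhd '' (univ ×ˢ Ioo 0 1)) :=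
    (isPreconnected_univ.prod isPreconnected_Ioo).image _ P.continuous_nbhd.continuousOn
  have hWsub : P.nbhd '' (univ ×ˢ Ioo 0 1) ⊆ P.nbhd '' (univ ×ˢ Ioo (-1) 1) :=
    image_mono (prod_mono subset_rfl (Ioo_subset_Ioo (by norm_num) le_rfl))
  have hcl_eq : ∀ x ∈ P.nbhd '' (univ ×ˢ Ioo 0 1), x ∈ g₁ '' Metric.closedBall 0 1 →
      x ∈ g₁ '' Metric.ball 0 1 := by
    rintro x hx ⟨a, ha, rfl⟩
    refine ⟨a, ?_, rfl⟩
    rw [Metric.mem_ball]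
    refine lt_of_le_of_ne ha fun h1 => hsph a h1 (hWsub hx)
  have hdisj : ∀ x ∈ P.nbhd '' (univ ×ˢ Ioo 0 1), x ∉ g₁ '' Metric.closedBall 0 1 := by
    by_contra! hne
    obtain ⟨x, hx, hxg⟩ := hne
    have hsub : P.nbhd '' (univ ×ˢ Ioo 0 1) ⊆ g₁ '' Metric.ball 0 1 := by
      refine hW.subset_of_closure_inter_subset hopen ⟨x, hx, hcl_eq x hx hxg⟩ ?_
      rintro z ⟨hz, hzW⟩
      exact hcl_eq z hzW (closure_minimal (image_mono hball) hclosed hz)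
    obtain ⟨y⟩ := ‹Nonempty St›
    -- a point of `S` would lie in the closed ball
    have h1 : P.nbhd (y, 0) ∈ closure (P.nbhd '' (univ ×ˢ Ioo 0 1)) := by
      refine image_closure_subset_closure_image P.continuous_nbhd ⟨(y, 0), ?_, rfl⟩
      rw [closure_prod_eq, closure_Ioo zero_ne_one]
      exact ⟨by simp, by simp⟩
    have h2 := closure_minimal (hsub.trans (image_mono hball)) hclosed h1
    obtain ⟨a, -, ha⟩ := h2
    exact (g a).2 ⟨(y, 0), by simp, ha.symm⟩
  have hcut : ∀ x ∈ Metric.closedBall (0 : EuclideanSpace ℝ (Fin 3)) 1,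
      (g x).1 ∉ P.nbhd '' (univ ×ˢ Ioo (-1) 1) := by
    rintro x hx ⟨⟨y, t⟩, ⟨-, ht⟩, h⟩
    have hxg : (g x).1 ∈ g₁ '' Metric.closedBall 0 1 := ⟨x, hx, rfl⟩
    rcases lt_trichotomy t 0 with h0 | h0 | h0
    · refine hdisj _ ⟨(P.τ y, -t), ⟨mem_univ _, by linarith, by linarith [ht.1]⟩, ?_⟩ hxg
      rw [← h]
      exact P.nbhd_flip (y, t)
    · exact (g x).2 ⟨(y, t), ⟨mem_univ _, h0⟩, h⟩
    · exact hdisj _ ⟨(y, t), ⟨mem_univ _, h0, ht.2⟩, h⟩ hxg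
  obtain ⟨g', hg', hgg'⟩ := exists_cutIncl_eq hg hcut
  refine ⟨g', hg', ?_, ?_, ?_⟩
  · intro a ha b hb hab
    refine hgi ha hb ?_
    rw [← hgg' a ha, ← hgg' b hb, hab]
  · convert hopen.preimage (continuous_subtype_val (p := fun x => x ∉ P.nbhd ''
        (univ ×ˢ Ioo (-1 : ℝ) 1))) using 1
    ext z
    constructor
    · rintro ⟨a, ha, rfl⟩
      exact ⟨a, ha, congrArg Subtype.val (hgg' a (hball ha)).symm⟩
    · rintro ⟨a, ha, haz⟩
      exact ⟨a, ha, P.isEmbedding_cutIncl.injective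
        ((hgg' a (hball ha)).trans (Subtype.ext haz))⟩
  · have h1 : P.cutIncl '' (g' '' Metric.sphere 0 1) = P.cutIncl '' (f '' Metric.sphere 0 1) := by
      rw [← image_comp, ← image_comp]
      exact (image_congr fun a ha => hgg' a (Metric.sphere_subset_closedBall ha)).trans hgs
    exact P.isEmbedding_cutIncl.injective.image_injective h1

/-! ### Boundary components -/

theorem isPreconnected_range_toCut : IsPreconnected (range P.toCut) := by
  have := P.connected
  exact isPreconnected_range P.continuous_toCut

/-- The copy of `St` is a whole component of the boundary of `M \\ S`: in its collar there are no
other boundary points. -/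
theorem connectedComponentIn_toCut [T2Space M] (y : St) :
    connectedComponentIn P.cutBoundary (P.toCut y) = range P.toCut := by
  have := P.compact
  have hsub : range P.toCut ⊆ P.cutBoundary := subset_union_left
  have hcoll : ∀ p, P.cutCollar p ∈ P.cutBoundary → P.cutCollar p ∈ range P.toCut := fun p hp =>
    hp.resolve_right fun h => P.nbhd_not_mem _ h
  refine Subset.antisymm ?_ (isPreconnected_range_toCut.subset_connectedComponentIn
    (mem_range_self y) hsub)
  have h1 : IsOpen (P.cutCollar '' (univ ×ˢ Iio 1)) :=
    isOpenEmbedding_cutCollar.isOpenMap _ (isOpen_univ.prod isOpen_Iio)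
  have h2 : IsClosed (P.cutCollar '' (univ ×ˢ Icc 0 1)) :=
    ((isCompact_univ.prod isCompact_Icc).image isOpenEmbedding_cutCollar.continuous).isClosed
  have h3 : ∀ y, P.toCut y ∈ P.cutCollar '' (univ ×ˢ Iio 1) := fun y =>
    ⟨(y, 0), ⟨mem_univ _, show (0 : ℝ≥0) < 1 from zero_lt_one⟩, cutCollar_zero y⟩
  have h4 : connectedComponentIn P.cutBoundary (P.toCut y) ⊆ P.cutCollar '' (univ ×ˢ Iio 1) := by
    refine isPreconnected_connectedComponentIn.subset_of_closure_inter_subset h1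
      ⟨P.toCut y, mem_connectedComponentIn (hsub ⟨y, rfl⟩), h3 y⟩ ?_
    rintro x ⟨hx, hxc⟩
    have h5 : x ∈ P.cutCollar '' (univ ×ˢ Icc 0 1) := by
      refine closure_minimal (image_mono ?_) h2 hx
      rintro ⟨y, s⟩ ⟨-, hs⟩
      exact ⟨mem_univ _, ⟨zero_le, le_of_lt hs⟩⟩
    obtain ⟨p, -, rfl⟩ := h5
    obtain ⟨y', hy'⟩ := hcoll p (connectedComponentIn_subset _ _ hxc)
    rw [← hy']
    exact h3 y'
  intro x hx
  obtain ⟨p, -, rfl⟩ := h4 hx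
  exact hcoll p (connectedComponentIn_subset _ _ hx)

/-- The components of the boundary of `M` remain incompressible in `M \\ S`. -/
theorem incompressible_cut [T2Space M] (hinc : ∀ x : {x : M // x ∉ P.surface}, x.1 ∈ bM →
      Incompressible {x : M // x ∉ P.surface}
        (connectedComponentIn {x : {x : M // x ∉ P.surface} | x.1 ∈ bM} x))
    {x : P.Cut} (hx : x.1 ∈ bM) (hxc : connectedComponentIn P.cutBoundary x ⊆ {x | x.1 ∈ bM}) :
    Incompressible P.Cut (connectedComponentIn P.cutBoundary x) := by
  have hι := P.isEmbedding_cutIncl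
  have hbM : ∀ x : {x : M // x ∉ P.surface}, x.1 ∈ bM → ∃ x', P.cutIncl x' = x := by
    intro x hx
    refine ⟨⟨x.1, ?_⟩, rfl⟩
    rintro ⟨a, -, ha⟩
    exact P.nbhd_not_mem a (ha ▸ hx)
  have hxB : x ∈ P.cutBoundary := Or.inr hx
  set K := connectedComponentIn P.cutBoundary x with hK
  -- the component in `M \\ S` is the component in the complement of `S`
  have hKι : P.cutIncl '' K =
      connectedComponentIn {x : {x : M // x ∉ P.surface} | x.1 ∈ bM} (P.cutIncl x) := by
    refine Subset.antisymm ?_ ?_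
    · refine (isPreconnected_connectedComponentIn.image _
        hι.continuous.continuousOn).subset_connectedComponentIn
        ⟨x, mem_connectedComponentIn hxB, rfl⟩ ?_
      rintro _ ⟨z, hz, rfl⟩
      exact hxc hz
    · set K' := connectedComponentIn {x : {x : M // x ∉ P.surface} | x.1 ∈ bM} (P.cutIncl x)
      have hK' : P.cutIncl '' (P.cutIncl ⁻¹' K') = K' := by
        refine image_preimage_eq_of_subset fun z hz => ?_
        exact hbM z (connectedComponentIn_subset {x : {x : M // x ∉ P.surface} | x.1 ∈ bM} _ hz)
      rw [← hK']
      refine image_mono (IsPreconnected.subset_connectedComponentIn ?_ ?_ ?_)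
      · rw [← hι.isInducing.isPreconnected_image, hK']
        exact isPreconnected_connectedComponentIn
      · exact mem_connectedComponentIn hx
      · intro z hz
        exact Or.inr (connectedComponentIn_subset {x : {x : M // x ∉ P.surface} | x.1 ∈ bM} _ hz)
  have hmem : ∀ z, P.cutIncl z ∈ P.cutIncl '' K ↔ z ∈ K := fun z =>
    hι.injective.mem_set_image
  obtain ⟨h1, h2⟩ := hinc (P.cutIncl x) hx
  rw [← hKι] at h1 h2
  constructor
  · intro g hg hgi hgK
    obtain ⟨d, hd, hdi, hdK, hds⟩ := h1 (P.cutIncl ∘ g) (hι.continuous.comp_continuousOn hg)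
      (hι.injective.comp_injOn hgi) fun a ha => (hmem _).trans (hgK a ha)
    have hdcut : ∀ a ∈ Metric.closedBall (0 : EuclideanSpace ℝ (Fin 2)) 1,
        (d a).1 ∉ P.nbhd '' (univ ×ˢ Ioo (-1) 1) := by
      intro a ha
      obtain ⟨z, -, hz⟩ := hdK ⟨a, ha, rfl⟩
      rw [← hz]
      exact z.2
    obtain ⟨d', hd', hdd'⟩ := exists_cutIncl_eq hd hdcut
    refine ⟨d', hd', ?_, ?_, ?_⟩
    · intro a ha b hb hab
      refine hdi ha hb ?_
      rw [← hdd' a ha, ← hdd' b hb, hab]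
    · rintro _ ⟨a, ha, rfl⟩
      rw [← hmem, hdd' a ha]
      exact hdK ⟨a, ha, rfl⟩
    · have h3 : P.cutIncl '' (d' '' Metric.sphere 0 1) =
          P.cutIncl '' (g '' Metric.sphere 0 1) := by
        rw [← image_comp, ← image_comp, ← hds]
        exact image_congr fun a ha => hdd' a (Metric.sphere_subset_closedBall ha)
      exact hι.injective.image_injective h3
  · rintro ⟨g, hg, hgi, hgK⟩
    refine h2 ⟨P.cutIncl ∘ g, hι.continuous.comp_continuousOn hg, hι.injective.comp_injOn hgi, ?_⟩
    rw [image_comp, hgK]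

end ProjectionSurface

/-! ### The diagram graph on the boundary of the chunk -/

theorem IsManifoldWithBoundary.preimage_symm {n : ℕ} [NeZero n] {X Y : Type*} [TopologicalSpace X]
    [TopologicalSpace Y] {B : Set X} (h : IsManifoldWithBoundary n X B) (φ : X ≃ₜ Y) :
    IsManifoldWithBoundary n Y (φ.symm ⁻¹' B) := by
  have := h.t2
  have := h.secondCountable
  refine ⟨φ.symm.isEmbedding.t2Space, φ.symm.isEmbedding.secondCountableTopology, fun y => ?_⟩
  obtain ⟨e, he, hB⟩ := h.exists_chart (φ.symm y)
  exact ⟨φ.symm.toOpenPartialHomeomorph.trans e, by simpa using he,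
    fun z hz => hB _ (by simpa using hz)⟩

namespace ProjectionSurface

variable {M : Type u} [TopologicalSpace M] {bM : Set M} {St : Type v} [TopologicalSpace St]
  {P : ProjectionSurface M bM St} {L : Set M} {E : Type*} {lo hi : St → ℝ}
  {Q : PatchSystem (P.diagram L) (P.crossings L) P.τ}

theorem EdgeSystem.path_star (G : P.EdgeSystem L E) (e : E) (s : ℝ) :
    G.path (G.star e) s = P.τ (G.path e (1 - s)) := by
  change (G.μ _ _).1 = _
  rw [G.μ_star]
  rfl

theorem EdgeSystem.star_star (G : P.EdgeSystem L E) (e : E) : G.star (G.star e) = e := by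
  refine (G.inj _ _ (1 / 2) (by norm_num) (1 / 2) (by norm_num) ?_).1
  change G.path (G.star (G.star e)) _ = G.path e _
  rw [G.path_star, G.path_star, P.τ_τ]
  norm_num

theorem EdgeSystem.ncard_start (G : P.EdgeSystem L E) {y : St} (hy : y ∈ P.crossings L) :
    {e | G.path e 0 = y}.ncard = 2 := by
  obtain ⟨e, e', hne, h, -⟩ := G.start y hy
  have : {e | G.path e 0 = y} = {e, e'} := by ext d; exact h d
  rw [this, ncard_pair hne]

/-- The edges that end at a crossing are the reversed images of those that start at its image under
`τ`. -/
theorem EdgeSystem.ncard_end (G : P.EdgeSystem L E) {y : St} (hy : y ∈ P.crossings L) :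
    {e | G.path e 1 = y}.ncard = 2 := by
  have : {e | G.path e 1 = y} = G.star '' {e | G.path e 0 = P.τ y} := by
    ext e
    constructor
    · intro he
      refine ⟨G.star e, ?_, G.star_star e⟩
      change G.path _ _ = _
      rw [G.path_star, sub_zero]
      exact congrArg P.τ he
    · rintro ⟨d, hd, rfl⟩
      change G.path _ _ = _
      rw [G.path_star, sub_self]
      exact (congrArg P.τ hd).trans (P.τ_τ y)
  rw [this, ncard_image_of_injective _ (Function.LeftInverse.injective G.star_star),
    G.ncard_start (P.tau_mem_crossings.2 hy)]

/-- The lifted diagram, as a graph in the boundary of `M \\ S`. -/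
noncomputable def EdgeSystem.graph [Finite E] (G : P.EdgeSystem L E) (hγ : Q.IsEdges G.path)
    (hV : (P.crossings L).Finite) : EmbeddedGraph P.Cut where
  verts := P.toCut '' P.crossings L
  finite_verts := hV.image _
  numEdges := Nat.card E
  edge i s := P.toCut (G.path ((Finite.equivFin E).symm i) s)
  continuous_edge i := continuous_toCut.comp ((hγ.continuous _).comp continuous_subtype_val)
  edge_zero_mem i := ⟨_, hγ.zero_mem _, rfl⟩
  edge_one_mem i := ⟨_, hγ.one_mem _, rfl⟩
  edge_not_vert i s hs := notMem_image_toCut (hγ.notMem _ s ⟨hs.1, hs.2⟩)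
  edge_inj i j s hs s' h := by
    have h1 := injective_toCut h
    have h2 := hγ.notMem ((Finite.equivFin E).symm i) s ⟨hs.1, hs.2⟩
    have h3 : (s' : ℝ) ∈ Ioo (0 : ℝ) 1 := by
      refine ⟨lt_of_le_of_ne s'.2.1 fun h0 => h2 ?_, lt_of_le_of_ne s'.2.2 fun h0 => h2 ?_⟩
      · rw [h1, ← h0]
        exact hγ.zero_mem _
      · rw [h1, h0]
        exact hγ.one_mem _
    obtain ⟨h4, h5⟩ := hγ.inj _ _ s ⟨hs.1, hs.2⟩ s' h3 h1
    exact ⟨(Finite.equivFin E).symm.injective h4, Subtype.ext h5⟩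

section Graph

variable [Finite E] {G : P.EdgeSystem L E} {hγ : Q.IsEdges G.path} {hV : (P.crossings L).Finite}

theorem EdgeSystem.support_graph : (G.graph hγ hV).support = P.toCut '' P.diagram L := by
  apply Subset.antisymm
  · rintro x (⟨y, hy, rfl⟩ | hx)
    · exact ⟨y, P.crossings_subset_diagram hy, rfl⟩
    · obtain ⟨i, s, rfl⟩ := mem_iUnion.1 hx
      exact ⟨_, hγ.mem _ _, rfl⟩
  · rintro _ ⟨y, hy, rfl⟩
    by_cases hyV : y ∈ P.crossings L
    · exact Or.inl ⟨y, hyV, rfl⟩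
    · obtain ⟨e, s, hs, rfl⟩ := hγ.cover y hy hyV
      refine Or.inr (mem_iUnion.2 ⟨Finite.equivFin E e, ⟨s, Ioo_subset_Icc_self hs⟩, ?_⟩)
      change P.toCut (G.path ((Finite.equivFin E).symm (Finite.equivFin E e)) s) = _
      rw [Equiv.symm_apply_apply]

theorem ncard_preimage_equiv {α β : Type*} (φ : α ≃ β) (s : Set β) :
    {a | φ a ∈ s}.ncard = s.ncard := by
  refine Eq.trans ?_ (ncard_image_of_injective s φ.symm.injective)
  rw [φ.symm.image_eq_preimage_symm]
  rfl

theorem EdgeSystem.valence_graph {y : St} (hy : y ∈ P.crossings L) :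
    (G.graph hγ hV).valence (P.toCut y) = 4 := by
  have h1 : {i | (G.graph hγ hV).edge i 0 = P.toCut y}.ncard = 2 :=
    (congrArg (ncard (α := Fin (Nat.card E))) (ext fun i => injective_toCut.eq_iff)).trans
      ((ncard_preimage_equiv (Finite.equivFin E).symm {e | G.path e 0 = y}).trans
        (G.ncard_start hy))
  have h2 : {i | (G.graph hγ hV).edge i 1 = P.toCut y}.ncard = 2 :=
    (congrArg (ncard (α := Fin (Nat.card E))) (ext fun i => injective_toCut.eq_iff)).trans
      ((ncard_preimage_equiv (Finite.equivFin E).symm {e | G.path e 1 = y}).trans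
        (G.ncard_end hy))
  rw [EmbeddedGraph.valence, h1, h2]

/-- `M \\ S` with the lifted diagram is a chunk.  A component of the boundary that does not meet
the diagram lies in the boundary of `M`. -/
theorem EdgeSystem.isChunk_graph [CompactSpace M] [ConnectedSpace M]
    (hM : IsManifoldWithBoundary 3 M bM) (hor : Orientable 3 M)
    (hinc : ∀ x : {x : M // x ∉ P.surface}, x.1 ∈ bM →
      Incompressible {x : M // x ∉ P.surface}
        (connectedComponentIn {x : {x : M // x ∉ P.surface} | x.1 ∈ bM} x))
    (hne : (P.diagram L).Nonempty) : IsChunk P.Cut P.cutBoundary (G.graph hγ hV) := by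
  have := hM.t2
  refine ⟨P.compactSpace_cut, P.connectedSpace_cut, P.isManifoldWithBoundary_cut hM,
    P.orientable_cut hor, P.irreducible_cut, ?_, ?_, ?_, ?_⟩
  · rw [support_graph]
    exact hne.image _
  · rw [support_graph]
    exact (image_subset_range _ _).trans subset_union_left
  · rintro _ ⟨y, hy, rfl⟩
    rw [valence_graph hy]
    norm_num
  · intro x hx hdisj
    have h1 : connectedComponentIn P.cutBoundary x ⊆ {x | x.1 ∈ bM} := by
      rintro z hz
      rcases connectedComponentIn_subset _ _ hz with ⟨y, rfl⟩ | hz'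
      · rw [connectedComponentIn_eq hz, connectedComponentIn_toCut, support_graph] at hdisj
        obtain ⟨d, hd⟩ := hne
        exact (disjoint_left.1 hdisj ⟨d, rfl⟩ ⟨d, hd, rfl⟩).elim
      · exact hz'
    exact P.incompressible_cut hinc (h1 (mem_connectedComponentIn hx)) h1

/-- Only the copy of `St` is divided into faces. -/
theorem EdgeSystem.interiorBoundary_graph [T2Space M] (hne : (P.diagram L).Nonempty) :
    interiorBoundary P.cutBoundary (G.graph hγ hV) = range P.toCut := by
  apply Subset.antisymm
  · rintro x ⟨hx, z, hz, hzs⟩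
    rw [support_graph] at hzs
    obtain ⟨y, -, rfl⟩ := hzs
    have := mem_connectedComponentIn hx
    rwa [connectedComponentIn_eq hz, connectedComponentIn_toCut] at this
  · rintro _ ⟨y, rfl⟩
    refine ⟨Or.inl ⟨y, rfl⟩, ?_⟩
    rw [connectedComponentIn_toCut, support_graph]
    obtain ⟨d, hd⟩ := hne
    exact ⟨_, ⟨d, rfl⟩, d, hd, rfl⟩

end Graph

/-! ### Crossing arcs -/

theorem IsHeights.crossingArc_eq (hh : P.IsHeights L lo hi) {y : St} (hy : y ∈ P.crossings L) :
    P.crossingArc L y = (fun t => P.nbhd (y, t)) '' Ioo (lo y) (hi y) := by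
  obtain ⟨h1, h2⟩ := hh y hy
  ext x
  constructor
  · rintro ⟨t₁, t, t₂, h3, h4, h5, h6, rfl⟩
    refine ⟨t, ?_, rfl⟩
    rcases (h2 _).1 h5 with h5 | h5 <;> rcases (h2 _).1 h6 with h6 | h6 <;>
      constructor <;> linarith
  · rintro ⟨t, ht, rfl⟩
    exact ⟨lo y, t, hi y, ht.1, ht.2, hh.lo_mem hy, hh.hi_mem hy, rfl⟩

theorem injective_nbhd_right (y : St) : Function.Injective fun t => P.nbhd (y, t) := by
  intro t t' h
  rcases P.nbhd_eq.1 h with h1 | h1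
  · exact (congrArg Prod.snd h1).symm
  · exact absurd (congrArg Prod.fst h1).symm (P.τ_ne y)

/-- A crossing arc lies over exactly two crossings, which `τ` exchanges. -/
theorem IsHeights.crossingArc_eq_iff (hh : P.IsHeights L lo hi) {y y' : St}
    (hy : y ∈ P.crossings L) (hy' : y' ∈ P.crossings L) :
    P.crossingArc L y = P.crossingArc L y' ↔ y = y' ∨ y = P.τ y' := by
  constructor
  · intro h
    rw [hh.crossingArc_eq hy, hh.crossingArc_eq hy'] at h
    have h1 := (hh y hy).1
    obtain ⟨t, -, ht⟩ : P.nbhd (y, (lo y + hi y) / 2) ∈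
        (fun t => P.nbhd (y', t)) '' Ioo (lo y') (hi y') := by
      rw [← h]
      exact ⟨_, ⟨by linarith, by linarith⟩, rfl⟩
    rcases P.nbhd_eq.1 ht with h2 | h2
    · exact Or.inl (congrArg Prod.fst h2)
    · exact Or.inr (congrArg Prod.fst h2)
  · rintro (rfl | rfl)
    · rfl
    · rw [hh.crossingArc_eq hy, hh.crossingArc_eq hy', hh.lo_tau hy', hh.hi_tau hy',
        ← image_neg_Ioo, image_image]
      exact image_congr fun t _ => P.nbhd_flip (y', t)

/-- A quotient map that is affine on the open edges, from the upper to the lower strand, takes them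
onto the crossing arcs at their starting points. -/
theorem EdgeSystem.bijOn_openEdge (G : P.EdgeSystem L E) (hh : P.IsHeights L lo hi)
    {q : {x : P.Cut // x ∉ P.toCut '' P.crossings L} → {x : M // x ∉ L}}
    (hq : ∀ e, ∀ s ∈ Ioo (0 : ℝ) 1, ∀ hx, (q ⟨P.toCut (G.path e s), hx⟩ : M) =
      P.nbhd (G.path e 0, hi (G.path e 0) + s * (lo (G.path e 0) - hi (G.path e 0)))) (e : E) :
    BijOn (fun x => (q x : M)) {x | ∃ s ∈ Ioo (0 : unitInterval) 1, P.toCut (G.path e s) = x.1}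
      (P.crossingArc L (G.path e 0)) := by
  have hV : G.path e 0 ∈ P.crossings L := (hh.isUnder_iff.1 (G.isUnder e)).1
  have hlt := (hh _ hV).1
  rw [hh.crossingArc_eq hV]
  refine ⟨?_, ?_, ?_⟩
  · rintro ⟨_, hx⟩ ⟨s, hs, rfl⟩
    have hs' : (s : ℝ) ∈ Ioo (0 : ℝ) 1 := ⟨hs.1, hs.2⟩
    refine ⟨_, ⟨?_, ?_⟩, (hq e s hs' hx).symm⟩ <;> nlinarith [hs'.1, hs'.2]
  · rintro ⟨_, hx⟩ ⟨s, hs, rfl⟩ ⟨_, hx'⟩ ⟨s', hs', rfl⟩ h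
    have h1 : (q ⟨P.toCut (G.path e s), hx⟩ : M) = q ⟨P.toCut (G.path e s'), hx'⟩ := h
    rw [hq e s ⟨hs.1, hs.2⟩, hq e s' ⟨hs'.1, hs'.2⟩] at h1
    have h2 := P.injective_nbhd_right _ h1
    have h3 : (s : ℝ) = s' := by
      have : ((s : ℝ) - s') * (lo (G.path e 0) - hi (G.path e 0)) = 0 := by linarith
      rcases mul_eq_zero.1 this with h4 | h4 <;> linarith
    obtain rfl : s = s' := Subtype.ext h3
    rfl
  · rintro _ ⟨t, ht, rfl⟩
    have hd : 0 < hi (G.path e 0) - lo (G.path e 0) := by linarith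
    have hs : (hi (G.path e 0) - t) / (hi (G.path e 0) - lo (G.path e 0)) ∈ Ioo (0 : ℝ) 1 :=
      ⟨div_pos (by linarith [ht.2]) hd, (div_lt_one hd).2 (by linarith [ht.1])⟩
    refine ⟨⟨_, notMem_image_toCut (G.notMem e _ hs)⟩,
      ⟨⟨_, Ioo_subset_Icc_self hs⟩, ⟨hs.1, hs.2⟩, rfl⟩, ?_⟩
    refine (hq e _ hs _).trans ?_
    congr 2
    field_simp
    ring

/-- Two edges start at each of the two crossings over an arc. -/
theorem EdgeSystem.ncard_crossingArc [Finite E] (G : P.EdgeSystem L E)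
    (hh : P.IsHeights L lo hi) {y : St} (hy : y ∈ P.crossings L) :
    {e | P.crossingArc L (G.path e 0) = P.crossingArc L y}.ncard = 4 := by
  have h1 : {e | P.crossingArc L (G.path e 0) = P.crossingArc L y} =
      {e | G.path e 0 = y} ∪ {e | G.path e 0 = P.τ y} := by
    ext e
    exact hh.crossingArc_eq_iff (hh.isUnder_iff.1 (G.isUnder e)).1 hy
  rw [h1, ncard_union_eq ?_ (toFinite _) (toFinite _), G.ncard_start hy,
    G.ncard_start (P.tau_mem_crossings.2 hy)]
  exact disjoint_left.2 fun e h h' => P.τ_ne y (h'.symm.trans h)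

/-- The two edges that start at a crossing, below, are opposite there. -/
theorem EdgeSystem.exists_oppositeAt (G : P.EdgeSystem L E) (hdiag : P.IsGeneralisedDiagram L)
    {y : St} (hy : y ∈ P.crossings L) :
    ∃ e e', e ≠ e' ∧ G.path e 0 = y ∧ G.path e' 0 = y ∧
      OppositeAt (P.diagram L) y (fun s => G.path e s) (fun s => G.path e' s) := by
  obtain ⟨e, e', hne, hst, hop⟩ := G.start y hy
  obtain ⟨h, hys, htar, h0, hc | hc⟩ := hdiag y (P.crossings_subset_diagram hy)
  · obtain ⟨f, -, hf⟩ := hc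
    obtain ⟨t, t', htt, h1, h2⟩ := hy
    have h3 := ((hf y hys t).1 h1).2
    have h4 := ((hf y hys t').1 h2).2
    linarith
  obtain ⟨f, g, hf, hg, hfg, hfgL⟩ := hc
  obtain ⟨d, d', hd, h1, h2⟩ := hop h f g hys h0 hf hg hfg hfgL
  have hd0 : G.path d 0 = y ∧ G.path d' 0 = y ∧ d ≠ d' := by
    rcases hd with ⟨rfl, rfl⟩ | ⟨rfl, rfl⟩
    · exact ⟨(hst _).2 (Or.inl rfl), (hst _).2 (Or.inr rfl), hne⟩
    · exact ⟨(hst _).2 (Or.inr rfl), (hst _).2 (Or.inl rfl), hne.symm⟩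
  have hlim : Tendsto ((↑) : unitInterval → ℝ) (𝓝[>] 0) (𝓝[>] 0) :=
    tendsto_nhdsWithin_iff.2 ⟨continuous_subtype_val.continuousWithinAt.tendsto,
      eventually_mem_nhdsWithin.mono fun s hs => hs⟩
  refine ⟨d, d', hd0.2.2, hd0.1, hd0.2.1, hd0.1, hd0.2.1, h, hys, htar, h0, fun z hz => ?_,
    hlim.eventually h1, hlim.eventually h2⟩
  constructor
  · rintro ⟨⟨z, t⟩, ht, rfl⟩
    rcases (hfgL _ hz t).1 ht with h3 | h3
    · exact Or.inr h3.1
    · exact Or.inl h3.1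
  · rintro (h3 | h3)
    · exact ⟨(z, _), (hfgL z hz _).2 (Or.inr ⟨h3, rfl⟩), rfl⟩
    · exact ⟨(z, _), (hfgL z hz _).2 (Or.inl ⟨h3, rfl⟩), rfl⟩

/-- The universe of `St` may differ from that of `M`, but `St` embeds in `M`.  So the cut surface
has a copy in the universe of `M`, as a decomposition requires. -/
theorem small_carrier (Q : PatchSystem (P.diagram L) (P.crossings L) P.τ) : Small.{u} Q.Carrier := by
  have : Small.{u} St := small_of_injective (injective_toCut (P := P))
  exact small_subtype _ _

end ProjectionSurface

namespace ProjectionSurface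

variable {M : Type u} [TopologicalSpace M] {bM : Set M} {St : Type v} [TopologicalSpace St]
  {P : ProjectionSurface M bM St} {L : Set M} {E : Type*}
  {Q : PatchSystem (P.diagram L) (P.crossings L) P.τ}
  {G : P.EdgeSystem L E} {edge : Q.Carrier → E} {R : ℝ → Q.Carrier → Q.Carrier}
  {c : Q.Carrier → ℝ → Q.Carrier} {κ : Q.Carrier → ℝ} {k : St → ℝ}

/-! ### The faces and the decomposition -/

/-- A numbering of the two corners at which sides over each edge start. -/
def IsCornerPair (Q : PatchSystem (P.diagram L) (P.crossings L) P.τ) (edge : Q.Carrier → E)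
    (corner : E → Bool → Q.Carrier) : Prop :=
  ∀ e, corner e false ≠ corner e true ∧
    ∀ z, (Q.proj z ∈ P.crossings L ∧ edge z = e) ↔ ∃ b, corner e b = z

variable {corner : E → Bool → Q.Carrier}

theorem exists_isCornerPair (h : Q.IsFlow G.path edge R) : ∃ corner, IsCornerPair Q edge corner := by
  choose α β hne h using h.edge_fiber
  refine ⟨fun e b => cond b (β e) (α e), fun e => ⟨hne e, fun z => (h e z).trans ?_⟩⟩
  simp [eq_comm]

theorem IsCornerPair.mem (hk : IsCornerPair Q edge corner) (e : E) (b : Bool) :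
    Q.proj (corner e b) ∈ P.crossings L := (((hk e).2 _).2 ⟨b, rfl⟩).1

theorem IsCornerPair.edge_eq (hk : IsCornerPair Q edge corner) (e : E) (b : Bool) :
    edge (corner e b) = e := (((hk e).2 _).2 ⟨b, rfl⟩).2

/-- The faces, carried by a space `X` in the universe of `M` that is homeomorphic to the surface cut
open along the diagram. -/
noncomputable def cutSurface [Finite E] [T2Space M] (h : Q.IsFaceData G.path edge R c κ k)
    (hV : (P.crossings L).Finite) (hne : (P.diagram L).Nonempty)
    (hk : IsCornerPair Q edge corner) {X : Type u} [TopologicalSpace X] (φ : Q.Carrier ≃ₜ X) :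
    CutSurface (G.graph h.edges hV) (interiorBoundary P.cutBoundary (G.graph h.edges hV)) where
  carrier := X
  compact := by
    have := P.compact
    exact φ.compactSpace
  bd := φ.symm ⁻¹' Q.bd
  manifold := by
    have := P.compact
    exact (Q.isManifoldWithBoundary P.isSurface h.closed).preimage_symm φ
  toX z := P.toCut (Q.proj (φ.symm z))
  continuous_toX := continuous_toCut.comp (Q.continuous_proj.comp φ.symm.continuous)
  range_toX := by
    rw [EdgeSystem.interiorBoundary_graph hne]
    exact (Q.surjective_proj.comp φ.symm.surjective).range_comp P.toCut
  injOn_toX z hz w hw hzw :=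
    φ.symm.injective (Q.injOn_proj hz hw (injective_toCut hzw))
  mem_bd_iff z := by
    rw [EdgeSystem.support_graph, injective_toCut.mem_set_image]
    rfl
  side i b s := φ (R s (corner ((Finite.equivFin E).symm i) b))
  continuous_side i b := φ.continuous.comp (h.flow.continuousOn.comp_continuous
    (continuous_subtype_val.prodMk continuous_const)
    fun _ => ⟨mem_univ _, h.subset (hk.mem _ _)⟩)
  toX_side i b s := by
    rw [φ.symm_apply_apply, h.flow.proj_eq _ (hk.mem _ _) _ s.2, hk.edge_eq]
    rfl
  side_ne i s hs hss := (hk _).1 (h.flow.inj _ _ (hk.mem _ _) (hk.mem _ _) s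
    ⟨le_of_lt hs.1, hs.2⟩ s ⟨le_of_lt hs.1, hs.2⟩ (φ.injective hss)).1
  exists_side z hz := by
    obtain ⟨α, hα, s, hs, hsz⟩ := h.flow.exists_eq _ hz
    obtain ⟨b, hb⟩ := ((hk (edge α)).2 α).1 ⟨hα, rfl⟩
    refine ⟨Finite.equivFin E (edge α), b, ⟨s, Ico_subset_Icc_self hs⟩, ?_⟩
    rw [Equiv.symm_apply_apply, hb]
    exact (congrArg φ hsz).trans (φ.apply_symm_apply z)

/-- The regluing takes the side that starts at a corner to the reversed side that starts at the
image of the corner under the involution. -/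
theorem regluing_flow (h : Q.IsFaceData G.path edge R c κ k) {α : Q.Carrier}
    (hα : Q.proj α ∈ P.crossings L) (s : ℝ) :
    Q.regluing R c (R s α) = R (1 - s) (Q.twistFun α) := by
  have hαD : α ∈ Q.bd := h.subset hα
  have htD : Q.twistFun α ∈ Q.bd := (h.tau_mem_diag _).2 hαD
  rw [PatchSystem.regluing, h.flow.twist _ _ hαD,
    PatchSystem.rotate_bd h.flow h.collar _ (h.flow.mem _ _ htD), h.flow.add _ _ _ htD]
  congr 1
  ring

/-- The rotation of the faces through a fraction `t` of a side. -/
noncomputable def faceRotation (h : Q.IsFaceData G.path edge R c κ k) {X : Type u}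
    [TopologicalSpace X] (φ : Q.Carrier ≃ₜ X) (t : ℝ) : X ≃ₜ X :=
  have := P.compact
  have := P.isSurface.t2
  (φ.symm.trans (PatchSystem.rotateHomeo h.flow h.collar h.closed t)).trans φ

/-- The involution of the faces that covers the deck transformation. -/
noncomputable def faceInvolution (Q : PatchSystem (P.diagram L) (P.crossings L) P.τ) {X : Type u}
    [TopologicalSpace X] (φ : Q.Carrier ≃ₜ X) : X ≃ₜ X :=
  (φ.symm.trans (Q.twistHomeo P.τ_τ)).trans φ

theorem faceGlue_apply (h : Q.IsFaceData G.path edge R c κ k) {X : Type u} [TopologicalSpace X]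
    (φ : Q.Carrier ≃ₜ X) (z : X) :
    faceRotation h φ 1 (faceInvolution Q φ z) = φ (Q.regluing R c (φ.symm z)) := by
  change φ (Q.rotate R c 1 (φ.symm (φ (Q.twistFun (φ.symm z))))) = _
  rw [φ.symm_apply_apply]
  rfl

section FaceGlue

variable (h : Q.IsFaceData G.path edge R c κ k) {X : Type u} [TopologicalSpace X]
  (φ : Q.Carrier ≃ₜ X)

theorem faceGlue_faceGlue (z : X) :
    faceRotation h φ 1 (faceInvolution Q φ (faceRotation h φ 1 (faceInvolution Q φ z))) = z := by
  rw [faceGlue_apply, faceGlue_apply, φ.symm_apply_apply,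
    PatchSystem.regluing_regluing h.flow h.collar h.tau_mem_diag h.invol, φ.apply_symm_apply]

theorem faceGlue_ne (z : X) : faceRotation h φ 1 (faceInvolution Q φ z) ≠ z := by
  rw [faceGlue_apply, Ne, ← φ.eq_symm_apply]
  exact PatchSystem.regluing_ne h.flow h.collar h.tau_mem_diag h.invol h.free _

theorem faceGlue_corner (z : X) (hz : Q.proj (φ.symm z) ∈ P.crossings L) :
    Q.proj (φ.symm (faceRotation h φ 1 (faceInvolution Q φ z))) ∈ P.crossings L := by
  have h1 := regluing_flow h hz 0
  have hD : φ.symm z ∈ Q.bd := h.subset hz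
  rw [h.flow.zero _ hD, sub_zero] at h1
  rw [faceGlue_apply, φ.symm_apply_apply, h1]
  exact h.flow.one_mem _ (h.tau_mem_vert _ hz)

end FaceGlue

/-- The chunk decomposition of the complement of the link defined by the regluing of the faces and
by a quotient map whose fibres are its classes. -/
noncomputable def decomposition [Finite E] [T2Space M] (h : Q.IsFaceData G.path edge R c κ k)
    (hV : (P.crossings L).Finite) (hne : (P.diagram L).Nonempty)
    (hk : IsCornerPair Q edge corner) {X : Type u} [TopologicalSpace X] (φ : Q.Carrier ≃ₜ X)
    (hC : IsChunk P.Cut P.cutBoundary (G.graph h.edges hV))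
    {q : {x : P.Cut // x ∉ P.toCut '' P.crossings L} → {x : M // x ∉ L}} (hq : IsQuotientMap q)
    (hqR : ∀ x y, q x = q y ↔ Relation.EqvGen (CutRel Q R c) x y) :
    ChunkDecomposition P.Cut P.cutBoundary {x : M // x ∉ L} where
  graph := G.graph h.edges hV
  isChunk := hC
  faces := cutSurface h hV hne hk φ
  glue := (faceInvolution Q φ).trans (faceRotation h φ 1)
  glue_glue := faceGlue_faceGlue h φ
  glue_ne := faceGlue_ne h φ
  glue_corner z hz :=
    ⟨_, faceGlue_corner h φ z (injective_toCut.mem_set_image.1 hz), rfl⟩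
  glue_side i b := by
    -- the side that starts at the image under `τ` of the corner where the given side starts
    set α := corner ((Finite.equivFin E).symm i) b with hα
    have hαV : Q.proj α ∈ P.crossings L := hk.mem _ _
    obtain ⟨b', hb'⟩ := ((hk (edge (Q.twistFun α))).2 (Q.twistFun α)).1
      ⟨h.tau_mem_vert _ hαV, rfl⟩
    have key : ∀ s : unitInterval, faceRotation h φ 1 (faceInvolution Q φ (φ (R s α))) =
        φ (R (unitInterval.symm s) (Q.twistFun α)) := fun s => by
      rw [faceGlue_apply, φ.symm_apply_apply, regluing_flow h hαV]
      rfl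
    refine ⟨Finite.equivFin E (edge (Q.twistFun α)), b', ?_⟩
    have h1 : ∀ s : unitInterval, (cutSurface h hV hne hk φ).side
        (Finite.equivFin E (edge (Q.twistFun α))) b' s = φ (R s (Q.twistFun α)) := fun s => by
      change φ (R s (corner ((Finite.equivFin E).symm (Finite.equivFin E _)) b')) = _
      rw [Equiv.symm_apply_apply, hb']
    apply Subset.antisymm
    · rintro _ ⟨_, ⟨s, rfl⟩, rfl⟩
      exact ⟨unitInterval.symm s, (h1 _).trans (key s).symm⟩
    · rintro _ ⟨s, rfl⟩
      refine ⟨_, ⟨unitInterval.symm s, rfl⟩, (key _).trans ?_⟩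
      rw [unitInterval.symm_symm, h1]
  quot := q
  isQuotientMap_quot := hq
  quot_eq_iff x y := by
    have h1 : CutRel Q R c = fun x y : {x : P.Cut // x ∉ (G.graph h.edges hV).verts} =>
        ∃ z, (cutSurface h hV hne hk φ).toX z = x.1 ∧ (cutSurface h hV hne hk φ).toX
          (((faceInvolution Q φ).trans (faceRotation h φ 1)) z) = y.1 := by
      funext x y
      refine propext (φ.symm.surjective.exists.trans (exists_congr fun z => and_congr Iff.rfl ?_))
      change _ ↔ P.toCut (Q.proj (φ.symm (faceRotation h φ 1 (faceInvolution Q φ z)))) = _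
      rw [faceGlue_apply, φ.symm_apply_apply]
    exact (hqR x y).trans (iff_of_eq (congrArg (fun r => Relation.EqvGen r x y) h1))

end ProjectionSurface
end LinkChunk

theorem theorem3p2 {M : Type u} {St : Type v} [TopologicalSpace M] [TopologicalSpace St]
    -- `M` is a compact, orientable, irreducible 3-manifold with boundary `bM`
    [CompactSpace M] [ConnectedSpace M] (bM : Set M) (hM : IsManifoldWithBoundary 3 M bM)
    (hor : Orientable 3 M) (hirr : Irreducible3 M)
    -- `P` is a nonorientable projection surface with orientable double cover `St`
    (P : ProjectionSurface M bM St)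
    -- the components of the boundary of `M` are incompressible in `M \ S`
    (hinc : ∀ x : {x : M // x ∉ P.surface}, x.1 ∈ bM →
      Incompressible {x : M // x ∉ P.surface}
        (connectedComponentIn {x : {x : M // x ∉ P.surface} | x.1 ∈ bM} x))
    -- `L` is a link with an alternating generalised diagram, each component having a crossing
    (L : Set M) (hL : IsLink L) (hLN : L ⊆ P.thickening)
    (hdiag : P.IsGeneralisedDiagram L) (halt : P.IsAlternating L)
    (hcr : ∀ x ∈ L, ∃ y t, y ∈ P.crossings L ∧ P.nbhd (y, t) ∈ connectedComponentIn L x) :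
    -- (1) `M \ L` decomposes into a single chunk, which is `M \\ S`
    ∃ 𝒟 : ChunkDecomposition P.Cut P.cutBoundary {x : M // x ∉ L},
      -- (2) its graph is the lifted diagram, with ideal vertices the crossings
      𝒟.graph.verts = P.toCut '' P.crossings L ∧
      𝒟.graph.support = P.toCut '' P.diagram L ∧
      -- each edge is an edge of the diagram, running from an under- to an over-crossing;
      -- `μ e` is the strand of the lifted link above it
      ∃ μ : Fin 𝒟.graph.numEdges → unitInterval → St × ℝ,
        (∀ e, Continuous (μ e) ∧ (∀ s, μ e s ∈ P.lift L) ∧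
          (∀ s, P.toCut (μ e s).1 = 𝒟.graph.edge e s) ∧
          P.IsUnder L (μ e 0) ∧ P.IsOver L (μ e 1)) ∧
        -- (3) faces are glued by first applying `τ` and then rotating each boundary component to
        -- the next edge, in the direction in which it runs from under- to over-crossing: the
        -- rotation `ρ 1` is isotopic to the identity by homeomorphisms `ρ t` that move the
        -- under-crossing end of every side along that side to its over-crossing end
        (∃ (τ' : 𝒟.faces.carrier ≃ₜ 𝒟.faces.carrier)
            (ρ : unitInterval → 𝒟.faces.carrier ≃ₜ 𝒟.faces.carrier),
          (∀ z y, 𝒟.faces.toX z = P.toCut y → 𝒟.faces.toX (τ' z) = P.toCut (P.τ y)) ∧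
          Continuous (fun p : unitInterval × 𝒟.faces.carrier => ρ p.1 p.2) ∧
          (∀ z, ρ 0 z = z) ∧
          (∀ e b t, ρ t (𝒟.faces.side e b 0) = 𝒟.faces.side e b t) ∧
          ∀ z, 𝒟.glue z = ρ 1 (τ' z)) ∧
        -- (4) each edge goes homeomorphically onto the crossing arc at its under-crossing,
        (∀ e, BijOn (fun x => (𝒟.quot x : M)) (𝒟.openEdge e) (P.crossingArc L (μ e 0).1)) ∧
        -- exactly four edges are glued to each crossing arc,
        (∀ y ∈ P.crossings L,
          {e | (fun x => (𝒟.quot x : M)) '' 𝒟.openEdge e = P.crossingArc L y}.ncard = 4) ∧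
        -- and at each ideal vertex two opposite edges are glued together.
        (∀ y ∈ P.crossings L, ∃ e e', e ≠ e' ∧
          OppositeAt (P.diagram L) y (fun s => (μ e s).1) (fun s => (μ e' s).1) ∧
          (fun x => (𝒟.quot x : M)) '' 𝒟.openEdge e = P.crossingArc L y ∧
          (fun x => (𝒟.quot x : M)) '' 𝒟.openEdge e' = P.crossingArc L y) := by
  have := hM.t2
  have := P.compact
  have := P.isSurface.t2
  obtain ⟨lo, hi, hh'⟩ := P.exists_heights hdiag
  have hh : P.IsHeights L lo hi := hh'
  have hV := P.finite_crossings hL hLN hdiag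
  have hD := P.isClosed_diagram hL hLN
  obtain ⟨Φ, hΦ⟩ := P.exists_isLinkFlow hL hLN hcr
  obtain ⟨G⟩ := hΦ.exists_edgeSystem hh hV halt
  obtain ⟨y₀, hy₀⟩ : (P.crossings L).Nonempty := by
    obtain ⟨n, f, -, -, hf⟩ := hL
    obtain ⟨y, -, hy, -⟩ := hcr (f (0, 1)) (hf ▸ mem_range_self _)
    exact ⟨y, hy⟩
  have : Finite (P.crossings L) := hV.to_subtype
  have : Nonempty (P.crossings L × Bool) := ⟨(⟨y₀, hy₀⟩, true)⟩
  have hne : (P.diagram L).Nonempty := ⟨y₀, P.crossings_subset_diagram hy₀⟩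
  have hVD := P.crossings_subset_diagram (L := L)
  have hτV : ∀ y, y ∈ P.crossings L → P.τ y ∈ P.crossings L := fun y => P.tau_mem_crossings.2
  -- the faces, the flow along their sides and the collar
  obtain ⟨Q, hγ, hsep⟩ := G.exists_patchSystem hL hLN hdiag
  obtain ⟨edge, side, hs⟩ := hγ.exists_sides hVD
  obtain ⟨R, hR⟩ := hs.exists_isFlow hγ hVD hV P.τ_τ hτV
  obtain ⟨c, hc⟩ := Q.exists_isCollar hD P.τ_τ P.τ_ne
  obtain ⟨κ, hκ⟩ := hR.exists_isPhase hγ hD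
  obtain ⟨C, r, k, H, hC⟩ := G.exists_isHeightData hh hV hD hγ
  have h : Q.IsFaceData G.path edge R c κ k :=
    ⟨hD, hVD, P.τ_τ, P.τ_ne, fun y => P.tau_mem_diagram, hτV, hγ, hR, hc, hκ, hC.continuous_len,
      hC.len_pos⟩
  obtain ⟨corner, hk⟩ := ProjectionSurface.exists_isCornerPair hR
  obtain ⟨q, hq, hqR, hqe⟩ := ProjectionSurface.exists_quot h hC hh hLN hsep
  have := ProjectionSurface.small_carrier Q
  let φ := Shrink.homeomorph.{u} Q.Carrier
  have hbij := G.bijOn_openEdge hh hqe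
  let ε := Finite.equivFin (P.crossings L × Bool)
  refine ⟨ProjectionSurface.decomposition h hV hne hk φ
    (ProjectionSurface.EdgeSystem.isChunk_graph hM hor hinc hne) hq hqR, rfl,
    ProjectionSurface.EdgeSystem.support_graph (hγ := h.edges) (hV := hV),
    fun i s => G.μ (ε.symm i) s, ?_, ?_, ?_, ?_, ?_⟩
  · exact fun i => ⟨(G.continuous_μ _).comp continuous_subtype_val, fun s => G.mem _ _,
      fun s => rfl, G.isUnder _, G.isOver _⟩
  · refine ⟨ProjectionSurface.faceInvolution Q φ, fun t => ProjectionSurface.faceRotation h φ t,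
      ?_, ?_, ?_, ?_, fun z => rfl⟩
    · intro z y hz
      have hy := ProjectionSurface.injective_toCut hz
      change P.toCut (Q.proj (φ.symm (φ (Q.twistFun (φ.symm z))))) = _
      rw [φ.symm_apply_apply, ← hy]
      rfl
    · exact φ.continuous.comp ((PatchSystem.continuous_rotate hR hc hD).comp
        ((continuous_subtype_val.comp continuous_fst).prodMk
          (φ.symm.continuous.comp continuous_snd)))
    · intro z
      exact (congrArg φ (PatchSystem.rotate_zero hR hc _)).trans (φ.apply_symm_apply z)
    · intro i b t
      have hα : corner (ε.symm i) b ∈ Q.bd := hVD (hk.mem _ _)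
      change φ (Q.rotate R c t (φ.symm (φ (R 0 (corner (ε.symm i) b))))) =
        φ (R t (corner (ε.symm i) b))
      rw [φ.symm_apply_apply, hR.zero _ hα, PatchSystem.rotate_bd hR hc _ hα]
  · exact fun i => hbij (ε.symm i)
  · intro y hy
    refine Eq.trans ?_ (G.ncard_crossingArc hh hy)
    refine Eq.trans ?_ (ProjectionSurface.ncard_preimage_equiv ε.symm _)
    refine congrArg (ncard (α := Fin (Nat.card _))) (ext fun i => ?_)
    exact Eq.congr_left (hbij (ε.symm i)).image_eq
  · intro y hy
    obtain ⟨e, e', hee, he, he', hop⟩ := G.exists_oppositeAt hdiag hy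
    obtain ⟨i, rfl⟩ := ε.symm.surjective e
    obtain ⟨i', rfl⟩ := ε.symm.surjective e'
    refine ⟨i, i', fun hi => hee (congrArg ε.symm hi), hop, ?_, ?_⟩
    · exact he ▸ (hbij (ε.symm i)).image_eq
    · exact he' ▸ (hbij (ε.symm i')).image_eq
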